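/- Let $d\ge 1$ be an integer and $\rho>0$. For each $n$ let $C_n=[0,n^{1/d})^d$ with its Euclidean toroidal metric $D(x,y)=\min_{k\in\mathbb Z^d}|x-y-n^{1/d}k|$, and let $U_1,\dots,U_n$ be independent and uniformly distributed on $C_n$. Put $\mathcal U_n=\{U_1,\dots,U_n\}$, $B_{i,\rho}=\{y\in C_n: D(y,U_i)\le\rho\}$, $$V=\operatorname{Volume}\Big(\bigcup_{i=1}^n B_{i,\rho}\Big),\qquad S=\sum_{i=1}^n \mathbf 1\{\mathcal U_n\cap B_{i,\rho}=\{U_i\}\},$$ and $\mu_V=\mathbb E V$, $\mu_S=\mathbb E S$, $\sigma_V^2=\operatorname{Var}V$, $\sigma_S^2=\operatorname{Var}S$. For $X\in\{V,S\}$ let $$D_X=\sup_{t\in\mathbb R}\Big|P\Big[\frac{X-\mathbb E X}{\sqrt{\operatorname{Var}X}}\le t\Big]-P[Z\le t]\Big|,$$ with $Z$ standard normal. Let $\pi_d=\pi^{d/2}/\Gamma(1+d/2)$ and $\phi=\pi_d\rho^d$. Let $\kappa_d$ be the maximum number of pairwise disjoint closed unit balls in $\mathbb R^d$ that all intersect the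 closed unit ball at the origin, and $\kappa_d^+=1+\kappa_d$. For $0\le r\le 2$ let $\omega_d(r)$ be the volume of the union of two unit balls in $\mathbb R^d$ with centres at distance $r$, and let $$J_{r,d}(\rho)=d\pi_d\int_0^r \exp(-\rho^d\omega_d(t))\,t^{d-1}\,dt,$$ $$g_V(\rho)=\rho^dJ_{2,d}(\rho)-(2^d\phi+\phi^2)e^{-2\phi},$$ $$g_S(\rho)=e^{-\phi}-\big(1+(2^d-2)\phi+\phi^2\big)e^{-2\phi}+\rho^d\big(J_{2,d}(\rho)-J_{1,d}(\rho)\big).$$ Let $\eta_V(\rho)=\lim_{n\to\infty}\eta_V(n,\rho)$ and $\eta_S(\rho)=\lim_{n\to\infty}\eta_S(n,\rho)$, where $$\begin{aligned}\eta_V(n,\rho)&=2\phi^2\big((3^d+1)\phi+1\big)^2\Big(1+(2^d+1)6^d\phi+\frac{2n-6^d\phi}{n-6^d\phi}\,6^{2d}\phi^2\Big)\\&\quad+2\phi^4\Big(3(4^d+2^d)\phi+3\cdot4^d\phi^2\,\frac{2n-3\cdot2^d\phi}{n-3\cdot2^d\phi}+4+\frac2n\Big),\end{aligned}$$ $$\begin{aligned}\eta_S(n,\rho)&=2(1+2\kappa_d)^2\Big(1+(2^d+1)3^d\phi+\frac{2n-3^d\phi}{n-3^d\phi}\,9^d\phi^2\Big)\\&\quad+\frac{(\kappa_d^+)^2}{2}\Big((2^d+2\cdot3^d+3)\phi+(2^{d+1}+1)\frac{2n-(2^{d+1}+1)\phi}{n-(2^{d+1}+1)\phi}\,\phi^2+\frac{4n-2}{n-1}\Big).\end{aligned}$$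 Then, for fixed $d$ and $\rho$, as $n\to\infty$: $$\lim_{n\to\infty}\big(1-n^{-1}\mu_V\big)=\lim_{n\to\infty}n^{-1}\mu_S=e^{-\phi},$$ $$\lim_{n\to\infty}n^{-1}\sigma_V^2=g_V(\rho)>0,\qquad \lim_{n\to\infty}n^{-1}\sigma_S^2=g_S(\rho)>0,$$ $$\limsup_{n\to\infty}n^{1/2}D_V\le\frac{1-e^{-\phi}}{5g_V(\rho)}\left(\sqrt{\frac{11\phi^2}{g_V(\rho)^{1/2}}+5\,\eta_V(\rho)^{1/2}}+\frac{2\phi}{g_V(\rho)^{1/4}}\right)^2,$$ $$\limsup_{n\to\infty}n^{1/2}D_S\le\frac{1-e^{-\phi}}{5g_S(\rho)}\left(\sqrt{\frac{11(\kappa_d^+)^2}{g_S(\rho)^{1/2}}+5\,\eta_S(\rho)^{1/2}}+\frac{2\kappa_d^+}{g_S(\rho)^{1/4}}\right)^2,$$ $$\liminf_{n\to\infty}n^{1/2}D_S\ge(8\pi g_S(\rho))^{-1/2}.$$ In particular $D_S=\Theta(n^{-1/2})$. -/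

import Mathlib

open Filter Topology MeasureTheory ProbabilityTheory

noncomputable section

namespace BinomialCoverage

/-- Euclidean space of dimension `d`. -/
abbrev E (d : ℕ) : Type := EuclideanSpace ℝ (Fin d)

/-! ### The torus, the covered volume and the number of singletons -/

/-- Side length `n ^ (1 / d)` of the cube of volume `n`. -/
def side (d n : ℕ) : ℝ := (n : ℝ) ^ (1 / (d : ℝ))

/-- The half-open cube `[0, n ^ (1 / d)) ^ d` of volume `n`. -/
def cube (d n : ℕ) : Set (E d) := {x | ∀ i, x i ∈ Set.Ico 0 (side d n)}

/-- The Euclidean toroidal distance on the cube: the least Euclidean distance between `x` and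
a translate of `y` by a vector of the lattice `(n ^ (1 / d)) • ℤ ^ d`. -/
def torusDist (d n : ℕ) (x y : E d) : ℝ :=
  ⨅ k : Fin d → ℤ, dist x (y + WithLp.toLp 2 (fun i => side d n * (k i : ℝ)))

/-- The closed toroidal ball of radius `r` about `x`, a subset of the cube. -/
def torusBall (d n : ℕ) (r : ℝ) (x : E d) : Set (E d) :=
  {y | y ∈ cube d n ∧ torusDist d n x y ≤ r}

/-- `V` as a function of the points: the volume of the union of the balls of radius `ρ`. -/
def coveredVolume (d n : ℕ) (ρ : ℝ) (u : Fin n → E d) : ℝ :=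
  volume.real (⋃ i, torusBall d n ρ (u i))

open scoped Classical in
/-- `S` as a function of the points: the number of `i` such that the ball of radius `ρ` about
the `i`-th point contains no other point of the point set. -/
def singletonCount (d n : ℕ) (ρ : ℝ) (u : Fin n → E d) : ℝ :=
  ∑ i, if Set.range u ∩ torusBall d n ρ (u i) = {u i} then (1 : ℝ) else 0

/-- The random vectors `U 0, …, U (n - 1)` are independent and uniformly distributed over the
cube of volume `n`. -/
structure IsUniformSample {Ω : Type*} [MeasurableSpace Ω] (d n : ℕ) (P : Measure Ω)
    (U : Fin n → Ω → E d) : Prop where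
  measurable : ∀ i, Measurable (U i)
  indep : iIndepFun U P
  uniform : ∀ i, pdf.IsUniform (U i) (cube d n) P volume

/-- Kolmogorov distance between the law of the standardization `(X - 𝔼 X) / SD(X)` of `X` and
the standard normal law. -/
def kolmogorovDist {Ω : Type*} [MeasurableSpace Ω] (P : Measure Ω) (X : Ω → ℝ) : ℝ :=
  ⨆ t : ℝ, |P.real {ω | (X ω - ∫ ω', X ω' ∂P) / √(variance X P) ≤ t}
    - (gaussianReal 0 1).real (Set.Iic t)|

/-! ### Constants -/

/-- Volume of the unit ball in dimension `d`. -/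
def unitBallVol (d : ℕ) : ℝ := Real.pi ^ ((d : ℝ) / 2) / Real.Gamma (1 + (d : ℝ) / 2)

/-- `φ = π_d ρ ^ d`, the volume of a ball of radius `ρ` in dimension `d`. -/
def phi (d : ℕ) (ρ : ℝ) : ℝ := unitBallVol d * ρ ^ d

/-- `κ_d`: the maximum number of pairwise disjoint closed unit balls that all intersect the
closed unit ball at the origin. (The set of such numbers is bounded, since the balls lie in a
ball of radius 3 and have equal volumes, so the supremum is a maximum.) -/
def kappa (d : ℕ) : ℕ :=
  sSup {m : ℕ | ∃ c : Fin m → E d,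
    (∀ i, (Metric.closedBall (c i) 1 ∩ Metric.closedBall 0 1).Nonempty) ∧
    Pairwise fun i j => Disjoint (Metric.closedBall (c i) 1) (Metric.closedBall (c j) 1)}

/-- `κ_d⁺ = 1 + κ_d`. -/
def kappaPlus (d : ℕ) : ℕ := 1 + kappa d

/-- `ω_d(r)`: the volume of the union of two unit balls whose centres are `r ≥ 0` apart. -/
def unionVol (d : ℕ) [NeZero d] (r : ℝ) : ℝ :=
  volume.real (Metric.closedBall (0 : E d) 1 ∪
    Metric.closedBall (EuclideanSpace.single (0 : Fin d) r) 1)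

/-- `J_{r,d}(ρ)`. -/
def J (d : ℕ) [NeZero d] (r ρ : ℝ) : ℝ :=
  d * unitBallVol d * ∫ t in (0 : ℝ)..r, Real.exp (-ρ ^ d * unionVol d t) * t ^ (d - 1)

/-- The limiting variance of the covered volume. -/
def gV (d : ℕ) [NeZero d] (ρ : ℝ) : ℝ :=
  ρ ^ d * J d 2 ρ - (2 ^ d * phi d ρ + phi d ρ ^ 2) * Real.exp (-2 * phi d ρ)

/-- The limiting variance of the number of singletons. -/
def gS (d : ℕ) [NeZero d] (ρ : ℝ) : ℝ :=
  Real.exp (-phi d ρ)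
    - (1 + (2 ^ d - 2) * phi d ρ + phi d ρ ^ 2) * Real.exp (-2 * phi d ρ)
    + ρ ^ d * (J d 2 ρ - J d 1 ρ)

/-- `η_V(n, ρ)`. -/
def etaVn (d n : ℕ) (ρ : ℝ) : ℝ :=
  2 * phi d ρ ^ 2 * ((3 ^ d + 1) * phi d ρ + 1) ^ 2 *
      (1 + (2 ^ d + 1) * 6 ^ d * phi d ρ
        + ((2 * n - 6 ^ d * phi d ρ) / (n - 6 ^ d * phi d ρ)) * 6 ^ (2 * d) * phi d ρ ^ 2)
    + 2 * phi d ρ ^ 4 *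
      (3 * (4 ^ d + 2 ^ d) * phi d ρ
        + 3 * 4 ^ d * phi d ρ ^ 2 *
          ((2 * n - 3 * 2 ^ d * phi d ρ) / (n - 3 * 2 ^ d * phi d ρ))
        + 4 + 2 / n)

/-- `η_S(n, ρ)`. -/
def etaSn (d n : ℕ) (ρ : ℝ) : ℝ :=
  2 * (1 + 2 * kappa d) ^ 2 *
      (1 + (2 ^ d + 1) * 3 ^ d * phi d ρ
        + ((2 * n - 3 ^ d * phi d ρ) / (n - 3 ^ d * phi d ρ)) * 9 ^ d * phi d ρ ^ 2)
    + (kappaPlus d : ℝ) ^ 2 / 2 *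
      ((2 ^ d + 2 * 3 ^ d + 3) * phi d ρ
        + (2 ^ (d + 1) + 1) *
          ((2 * n - (2 ^ (d + 1) + 1) * phi d ρ) / (n - (2 ^ (d + 1) + 1) * phi d ρ))
          * phi d ρ ^ 2
        + (4 * n - 2) / (n - 1))

/-- `η_V(ρ) = lim_n η_V(n, ρ)`; the limit exists and is computed in `etaV_eq`. -/
def etaV (d : ℕ) (ρ : ℝ) : ℝ := limUnder atTop fun n : ℕ => etaVn d n ρ

/-- `η_S(ρ) = lim_n η_S(n, ρ)`; the limit exists and is computed in `etaS_eq`. -/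
def etaS (d : ℕ) (ρ : ℝ) : ℝ := limUnder atTop fun n : ℕ => etaSn d n ρ

theorem tendsto_ratio (a b c : ℝ) :
    Tendsto (fun n : ℕ => (a * (n : ℝ) - b) / ((n : ℝ) - c)) atTop (𝓝 a) := by
  have h1 : Tendsto (fun n : ℕ => (n : ℝ) - c) atTop atTop :=
    tendsto_atTop_add_const_right _ (-c) tendsto_natCast_atTop_atTop
  have h2 : Tendsto (fun n : ℕ => a + (a * c - b) / ((n : ℝ) - c)) atTop (𝓝 (a + 0)) :=
    tendsto_const_nhds.add (h1.const_div_atTop _)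
  rw [add_zero] at h2
  refine h2.congr' ?_
  filter_upwards [h1.eventually_gt_atTop 0] with n hn
  field_simp
  ring

theorem tendsto_etaVn (d : ℕ) (ρ : ℝ) :
    Tendsto (fun n : ℕ => etaVn d n ρ) atTop (𝓝
      (2 * phi d ρ ^ 2 * ((3 ^ d + 1) * phi d ρ + 1) ^ 2 *
          (1 + (2 ^ d + 1) * 6 ^ d * phi d ρ + 2 * 6 ^ (2 * d) * phi d ρ ^ 2)
        + 2 * phi d ρ ^ 4 *
          (3 * (4 ^ d + 2 ^ d) * phi d ρ + 3 * 4 ^ d * phi d ρ ^ 2 * 2 + 4 + 0))) := by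
  unfold etaVn
  have h := tendsto_const_div_atTop_nhds_zero_nat (2 : ℝ)
  exact ((((tendsto_ratio 2 _ _).mul_const _).mul_const _).const_add _ |>.const_mul _).add
    (((((tendsto_ratio 2 _ _).const_mul _).const_add _).add_const _ |>.add h).const_mul _)

theorem tendsto_etaSn (d : ℕ) (ρ : ℝ) :
    Tendsto (fun n : ℕ => etaSn d n ρ) atTop (𝓝
      (2 * (1 + 2 * kappa d) ^ 2 *
          (1 + (2 ^ d + 1) * 3 ^ d * phi d ρ + 2 * 9 ^ d * phi d ρ ^ 2)
        + (kappaPlus d : ℝ) ^ 2 / 2 *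
          ((2 ^ d + 2 * 3 ^ d + 3) * phi d ρ
            + (2 ^ (d + 1) + 1) * 2 * phi d ρ ^ 2 + 4))) := by
  unfold etaSn
  exact ((((tendsto_ratio 2 _ _).mul_const _).mul_const _).const_add _ |>.const_mul _).add
    ((((((tendsto_ratio 2 _ _).const_mul _).mul_const _).const_add _).add
      (tendsto_ratio 4 2 1)).const_mul _)

theorem etaV_eq (d : ℕ) (ρ : ℝ) :
    etaV d ρ =
      2 * phi d ρ ^ 2 * ((3 ^ d + 1) * phi d ρ + 1) ^ 2 *
          (1 + (2 ^ d + 1) * 6 ^ d * phi d ρ + 2 * 6 ^ (2 * d) * phi d ρ ^ 2)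
        + 2 * phi d ρ ^ 4 *
          (3 * (4 ^ d + 2 ^ d) * phi d ρ + 6 * 4 ^ d * phi d ρ ^ 2 + 4) :=
  (tendsto_etaVn d ρ).limUnder_eq.trans (by ring)

theorem etaS_eq (d : ℕ) (ρ : ℝ) :
    etaS d ρ =
      2 * (1 + 2 * kappa d) ^ 2 *
          (1 + (2 ^ d + 1) * 3 ^ d * phi d ρ + 2 * 9 ^ d * phi d ρ ^ 2)
        + (kappaPlus d : ℝ) ^ 2 / 2 *
          ((2 ^ d + 2 * 3 ^ d + 3) * phi d ρ
            + (2 ^ (d + 1) + 1) * 2 * phi d ρ ^ 2 + 4) :=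
  (tendsto_etaSn d ρ).limUnder_eq

end BinomialCoverage

end

open BinomialCoverage

noncomputable section
namespace BinomialCoverage

/-! Both `V` and `n - S`, the number of points that have a neighbour, are multiples of the mean,
over a random ball, of the indicator that this ball holds a point. For `V` the centre is uniform on
the torus and all `n` points count; for `n - S` the centre is a uniformly chosen sample point and
the other `n - 1` points count. A size-biased copy of such a mean arises by conditioning the random
ball to be nonempty. The number of points in a ball of measure `p` is binomial; it becomes binomial
conditioned to be positive if a uniformly chosen point, when it lies outside the ball, is moved to a
uniform place inside with a probability (`moveProb`) that depends on the count. So the size-biased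
copy differs from the original by a displacement of at most one point, which changes `V` by at most
`φ` and `S` by at most `κ_d + 1`.

Stein's method turns such a bounded coupling into a normal approximation
(`kolmogorovDist_le_of_sizeBias`, specialised in `kolmogorovDist_le_of_coverage`). Indicators are
smoothed to ramps of width `α`; the Stein solution of a ramp and its derivative are bounded by 1;
the mean oscillation of the ramp under the law in question is controlled by the Kolmogorov distance
`D` itself. This gives an inequality for `D` with a multiple of `D / α` on the right; solving for
`D` and optimizing `α` produces the squared sums of square roots (`le_of_forall_smoothing`).

There remains the mean absolute deviation of the conditional mean change `meanMove`. It is replaced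
by a simpler functional (`volMove`, `isoMove`) at a mean cost of order `1 / n`. The variance of that
functional is of order `1 / n` by the Efron–Stein inequality, because deleting one point has only a
local effect. The constants found in this way are dominated by `η_V` and `η_S` (`sq_le_etaV`,
`le_etaS`), so the explicit formulas for these enter only as upper bounds.

Means and variances are computed exactly: a point avoids two given balls with probability `1 - 2 *
p` plus the measure of their overlap. Centres more than `2 * ρ` apart have no overlap and contribute
through the limit of `n * ((1 - 2 * φ / n) ^ n - (1 - φ / n) ^ (2 * n))`, which is `-φ ^ 2 * exp (-2
* φ)`; nearer centres contribute an integral over a ball, which scaling and polar coordinates turn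
into `J`. Positivity of the limits rests on Taylor bounds for the exponential and on the integral of
the overlap volume being `φ ^ 2` (`integral_lens`).

For the lower bound, `S` is integer valued: its distribution function is flat between consecutive
integers, where the normal one rises by about a density over a standard deviation. -/

/-! ### The standard normal density -/

/-- The standard normal density. -/
abbrev nd (x : ℝ) : ℝ := gaussianPDFReal 0 1 x

theorem nd_eq (x : ℝ) : nd x = (√(2 * Real.pi))⁻¹ * Real.exp (-x ^ 2 / 2) := by
  simp [nd, gaussianPDFReal]

theorem nd_pos (x : ℝ) : 0 < nd x := gaussianPDFReal_pos 0 1 x one_ne_zero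

theorem nd_neg (x : ℝ) : nd (-x) = nd x := by simp [nd_eq]

theorem hasDerivAt_nd (x : ℝ) : HasDerivAt nd (-(x * nd x)) x := by
  have h : HasDerivAt (fun x : ℝ => (√(2 * Real.pi))⁻¹ * Real.exp (-x ^ 2 / 2))
      ((√(2 * Real.pi))⁻¹ * (Real.exp (-x ^ 2 / 2) * (-(2 * x) / 2))) x := by
    have := ((hasDerivAt_pow 2 x).neg.div_const 2).exp.const_mul (√(2 * Real.pi))⁻¹
    simpa using this
  have e : nd = fun x : ℝ => (√(2 * Real.pi))⁻¹ * Real.exp (-x ^ 2 / 2) := funext nd_eq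
  rw [e]
  convert h using 1
  ring

theorem continuous_nd : Continuous nd :=
  continuous_iff_continuousAt.2 fun x => (hasDerivAt_nd x).continuousAt

theorem integrable_nd : Integrable nd := integrable_gaussianPDFReal 0 1

theorem integral_nd : ∫ x, nd x = 1 := integral_gaussianPDFReal_eq_one 0 one_ne_zero

/-- The rational bound `2 / 5` for the maximum of the density is the source of the constants 11 and
5 in the final estimates. -/
theorem inv_sqrt_two_pi_le : (√(2 * Real.pi))⁻¹ ≤ (2 / 5 : ℝ) := by
  rw [inv_le_comm₀ (by positivity) (by norm_num)]
  apply Real.le_sqrt_of_sq_le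
  have := Real.pi_gt_d2
  norm_num at this ⊢
  linarith

theorem nd_le (x : ℝ) : nd x ≤ 2 / 5 := by
  rw [nd_eq]
  have : Real.exp (-x ^ 2 / 2) ≤ 1 := Real.exp_le_one_iff.2 (by nlinarith [sq_nonneg x])
  calc _ ≤ (√(2 * Real.pi))⁻¹ * 1 := by gcongr
    _ ≤ _ := by simpa using inv_sqrt_two_pi_le

/-- The standard normal distribution function. -/
def ncdf (w : ℝ) : ℝ := ∫ x in Set.Iic w, nd x

theorem gaussianReal_real_Iic (w : ℝ) : (gaussianReal 0 1).real (Set.Iic w) = ncdf w := by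
  rw [measureReal_def, gaussianReal_apply_eq_integral 0 one_ne_zero, ENNReal.toReal_ofReal]
  · rfl
  · exact integral_nonneg fun x => (nd_pos x).le

theorem ncdf_nonneg (w : ℝ) : 0 ≤ ncdf w := integral_nonneg fun x => (nd_pos x).le

theorem ncdf_compl (w : ℝ) : ∫ x in Set.Ioi w, nd x = 1 - ncdf w := by
  have := intervalIntegral.integral_Iic_add_Ioi (b := w)
    (integrable_nd.integrableOn) (integrable_nd.integrableOn)
  rw [integral_nd] at this
  unfold ncdf
  linarith

theorem ncdf_le_one (w : ℝ) : ncdf w ≤ 1 := by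
  have : 0 ≤ ∫ x in Set.Ioi w, nd x := integral_nonneg fun x => (nd_pos x).le
  linarith [ncdf_compl w]

theorem ncdf_neg (w : ℝ) : ncdf (-w) = 1 - ncdf w := by
  rw [← ncdf_compl, ncdf, ← integral_comp_neg_Ioi]
  simp [nd_neg]

theorem ncdf_sub (a b : ℝ) : ncdf b - ncdf a = ∫ x in a..b, nd x :=
  intervalIntegral.integral_Iic_sub_Iic integrable_nd.integrableOn integrable_nd.integrableOn

theorem hasDerivAt_ncdf (w : ℝ) : HasDerivAt ncdf (nd w) w := by
  have h : HasDerivAt (fun u => ncdf 0 + ∫ x in (0 : ℝ)..u, nd x) (nd w) w :=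
    (intervalIntegral.integral_hasDerivAt_right (continuous_nd.intervalIntegrable _ _)
      (continuous_nd.stronglyMeasurableAtFilter _ _) continuous_nd.continuousAt).const_add _
  refine h.congr_of_eventuallyEq (Eventually.of_forall fun u => ?_)
  simp only
  rw [← ncdf_sub]
  ring

theorem continuous_ncdf : Continuous ncdf :=
  continuous_iff_continuousAt.2 fun x => (hasDerivAt_ncdf x).continuousAt

theorem ncdf_sub_le {a b : ℝ} (h : a ≤ b) : ncdf b - ncdf a ≤ 2 / 5 * (b - a) := by
  rw [ncdf_sub]
  have := intervalIntegral.integral_mono_on (g := fun _ => (2 / 5 : ℝ)) h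
    (continuous_nd.intervalIntegrable (μ := volume) a b)
    (continuous_const.intervalIntegrable a b) (fun x _ => nd_le x)
  simp only [intervalIntegral.integral_const, smul_eq_mul] at this
  linarith

theorem tendsto_ncdf_atTop : Tendsto ncdf atTop (𝓝 1) := by
  refine (tendsto_cdf_atTop (gaussianReal 0 1)).congr fun x => ?_
  rw [cdf_eq_real, gaussianReal_real_Iic]

theorem ncdf_zero : ncdf 0 = 1 / 2 := by
  have := ncdf_neg 0
  simp at this
  linarith

theorem tendsto_nd_atTop : Tendsto nd atTop (𝓝 0) := by
  have h1 : Tendsto (fun x : ℝ => -x ^ 2 / 2) atTop atBot := by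
    have : Tendsto (fun x : ℝ => x ^ 2 / 2) atTop atTop :=
      (tendsto_pow_atTop two_ne_zero).atTop_div_const (by norm_num)
    refine (tendsto_neg_atTop_atBot.comp this).congr fun x => ?_
    simp [neg_div]
  have := (Real.tendsto_exp_atBot.comp h1).const_mul (√(2 * Real.pi))⁻¹
  simpa [funext nd_eq] using this

/-- Mills' bound. -/
theorem mul_ncdf_compl_le {w : ℝ} (hw : 0 ≤ w) : w * (1 - ncdf w) ≤ nd w := by
  have hd : ∀ x ∈ Set.Ici w, HasDerivAt (fun x => -nd x) (x * nd x) x := fun x _ => by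
    simpa using (hasDerivAt_nd x).fun_neg
  have ht : Tendsto (fun x => -nd x) atTop (𝓝 0) := by simpa using tendsto_nd_atTop.neg
  have hi : IntegrableOn (fun x => x * nd x) (Set.Ioi w) :=
    integrableOn_Ioi_deriv_of_nonneg' hd
      (fun x hx => mul_nonneg (hw.trans (le_of_lt hx)) (nd_pos x).le) ht
  have he := integral_Ioi_of_hasDerivAt_of_tendsto' hd hi ht
  rw [← ncdf_compl, ← integral_const_mul]
  calc _ ≤ ∫ x in Set.Ioi w, x * nd x :=
        setIntegral_mono_on (integrable_nd.const_mul w).integrableOn hi measurableSet_Ioi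
          fun x hx => mul_le_mul_of_nonneg_right (le_of_lt hx) (nd_pos x).le
    _ = nd w := by rw [he]; ring

/-- By symmetry take `w ≥ 0`. The difference of the two sides tends to 0 at infinity and is
monotone, since its derivative is the density times `2 * ncdf w - 1 - w`, and `2 * ncdf w - 1 ≤ (4 /
5) * w`. This is what bounds the Stein solution by 1. -/
theorem ncdf_mul_compl_le (w : ℝ) : ncdf w * (1 - ncdf w) ≤ nd w := by
  have key : ∀ w : ℝ, 0 ≤ w → ncdf w * (1 - ncdf w) ≤ nd w := by
    have hanti : AntitoneOn (fun w => nd w - ncdf w * (1 - ncdf w)) (Set.Ici 0) := by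
      have hd : ∀ w : ℝ, HasDerivAt (fun w => nd w - ncdf w * (1 - ncdf w))
          (nd w * (2 * ncdf w - 1 - w)) w := fun w => by
        have := (hasDerivAt_nd w).fun_sub
          ((hasDerivAt_ncdf w).fun_mul ((hasDerivAt_ncdf w).const_sub 1))
        refine this.congr_deriv ?_
        ring
      refine antitoneOn_of_deriv_nonpos (convex_Ici 0)
        (fun x _ => (hd x).continuousAt.continuousWithinAt)
        (fun x _ => (hd x).differentiableAt.differentiableWithinAt) fun x hx => ?_
      rw [interior_Ici] at hx
      rw [(hd x).deriv]
      have := ncdf_sub_le (le_of_lt hx)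
      rw [ncdf_zero] at this
      have hx' : (0 : ℝ) < x := hx
      exact mul_nonpos_of_nonneg_of_nonpos (nd_pos x).le (by linarith)
    have ht : Tendsto (fun w => nd w - ncdf w * (1 - ncdf w)) atTop (𝓝 0) := by
      have := tendsto_nd_atTop.sub (tendsto_ncdf_atTop.mul (tendsto_ncdf_atTop.const_sub 1))
      simpa using this
    intro w hw
    have : (0 : ℝ) ≤ nd w - ncdf w * (1 - ncdf w) := by
      refine le_of_tendsto ht ?_
      filter_upwards [eventually_ge_atTop w] with v hv
      exact hanti hw (hw.trans hv) hv
    linarith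
  rcases le_total 0 w with h | h
  · exact key w h
  · have := key (-w) (by linarith)
    rw [ncdf_neg, nd_neg] at this
    linarith

/-! ### The Stein equation for a monotone test function -/

section Stein

variable (h : ℝ → ℝ)

/-- Mean of `h` under the standard normal law. -/
def nmean : ℝ := ∫ x, h x * nd x

/-- Numerator of the solution of the Stein equation. -/
def steinNum (w : ℝ) : ℝ := ∫ x in Set.Iic w, (h x - nmean h) * nd x

/-- Solution of the Stein equation `f' w - w f w = h w - nmean h`. -/
def steinSol (w : ℝ) : ℝ := steinNum h w / nd w

/-- Derivative of the solution of the Stein equation. -/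
def steinDeriv (w : ℝ) : ℝ := w * steinSol h w + (h w - nmean h)

variable {h}

theorem integrable_mul_nd (hc : Continuous h) (h0 : ∀ x, 0 ≤ h x) (h1 : ∀ x, h x ≤ 1) :
    Integrable fun x => h x * nd x := by
  refine integrable_nd.mono' (hc.mul continuous_nd).aestronglyMeasurable
    (Eventually.of_forall fun x => ?_)
  rw [Real.norm_eq_abs, abs_of_nonneg (mul_nonneg (h0 x) (nd_pos x).le)]
  nlinarith [h1 x, nd_pos x]

theorem integrable_sub_mul_nd (hc : Continuous h) (h0 : ∀ x, 0 ≤ h x) (h1 : ∀ x, h x ≤ 1) :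
    Integrable fun x => (h x - nmean h) * nd x := by
  simp only [sub_mul]
  exact (integrable_mul_nd hc h0 h1).sub (integrable_nd.const_mul _)

theorem hasDerivAt_steinNum (hc : Continuous h) (h0 : ∀ x, 0 ≤ h x) (h1 : ∀ x, h x ≤ 1) (w : ℝ) :
    HasDerivAt (steinNum h) ((h w - nmean h) * nd w) w := by
  have hi := integrable_sub_mul_nd hc h0 h1
  have hcc : Continuous fun x => (h x - nmean h) * nd x :=
    (hc.sub continuous_const).mul continuous_nd
  have h : HasDerivAt (fun u => steinNum h 0 + ∫ x in (0 : ℝ)..u, (h x - nmean h) * nd x)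
      ((h w - nmean h) * nd w) w :=
    (intervalIntegral.integral_hasDerivAt_right (hcc.intervalIntegrable _ _)
      (hcc.stronglyMeasurableAtFilter _ _) hcc.continuousAt).const_add _
  refine h.congr_of_eventuallyEq (Eventually.of_forall fun u => ?_)
  simp only [steinNum]
  rw [← intervalIntegral.integral_Iic_sub_Iic hi.integrableOn hi.integrableOn]
  ring

theorem hasDerivAt_steinSol (hc : Continuous h) (h0 : ∀ x, 0 ≤ h x) (h1 : ∀ x, h x ≤ 1) (w : ℝ) :
    HasDerivAt (steinSol h) (steinDeriv h w) w := by
  have := (hasDerivAt_steinNum hc h0 h1 w).fun_div (hasDerivAt_nd w) (nd_pos w).ne'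
  refine this.congr_deriv ?_
  have := (nd_pos w).ne'
  unfold steinDeriv steinSol
  field_simp
  ring

theorem continuous_steinSol (hc : Continuous h) (h0 : ∀ x, 0 ≤ h x) (h1 : ∀ x, h x ≤ 1) :
    Continuous (steinSol h) :=
  continuous_iff_continuousAt.2 fun x => (hasDerivAt_steinSol hc h0 h1 x).continuousAt

theorem continuous_steinDeriv (hc : Continuous h) (h0 : ∀ x, 0 ≤ h x) (h1 : ∀ x, h x ≤ 1) :
    Continuous (steinDeriv h) :=
  (continuous_id.mul (continuous_steinSol hc h0 h1)).add (hc.sub continuous_const)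

/-- The two pieces into which a point splits the normal mean of an antitone function. -/
theorem exists_split (hc : Continuous h) (h0 : ∀ x, 0 ≤ h x) (h1 : ∀ x, h x ≤ 1)
    (ha : Antitone h) (w : ℝ) : ∃ a c : ℝ, nmean h = a + c ∧
      steinNum h w = (1 - ncdf w) * a - ncdf w * c ∧ h w * ncdf w ≤ a ∧ a ≤ ncdf w ∧
      0 ≤ c ∧ c ≤ h w * (1 - ncdf w) := by
  have hi := integrable_mul_nd hc h0 h1
  refine ⟨∫ x in Set.Iic w, h x * nd x, ∫ x in Set.Ioi w, h x * nd x, ?_, ?_, ?_, ?_, ?_, ?_⟩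
  · rw [intervalIntegral.integral_Iic_add_Ioi hi.integrableOn hi.integrableOn, nmean]
  · have e : nmean h = (∫ x in Set.Iic w, h x * nd x) + ∫ x in Set.Ioi w, h x * nd x := by
      rw [intervalIntegral.integral_Iic_add_Ioi hi.integrableOn hi.integrableOn, nmean]
    have : steinNum h w = (∫ x in Set.Iic w, h x * nd x) - nmean h * ncdf w := by
      simp only [steinNum, sub_mul]
      rw [integral_sub hi.integrableOn (integrable_nd.const_mul _).integrableOn,
        integral_const_mul, ncdf]
    rw [this, e]
    ring
  · rw [ncdf, ← integral_const_mul]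
    exact setIntegral_mono_on (integrable_nd.const_mul _).integrableOn hi.integrableOn
      measurableSet_Iic fun x hx => mul_le_mul_of_nonneg_right (ha hx) (nd_pos x).le
  · rw [ncdf]
    exact setIntegral_mono_on hi.integrableOn integrable_nd.integrableOn
      measurableSet_Iic fun x _ => mul_le_of_le_one_left (nd_pos x).le (h1 x)
  · exact integral_nonneg fun x => mul_nonneg (h0 x) (nd_pos x).le
  · rw [← ncdf_compl, ← integral_const_mul]
    exact setIntegral_mono_on hi.integrableOn (integrable_nd.const_mul _).integrableOn
      measurableSet_Ioi fun x hx => mul_le_mul_of_nonneg_right (ha (le_of_lt hx)) (nd_pos x).le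

/-- With `a` and `c` from `exists_split`, the numerator is a difference of two numbers in `[0, ncdf
w * (1 - ncdf w)]`, and `ncdf_mul_compl_le` compares that length with the density. -/
theorem abs_steinSol_le (hc : Continuous h) (h0 : ∀ x, 0 ≤ h x) (h1 : ∀ x, h x ≤ 1)
    (ha : Antitone h) (w : ℝ) : |steinSol h w| ≤ 1 := by
  obtain ⟨a, c, -, hn, ha1, ha2, hc1, hc2⟩ := exists_split hc h0 h1 ha w
  have hp := nd_pos w
  have h3 := ncdf_mul_compl_le w
  have h4 := ncdf_nonneg w
  have h5 := ncdf_le_one w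
  rw [steinSol, abs_div, abs_of_pos hp, div_le_one hp, hn, abs_le]
  constructor <;> nlinarith [mul_le_mul_of_nonneg_left ha1 (sub_nonneg.2 h5),
    mul_le_mul_of_nonneg_left ha2 (sub_nonneg.2 h5), mul_le_mul_of_nonneg_left hc2 h4,
    mul_nonneg h4 hc1]

/-- The derivative is affine in the two pieces `a` and `c` of `exists_split`. For `w ≥ 0` Mills'
bound makes `w / nd w * (1 - ncdf w)` at most 1, which fixes the sign of the coefficient of `a`, so
the extreme values are those at the ends of the ranges of `a` and `c`. For `w ≤ 0` the roles are
exchanged and Mills' bound is used at `-w`. -/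
theorem abs_steinDeriv_le (hc : Continuous h) (h0 : ∀ x, 0 ≤ h x) (h1 : ∀ x, h x ≤ 1)
    (ha : Antitone h) (w : ℝ) : |steinDeriv h w| ≤ 1 := by
  obtain ⟨a, c, hm, hn, ha1, ha2, hc1, hc2⟩ := exists_split hc h0 h1 ha w
  have hp := nd_pos w
  have h4 := ncdf_nonneg w
  have h5 := ncdf_le_one w
  have hh0 := h0 w
  have hh1 := h1 w
  have key : steinDeriv h w = w / nd w * ((1 - ncdf w) * a - ncdf w * c) + h w - a - c := by
    rw [steinDeriv, steinSol, hn, hm]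
    ring
  set F := ncdf w
  set k := w / nd w with hk
  rw [key, abs_le]
  rcases le_total 0 w with hw | hw
  · have hk0 : 0 ≤ k := div_nonneg hw hp.le
    have hy : k * (1 - F) ≤ 1 := by
      rw [hk, div_mul_eq_mul_div, div_le_one hp]
      exact mul_ncdf_compl_le hw
    have hy0 : 0 ≤ k * (1 - F) := mul_nonneg hk0 (by linarith)
    have hcc : k * F * c ≤ k * (1 - F) * (h w * F) := by
      have := mul_le_mul_of_nonneg_left hc2 (mul_nonneg hk0 h4)
      linarith
    constructor
    · have e1 : (1 - k * (1 - F)) * a ≤ (1 - k * (1 - F)) * F :=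
        mul_le_mul_of_nonneg_left ha2 (by linarith)
      have e2 : 0 ≤ (1 - k * (1 - F)) * (F * h w) :=
        mul_nonneg (by linarith) (mul_nonneg h4 hh0)
      nlinarith
    · have e1 : 0 ≤ (1 - k * (1 - F)) * a :=
        mul_nonneg (by linarith) (le_trans (mul_nonneg hh0 h4) ha1)
      have e2 : 0 ≤ k * F * c := mul_nonneg (mul_nonneg hk0 h4) hc1
      linarith
  · have hk0 : 0 ≤ -k := by
      rw [hk, ← neg_div]
      exact div_nonneg (by linarith) hp.le
    have hy : -k * F ≤ 1 := by
      have := mul_ncdf_compl_le (w := -w) (by linarith)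
      rw [ncdf_neg, nd_neg] at this
      rw [hk, ← neg_div, div_mul_eq_mul_div, div_le_one hp]
      simpa using this
    have hy0 : 0 ≤ -k * F := mul_nonneg hk0 h4
    have hca : -k * (1 - F) * (h w * F) ≤ -k * (1 - F) * a :=
      mul_le_mul_of_nonneg_left ha1 (mul_nonneg hk0 (by linarith))
    have hca2 : -k * (1 - F) * a ≤ -k * (1 - F) * F :=
      mul_le_mul_of_nonneg_left ha2 (mul_nonneg hk0 (by linarith))
    have e1 : (1 - (-k * F)) * c ≤ (1 - (-k * F)) * (h w * (1 - F)) :=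
      mul_le_mul_of_nonneg_left hc2 (by linarith)
    have e2 : 0 ≤ (1 - (-k * F)) * c := mul_nonneg (by linarith) hc1
    have e3 : 0 ≤ (-k * F) * (h w * (1 - F)) :=
      mul_nonneg hy0 (mul_nonneg hh0 (by linarith))
    have e4 : (-k * F) * (1 - F) ≤ 1 * (1 - F) :=
      mul_le_mul_of_nonneg_right hy (by linarith)
    constructor
    · nlinarith [mul_nonneg hh0 h4]
    · nlinarith [mul_nonneg hh0 h4, mul_nonneg hh0 (sub_nonneg.2 h5)]

/-- First order expansion of the solution of the Stein equation. -/
theorem abs_steinSol_sub_le (hc : Continuous h) (h0 : ∀ x, 0 ≤ h x) (h1 : ∀ x, h x ≤ 1)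
    (ha : Antitone h) {w δ b : ℝ} (hδ : |δ| ≤ b) :
    |steinSol h (w + δ) - steinSol h w - δ * steinDeriv h w| ≤
      b ^ 2 / 2 * (1 + |w|) + ∫ t in -b..b, |h (w + t) - h w| := by
  have hcs := continuous_steinDeriv hc h0 h1
  have hb : 0 ≤ b := (abs_nonneg δ).trans hδ
  have hlip : ∀ t, |steinSol h (w + t) - steinSol h w| ≤ |t| := fun t => by
    have := Convex.norm_image_sub_le_of_norm_hasDerivWithin_le (f := steinSol h)
      (f' := steinDeriv h) (s := Set.univ) (x := w) (y := w + t) (C := 1)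
      (fun x _ => (hasDerivAt_steinSol hc h0 h1 x).hasDerivWithinAt)
      (fun x _ => abs_steinDeriv_le hc h0 h1 ha x) convex_univ trivial trivial
    simpa using this
  -- The Stein equation is substituted at both points: the part coming from `w * f w` is Lipschitz
  -- with constant `1 + |w|`, and what is left is the oscillation of `h`.
  have hpt : ∀ t, |steinDeriv h (w + t) - steinDeriv h w| ≤
      |t| * (1 + |w|) + |h (w + t) - h w| := fun t => by
    have e : steinDeriv h (w + t) - steinDeriv h w =
        t * steinSol h (w + t) + w * (steinSol h (w + t) - steinSol h w) + (h (w + t) - h w) := by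
      unfold steinDeriv
      ring
    rw [e]
    refine (abs_add_le _ _).trans (add_le_add_left ((abs_add_le _ _).trans ?_) _)
    rw [abs_mul, abs_mul]
    have := mul_le_mul_of_nonneg_left (hlip t) (abs_nonneg w)
    have := mul_le_mul_of_nonneg_left (abs_steinSol_le hc h0 h1 ha (w + t)) (abs_nonneg t)
    linarith
  have hftc : steinSol h (w + δ) - steinSol h w - δ * steinDeriv h w =
      ∫ t in (0 : ℝ)..δ, (steinDeriv h (w + t) - steinDeriv h w) := by
    rw [intervalIntegral.integral_sub
      (Continuous.intervalIntegrable (by fun_prop) _ _)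
      (continuous_const.intervalIntegrable _ _),
      intervalIntegral.integral_comp_add_left (fun t => steinDeriv h t) w,
      intervalIntegral.integral_eq_sub_of_hasDerivAt
        (fun x _ => hasDerivAt_steinSol hc h0 h1 x) (hcs.intervalIntegrable _ _)]
    simp
  have hsub : Continuous fun t => |h (w + t) - h w| := by fun_prop
  have habs : Continuous fun t : ℝ => |t| * (1 + |w|) := by fun_prop
  have hbd : ∀ u v : ℝ, u ≤ v → -b ≤ u → v ≤ b →
      ∫ t in u..v, (|t| * (1 + |w|) + |h (w + t) - h w|) ≤
      (∫ t in u..v, |t|) * (1 + |w|) + ∫ t in -b..b, |h (w + t) - h w| := by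
    intro u v huv hu hv
    rw [intervalIntegral.integral_add (habs.intervalIntegrable _ _) (hsub.intervalIntegrable _ _),
      intervalIntegral.integral_mul_const]
    gcongr
    exact intervalIntegral.integral_mono_interval hu huv hv
      (Eventually.of_forall fun t => abs_nonneg _) (hsub.intervalIntegrable _ _)
  have hw : (0 : ℝ) ≤ 1 + |w| := by positivity
  rw [hftc]
  rcases le_total 0 δ with hd | hd
  · refine (intervalIntegral.norm_integral_le_of_norm_le
      (f := fun t => steinDeriv h (w + t) - steinDeriv h w) hd
      (Eventually.of_forall fun t _ => hpt t)
      ((habs.fun_add hsub).intervalIntegrable _ _)).trans ?_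
    rw [abs_of_nonneg hd] at hδ
    refine (hbd 0 δ hd (by linarith) hδ).trans ?_
    have : ∫ t in (0 : ℝ)..δ, |t| = δ ^ 2 / 2 := by
      rw [intervalIntegral.integral_congr (g := fun t => t)]
      · simp
      · intro t ht
        rw [Set.uIcc_of_le hd] at ht
        exact abs_of_nonneg ht.1
    rw [this]
    gcongr
  · rw [intervalIntegral.integral_symm, abs_neg]
    refine (intervalIntegral.norm_integral_le_of_norm_le
      (f := fun t => steinDeriv h (w + t) - steinDeriv h w) hd
      (Eventually.of_forall fun t _ => hpt t)
      ((habs.fun_add hsub).intervalIntegrable _ _)).trans ?_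
    rw [abs_of_nonpos hd] at hδ
    refine (hbd δ 0 hd (by linarith) hb).trans ?_
    have : ∫ t in δ..(0 : ℝ), |t| = (-δ) ^ 2 / 2 := by
      rw [intervalIntegral.integral_congr (g := fun t => -t)]
      · rw [intervalIntegral.integral_neg, integral_id]
        ring
      · intro t ht
        rw [Set.uIcc_of_le hd] at ht
        exact abs_of_nonpos ht.2
    rw [this]
    have : 0 ≤ -δ := by linarith
    gcongr

end Stein

end BinomialCoverage
end

noncomputable section
namespace BinomialCoverage

/-! ### Smoothed indicators and the Kolmogorov distance -/

/-- The continuous function that is `1` up to `z`, `0` from `z + α` on, and affine between. -/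
def ramp (z α w : ℝ) : ℝ := max 0 (z + α - max z w) / α

section Ramp

variable {z α : ℝ}

theorem continuous_ramp : Continuous (ramp z α) := by
  unfold ramp
  fun_prop

theorem ramp_nonneg (hα : 0 < α) (w : ℝ) : 0 ≤ ramp z α w :=
  div_nonneg (le_max_left _ _) hα.le

theorem ramp_le_one (hα : 0 < α) (w : ℝ) : ramp z α w ≤ 1 := by
  rw [ramp, div_le_one hα]
  exact max_le hα.le (by linarith [le_max_left z w])

theorem antitone_ramp (hα : 0 < α) : Antitone (ramp z α) := fun a b h => by
  unfold ramp
  gcongr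

theorem ramp_eq_one (hα : 0 < α) {w : ℝ} (h : w ≤ z) : ramp z α w = 1 := by
  rw [ramp, max_eq_left h, add_sub_cancel_left, max_eq_right hα.le, div_self hα.ne']

theorem ramp_eq_zero {w : ℝ} (h : z + α ≤ w) : ramp z α w = 0 := by
  rw [ramp, max_eq_left, zero_div]
  linarith [le_max_right z w]

theorem ramp_add (w t : ℝ) : ramp z α (w + t) = ramp (z - t) α w := by
  unfold ramp
  congr 2
  rw [show max z (w + t) = max (z - t) w + t by rw [← max_add_add_right]; simp]
  ring

/-- A ramp is the average of the indicators of `Iic x` over `x` between `z` and `z + α`, so its mean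
under any law is an average of the distribution function. -/
theorem ramp_eq_integral (hα : 0 < α) (w : ℝ) :
    ramp z α w = α⁻¹ * ∫ x in z..(z + α), (Set.Ici w).indicator 1 x := by
  rw [intervalIntegral.integral_of_le (by linarith), integral_indicator_one measurableSet_Ici,
    measureReal_restrict_apply measurableSet_Ici, measureReal_congr
      (show (Set.Ici w ∩ Set.Ioc z (z + α) : Set ℝ) =ᵐ[volume] Set.Icc (max z w) (z + α) from ?_),
    Real.volume_real_Icc, ramp, max_comm]
  · ring
  · have : (Set.Ici w ∩ Set.Icc z (z + α) : Set ℝ) = Set.Icc (max z w) (z + α) := by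
      ext x
      simp only [Set.mem_inter_iff, Set.mem_Ici, Set.mem_Icc, sup_le_iff]
      tauto
    rw [← this]
    exact (ae_eq_refl _).inter Ioc_ae_eq_Icc

/-- Mean of a smoothed indicator as an average of the distribution function. -/
theorem integral_ramp (hα : 0 < α) (Q : Measure ℝ) [IsProbabilityMeasure Q] :
    ∫ w, ramp z α w ∂Q = α⁻¹ * ∫ x in z..(z + α), Q.real (Set.Iic x) := by
  simp_rw [ramp_eq_integral hα, integral_const_mul]
  congr 1
  rw [intervalIntegral.integral_of_le (by linarith)]
  simp_rw [intervalIntegral.integral_of_le (show z ≤ z + α by linarith)]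
  rw [integral_integral_swap]
  · congr 1 with x
    rw [← integral_indicator_one measurableSet_Iic]
    rfl
  · have hm : MeasurableSet {p : ℝ × ℝ | p.1 ≤ p.2} :=
      measurableSet_le measurable_fst measurable_snd
    refine Integrable.mono' (integrable_const (1 : ℝ))
      (Measurable.aestronglyMeasurable (f := {p : ℝ × ℝ | p.1 ≤ p.2}.indicator 1)
        (measurable_one.indicator hm))
      (Eventually.of_forall fun p => ?_)
    rw [Real.norm_eq_abs]
    by_cases hp : p.1 ≤ p.2 <;> simp [Function.uncurry, Set.indicator, hp]

end Ramp

section Kolmogorov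

variable {Ω : Type*} [MeasurableSpace Ω] {P : Measure Ω} [IsProbabilityMeasure P] {X : Ω → ℝ}

theorem abs_cdf_sub_le_one (A : Set Ω) (t : ℝ) :
    |P.real A - (gaussianReal 0 1).real (Set.Iic t)| ≤ 1 := by
  have h1 : P.real A ≤ 1 := measureReal_le_one
  have h2 : (gaussianReal 0 1).real (Set.Iic t) ≤ 1 := measureReal_le_one
  rw [abs_le]
  constructor <;> linarith [measureReal_nonneg (μ := P) (s := A),
    measureReal_nonneg (μ := gaussianReal 0 1) (s := Set.Iic t)]

theorem le_kolmogorovDist (t : ℝ) :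
    |P.real {ω | (X ω - ∫ ω', X ω' ∂P) / √(variance X P) ≤ t} - ncdf t| ≤
      kolmogorovDist P X := by
  rw [← gaussianReal_real_Iic]
  refine le_ciSup (f := fun t : ℝ => |P.real {ω | (X ω - ∫ ω', X ω' ∂P) / √(variance X P) ≤ t}
    - (gaussianReal 0 1).real (Set.Iic t)|) ⟨1, ?_⟩ t
  rintro _ ⟨t, rfl⟩
  exact abs_cdf_sub_le_one _ _

omit [IsProbabilityMeasure P] in
theorem kolmogorovDist_le {c : ℝ}
    (h : ∀ t, |P.real {ω | (X ω - ∫ ω', X ω' ∂P) / √(variance X P) ≤ t} - ncdf t| ≤ c) :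
    kolmogorovDist P X ≤ c :=
  ciSup_le fun t => by
    rw [gaussianReal_real_Iic]
    exact h t

end Kolmogorov

/-- Mean oscillation of a smoothed indicator under a law that is close to the normal law. -/
theorem abs_ramp_sub_ramp_integral_le {Q : Measure ℝ} [IsProbabilityMeasure Q] {D : ℝ}
    (hD : ∀ t, |Q.real (Set.Iic t) - ncdf t| ≤ D) {z α : ℝ} (hα : 0 < α) (t : ℝ) :
    ∫ w, |ramp z α (w + t) - ramp z α w| ∂Q ≤ |t| * (2 / 5 + 2 * D / α) := by
  have hint : ∀ z, Integrable (ramp z α) Q := fun z =>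
    Integrable.mono' (integrable_const (1 : ℝ)) continuous_ramp.aestronglyMeasurable
      (Eventually.of_forall fun w => by
        rw [Real.norm_eq_abs, abs_of_nonneg (ramp_nonneg hα w)]
        exact ramp_le_one hα w)
  set F : ℝ → ℝ := fun x => Q.real (Set.Iic x)
  have hFm : Monotone F := fun a b h => measureReal_mono (Set.Iic_subset_Iic.2 h)
  have hFi : ∀ a b, IntervalIntegrable F volume a b := fun a b => hFm.intervalIntegrable
  have hFs : ∀ a b, IntervalIntegrable (fun u => F (u + α)) volume a b := fun a b =>
    Monotone.intervalIntegrable fun u v h => hFm (by linarith)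
  have key : ∀ x y : ℝ, x ≤ y →
      ∫ w, (ramp y α w - ramp x α w) ∂Q ≤ (y - x) * (2 / 5 + 2 * D / α) := by
    intro x y hxy
    rw [integral_sub (hint y) (hint x), integral_ramp hα, integral_ramp hα, ← mul_sub]
    -- Two windows of length `α` shifted against each other: the common part cancels, and increments
    -- of `F` over length `α` remain.
    have e : (∫ u in y..(y + α), F u) - ∫ u in x..(x + α), F u =
        ∫ u in x..y, (F (u + α) - F u) := by
      rw [intervalIntegral.integral_sub (hFs _ _) (hFi _ _),
        intervalIntegral.integral_comp_add_right F α]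
      have h1 := intervalIntegral.integral_add_adjacent_intervals (hFi x y) (hFi y (y + α))
      have h2 := intervalIntegral.integral_add_adjacent_intervals (hFi x (x + α))
        (hFi (x + α) (y + α))
      linarith
    -- `F` is within `D` of `ncdf` at both ends of the increment. The unknown distance re-enters
    -- here and makes the final bound implicit.
    have e2 : ∫ u in x..y, (F (u + α) - F u) ≤ (y - x) * (2 / 5 * α + 2 * D) := by
      have := intervalIntegral.integral_mono_on (g := fun _ => 2 / 5 * α + 2 * D) hxy
        ((hFs x y).sub (hFi x y))
        (continuous_const.intervalIntegrable x y) (fun u _ => ?_)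
      · simp only [intervalIntegral.integral_const, smul_eq_mul] at this
        exact this
      · have h1 := abs_le.1 (hD (u + α))
        have h2 := abs_le.1 (hD u)
        have h3 := ncdf_sub_le (show u ≤ u + α by linarith)
        simp only [F]
        linarith [h1.2, h2.1]
    calc _ ≤ α⁻¹ * ((y - x) * (2 / 5 * α + 2 * D)) := by
          change α⁻¹ * ((∫ u in y..(y + α), F u) - ∫ u in x..(x + α), F u) ≤ _
          rw [e]
          gcongr
      _ = _ := by field_simp
  rcases le_total 0 t with ht | ht
  · have e : ∀ w, |ramp z α (w + t) - ramp z α w| = ramp z α w - ramp (z - t) α w := fun w => by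
      rw [abs_of_nonpos (sub_nonpos.2 (antitone_ramp hα (by linarith))), ramp_add]
      ring
    simp_rw [e]
    refine (key _ _ (by linarith)).trans (le_of_eq ?_)
    rw [abs_of_nonneg ht]
    ring
  · have e : ∀ w, |ramp z α (w + t) - ramp z α w| = ramp (z - t) α w - ramp z α w := fun w => by
      rw [abs_of_nonneg (sub_nonneg.2 (antitone_ramp hα (by linarith))), ramp_add]
    simp_rw [e]
    refine (key _ _ (by linarith)).trans (le_of_eq ?_)
    rw [abs_of_nonpos ht]
    ring

theorem nmean_ramp_le {z α : ℝ} (hα : 0 < α) : nmean (ramp z α) ≤ ncdf z + 2 / 5 * α := by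
  have h := integrable_mul_nd (h := ramp z α) continuous_ramp (ramp_nonneg hα) (ramp_le_one hα)
  have : nmean (ramp z α) ≤ ncdf (z + α) := by
    rw [nmean, ncdf, ← integral_indicator measurableSet_Iic]
    refine integral_mono h (integrable_nd.indicator measurableSet_Iic) fun x => ?_
    by_cases hx : x ≤ z + α
    · rw [Set.indicator_of_mem (Set.mem_Iic.2 hx)]
      exact mul_le_of_le_one_left (nd_pos x).le (ramp_le_one hα x)
    · rw [Set.indicator_of_notMem (by simpa using hx)]
      simp [ramp_eq_zero (not_le.1 hx).le]
  linarith [ncdf_sub_le (show z ≤ z + α by linarith)]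

theorem le_nmean_ramp {z α : ℝ} (hα : 0 < α) : ncdf z ≤ nmean (ramp z α) := by
  have h := integrable_mul_nd (h := ramp z α) continuous_ramp (ramp_nonneg hα) (ramp_le_one hα)
  rw [nmean, ncdf, ← integral_indicator measurableSet_Iic]
  refine integral_mono (integrable_nd.indicator measurableSet_Iic) h fun x => ?_
  by_cases hx : x ≤ z
  · rw [Set.indicator_of_mem (Set.mem_Iic.2 hx)]
    simp [ramp_eq_one hα hx]
  · rw [Set.indicator_of_notMem (by simpa using hx)]
    exact mul_nonneg (ramp_nonneg hα x) (nd_pos x).le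

/-- Kolmogorov distance from smoothed indicators. -/
theorem abs_cdf_sub_le_of_ramp {Q : Measure ℝ} [IsProbabilityMeasure Q] {α ε : ℝ} (hα : 0 < α)
    (h : ∀ z, |∫ w, ramp z α w ∂Q - nmean (ramp z α)| ≤ ε) (t : ℝ) :
    |Q.real (Set.Iic t) - ncdf t| ≤ 2 / 5 * α + ε := by
  have hint : ∀ z, Integrable (ramp z α) Q := fun z =>
    Integrable.mono' (integrable_const (1 : ℝ)) continuous_ramp.aestronglyMeasurable
      (Eventually.of_forall fun w => by
        rw [Real.norm_eq_abs, abs_of_nonneg (ramp_nonneg hα w)]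
        exact ramp_le_one hα w)
  have h1 : Q.real (Set.Iic t) ≤ ∫ w, ramp t α w ∂Q := by
    rw [← integral_indicator_one measurableSet_Iic]
    refine integral_mono ((integrable_const (1 : ℝ)).indicator measurableSet_Iic) (hint t)
      fun x => ?_
    by_cases hx : x ≤ t
    · rw [Set.indicator_of_mem (Set.mem_Iic.2 hx)]
      simp [ramp_eq_one hα hx]
    · rw [Set.indicator_of_notMem (by simpa using hx)]
      exact ramp_nonneg hα x
  have h2 : ∫ w, ramp (t - α) α w ∂Q ≤ Q.real (Set.Iic t) := by
    rw [← integral_indicator_one measurableSet_Iic]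
    refine integral_mono (hint _) ((integrable_const (1 : ℝ)).indicator measurableSet_Iic)
      fun x => ?_
    by_cases hx : x ≤ t
    · rw [Set.indicator_of_mem (Set.mem_Iic.2 hx)]
      exact ramp_le_one hα x
    · rw [Set.indicator_of_notMem (by simpa using hx), ramp_eq_zero (by linarith)]
  have h3 := abs_le.1 (h t)
  have h4 := abs_le.1 (h (t - α))
  have h5 := nmean_ramp_le (z := t) hα
  have h6 := le_nmean_ramp (z := t - α) hα
  have h7 := ncdf_sub_le (show t - α ≤ t by linarith)
  rw [abs_le]
  constructor <;> linarith [h3.2, h4.1]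

/-- Optimization over the smoothing parameter. -/
theorem le_of_forall_smoothing {D a b : ℝ} (ha : 0 < a) (hb : 0 ≤ b)
    (h : ∀ α : ℝ, 0 < α → D ≤ 2 / 5 * α + (b + a * (7 / 5 + 2 * D / α))) :
    D ≤ (√(11 * a + 5 * b) + 2 * √a) ^ 2 / 5 := by
  set r := √(11 * a + 5 * b) with hr
  set q := √a with hq
  have hr2 : r ^ 2 = 11 * a + 5 * b := Real.sq_sqrt (by positivity)
  have hq2 : q ^ 2 = a := Real.sq_sqrt ha.le
  have hq0 : 0 < q := Real.sqrt_pos.2 ha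
  have hr0 : 0 < r := Real.sqrt_pos.2 (by positivity)
  -- Write `α = 2 * a + x`. Solved for `D`, the hypothesis bounds `D` by `2 * x / 5 + 3 * a + b +
  -- (22 * a ^ 2 / 5 + 2 * a * b) / x`, which is least at `x ^ 2 = a * (11 * a + 5 * b)`, that is at
  -- `x = q * r`.
  have h1 := h (2 * a + q * r) (by positivity)
  have hα : 0 < 2 * a + q * r := by positivity
  have h2 : D * (q * r) ≤ (2 / 5 * (2 * a + q * r) + b + 7 / 5 * a) * (2 * a + q * r) := by
    have := mul_le_mul_of_nonneg_right h1 hα.le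
    have e : 2 * D / (2 * a + q * r) * (2 * a + q * r) = 2 * D := div_mul_cancel₀ _ hα.ne'
    nlinarith
  have h3 : (2 / 5 * (2 * a + q * r) + b + 7 / 5 * a) * (2 * a + q * r) =
      (r + 2 * q) ^ 2 / 5 * (q * r) := by
    have hb' : b = (r ^ 2 - 11 * a) / 5 := by linarith
    rw [hb', ← hq2]
    ring
  exact le_of_mul_le_mul_right (h2.trans_eq h3) (by positivity)

end BinomialCoverage
end

noncomputable section
namespace BinomialCoverage

/-! ### A Berry–Esseen bound from a bounded size-bias coupling -/

theorem integrable_of_abs_le {α : Type*} [MeasurableSpace α] {μ : Measure α} [IsFiniteMeasure μ]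
    {f : α → ℝ} {C : ℝ} (hf : Measurable f) (h : ∀ x, |f x| ≤ C) : Integrable f μ :=
  Integrable.mono' (integrable_const C) hf.aestronglyMeasurable (Eventually.of_forall h)

theorem measurable_integral_right {α β : Type*} [MeasurableSpace α] [MeasurableSpace β]
    {μ : Measure β} [SFinite μ] {f : α → β → ℝ} (hf : Measurable (Function.uncurry f)) :
    Measurable fun x => ∫ y, f x y ∂μ :=
  (hf.stronglyMeasurable.integral_prod_right).measurable

theorem abs_integral_le_of_abs_le {α : Type*} [MeasurableSpace α] {μ : Measure α}
    [IsProbabilityMeasure μ] {f : α → ℝ} {C : ℝ} (h : ∀ x, |f x| ≤ C) :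
    |∫ x, f x ∂μ| ≤ C := by
  have := norm_integral_le_of_norm_le_const (μ := μ) (f := f) (Eventually.of_forall h)
  simpa using this

/-- The size-biased variable is described by a subprobability density `w ω` on an auxiliary space:
it equals `Z ω θ` with weight `w ω θ` and stays at `Y ω` with the remaining probability, which is
what `hSB` expresses. A first-order expansion of the Stein solution in the identity `hSB` leaves two
errors. One is linear in the conditional mean change and is controlled by its deviation `Δ`; the
other is a Taylor remainder, controlled by `B` and the oscillation of the ramp. -/
theorem kolmogorovDist_le_of_sizeBias {Ω Θ : Type*} [MeasurableSpace Ω] [MeasurableSpace Θ]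
    {P : Measure Ω} [IsProbabilityMeasure P] {τ : Measure Θ} [IsProbabilityMeasure τ]
    {Y : Ω → ℝ} {Z w : Ω → Θ → ℝ} {M C B Δ : ℝ} (hY : Measurable Y)
    (hZ : Measurable (Function.uncurry Z)) (hw : Measurable (Function.uncurry w))
    (hYM : ∀ ω, |Y ω| ≤ M) (hw0 : ∀ ω θ, 0 ≤ w ω θ) (hwC : ∀ ω θ, w ω θ ≤ C)
    (hw1 : ∀ ω, ∫ θ, w ω θ ∂τ ≤ 1) (hB : 0 < B) (hZB : ∀ ω θ, w ω θ ≠ 0 → |Z ω θ - Y ω| ≤ B)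
    (hμ : 0 < ∫ ω, Y ω ∂P) (hσ : 0 < variance Y P)
    (hSB : ∀ f : ℝ → ℝ, Continuous f → ∫ ω, Y ω * f (Y ω) ∂P = (∫ ω, Y ω ∂P) *
      (∫ ω, f (Y ω) ∂P + ∫ ω, ∫ θ, w ω θ * (f (Z ω θ) - f (Y ω)) ∂τ ∂P))
    (hΔ : ∫ ω, |∫ θ, w ω θ * (Z ω θ - Y ω) ∂τ - ∫ ω', ∫ θ, w ω' θ * (Z ω' θ - Y ω') ∂τ ∂P| ∂P ≤ Δ) :
    kolmogorovDist P Y ≤ (∫ ω, Y ω ∂P) / (5 * variance Y P) *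
      (√(11 * B ^ 2 / √(variance Y P) + 5 * Δ) + 2 * B / √(√(variance Y P))) ^ 2 := by
  set μ := ∫ ω, Y ω ∂P with hμdef
  set v := variance Y P with hv
  set s := √v with hs
  have hs0 : 0 < s := Real.sqrt_pos.2 hσ
  have hs2 : s ^ 2 = v := Real.sq_sqrt hσ.le
  set T : Ω → ℝ := fun ω => ∫ θ, w ω θ * (Z ω θ - Y ω) ∂τ with hT
  have hΔ0 : 0 ≤ Δ := (integral_nonneg fun ω => abs_nonneg _).trans hΔ
  have hY' : Measurable fun p : Ω × Θ => Y p.1 := hY.comp measurable_fst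
  have hwZ : ∀ ω θ, |w ω θ * (Z ω θ - Y ω)| ≤ C * B := fun ω θ => by
    have hC : 0 ≤ C := (hw0 ω θ).trans (hwC ω θ)
    by_cases h : w ω θ = 0
    · rw [h, zero_mul, abs_zero]
      positivity
    · rw [abs_mul, abs_of_nonneg (hw0 ω θ)]
      exact mul_le_mul (hwC ω θ) (hZB ω θ h) (abs_nonneg _) hC
  have hTm : Measurable T := measurable_integral_right (hw.mul (hZ.sub hY'))
  have hTb : ∀ ω, |T ω| ≤ C * B := fun ω => abs_integral_le_of_abs_le (hwZ ω)
  have hTi : Integrable T P := integrable_of_abs_le hTm hTb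
  have hYi : Integrable Y P := integrable_of_abs_le hY hYM
  have hY2i : Integrable (fun ω => Y ω ^ 2) P :=
    integrable_of_abs_le (C := M ^ 2) (hY.pow_const 2) fun ω => by
      rw [abs_pow]
      exact pow_le_pow_left₀ (abs_nonneg _) (hYM ω) 2
  have hvar : v = ∫ ω, Y ω ^ 2 ∂P - μ ^ 2 := by
    rw [hv, variance_eq_sub]
    · rfl
    · exact (memLp_two_iff_integrable_sq hY.aestronglyMeasurable).2 hY2i
  -- The size-bias identity for the identity function: `μ` times the mean change is the variance.
  have hTmean : ∫ ω, T ω ∂P = v / μ := by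
    have := hSB id continuous_id
    simp only [id] at this
    have e : ∫ ω, Y ω * Y ω ∂P = ∫ ω, Y ω ^ 2 ∂P := by simp_rw [sq]
    rw [e] at this
    rw [eq_div_iff hμ.ne', hvar, this]
    simp only [hT]
    ring
  set W : Ω → ℝ := fun ω => (Y ω - μ) / s with hW
  have hWm : Measurable W := (hY.sub_const μ).div_const s
  set Q : Measure ℝ := P.map W with hQ
  have : IsProbabilityMeasure Q := Measure.isProbabilityMeasure_map hWm.aemeasurable
  have hQF : ∀ t, Q.real (Set.Iic t) = P.real {ω | (Y ω - ∫ ω', Y ω' ∂P) / √(variance Y P) ≤ t} :=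
    fun t => by
      rw [hQ, map_measureReal_apply hWm measurableSet_Iic]
      rfl
  set D := kolmogorovDist P Y
  have hD : ∀ t, |Q.real (Set.Iic t) - ncdf t| ≤ D := fun t => by
    rw [hQF]
    exact le_kolmogorovDist t
  set β := B / s with hβ
  have hβ0 : 0 < β := div_pos hB hs0
  have hW2 : ∫ ω, W ω ^ 2 ∂P = 1 := by
    have e : ∀ ω, W ω ^ 2 = (Y ω ^ 2 - 2 * μ * Y ω + μ ^ 2) / v := fun ω => by
      simp only [hW, div_pow, hs2]
      ring
    simp_rw [e]
    have i1 : Integrable (fun ω => Y ω ^ 2 - 2 * μ * Y ω) P := hY2i.sub (hYi.const_mul _)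
    rw [integral_div, integral_add i1 (integrable_const _),
      integral_sub hY2i (hYi.const_mul _), integral_const_mul, ← hμdef]
    simp only [integral_const, probReal_univ, one_smul]
    rw [div_eq_one_iff_eq hσ.ne', hvar]
    ring
  have hWi : Integrable W P := (hYi.sub (integrable_const _)).div_const _
  have hW2i : Integrable (fun ω => W ω ^ 2) P := by
    by_contra h
    rw [integral_undef h] at hW2
    exact zero_ne_one hW2
  have hW1 : ∫ ω, |W ω| ∂P ≤ 1 := by
    have : ∫ ω, |W ω| ∂P ≤ ∫ ω, (1 + W ω ^ 2) / 2 ∂P :=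
      integral_mono hWi.abs (((integrable_const _).add hW2i).div_const 2) fun ω => by
        have := sq_nonneg (|W ω| - 1)
        have e := sq_abs (W ω)
        simp only
        linarith
    rw [integral_div, integral_add (integrable_const _) hW2i, hW2] at this
    simpa using this
  -- the Stein identity for smoothed indicators
  have main : ∀ α : ℝ, 0 < α → ∀ z, |∫ x, ramp z α x ∂Q - nmean (ramp z α)| ≤
      μ * Δ / v + μ * B ^ 2 / s ^ 3 * (7 / 5 + 2 * D / α) := by
    intro α hα z
    have hc : Continuous (ramp z α) := continuous_ramp
    have h0 := ramp_nonneg (z := z) hα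
    have h1 := ramp_le_one (z := z) hα
    have ha := antitone_ramp (z := z) hα
    set h := ramp z α with hh
    set f := steinSol h with hf
    set fp := steinDeriv h with hfp
    have hfc : Continuous f := continuous_steinSol hc h0 h1
    have hfpc : Continuous fp := continuous_steinDeriv hc h0 h1
    have hfb : ∀ x, |f x| ≤ 1 := abs_steinSol_le hc h0 h1 ha
    have hfpb : ∀ x, |fp x| ≤ 1 := abs_steinDeriv_le hc h0 h1 ha
    have hfW : Integrable (fun ω => f (W ω)) P :=
      integrable_of_abs_le (hfc.measurable.comp hWm) fun ω => hfb _
    have hfpW : Integrable (fun ω => fp (W ω)) P :=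
      integrable_of_abs_le (hfpc.measurable.comp hWm) fun ω => hfpb _
    have hhW : Integrable (fun ω => h (W ω)) P :=
      integrable_of_abs_le (hc.measurable.comp hWm) fun ω => by
        rw [abs_of_nonneg (h0 _)]
        exact h1 _
    have hfpT : Integrable (fun ω => fp (W ω) * T ω) P :=
      integrable_of_abs_le (C := 1 * (C * B)) ((hfpc.measurable.comp hWm).mul hTm) fun ω => by
        rw [abs_mul]
        exact mul_le_mul (hfpb _) (hTb _) (abs_nonneg _) zero_le_one
    have hYfi : Integrable (fun ω => Y ω * f (W ω)) P :=
      integrable_of_abs_le (C := M * 1) (hY.mul (hfc.measurable.comp hWm)) fun ω => by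
        rw [abs_mul]
        exact mul_le_mul (hYM ω) (hfb _) (abs_nonneg _) ((abs_nonneg _).trans (hYM ω))
    -- Centring removes the unperturbed term of the size-bias identity, so only the increment of `f`
    -- under the coupling remains.
    have hWf : ∫ ω, W ω * f (W ω) ∂P =
        μ / s * ∫ ω, ∫ θ, w ω θ * (f ((Z ω θ - μ) / s) - f (W ω)) ∂τ ∂P := by
      have := hSB (fun y => f ((y - μ) / s)) (by fun_prop)
      have e : ∀ ω, W ω * f (W ω) = (Y ω * f (W ω) - μ * f (W ω)) / s := fun ω => by
        simp only [hW]
        ring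
      simp_rw [e]
      rw [integral_div, integral_sub hYfi (hfW.const_mul _), integral_const_mul]
      change ∫ ω, Y ω * f (W ω) ∂P = μ * (∫ ω, f (W ω) ∂P +
        ∫ ω, ∫ θ, w ω θ * (f ((Z ω θ - μ) / s) - f (W ω)) ∂τ ∂P) at this
      rw [this]
      ring
    -- The weighted remainder of the first-order expansion of `f` at `W ω`.
    set ρ : Ω → Θ → ℝ := fun ω θ =>
      w ω θ * (f ((Z ω θ - μ) / s) - f (W ω) - (Z ω θ - Y ω) / s * fp (W ω)) with hρ
    set G : ℝ → ℝ := fun x => ∫ t in -β..β, |h (x + t) - h x| with hG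
    have hρle : ∀ ω θ, |ρ ω θ| ≤ w ω θ * (β ^ 2 / 2 * (1 + |W ω|) + G (W ω)) := fun ω θ => by
      by_cases hw' : w ω θ = 0
      · simp [hρ, hw']
      · rw [hρ, abs_mul, abs_of_nonneg (hw0 ω θ)]
        refine mul_le_mul_of_nonneg_left ?_ (hw0 ω θ)
        have e : (Z ω θ - μ) / s = W ω + (Z ω θ - Y ω) / s := by
          simp only [hW]
          ring
        rw [e]
        refine abs_steinSol_sub_le hc h0 h1 ha ?_
        rw [abs_div, abs_of_pos hs0]
        exact div_le_div_of_nonneg_right (hZB ω θ hw') hs0.le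
    have hWm' : Measurable fun p : Ω × Θ => W p.1 := hWm.comp measurable_fst
    have hZ' : Measurable fun p : Ω × Θ => Z p.1 p.2 := hZ
    have hw' : Measurable fun p : Ω × Θ => w p.1 p.2 := hw
    have hρm : Measurable (Function.uncurry ρ) := by
      have m1 : Measurable fun p : Ω × Θ => f ((Z p.1 p.2 - μ) / s) :=
        hfc.measurable.comp ((hZ'.sub_const μ).div_const s)
      have m2 : Measurable fun p : Ω × Θ => f (W p.1) := hfc.measurable.comp hWm'
      have m3 : Measurable fun p : Ω × Θ => fp (W p.1) := hfpc.measurable.comp hWm'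
      exact hw'.mul ((m1.sub m2).sub (((hZ'.sub hY').div_const s).mul m3))
    have hwi : ∀ ω, Integrable (w ω) τ := fun ω =>
      integrable_of_abs_le (hw.comp measurable_prodMk_left) fun θ => by
        rw [abs_of_nonneg (hw0 ω θ)]
        exact hwC ω θ
    have hwZi : ∀ ω, Integrable (fun θ => w ω θ * (Z ω θ - Y ω)) τ := fun ω =>
      integrable_of_abs_le ((hw.mul (hZ.sub hY')).comp measurable_prodMk_left) (hwZ ω)
    have hρi : ∀ ω, Integrable (ρ ω) τ := fun ω =>
      ((hwi ω).mul_const _).mono' (hρm.comp measurable_prodMk_left).aestronglyMeasurable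
        (Eventually.of_forall (hρle ω))
    have hinner : ∀ ω, ∫ θ, w ω θ * (f ((Z ω θ - μ) / s) - f (W ω)) ∂τ =
        fp (W ω) * T ω / s + ∫ θ, ρ ω θ ∂τ := fun ω => by
      have e : ∀ θ, w ω θ * (f ((Z ω θ - μ) / s) - f (W ω)) =
          w ω θ * (Z ω θ - Y ω) * (fp (W ω) / s) + ρ ω θ := fun θ => by
        simp only [hρ]
        ring
      simp_rw [e]
      rw [integral_add ((hwZi ω).mul_const _) (hρi ω), integral_mul_const]
      simp only [hT]
      ring
    have hGc : Continuous G := by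
      apply intervalIntegral.continuous_parametric_intervalIntegral_of_continuous'
      simp only [Function.uncurry_def]
      fun_prop
    have hosc : ∀ x t, |h (x + t) - h x| ≤ 1 := fun x t => by
      rw [abs_le]
      constructor <;> linarith [h0 x, h1 x, h0 (x + t), h1 (x + t)]
    have hG0 : ∀ x, 0 ≤ G x := fun x =>
      intervalIntegral.integral_nonneg (by linarith) fun t _ => abs_nonneg _
    have hGb : ∀ x, |G x| ≤ 1 * |β - -β| := fun x =>
      intervalIntegral.norm_integral_le_of_norm_le_const (f := fun t => |h (x + t) - h x|)
        fun t _ => by simpa using hosc x t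
    have hGi : Integrable (fun ω => G (W ω)) P :=
      integrable_of_abs_le (hGc.measurable.comp hWm) fun ω => hGb _
    have hρint : ∀ ω, |∫ θ, ρ ω θ ∂τ| ≤ β ^ 2 / 2 * (1 + |W ω|) + G (W ω) := fun ω => by
      have hK : 0 ≤ β ^ 2 / 2 * (1 + |W ω|) + G (W ω) := by
        have := hG0 (W ω)
        positivity
      calc _ ≤ ∫ θ, |ρ ω θ| ∂τ := abs_integral_le_integral_abs
        _ ≤ ∫ θ, w ω θ * (β ^ 2 / 2 * (1 + |W ω|) + G (W ω)) ∂τ :=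
            integral_mono (hρi ω).abs ((hwi ω).mul_const _) (hρle ω)
        _ ≤ _ := by
            rw [integral_mul_const]
            exact mul_le_of_le_one_left hK (hw1 ω)
    have hbi : Integrable (fun ω => β ^ 2 / 2 * (1 + |W ω|) + G (W ω)) P :=
      (((integrable_const _).add hWi.abs).const_mul _).add hGi
    have hρo : Integrable (fun ω => ∫ θ, ρ ω θ ∂τ) P :=
      hbi.mono' (measurable_integral_right hρm).aestronglyMeasurable (Eventually.of_forall hρint)
    -- Exchanging the integrals, the oscillation for a fixed shift `t` is linear in `|t|`, and `|t|`
    -- integrates to `β ^ 2` over `[-β, β]`.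
    have hGint : ∫ ω, G (W ω) ∂P ≤ β ^ 2 * (2 / 5 + 2 * D / α) := by
      have e : ∫ ω, G (W ω) ∂P = ∫ x, G x ∂Q :=
        (integral_map hWm.aemeasurable hGc.aestronglyMeasurable).symm
      rw [e, hG]
      simp_rw [intervalIntegral.integral_of_le (show -β ≤ β by linarith)]
      rw [integral_integral_swap]
      · have hmono : ∫ t in Set.Ioc (-β) β, ∫ x, |h (x + t) - h x| ∂Q ≤
            ∫ t in Set.Ioc (-β) β, |t| * (2 / 5 + 2 * D / α) := by
          refine integral_mono_of_nonneg (Eventually.of_forall fun t =>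
            integral_nonneg fun x => abs_nonneg _) ?_
            (Eventually.of_forall fun t => abs_ramp_sub_ramp_integral_le hD hα t)
          rw [← IntegrableOn, ← intervalIntegrable_iff_integrableOn_Ioc_of_le (by linarith)]
          exact Continuous.intervalIntegrable (by fun_prop) _ _
        refine hmono.trans (le_of_eq ?_)
        rw [integral_mul_const, ← intervalIntegral.integral_of_le (by linarith)]
        congr 1
        rw [← intervalIntegral.integral_add_adjacent_intervals (b := 0)
          (continuous_abs.intervalIntegrable _ _) (continuous_abs.intervalIntegrable _ _),
          intervalIntegral.integral_congr (g := fun t => -t) (a := -β),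
          intervalIntegral.integral_congr (g := fun t => t) (a := 0)]
        · rw [intervalIntegral.integral_neg, integral_id, integral_id]
          ring
        · intro t ht
          rw [Set.uIcc_of_le hβ0.le] at ht
          exact abs_of_nonneg ht.1
        · intro t ht
          rw [Set.uIcc_of_le (by linarith)] at ht
          exact abs_of_nonpos ht.2
      · refine integrable_of_abs_le (C := 1) ?_ fun p => ?_
        · have : Continuous (Function.uncurry fun x t : ℝ => |h (x + t) - h x|) := by
            simp only [Function.uncurry_def]
            fun_prop
          exact this.measurable
        · simp only [Function.uncurry_def, abs_abs]
          exact hosc _ _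
    have e1 : ∫ x, h x ∂Q - nmean h = ∫ ω, (fp (W ω) - W ω * f (W ω)) ∂P := by
      have : ∀ ω, fp (W ω) - W ω * f (W ω) = h (W ω) - nmean h := fun ω => by
        simp only [hfp, steinDeriv, hf]
        ring
      simp_rw [this]
      rw [integral_sub hhW (integrable_const _), hQ,
        integral_map hWm.aemeasurable hc.aestronglyMeasurable]
      simp
    have hWfi : Integrable (fun ω => W ω * f (W ω)) P := by
      refine hWi.abs.mono' (hWm.mul (hfc.measurable.comp hWm)).aestronglyMeasurable
        (Eventually.of_forall fun ω => ?_)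
      rw [Real.norm_eq_abs, abs_mul]
      exact mul_le_of_le_one_right (abs_nonneg _) (hfb _)
    have e2 : ∫ x, h x ∂Q - nmean h = ∫ ω, fp (W ω) * (1 - μ / v * T ω) ∂P -
        μ / s * ∫ ω, ∫ θ, ρ ω θ ∂τ ∂P := by
      rw [e1, integral_sub hfpW hWfi, hWf]
      simp_rw [hinner]
      rw [integral_add (hfpT.div_const _) hρo, integral_div]
      have : ∀ ω, fp (W ω) * (1 - μ / v * T ω) = fp (W ω) - μ / v * (fp (W ω) * T ω) :=
        fun ω => by ring
      simp_rw [this]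
      rw [integral_sub hfpW (hfpT.const_mul _), integral_const_mul, ← hs2]
      field_simp
      ring
    have b1 : |∫ ω, fp (W ω) * (1 - μ / v * T ω) ∂P| ≤ μ * Δ / v := by
      calc _ ≤ ∫ ω, |fp (W ω) * (1 - μ / v * T ω)| ∂P := abs_integral_le_integral_abs
        _ ≤ ∫ ω, μ / v * |T ω - ∫ ω', T ω' ∂P| ∂P := by
            refine integral_mono_of_nonneg (Eventually.of_forall fun ω => abs_nonneg _)
              ((hTi.sub (integrable_const _)).abs.const_mul _) (Eventually.of_forall fun ω => ?_)
            have e : 1 - μ / v * T ω = -(μ / v * (T ω - v / μ)) := by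
              field_simp
              ring
            simp only
            rw [hTmean, abs_mul, e, abs_neg, abs_mul, abs_of_pos (div_pos hμ hσ)]
            exact mul_le_of_le_one_left (by positivity) (hfpb _)
        _ ≤ μ / v * Δ := by
            rw [integral_const_mul]
            gcongr
        _ = _ := by ring
    -- Here `7 / 5` is `1 + 2 / 5`: the 1 comes from the mean of `(1 + |W|) / 2`, the `2 / 5` from
    -- the normal density.
    have b2 : |∫ ω, ∫ θ, ρ ω θ ∂τ ∂P| ≤ β ^ 2 * (7 / 5 + 2 * D / α) := by
      calc _ ≤ ∫ ω, |∫ θ, ρ ω θ ∂τ| ∂P := abs_integral_le_integral_abs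
        _ ≤ ∫ ω, (β ^ 2 / 2 * (1 + |W ω|) + G (W ω)) ∂P := integral_mono hρo.abs hbi hρint
        _ = β ^ 2 / 2 * (1 + ∫ ω, |W ω| ∂P) + ∫ ω, G (W ω) ∂P := by
            have i2 : Integrable (fun ω => β ^ 2 / 2 * (1 + |W ω|)) P :=
              ((integrable_const _).add hWi.abs).const_mul _
            rw [integral_add i2 hGi,
              integral_const_mul, integral_add (integrable_const _) hWi.abs]
            simp
        _ ≤ β ^ 2 / 2 * (1 + 1) + β ^ 2 * (2 / 5 + 2 * D / α) := by gcongr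
        _ = _ := by ring
    rw [e2]
    calc _ ≤ |∫ ω, fp (W ω) * (1 - μ / v * T ω) ∂P| + |μ / s * ∫ ω, ∫ θ, ρ ω θ ∂τ ∂P| :=
          abs_sub _ _
      _ ≤ μ * Δ / v + μ / s * (β ^ 2 * (7 / 5 + 2 * D / α)) := by
          rw [abs_mul (μ / s), abs_of_pos (div_pos hμ hs0)]
          gcongr
      _ = _ := by
          rw [hβ]
          field_simp
  have hopt := le_of_forall_smoothing (D := D) (a := μ * B ^ 2 / s ^ 3) (b := μ * Δ / v)
    (by positivity) (by positivity) fun α hα => kolmogorovDist_le fun t => by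
      rw [← hQF]
      exact abs_cdf_sub_le_of_ramp hα (main α hα) t
  refine hopt.trans (le_of_eq ?_)
  have e1 : 11 * (μ * B ^ 2 / s ^ 3) + 5 * (μ * Δ / v) =
      μ / v * (11 * B ^ 2 / s + 5 * Δ) := by
    rw [← hs2]
    field_simp
  have e2 : √(μ * B ^ 2 / s ^ 3) = √(μ / v) * (B / √s) := by
    rw [← hs2, show μ * B ^ 2 / s ^ 3 = μ / s ^ 2 * (B ^ 2 / s) by field_simp,
      Real.sqrt_mul (by positivity), Real.sqrt_div (sq_nonneg B), Real.sqrt_sq hB.le]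
  rw [e1, e2, Real.sqrt_mul (by positivity)]
  have e3 : √(μ / v) ^ 2 = μ / v := Real.sq_sqrt (by positivity)
  calc _ = √(μ / v) ^ 2 * (√(11 * B ^ 2 / s + 5 * Δ) + 2 * B / √s) ^ 2 / 5 := by ring
    _ = _ := by
      rw [e3]
      field_simp

end BinomialCoverage
end

noncomputable section
namespace BinomialCoverage

/-! ### Product measures: resampling a coordinate, and the Efron–Stein inequality -/

section Resample

variable {X : Type*} [MeasurableSpace X] {n : ℕ} (ν : Measure X) [IsProbabilityMeasure ν]

/-- Law of `n` independent points with law `ν`. -/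
abbrev iidLaw (n : ℕ) : Measure (Fin n → X) := Measure.pi fun _ => ν

theorem measurable_update_pair (i : Fin n) :
    Measurable fun p : (Fin n → X) × X => Function.update p.1 i p.2 := by
  refine measurable_pi_lambda _ fun k => ?_
  by_cases h : k = i
  · subst h
    simpa using measurable_snd
  · simp only [Function.update_of_ne h]
    exact (measurable_pi_apply k).comp measurable_fst

/-- Exchanging the `i`-th point with an independent copy preserves the law. -/
theorem measurePreserving_exchange (i : Fin n) :
    MeasurePreserving (fun p : (Fin n → X) × X => (Function.update p.1 i p.2, p.1 i))
      ((iidLaw ν n).prod ν) ((iidLaw ν n).prod ν) := by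
  have hm : Measurable fun p : (Fin n → X) × X => (Function.update p.1 i p.2, p.1 i) :=
    (measurable_update_pair i).prodMk ((measurable_pi_apply i).comp measurable_fst)
  refine ⟨hm, ?_⟩
  symm
  refine Measure.prod_eq_generateFrom (C := Set.pi Set.univ '' Set.pi Set.univ
    fun _ => {s : Set X | MeasurableSet s}) (D := {s | MeasurableSet s}) generateFrom_pi
    MeasurableSpace.generateFrom_measurableSet isPiSystem_pi
    MeasurableSpace.isPiSystem_measurableSet
    ⟨fun _ => Set.univ, fun _ => ⟨fun _ => Set.univ, by simp, by simp⟩,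
      fun _ => measure_lt_top _ _, Set.iUnion_const _⟩
    ⟨fun _ => Set.univ, fun _ => MeasurableSet.univ, fun _ => measure_lt_top _ _,
      Set.iUnion_const _⟩ ?_
  rintro _ ⟨s, hs, rfl⟩ t ht
  have hs' : ∀ k, MeasurableSet (s k) := fun k => hs k trivial
  have ht' : MeasurableSet t := ht
  rw [Measure.map_apply hm ((MeasurableSet.univ_pi hs').prod ht')]
  have e : (fun p : (Fin n → X) × X => (Function.update p.1 i p.2, p.1 i)) ⁻¹'
      (Set.pi Set.univ s ×ˢ t) = Set.pi Set.univ (Function.update s i t) ×ˢ s i := by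
    ext ⟨u, v⟩
    simp only [Set.mem_preimage, Set.mem_prod, Set.mem_pi, Set.mem_univ, true_implies]
    constructor
    · rintro ⟨h1, h2⟩
      refine ⟨fun k => ?_, by simpa using h1 i⟩
      by_cases h : k = i
      · subst h
        simpa using h2
      · simpa [Function.update_of_ne h] using h1 k
    · rintro ⟨h1, h2⟩
      refine ⟨fun k => ?_, by simpa using h1 i⟩
      by_cases h : k = i
      · subst h
        simpa using h2
      · simpa [Function.update_of_ne h] using h1 k
  rw [e, Measure.prod_prod, Measure.pi_pi, Measure.pi_pi,
    ← Finset.mul_prod_erase Finset.univ _ (Finset.mem_univ i),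
    ← Finset.mul_prod_erase Finset.univ (fun k => ν (s k)) (Finset.mem_univ i)]
  have e2 : ∏ k ∈ Finset.univ.erase i, ν (Function.update s i t k) =
      ∏ k ∈ Finset.univ.erase i, ν (s k) :=
    Finset.prod_congr rfl fun k hk => by
      rw [Function.update_of_ne (Finset.ne_of_mem_erase hk)]
  rw [e2, Function.update_self]
  ring

theorem integral_exchange (i : Fin n) {Ψ : (Fin n → X) → X → ℝ} {C : ℝ}
    (hΨ : Measurable (Function.uncurry Ψ)) (hC : ∀ u v, |Ψ u v| ≤ C) :
    ∫ u, ∫ v, Ψ (Function.update u i v) (u i) ∂ν ∂(iidLaw ν n) =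
      ∫ u, ∫ v, Ψ u v ∂ν ∂(iidLaw ν n) := by
  have hmp := measurePreserving_exchange ν i
  have h1 : Integrable (Function.uncurry Ψ) ((iidLaw ν n).prod ν) :=
    integrable_of_abs_le hΨ fun p => hC _ _
  have h2 := hmp.integrable_comp_of_integrable h1
  have h3 := integral_map (μ := (iidLaw ν n).prod ν) (f := Function.uncurry Ψ) hmp.measurable.aemeasurable
    hΨ.aestronglyMeasurable
  rw [hmp.map_eq, integral_prod _ h1] at h3
  exact ((integral_prod _ h2).symm.trans h3.symm)

theorem integral_resample (i : Fin n) {F : (Fin n → X) → ℝ} {C : ℝ} (hF : Measurable F)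
    (hC : ∀ u, |F u| ≤ C) :
    ∫ u, ∫ v, F (Function.update u i v) ∂ν ∂(iidLaw ν n) = ∫ u, F u ∂(iidLaw ν n) := by
  have := integral_exchange ν i (Ψ := fun u _ => F u) (hF.comp measurable_fst) fun u _ => hC u
  simpa using this

theorem measurable_integral_update (i : Fin n) {F : (Fin n → X) → ℝ} (hF : Measurable F) :
    Measurable fun u => ∫ v, F (Function.update u i v) ∂ν :=
  measurable_integral_right (f := fun u v => F (Function.update u i v))
    (hF.comp (measurable_update_pair i))

theorem measurable_update_right (u : Fin n → X) (i : Fin n) :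
    Measurable fun v => Function.update u i v :=
  (measurable_update_pair i).comp measurable_prodMk_left

omit [MeasurableSpace X] in
theorem eq_of_forall_update_eq {h : (Fin n → X) → ℝ}
    (hh : ∀ i u v, h (Function.update u i v) = h u) (u u' : Fin n → X) : h u = h u' := by
  have key : ∀ I : Finset (Fin n), h (I.piecewise u u') = h u' := by
    intro I
    induction I using Finset.induction_on with
    | empty => simp
    | insert i I _ ih => rw [Finset.piecewise_insert, hh, ih]
  simpa using key Finset.univ

-- One step of the Efron–Stein induction, in a single coordinate. The left side is the variance of
-- `φ` plus the squared difference of the means of `φ` and `h`; the variance is at most the mean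
-- square distance to the constant `g`, and the second term is handled by Jensen's inequality.
variable {ν} in
theorem integral_sub_mean_sq_le {φ h : X → ℝ} {C : ℝ} (hφ : Measurable φ) (hh : Measurable h) (hφC : ∀ x, |φ x| ≤ C)
    (hhC : ∀ x, |h x| ≤ C) (g : ℝ) :
    ∫ x, (φ x - ∫ y, h y ∂ν) ^ 2 ∂ν ≤ ∫ x, (φ x - g) ^ 2 ∂ν + ∫ x, (φ x - h x) ^ 2 ∂ν := by
  have hφi : Integrable φ ν := integrable_of_abs_le hφ hφC
  have hhi : Integrable h ν := integrable_of_abs_le hh hhC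
  have hφ2 : Integrable (fun x => φ x ^ 2) ν :=
    integrable_of_abs_le (C := C ^ 2) (hφ.pow_const 2) fun x => by
      rw [abs_pow]
      exact pow_le_pow_left₀ (abs_nonneg _) (hφC x) 2
  have hd2 : Integrable (fun x => (φ x - h x) ^ 2) ν :=
    integrable_of_abs_le (C := (C + C) ^ 2) ((hφ.sub hh).pow_const 2) fun x => by
      rw [abs_pow]
      exact pow_le_pow_left₀ (abs_nonneg _)
        ((abs_sub _ _).trans (add_le_add (hφC x) (hhC x))) 2
  have expand : ∀ c : ℝ, ∫ x, (φ x - c) ^ 2 ∂ν =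
      ∫ x, φ x ^ 2 ∂ν - 2 * c * ∫ x, φ x ∂ν + c ^ 2 := fun c => by
    have e : ∀ x, (φ x - c) ^ 2 = φ x ^ 2 - 2 * c * φ x + c ^ 2 := fun x => by ring
    have i1 : Integrable (fun x => φ x ^ 2 - 2 * c * φ x) ν := hφ2.sub (hφi.const_mul _)
    simp_rw [e]
    rw [integral_add i1 (integrable_const _), integral_sub hφ2 (hφi.const_mul _),
      integral_const_mul]
    simp
  have jensen : (∫ x, (φ x - h x) ∂ν) ^ 2 ≤ ∫ x, (φ x - h x) ^ 2 ∂ν := by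
    have hi : Integrable (fun x => φ x - h x) ν := hφi.sub hhi
    set m := ∫ x, (φ x - h x) ∂ν with hm
    have h0 : 0 ≤ ∫ x, (φ x - h x - m) ^ 2 ∂ν := integral_nonneg fun x => sq_nonneg _
    have e : ∀ x, (φ x - h x - m) ^ 2 = (φ x - h x) ^ 2 - 2 * m * (φ x - h x) + m ^ 2 :=
      fun x => by ring
    have i1 : Integrable (fun x => (φ x - h x) ^ 2 - 2 * m * (φ x - h x)) ν :=
      hd2.sub (hi.const_mul _)
    simp_rw [e] at h0
    rw [integral_add i1 (integrable_const _), integral_sub hd2 (hi.const_mul _),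
      integral_const_mul, ← hm] at h0
    simp at h0
    nlinarith
  rw [integral_sub hφi hhi] at jensen
  rw [expand, expand]
  nlinarith [sq_nonneg (∫ x, φ x ∂ν - g)]

/-- The Efron–Stein inequality. -/
theorem variance_le_sum_integral_sq {f : (Fin n → X) → ℝ} {g : Fin n → (Fin n → X) → ℝ} {C : ℝ}
    (hf : Measurable f) (hg : ∀ i, Measurable (g i)) (hfC : ∀ u, |f u| ≤ C)
    (hgC : ∀ i u, |g i u| ≤ C) (hgi : ∀ i u v, g i (Function.update u i v) = g i u) :
    variance f (iidLaw ν n) ≤ ∑ i, ∫ u, (f u - g i u) ^ 2 ∂(iidLaw ν n) := by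
  have hsq : ∀ a b : ℝ, |a| ≤ C → |b| ≤ C → |(a - b) ^ 2| ≤ (C + C) ^ 2 := fun a b ha hb => by
    rw [abs_pow]
    exact pow_le_pow_left₀ (abs_nonneg _) ((abs_sub _ _).trans (add_le_add ha hb)) 2
  -- Here `h` is `f` with the coordinates in `I` averaged out one after another. Each averaging
  -- costs at most the term of that coordinate; when all are averaged out, `h` is constant.
  have key : ∀ I : Finset (Fin n), ∃ h : (Fin n → X) → ℝ, Measurable h ∧ (∀ u, |h u| ≤ C) ∧
      (∀ i ∈ I, ∀ u v, h (Function.update u i v) = h u) ∧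
      ∫ u, (f u - h u) ^ 2 ∂(iidLaw ν n) ≤ ∑ i ∈ I, ∫ u, (f u - g i u) ^ 2 ∂(iidLaw ν n) := by
    intro I
    induction I using Finset.induction_on with
    | empty => exact ⟨f, hf, hfC, by simp, by simp⟩
    | insert j I hj ih =>
      obtain ⟨h, hm, hC, hI, hle⟩ := ih
      set k : (Fin n → X) → ℝ := fun u => ∫ v, h (Function.update u j v) ∂ν with hk
      have hkm : Measurable k := measurable_integral_update ν j hm
      have hkC : ∀ u, |k u| ≤ C := fun u => abs_integral_le_of_abs_le fun v => hC _
      have hkj : ∀ u v, k (Function.update u j v) = k u := fun u v => by simp [hk]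
      refine ⟨k, hkm, hkC, fun i hi u v => ?_, ?_⟩
      · by_cases hij : i = j
        · subst hij
          exact hkj u v
        · have hi' : i ∈ I := (Finset.mem_insert.1 hi).resolve_left hij
          simp only [hk]
          congr 1 with v'
          rw [Function.update_comm hij, hI i hi']
      · rw [Finset.sum_insert hj]
        have m1 : Measurable fun u => (f u - k u) ^ 2 := (hf.sub hkm).pow_const 2
        have m2 : Measurable fun u => (f u - g j u) ^ 2 := (hf.sub (hg j)).pow_const 2
        have m3 : Measurable fun u => (f u - h u) ^ 2 := (hf.sub hm).pow_const 2
        have b2 : ∀ u, |(f u - g j u) ^ 2| ≤ (C + C) ^ 2 := fun u => hsq _ _ (hfC u) (hgC j u)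
        have b3 : ∀ u, |(f u - h u) ^ 2| ≤ (C + C) ^ 2 := fun u => hsq _ _ (hfC u) (hC u)
        rw [← integral_resample ν j m1 (fun u => hsq _ _ (hfC u) (hkC u))]
        refine le_trans ?_ (add_le_add_right hle _)
        rw [← integral_resample ν j m2 b2, ← integral_resample ν j m3 b3, ← integral_add
          (integrable_of_abs_le (measurable_integral_update ν j m2)
            fun u => abs_integral_le_of_abs_le fun v => b2 _)
          (integrable_of_abs_le (measurable_integral_update ν j m3)
            fun u => abs_integral_le_of_abs_le fun v => b3 _)]
        refine integral_mono
          (integrable_of_abs_le (measurable_integral_update ν j m1)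
            fun u => abs_integral_le_of_abs_le fun v => hsq _ _ (hfC _) (hkC _))
          ((integrable_of_abs_le (measurable_integral_update ν j m2)
            fun u => abs_integral_le_of_abs_le fun v => b2 _).add
          (integrable_of_abs_le (measurable_integral_update ν j m3)
            fun u => abs_integral_le_of_abs_le fun v => b3 _)) fun u => ?_
        simp only [hkj, hgi]
        exact integral_sub_mean_sq_le (hf.comp (measurable_update_right u j))
          (hm.comp (measurable_update_right u j)) (fun v => hfC _) (fun v => hC _) _
  obtain ⟨h, hm, hC, hI, hle⟩ := key Finset.univ
  refine le_trans ?_ hle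
  have : Nonempty (Fin n → X) := (iidLaw ν n).nonempty_of_neZero
  obtain ⟨u₀⟩ := this
  have hc : ∀ u, h u = h u₀ := fun u =>
    eq_of_forall_update_eq (fun i u v => hI i (Finset.mem_univ i) u v) u u₀
  simp_rw [hc]
  rw [← variance_sub_const hf.aestronglyMeasurable (h u₀)]
  exact variance_le_expectation_sq (hf.sub_const _).aestronglyMeasurable

end Resample

/-! ### Indicators -/

open scoped Classical in
/-- Indicator of a proposition. -/
def ind (p : Prop) : ℝ := if p then 1 else 0

open scoped Classical in
/-- Number of elements of a finset that satisfy a predicate. -/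
def cnt {ι : Type*} (I : Finset ι) (p : ι → Prop) : ℕ := {i ∈ I | p i}.card

section Ind

variable {p q : Prop} {ι : Type*} {I : Finset ι} {r s : ι → Prop}

theorem ind_of (h : p) : ind p = 1 := if_pos h
theorem ind_of_not (h : ¬p) : ind p = 0 := if_neg h
theorem ind_nonneg : 0 ≤ ind p := by unfold ind; split_ifs <;> norm_num
theorem ind_le_one : ind p ≤ 1 := by unfold ind; split_ifs <;> norm_num
theorem abs_ind_le_one : |ind p| ≤ 1 := by unfold ind; split_ifs <;> norm_num
theorem ind_not : ind (¬p) = 1 - ind p := by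
  by_cases h : p <;> simp [ind, h]
theorem ind_and : ind (p ∧ q) = ind p * ind q := by
  by_cases h : p <;> by_cases h' : q <;> simp [ind, h, h']
theorem ind_congr (h : p ↔ q) : ind p = ind q := by rw [propext h]

theorem measurable_ind {α : Type*} [MeasurableSpace α] {p : α → Prop}
    (h : MeasurableSet {a | p a}) : Measurable fun a => ind (p a) := by
  classical
  unfold ind
  exact (Measurable.ite (by convert h) measurable_const measurable_const)

theorem integral_ind {α : Type*} [MeasurableSpace α] {μ : Measure α} {p : α → Prop}
    (h : MeasurableSet {a | p a}) : ∫ a, ind (p a) ∂μ = μ.real {a | p a} := by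
  rw [← integral_indicator_one h]
  rfl

theorem cnt_eq_sum : (cnt I r : ℝ) = ∑ i ∈ I, ind (r i) := by
  simp [cnt, ind, Finset.sum_boole]

theorem cnt_mono (h : ∀ i ∈ I, r i → s i) : cnt I r ≤ cnt I s := by
  classical
  refine Finset.card_le_card fun i hi => ?_
  simp only [Finset.mem_filter] at hi ⊢
  exact ⟨hi.1, h i hi.1 hi.2⟩

theorem cnt_congr (h : ∀ i ∈ I, r i ↔ s i) : cnt I r = cnt I s :=
  le_antisymm (cnt_mono fun i hi => (h i hi).1) (cnt_mono fun i hi => (h i hi).2)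

theorem cnt_le_card : cnt I r ≤ I.card := by
  classical exact Finset.card_filter_le _ _

theorem cnt_eq_zero : cnt I r = 0 ↔ ∀ i ∈ I, ¬r i := by
  simp [cnt, Finset.filter_eq_empty_iff]

theorem cnt_pos : 1 ≤ cnt I r ↔ ∃ i ∈ I, r i := by
  rw [Nat.one_le_iff_ne_zero, Ne, cnt_eq_zero]
  push Not
  rfl

theorem cnt_erase [DecidableEq ι] {i : ι} (hi : i ∈ I) :
    (cnt I r : ℝ) = ind (r i) + cnt (I.erase i) r := by
  rw [cnt_eq_sum, cnt_eq_sum, Finset.add_sum_erase _ (fun i => ind (r i)) hi]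

theorem measurable_cnt {α : Type*} [MeasurableSpace α] {r : α → ι → Prop}
    (h : ∀ i ∈ I, MeasurableSet {a | r a i}) : Measurable fun a => cnt I (r a) := by
  classical
  unfold cnt
  simp only [Finset.card_filter]
  refine Finset.measurable_sum _ fun i hi => Measurable.ite ?_ measurable_const measurable_const
  convert h i hi

end Ind

end BinomialCoverage
end

noncomputable section
namespace BinomialCoverage

/-! ### The probability of moving a point in the size-bias coupling -/

/-- The binomial tail, in its incomplete beta form, that enters the probability of moving a
point. -/
def betaTail (m : ℕ) (p : ℝ) (k : ℕ) : ℝ :=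
  m * ∫ t in (0 : ℝ)..p, t ^ k * (1 - t) ^ (m - 1 - k)

/-- Probability of moving a point into a ball that holds `k` of the `m` points, in the coupling of
the binomial law with its law conditioned to be positive. -/
def moveProb (m : ℕ) (p : ℝ) (k : ℕ) : ℝ :=
  if k < m then (1 - p) ^ m / (1 - (1 - p) ^ m) * (betaTail m p k / (p ^ k * (1 - p) ^ (m - k)))
  else 0

section MoveProb

variable {m : ℕ} {p : ℝ}

theorem one_sub_pow_lt_one (hm : 1 ≤ m) (hp0 : 0 < p) (hp1 : p < 1) : (1 - p) ^ m < 1 :=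
  pow_lt_one₀ (by linarith) (by linarith) (by omega)

theorem betaTail_zero : betaTail m p 0 = 1 - (1 - p) ^ m := by
  have h : ∀ t ∈ Set.uIcc 0 p, HasDerivAt (fun t : ℝ => -(1 - t) ^ m)
      (m * (t ^ 0 * (1 - t) ^ (m - 1 - 0))) t := fun t _ => by
    have := (((hasDerivAt_id t).const_sub 1).fun_pow m).fun_neg
    simpa using this
  rw [betaTail, ← intervalIntegral.integral_const_mul, intervalIntegral.integral_eq_sub_of_hasDerivAt h
    (Continuous.intervalIntegrable (by fun_prop) _ _)]
  simp
  ring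

/-- The fundamental theorem of calculus for `t ^ (k + 1) * (1 - t) ^ (m - (k + 1))`. For a binomial
`N`, `betaTail m p k` is `P(N > k)` divided by `(m - 1).choose k` when `k < m`, so this is `P(N = k
+ 1) = P(N > k) - P(N > k + 1)` up to a factor. When `k + 1 = m` the second term has coefficient 0,
so the truncated exponent in it does not matter. -/
theorem betaTail_succ {k : ℕ} (hk : k + 1 ≤ m) :
    p ^ (k + 1) * (1 - p) ^ (m - (k + 1)) =
      (k + 1) / m * betaTail m p k - (1 - (k + 1) / m) * betaTail m p (k + 1) := by
  have hm : (m : ℝ) ≠ 0 := by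
    have : 0 < m := by omega
    positivity
  have h : ∀ t ∈ Set.uIcc 0 p, HasDerivAt (fun t : ℝ => t ^ (k + 1) * (1 - t) ^ (m - (k + 1)))
      ((k + 1) * (t ^ k * (1 - t) ^ (m - 1 - k)) -
        (m - (k + 1)) * (t ^ (k + 1) * (1 - t) ^ (m - 1 - (k + 1)))) t := fun t _ => by
    have := ((hasDerivAt_id t).fun_pow (k + 1)).fun_mul
      (((hasDerivAt_id t).const_sub 1).fun_pow (m - (k + 1)))
    refine this.congr_deriv ?_
    simp only [id]
    rw [show m - (k + 1) = m - 1 - k by omega, show m - 1 - (k + 1) = m - 1 - k - 1 by omega,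
      show ((m - 1 - k : ℕ) : ℝ) = m - (k + 1) by
        rw [show m - 1 - k = m - (k + 1) by omega]; push_cast [Nat.cast_sub hk]; ring]
    push_cast
    simp
    ring
  have hi := intervalIntegral.integral_eq_sub_of_hasDerivAt h
    (Continuous.intervalIntegrable (by fun_prop) _ _)
  rw [intervalIntegral.integral_sub (Continuous.intervalIntegrable (by fun_prop) _ _)
    (Continuous.intervalIntegrable (by fun_prop) _ _), intervalIntegral.integral_const_mul,
    intervalIntegral.integral_const_mul] at hi
  simp only [ne_eq, Nat.add_eq_zero_iff, one_ne_zero, and_false, not_false_eq_true, zero_pow,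
    zero_mul, sub_zero] at hi
  rw [← hi]
  unfold betaTail
  field_simp

theorem betaTail_nonneg (hp0 : 0 < p) (hp1 : p < 1) (k : ℕ) : 0 ≤ betaTail m p k :=
  mul_nonneg (Nat.cast_nonneg m) (intervalIntegral.integral_nonneg hp0.le fun t ht =>
    mul_nonneg (pow_nonneg ht.1 _) (pow_nonneg (by linarith [ht.2]) _))

/-- On `[0, p]` the odds `t / (1 - t)` are at most `p / (1 - p)`. This is exactly what makes
`moveProb` at most 1. -/
theorem betaTail_le (hp0 : 0 < p) (hp1 : p < 1) {k : ℕ} (hk : k < m) :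
    betaTail m p k * (1 - p) ^ k ≤ p ^ k * betaTail m p 0 := by
  have : (∫ t in (0 : ℝ)..p, t ^ k * (1 - t) ^ (m - 1 - k)) * (1 - p) ^ k ≤
      p ^ k * ∫ t in (0 : ℝ)..p, t ^ 0 * (1 - t) ^ (m - 1 - 0) := by
    rw [← intervalIntegral.integral_mul_const, ← intervalIntegral.integral_const_mul]
    refine intervalIntegral.integral_mono_on hp0.le
      (Continuous.intervalIntegrable (by fun_prop) _ _)
      (Continuous.intervalIntegrable (by fun_prop) _ _) fun t ht => ?_
    have h1 : t * (1 - p) ≤ p * (1 - t) := by linarith [ht.2]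
    have h2 : (t * (1 - p)) ^ k ≤ (p * (1 - t)) ^ k :=
      pow_le_pow_left₀ (mul_nonneg ht.1 (by linarith)) h1 k
    have h3 : (1 - t) ^ (m - 1) = (1 - t) ^ k * (1 - t) ^ (m - 1 - k) := by
      rw [← pow_add]
      congr 1
      omega
    have h4 : 0 ≤ (1 - t) ^ (m - 1 - k) := pow_nonneg (by linarith [ht.2]) _
    rw [mul_pow, mul_pow] at h2
    simp only [pow_zero, one_mul, Nat.sub_zero]
    rw [h3]
    nlinarith
  unfold betaTail
  have hm : (0 : ℝ) ≤ m := Nat.cast_nonneg m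
  nlinarith

theorem moveProb_nonneg (hm : 1 ≤ m) (hp0 : 0 < p) (hp1 : p < 1) (k : ℕ) :
    0 ≤ moveProb m p k := by
  have h1 := one_sub_pow_lt_one hm hp0 hp1
  have h2 := betaTail_nonneg (m := m) hp0 hp1 k
  have h3 : 0 < 1 - p := by linarith
  have h4 : 0 < 1 - (1 - p) ^ m := by linarith
  unfold moveProb
  split_ifs
  · positivity
  · exact le_rfl

theorem moveProb_le_one (hm : 1 ≤ m) (hp0 : 0 < p) (hp1 : p < 1) (k : ℕ) :
    moveProb m p k ≤ 1 := by
  have h1 := one_sub_pow_lt_one hm hp0 hp1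
  have h3 : 0 < 1 - p := by linarith
  have h4 : 0 < 1 - (1 - p) ^ m := by linarith
  unfold moveProb
  split_ifs with hk
  · have h5 := betaTail_le hp0 hp1 hk
    rw [betaTail_zero] at h5
    rw [div_mul_div_comm, div_le_one (by positivity)]
    have e : (1 - p) ^ m = (1 - p) ^ k * (1 - p) ^ (m - k) := by
      rw [← pow_add]
      congr 1
      omega
    have h6 := mul_le_mul_of_nonneg_right h5 (pow_nonneg h3.le (m - k))
    calc (1 - p) ^ m * betaTail m p k = betaTail m p k * (1 - p) ^ k * (1 - p) ^ (m - k) := by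
          rw [e]; ring
      _ ≤ _ := h6
      _ = _ := by ring
  · exact zero_le_one

/-- The balance equation that characterises `moveProb`. After division by `1 - (1 - p) ^ m` the left
side is the density of the conditioned binomial relative to the original one; the right side is 1
plus the inflow from count `k - 1` minus the outflow from count `k`, where `1 - k / m` is the
probability that a uniformly chosen point lies outside the ball. The truncated `k - 1` at `k = 0`
and the default value of `moveProb` at `k = m` both carry a factor 0. -/
theorem moveProb_recursion (hm : 1 ≤ m) (hp0 : 0 < p) (hp1 : p < 1) {k : ℕ} (hk : k ≤ m) :
    ind (1 ≤ k) = (1 - (1 - p) ^ m) * (1 + k / m * ((1 - p) / p) * moveProb m p (k - 1) -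
      (1 - k / m) * moveProb m p k) := by
  have h1 := one_sub_pow_lt_one hm hp0 hp1
  have h3 : 0 < 1 - p := by linarith
  have h4 : 0 < 1 - (1 - p) ^ m := by linarith
  have hm' : (0 : ℝ) < m := by exact_mod_cast hm
  rcases k with _ | k
  · rw [ind_of_not (by simp)]
    have : moveProb m p 0 = 1 := by
      rw [moveProb, if_pos (by omega), betaTail_zero]
      simp only [pow_zero, one_mul, Nat.sub_zero]
      field_simp
    rw [this]
    simp
  · rw [ind_of (by omega)]
    have e := betaTail_succ (p := p) hk
    have e1 : (1 - ((k + 1 : ℕ) : ℝ) / m) * moveProb m p (k + 1) =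
        (1 - p) ^ m / (1 - (1 - p) ^ m) * ((1 - ((k : ℝ) + 1) / m) * betaTail m p (k + 1)) /
          (p ^ (k + 1) * (1 - p) ^ (m - (k + 1))) := by
      rcases Nat.lt_or_ge (k + 1) m with h | h
      · rw [moveProb, if_pos h]
        push_cast
        ring
      · have : k + 1 = m := le_antisymm hk h
        have h0 : 1 - ((k : ℝ) + 1) / m = 0 := by
          rw [← this]
          push_cast
          rw [div_self (by positivity), sub_self]
        rw [show ((k + 1 : ℕ) : ℝ) = (k : ℝ) + 1 by push_cast; rfl, h0]
        simp
    have e2 : ((k + 1 : ℕ) : ℝ) / m * ((1 - p) / p) * moveProb m p (k + 1 - 1) =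
        (1 - p) ^ m / (1 - (1 - p) ^ m) * (((k : ℝ) + 1) / m * betaTail m p k) /
          (p ^ (k + 1) * (1 - p) ^ (m - (k + 1))) := by
      rw [Nat.add_sub_cancel, moveProb, if_pos (by omega),
        show m - k = m - (k + 1) + 1 by omega]
      push_cast
      field_simp
      ring
    rw [e1, e2, add_sub_assoc, ← sub_div, ← mul_sub, ← e, mul_div_assoc, div_self (by positivity)]
    field_simp
    ring

end MoveProb

/-! ### Size-biasing the coverage of a ball -/

section SizeBias

variable {X : Type*} [MeasurableSpace X] {n : ℕ} {ν : Measure X} [IsProbabilityMeasure ν]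

/-- Conditioning a ball to hold at least one of the points indexed by `I`, by moving a point. -/
theorem integral_ind_one_le_cnt {I : Finset (Fin n)} {m : ℕ} {A : (Fin n → X) → X → Prop} {p C : ℝ}
    (hI : I.card = m) (hm : 1 ≤ m) (hp0 : 0 < p) (hp1 : p < 1)
    (hA : MeasurableSet {q : (Fin n → X) × X | A q.1 q.2})
    (hAI : ∀ i ∈ I, ∀ u v x, A (Function.update u i v) x ↔ A u x)
    (hAp : ∀ u, ν.real {x | A u x} = p) {F : (Fin n → X) → ℝ} (hF : Measurable F)
    (hFC : ∀ u, |F u| ≤ C) :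
    ∫ u, ind (1 ≤ cnt I fun i => A u (u i)) * F u ∂(iidLaw ν n) =
      (1 - (1 - p) ^ m) * (∫ u, F u ∂(iidLaw ν n) + ∑ i ∈ I, ∫ u, ∫ v,
        moveProb m p (cnt I fun i => A u (u i)) * ind (¬A u (u i)) * ind (A u v) / (m * p) *
          (F (Function.update u i v) - F u) ∂ν ∂(iidLaw ν n)) := by
  classical
  set N : (Fin n → X) → ℕ := fun u => cnt I fun i => A u (u i) with hN
  have hAm : ∀ i, MeasurableSet {u : Fin n → X | A u (u i)} := fun i => by
    have : Measurable fun u : Fin n → X => (u, u i) := measurable_id.prodMk (measurable_pi_apply i)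
    exact this hA
  have hNm : Measurable N := measurable_cnt fun i _ => hAm i
  have hK0 := moveProb_nonneg hm hp0 hp1
  have hK1 := moveProb_le_one hm hp0 hp1
  have hKb : ∀ k, |moveProb m p k| ≤ 1 := fun k => by
    rw [abs_of_nonneg (hK0 k)]
    exact hK1 k
  have hKm : Measurable (moveProb m p) := measurable_from_top
  have hC : 0 ≤ C := by
    have : Nonempty (Fin n → X) := (iidLaw ν n).nonempty_of_neZero
    exact (abs_nonneg _).trans (hFC this.some)
  have hm' : (0 : ℝ) < m := by exact_mod_cast hm
  have mA : Measurable fun q : (Fin n → X) × X => ind (A q.1 q.2) := measurable_ind hA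
  have mAi : ∀ i, Measurable fun u : Fin n → X => ind (A u (u i)) := fun i => measurable_ind (hAm i)
  have mNi : ∀ i, Measurable fun u : Fin n → X => ind (¬A u (u i)) := fun i =>
    measurable_ind (hAm i).compl
  have hint : ∀ u, ∫ v, ind (A u v) ∂ν = p := fun u => by
    rw [integral_ind (by exact measurable_prodMk_left hA)]
    exact hAp u
  have hiA : ∀ u, Integrable (fun v => ind (A u v)) ν := fun u => integrable_of_abs_le (C := 1)
    (mA.comp measurable_prodMk_left) fun v => abs_ind_le_one
  -- the inserted point
  have hins : ∀ i ∈ I, ∫ u, ∫ v, moveProb m p (N u) * ind (¬A u (u i)) * ind (A u v) *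
      F (Function.update u i v) ∂ν ∂(iidLaw ν n) =
      (1 - p) * ∫ u, ind (A u (u i)) * moveProb m p (N u - 1) * F u ∂(iidLaw ν n) := by
    intro i hi
    have hE : ∀ u, cnt (I.erase i) (fun k => A u (u k)) + (if A u (u i) then 1 else 0) = N u :=
      fun u => by
        have := cnt_erase (r := fun k => A u (u k)) hi
        have e : ((cnt (I.erase i) (fun k => A u (u k)) + (if A u (u i) then 1 else 0) : ℕ) : ℝ) =
            (N u : ℕ) := by
          push_cast
          rw [hN, this, ind]
          ring
        exact_mod_cast e
    set Ψ : (Fin n → X) → X → ℝ := fun u v => ind (¬A u v) *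
      (ind (A u (u i)) * moveProb m p (N u - 1) * F u) with hΨ
    have hΨm : Measurable (Function.uncurry Ψ) := by
      have m1 : Measurable fun q : (Fin n → X) × X => ind (¬A q.1 q.2) := measurable_ind hA.compl
      have m2 : Measurable fun u => ind (A u (u i)) * moveProb m p (N u - 1) * F u :=
        ((mAi i).mul (hKm.comp ((measurable_from_top (f := fun k : ℕ => k - 1)).comp hNm))).mul hF
      exact m1.mul (m2.comp measurable_fst)
    have hΨb : ∀ u v, |Ψ u v| ≤ C := fun u v => by
      rw [hΨ, abs_mul, abs_mul, abs_mul]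
      calc _ ≤ 1 * (1 * 1 * C) := by
            gcongr
            exacts [abs_ind_le_one, abs_ind_le_one, hKb _, hFC u]
        _ = C := by ring
    have key := integral_exchange ν i hΨm hΨb
    have e1 : ∀ u v, Ψ (Function.update u i v) (u i) =
        moveProb m p (N u) * ind (¬A u (u i)) * ind (A u v) * F (Function.update u i v) := by
      intro u v
      simp only [hΨ]
      rw [ind_congr (not_congr (hAI i hi u v (u i))), Function.update_self,
        ind_congr (hAI i hi u v v)]
      by_cases h1 : A u (u i)
      · rw [ind_of_not (not_not.2 h1)]
        ring
      · by_cases h2 : A u v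
        · have : N (Function.update u i v) - 1 = N u := by
            rw [← hE (Function.update u i v), ← hE u, if_neg h1, if_pos
              (by rw [Function.update_self]; exact (hAI i hi u v v).2 h2)]
            have : (cnt (I.erase i) fun k => A (Function.update u i v) (Function.update u i v k)) =
                cnt (I.erase i) fun k => A u (u k) := cnt_congr fun k hk => by
              rw [Function.update_of_ne (Finset.ne_of_mem_erase hk), hAI i hi]
            rw [this]
            rfl
          rw [this]
          ring
        · rw [ind_of_not h2]
          ring
    have e2 : ∀ u, ∫ v, Ψ u v ∂ν = (1 - p) * (ind (A u (u i)) * moveProb m p (N u - 1) * F u) := by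
      intro u
      simp only [hΨ]
      rw [integral_mul_const]
      congr 1
      simp_rw [ind_not]
      rw [integral_sub (integrable_const _) (hiA u), hint]
      simp
    simp_rw [e1, e2] at key
    rw [key, integral_const_mul]
  have hbd : ∀ i u, |ind (A u (u i)) * moveProb m p (N u - 1) * F u| ≤ C := fun i u => by
    rw [abs_mul, abs_mul]
    calc _ ≤ 1 * 1 * C := by
          gcongr
          exacts [abs_ind_le_one, hKb _, hFC u]
      _ = C := by ring
  have hbd2 : ∀ i u, |moveProb m p (N u) * ind (¬A u (u i)) * F u| ≤ C := fun i u => by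
    rw [abs_mul, abs_mul]
    calc _ ≤ 1 * 1 * C := by
          gcongr
          exacts [hKb _, abs_ind_le_one, hFC u]
      _ = C := by ring
  have hi1 : ∀ i, Integrable (fun u => ind (A u (u i)) * moveProb m p (N u - 1) * F u)
      (iidLaw ν n) := fun i => integrable_of_abs_le
    (((mAi i).mul (hKm.comp ((measurable_from_top (f := fun k : ℕ => k - 1)).comp hNm))).mul hF)
      (hbd i)
  have hi2 : ∀ i, Integrable (fun u => moveProb m p (N u) * ind (¬A u (u i)) * F u)
      (iidLaw ν n) := fun i => integrable_of_abs_le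
    (((hKm.comp hNm).mul (mNi i)).mul hF) (hbd2 i)
  have hterm : ∀ i ∈ I, ∫ u, ∫ v, moveProb m p (N u) * ind (¬A u (u i)) * ind (A u v) / (m * p) *
      (F (Function.update u i v) - F u) ∂ν ∂(iidLaw ν n) =
      ∫ u, ((1 - p) / (m * p) * (ind (A u (u i)) * moveProb m p (N u - 1) * F u) -
        1 / m * (moveProb m p (N u) * ind (¬A u (u i)) * F u)) ∂(iidLaw ν n) := by
    intro i hi
    have mG : Measurable (Function.uncurry fun (u : Fin n → X) v =>
        moveProb m p (N u) * ind (¬A u (u i)) * ind (A u v) * F (Function.update u i v)) :=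
      ((((hKm.comp hNm).mul (mNi i)).comp measurable_fst).mul mA).mul
        (hF.comp (measurable_update_pair i))
    have bG : ∀ (u : Fin n → X) v, |moveProb m p (N u) * ind (¬A u (u i)) * ind (A u v) *
        F (Function.update u i v)| ≤ C := fun u v => by
      rw [abs_mul, abs_mul, abs_mul]
      calc _ ≤ 1 * 1 * 1 * C := by
            gcongr
            exacts [hKb _, abs_ind_le_one, abs_ind_le_one, hFC _]
        _ = C := by ring
    have e : ∀ u, ∫ v, moveProb m p (N u) * ind (¬A u (u i)) * ind (A u v) / (m * p) *
        (F (Function.update u i v) - F u) ∂ν =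
        1 / (m * p) * (∫ v, moveProb m p (N u) * ind (¬A u (u i)) * ind (A u v) *
          F (Function.update u i v) ∂ν) -
        1 / m * (moveProb m p (N u) * ind (¬A u (u i)) * F u) := fun u => by
      have e' : ∀ v, moveProb m p (N u) * ind (¬A u (u i)) * ind (A u v) / (m * p) *
          (F (Function.update u i v) - F u) =
          1 / (m * p) * (moveProb m p (N u) * ind (¬A u (u i)) * ind (A u v) *
            F (Function.update u i v)) -
          ind (A u v) * (1 / (m * p) * (moveProb m p (N u) * ind (¬A u (u i)) * F u)) :=
        fun v => by ring
      simp_rw [e']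
      have iG : Integrable (fun v => moveProb m p (N u) * ind (¬A u (u i)) * ind (A u v) *
          F (Function.update u i v)) ν :=
        integrable_of_abs_le mG.of_uncurry_left (bG u)
      rw [integral_sub (iG.const_mul _) ((hiA u).mul_const _),
        integral_const_mul, integral_mul_const, hint]
      field_simp
    simp_rw [e]
    have iG : Integrable (fun u => ∫ v, moveProb m p (N u) * ind (¬A u (u i)) * ind (A u v) *
        F (Function.update u i v) ∂ν) (iidLaw ν n) :=
      integrable_of_abs_le (measurable_integral_right mG)
        fun u => abs_integral_le_of_abs_le (bG u)
    rw [integral_sub (iG.const_mul _) ((hi2 i).const_mul _),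
      integral_const_mul, hins i hi, integral_sub ((hi1 i).const_mul _) ((hi2 i).const_mul _),
      integral_const_mul, integral_const_mul]
    ring
  have hi3 : ∀ i ∈ I, Integrable (fun u => (1 - p) / (m * p) * (ind (A u (u i)) *
      moveProb m p (N u - 1) * F u) - 1 / m * (moveProb m p (N u) * ind (¬A u (u i)) * F u))
      (iidLaw ν n) := fun i _ => ((hi1 i).const_mul _).sub ((hi2 i).const_mul _)
  rw [Finset.sum_congr rfl hterm, ← integral_finsetSum _ hi3, ← integral_add
      (integrable_of_abs_le hF hFC) (integrable_finsetSum _ hi3), ← integral_const_mul]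
  -- From here the identity is pointwise in `u` and reduces to `moveProb_recursion` at the count `N
  -- u`.
  congr 1 with u
  have hc : (∑ i ∈ I, ind (A u (u i))) = N u := cnt_eq_sum.symm
  have hc2 : (∑ i ∈ I, ind (¬A u (u i))) = m - N u := by
    simp_rw [ind_not]
    rw [Finset.sum_sub_distrib, hc, Finset.sum_const, hI]
    simp
  have hs : ∑ i ∈ I, ((1 - p) / (m * p) * (ind (A u (u i)) * moveProb m p (N u - 1) * F u) -
        1 / m * (moveProb m p (N u) * ind (¬A u (u i)) * F u)) =
      (1 - p) / (m * p) * moveProb m p (N u - 1) * F u * (∑ i ∈ I, ind (A u (u i))) -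
        1 / m * (moveProb m p (N u) * F u) * ∑ i ∈ I, ind (¬A u (u i)) := by
    rw [Finset.mul_sum, Finset.mul_sum, ← Finset.sum_sub_distrib]
    exact Finset.sum_congr rfl fun i _ => by ring
  rw [hs, hc, hc2, moveProb_recursion hm hp0 hp1 (k := N u) (hI ▸ cnt_le_card)]
  field_simp
  ring

end SizeBias

end BinomialCoverage
end

noncomputable section
namespace BinomialCoverage

/-! ### Normal approximation for a mean number of nonempty balls -/

section Coverage

/-- Uniform law on `Fin n`. -/
def unifFin (n : ℕ) : Measure (Fin n) := (n : ENNReal)⁻¹ • Measure.count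

theorem integral_unifFin {n : ℕ} (f : Fin n → ℝ) : ∫ i, f i ∂(unifFin n) = (n : ℝ)⁻¹ * ∑ i, f i := by
  rw [unifFin, integral_smul_measure, integral_count]
  simp

theorem isProbabilityMeasure_unifFin {n : ℕ} (hn : 1 ≤ n) : IsProbabilityMeasure (unifFin n) := by
  refine ⟨?_⟩
  rw [unifFin, Measure.smul_apply, Measure.count_apply MeasurableSet.univ]
  simp only [Set.encard_univ, ENat.card_eq_coe_fintype_card, Fintype.card_fin, smul_eq_mul]
  exact ENNReal.inv_mul_cancel (by simpa using by omega) (by simp)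

variable {X S : Type*} [MeasurableSpace X] [MeasurableSpace S] {n m : ℕ} {ν : Measure X}
  [IsProbabilityMeasure ν] {α : Measure S} [IsProbabilityMeasure α] {I : S → Finset (Fin n)}
  {A : S → (Fin n → X) → X → Prop} {c p B Δ : ℝ} {Y T : (Fin n → X) → ℝ}

/-- Puts the random index, the random ball and the new position into one probability space, as
`kolmogorovDist_le_of_sizeBias` requires; the factor `n` offsets the uniform choice of the index. -/
theorem integral_unifFin_prod (hn : 1 ≤ n) {g : Fin n → S → X → ℝ} {C : ℝ}
    (hg : ∀ i, Measurable (Function.uncurry (g i))) (hC : ∀ i a v, |g i a v| ≤ C)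
    (hI : ∀ i a v, i ∉ I a → g i a v = 0) :
    ∫ θ, n * g θ.1 θ.2.1 θ.2.2 ∂((unifFin n).prod (α.prod ν)) =
      ∫ a, ∑ i ∈ I a, ∫ v, g i a v ∂ν ∂α := by
  have := isProbabilityMeasure_unifFin hn
  have hgm : Measurable fun θ : Fin n × S × X => n * g θ.1 θ.2.1 θ.2.2 := by
    refine measurable_from_prod_countable_right fun i => ?_
    exact (hg i).const_mul _
  have hn' : (n : ℝ) ≠ 0 := by
    have : 0 < n := hn
    positivity
  have hi : ∀ i, Integrable (Function.uncurry (g i)) (α.prod ν) := fun i =>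
    integrable_of_abs_le (hg i) fun q => hC i _ _
  rw [integral_prod _ (integrable_of_abs_le (C := n * C) hgm fun θ => by
    rw [abs_mul, Nat.abs_cast]
    exact mul_le_mul_of_nonneg_left (hC _ _ _) (Nat.cast_nonneg n)), integral_unifFin]
  simp_rw [integral_const_mul]
  rw [← Finset.mul_sum, inv_mul_cancel_left₀ hn']
  have e : ∀ i, ∫ q : S × X, g i q.1 q.2 ∂(α.prod ν) = ∫ a, ∫ v, g i a v ∂ν ∂α := fun i =>
    integral_prod _ (hi i)
  simp_rw [e]
  rw [← integral_finsetSum _ fun i _ => integrable_of_abs_le (measurable_integral_right (hg i))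
    fun a => abs_integral_le_of_abs_le (hC i a)]
  congr 1 with a
  symm
  refine Finset.sum_subset (Finset.subset_univ _) fun i _ hi => ?_
  simp [hI i a _ hi]

/-- Weight of the move of the `i`-th point to `v`, when the ball at `a` is conditioned to be
nonempty. -/
def moveWeight (I : S → Finset (Fin n)) (A : S → (Fin n → X) → X → Prop) (m : ℕ) (p : ℝ)
    (u : Fin n → X) (i : Fin n) (a : S) (v : X) : ℝ :=
  moveProb m p (cnt (I a) fun i => A a u (u i)) * ind (¬A a u (u i)) * ind (A a u v) / (m * p)

theorem measurable_mem_coord (hA : MeasurableSet {q : S × (Fin n → X) × X | A q.1 q.2.1 q.2.2})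
    (i : Fin n) : MeasurableSet {q : S × (Fin n → X) | A q.1 q.2 (q.2 i)} := by
  have : Measurable fun q : S × (Fin n → X) => (q.1, q.2, q.2 i) :=
    measurable_fst.prodMk (measurable_snd.prodMk ((measurable_pi_apply i).comp measurable_snd))
  exact this hA

theorem measurable_coverCount (hIm : ∀ i, MeasurableSet {a | i ∈ I a})
    (hA : MeasurableSet {q : S × (Fin n → X) × X | A q.1 q.2.1 q.2.2}) :
    Measurable fun q : S × (Fin n → X) => cnt (I q.1) fun i => A q.1 q.2 (q.2 i) := by
  have e : ∀ q : S × (Fin n → X), (cnt (I q.1) fun i => A q.1 q.2 (q.2 i)) =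
      cnt Finset.univ fun i => i ∈ I q.1 ∧ A q.1 q.2 (q.2 i) := fun q => by
    classical
    unfold cnt
    congr 1
    ext i
    simp
  simp_rw [e]
  exact measurable_cnt fun i _ =>
    ((measurable_fst (hIm i)).inter (measurable_mem_coord hA i) : MeasurableSet _)

theorem measurable_moveWeight (hIm : ∀ i, MeasurableSet {a | i ∈ I a})
    (hA : MeasurableSet {q : S × (Fin n → X) × X | A q.1 q.2.1 q.2.2}) (i : Fin n) :
    Measurable fun q : (Fin n → X) × S × X => moveWeight I A m p q.1 i q.2.1 q.2.2 := by
  have r1 : Measurable fun q : (Fin n → X) × S × X => (q.2.1, q.1) :=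
    (measurable_fst.comp measurable_snd).prodMk measurable_fst
  have r2 : Measurable fun q : (Fin n → X) × S × X => (q.2.1, q.1, q.2.2) :=
    (measurable_fst.comp measurable_snd).prodMk
      (measurable_fst.prodMk (measurable_snd.comp measurable_snd))
  have m1 : Measurable fun q : (Fin n → X) × S × X =>
      moveProb m p (cnt (I q.2.1) fun i => A q.2.1 q.1 (q.1 i)) :=
    (measurable_from_top (f := moveProb m p)).comp ((measurable_coverCount hIm hA).comp r1)
  have m2 : Measurable fun q : (Fin n → X) × S × X => ind (¬A q.2.1 q.1 (q.1 i)) :=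
    measurable_ind (r1 (measurable_mem_coord hA i)).compl
  have m3 : Measurable fun q : (Fin n → X) × S × X => ind (A q.2.1 q.1 q.2.2) :=
    measurable_ind (r2 hA)
  exact ((m1.mul m2).mul m3).div_const _

omit [MeasurableSpace X] [MeasurableSpace S] in
theorem moveWeight_nonneg (hm : 1 ≤ m) (hp0 : 0 < p) (hp1 : p < 1) (u : Fin n → X) (i : Fin n)
    (a : S) (v : X) : 0 ≤ moveWeight I A m p u i a v :=
  div_nonneg (mul_nonneg (mul_nonneg (moveProb_nonneg hm hp0 hp1 _) ind_nonneg) ind_nonneg)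
    (mul_nonneg (Nat.cast_nonneg m) hp0.le)

omit [MeasurableSpace X] [MeasurableSpace S] in
theorem moveWeight_le (hm : 1 ≤ m) (hp0 : 0 < p) (hp1 : p < 1) (u : Fin n → X) (i : Fin n)
    (a : S) (v : X) : moveWeight I A m p u i a v ≤ 1 / (m * p) := by
  have hm' : (0 : ℝ) < m := by exact_mod_cast hm
  unfold moveWeight
  gcongr
  exact mul_le_one₀ (mul_le_one₀ (moveProb_le_one hm hp0 hp1 _) ind_nonneg ind_le_one)
    ind_nonneg ind_le_one

omit [IsProbabilityMeasure ν] in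
theorem sum_integral_moveWeight_le (hm : 1 ≤ m) (hI : ∀ a, (I a).card = m) (hp0 : 0 < p)
    (hp1 : p < 1) (hA : MeasurableSet {q : S × (Fin n → X) × X | A q.1 q.2.1 q.2.2})
    (hAp : ∀ a u, ν.real {x | A a u x} = p) (u : Fin n → X) (a : S) :
    ∑ i ∈ I a, ∫ v, moveWeight I A m p u i a v ∂ν ≤ 1 := by
  have hm' : (0 : ℝ) < m := by exact_mod_cast hm
  have hint : ∫ v, ind (A a u v) ∂ν = p := by
    rw [integral_ind (by exact measurable_prodMk_left (measurable_prodMk_left hA))]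
    exact hAp a u
  have h : ∀ i ∈ I a, ∫ v, moveWeight I A m p u i a v ∂ν ≤ 1 / m := fun i _ => by
    unfold moveWeight
    rw [integral_div, integral_const_mul, hint]
    have : moveProb m p (cnt (I a) fun i => A a u (u i)) * ind (¬A a u (u i)) ≤ 1 :=
      mul_le_one₀ (moveProb_le_one hm hp0 hp1 _) ind_nonneg ind_le_one
    calc _ ≤ 1 * p / (m * p) := by gcongr
      _ = _ := by field_simp
  calc _ ≤ ∑ i ∈ I a, (1 : ℝ) / m := Finset.sum_le_sum h
    _ = 1 := by
      rw [Finset.sum_const, hI, nsmul_eq_mul, mul_one_div, div_self hm'.ne']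

/-- The conditional mean change of `Y` under the size-bias coupling. -/
def meanMove (I : S → Finset (Fin n)) (A : S → (Fin n → X) → X → Prop) (m : ℕ) (p : ℝ)
    (ν : Measure X) (α : Measure S) (Y : (Fin n → X) → ℝ) (u : Fin n → X) : ℝ :=
  ∫ a, ∑ i ∈ I a, ∫ v, moveWeight I A m p u i a v * (Y (Function.update u i v) - Y u) ∂ν ∂α

theorem measurable_coverage (hIm : ∀ i, MeasurableSet {a | i ∈ I a})
    (hA : MeasurableSet {q : S × (Fin n → X) × X | A q.1 q.2.1 q.2.2})
    (hY : ∀ u, Y u = c * ∫ a, ind (1 ≤ cnt (I a) fun i => A a u (u i)) ∂α) : Measurable Y := by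
  have : Measurable (Function.uncurry fun (u : Fin n → X) (a : S) =>
      ind (1 ≤ cnt (I a) fun i => A a u (u i))) :=
    measurable_ind (((measurable_coverCount hIm hA).comp measurable_swap)
      (measurableSet_Ici (a := 1)))
  rw [funext hY]
  exact (measurable_integral_right this).const_mul c

/-- Size-biasing a mean number of nonempty balls. -/
theorem integral_coverage_mul (hm : 1 ≤ m) (hI : ∀ a, (I a).card = m)
    (hIm : ∀ i, MeasurableSet {a | i ∈ I a})
    (hA : MeasurableSet {q : S × (Fin n → X) × X | A q.1 q.2.1 q.2.2})
    (hAI : ∀ a, ∀ i ∈ I a, ∀ u v x, A a (Function.update u i v) x ↔ A a u x)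
    (hp0 : 0 < p) (hp1 : p < 1) (hAp : ∀ a u, ν.real {x | A a u x} = p)
    (hY : ∀ u, Y u = c * ∫ a, ind (1 ≤ cnt (I a) fun i => A a u (u i)) ∂α)
    {F : (Fin n → X) → ℝ} {C : ℝ} (hF : Measurable F) (hFC : ∀ u, |F u| ≤ C) :
    ∫ u, Y u * F u ∂(iidLaw ν n) = c * (1 - (1 - p) ^ m) * (∫ u, F u ∂(iidLaw ν n) +
      ∫ u, ∫ a, ∑ i ∈ I a, ∫ v, moveWeight I A m p u i a v *
        (F (Function.update u i v) - F u) ∂ν ∂α ∂(iidLaw ν n)) := by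
  classical
  have mI : Measurable (Function.uncurry fun (u : Fin n → X) (a : S) =>
      ind (1 ≤ cnt (I a) fun i => A a u (u i))) :=
    measurable_ind (((measurable_coverCount hIm hA).comp measurable_swap)
      (measurableSet_Ici (a := 1)))
  have hC : 0 ≤ C := by
    have : Nonempty (Fin n → X) := (iidLaw ν n).nonempty_of_neZero
    exact (abs_nonneg _).trans (hFC this.some)
  have e1 : ∀ u, Y u * F u = c * ∫ a, ind (1 ≤ cnt (I a) fun i => A a u (u i)) * F u ∂α := fun u => by
    rw [hY, integral_mul_const, mul_assoc]
  have m2 : Measurable (Function.uncurry fun (u : Fin n → X) (a : S) =>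
      ind (1 ≤ cnt (I a) fun i => A a u (u i)) * F u) := mI.mul (hF.comp measurable_fst)
  have i2 : Integrable (Function.uncurry fun (u : Fin n → X) (a : S) =>
      ind (1 ≤ cnt (I a) fun i => A a u (u i)) * F u) ((iidLaw ν n).prod α) :=
    integrable_of_abs_le (C := 1 * C) m2 fun q => by
      rw [Function.uncurry_def, abs_mul]
      exact mul_le_mul abs_ind_le_one (hFC _) (abs_nonneg _) zero_le_one
  have hsec : ∀ a, MeasurableSet {q : (Fin n → X) × X | A a q.1 q.2} := fun a =>
    measurable_prodMk_left hA
  -- the change, as a function of all variables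
  set g : Fin n → (Fin n → X) → S → X → ℝ := fun i u a v =>
    ind (i ∈ I a) * (moveWeight I A m p u i a v * (F (Function.update u i v) - F u)) with hg
  have mg : ∀ i, Measurable fun q : (Fin n → X) × S × X => g i q.1 q.2.1 q.2.2 := fun i => by
    have r : Measurable fun q : (Fin n → X) × S × X => (q.1, q.2.2) :=
      measurable_fst.prodMk (measurable_snd.comp measurable_snd)
    exact (measurable_ind ((measurable_fst.comp measurable_snd) (hIm i))).mul
      ((measurable_moveWeight hIm hA i).mul
        ((hF.comp ((measurable_update_pair i).comp r)).sub (hF.comp measurable_fst)))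
  have bg : ∀ i u a v, |g i u a v| ≤ 1 / (m * p) * (C + C) := fun i u a v => by
    rw [hg, abs_mul, abs_mul, abs_of_nonneg (moveWeight_nonneg hm hp0 hp1 u i a v)]
    calc _ ≤ 1 * (1 / (m * p) * (C + C)) := by
          gcongr
          · exact mul_nonneg (moveWeight_nonneg hm hp0 hp1 u i a v) (abs_nonneg _)
          · exact abs_ind_le_one
          · exact moveWeight_le hm hp0 hp1 u i a v
          · exact (abs_sub _ _).trans (add_le_add (hFC _) (hFC _))
      _ = _ := one_mul _
  have mg2 : ∀ i, Measurable (Function.uncurry fun (u : Fin n → X) (a : S) => ∫ v, g i u a v ∂ν) :=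
    fun i => measurable_integral_right (f := fun (q : (Fin n → X) × S) v => g i q.1 q.2 v)
      ((mg i).comp MeasurableEquiv.prodAssoc.measurable)
  have bg2 : ∀ i (u : Fin n → X) a, |∫ v, g i u a v ∂ν| ≤ 1 / (m * p) * (C + C) := fun i u a =>
    abs_integral_le_of_abs_le (bg i u a)
  have ig2 : ∀ i, Integrable (Function.uncurry fun (u : Fin n → X) (a : S) => ∫ v, g i u a v ∂ν)
      ((iidLaw ν n).prod α) := fun i => integrable_of_abs_le (mg2 i) fun q => bg2 i _ _
  have hsum : ∀ (u : Fin n → X) a, ∑ i ∈ I a, ∫ v, moveWeight I A m p u i a v *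
      (F (Function.update u i v) - F u) ∂ν = ∑ i, ∫ v, g i u a v ∂ν := fun u a => by
    rw [← Finset.sum_subset (Finset.subset_univ (I a))]
    · refine Finset.sum_congr rfl fun i hi => ?_
      simp [hg, ind_of hi]
    · intro i _ hi
      simp [hg, ind_of_not hi]
  simp_rw [e1, hsum]
  rw [integral_const_mul, integral_integral_swap i2]
  have e2 : ∀ a, ∫ u, ind (1 ≤ cnt (I a) fun i => A a u (u i)) * F u ∂(iidLaw ν n) =
      (1 - (1 - p) ^ m) * (∫ u, F u ∂(iidLaw ν n) + ∑ i, ∫ u, ∫ v, g i u a v ∂ν ∂(iidLaw ν n)) :=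
    fun a => by
      rw [integral_ind_one_le_cnt (hI a) hm hp0 hp1 (hsec a) (hAI a) (hAp a) hF hFC]
      congr 2
      rw [← Finset.sum_subset (Finset.subset_univ (I a))]
      · refine Finset.sum_congr rfl fun i hi => ?_
        simp only [hg, ind_of hi, one_mul]
        rfl
      · intro i _ hi
        simp [hg, ind_of_not hi]
  simp_rw [e2]
  have i3 : ∀ i, Integrable (fun a => ∫ u, ∫ v, g i u a v ∂ν ∂(iidLaw ν n)) α := fun i =>
    (ig2 i).integral_prod_right
  have i4 : ∀ i, Integrable (fun u => ∫ a, ∫ v, g i u a v ∂ν ∂α) (iidLaw ν n) := fun i =>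
    (ig2 i).integral_prod_left
  rw [integral_const_mul, integral_add (integrable_const _) (integrable_finsetSum _ fun i _ => i3 i),
    integral_finsetSum _ fun i _ => i3 i, mul_assoc]
  congr 3
  · simp
  · have e3 : ∀ u : Fin n → X, ∫ a, ∑ i, ∫ v, g i u a v ∂ν ∂α = ∑ i, ∫ a, ∫ v, g i u a v ∂ν ∂α :=
      fun u => integral_finsetSum _ fun i _ =>
        integrable_of_abs_le ((mg2 i).of_uncurry_left) fun a => bg2 i u a
    simp_rw [e3]
    rw [integral_finsetSum _ fun i _ => i4 i]
    exact Finset.sum_congr rfl fun i _ => (integral_integral_swap (ig2 i)).symm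

/-- `S` indexes the balls, `I a` is the set of points that count for the ball `a` and may be moved,
and `A a u x` means that `x` lies in this ball. The ball may depend on the configuration, but by
`hAI` not on the points of `I a`; this allows balls centred at sample points. The bound `B` is
required only for moves from outside a ball to its inside. -/
theorem kolmogorovDist_le_of_coverage (hn : 1 ≤ n) (hm : 1 ≤ m) (hI : ∀ a, (I a).card = m)
    (hIm : ∀ i, MeasurableSet {a | i ∈ I a})
    (hA : MeasurableSet {q : S × (Fin n → X) × X | A q.1 q.2.1 q.2.2})
    (hAI : ∀ a, ∀ i ∈ I a, ∀ u v x, A a (Function.update u i v) x ↔ A a u x)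
    (hp0 : 0 < p) (hp1 : p < 1) (hAp : ∀ a u, ν.real {x | A a u x} = p) (hc : 0 < c)
    (hY : ∀ u, Y u = c * ∫ a, ind (1 ≤ cnt (I a) fun i => A a u (u i)) ∂α) (hB : 0 < B)
    (hYB : ∀ a, ∀ i ∈ I a, ∀ u v, ¬A a u (u i) → A a u v → |Y (Function.update u i v) - Y u| ≤ B)
    (hσ : 0 < variance Y (iidLaw ν n))
    (hΔ : ∫ u, |meanMove I A m p ν α Y u - ∫ u', meanMove I A m p ν α Y u' ∂(iidLaw ν n)|
      ∂(iidLaw ν n) ≤ Δ) :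
    kolmogorovDist (iidLaw ν n) Y ≤ c * (1 - (1 - p) ^ m) / (5 * variance Y (iidLaw ν n)) *
      (√(11 * B ^ 2 / √(variance Y (iidLaw ν n)) + 5 * Δ) +
        2 * B / √(√(variance Y (iidLaw ν n)))) ^ 2 := by
  have hunif := isProbabilityMeasure_unifFin hn
  have hYm := measurable_coverage hIm hA hY
  have hm' : (0 : ℝ) < m := by exact_mod_cast hm
  have hYc : ∀ u, |Y u| ≤ c := fun u => by
    have := abs_integral_le_of_abs_le (μ := α) (C := 1)
      (f := fun a => ind (1 ≤ cnt (I a) fun i => A a u (u i))) fun a => abs_ind_le_one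
    rw [hY, abs_mul, abs_of_pos hc]
    exact mul_le_of_le_one_right hc.le this
  have hYmean : ∫ u, Y u ∂(iidLaw ν n) = c * (1 - (1 - p) ^ m) := by
    have := integral_coverage_mul hm hI hIm hA hAI hp0 hp1 hAp hY (F := fun _ => 1) (C := 1)
      measurable_const (by simp)
    simpa using this
  have hμ : 0 < ∫ u, Y u ∂(iidLaw ν n) := by
    rw [hYmean]
    exact mul_pos hc (sub_pos.2 (one_sub_pow_lt_one hm hp0 hp1))
  set w : (Fin n → X) → Fin n × S × X → ℝ := fun u θ =>
    n * (ind (θ.1 ∈ I θ.2.1) * moveWeight I A m p u θ.1 θ.2.1 θ.2.2) with hw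
  have hwm : Measurable (Function.uncurry w) := by
    have r : ∀ i : Fin n, Measurable fun q : (Fin n → X) × S × X =>
        (n : ℝ) * (ind (i ∈ I q.2.1) * moveWeight I A m p q.1 i q.2.1 q.2.2) := fun i =>
      ((measurable_ind ((measurable_fst.comp measurable_snd) (hIm i))).mul
        (measurable_moveWeight hIm hA i)).const_mul _
    have r2 : Measurable fun q : Fin n × (Fin n → X) × S × X =>
        (n : ℝ) * (ind (q.1 ∈ I q.2.2.1) * moveWeight I A m p q.2.1 q.1 q.2.2.1 q.2.2.2) :=
      measurable_from_prod_countable_right r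
    have r3 : Measurable fun q : (Fin n → X) × Fin n × S × X => (q.2.1, q.1, q.2.2) :=
      (measurable_fst.comp measurable_snd).prodMk
        (measurable_fst.prodMk (measurable_snd.comp measurable_snd))
    exact r2.comp r3
  have hupd : Measurable fun q : (Fin n → X) × Fin n × S × X =>
      Function.update q.1 q.2.1 q.2.2.2 := by
    have r2 : Measurable fun q : Fin n × (Fin n → X) × X => Function.update q.2.1 q.1 q.2.2 :=
      measurable_from_prod_countable_right fun i => measurable_update_pair i
    have r3 : Measurable fun q : (Fin n → X) × Fin n × S × X => (q.2.1, q.1, q.2.2.2) :=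
      (measurable_fst.comp measurable_snd).prodMk
        (measurable_fst.prodMk (measurable_snd.comp (measurable_snd.comp measurable_snd)))
    exact r2.comp r3
  have hone : ∀ u, ∀ G : Fin n → X → ℝ, ∀ C, (∀ i, Measurable (G i)) → (∀ i v, |G i v| ≤ C) →
      ∫ θ, w u θ * G θ.1 θ.2.2 ∂((unifFin n).prod (α.prod ν)) =
      ∫ a, ∑ i ∈ I a, ∫ v, moveWeight I A m p u i a v * G i v ∂ν ∂α := by
    intro u G C hG hGC
    have := integral_unifFin_prod (α := α) (ν := ν) (I := I) hn (C := 1 / (m * p) * C)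
      (g := fun i a v => ind (i ∈ I a) * moveWeight I A m p u i a v * G i v) (fun i => ?_)
      (fun i a v => ?_) (fun i a v hi => by simp [ind_of_not hi])
    · simp only [hw]
      simp_rw [mul_assoc] at this ⊢
      rw [this]
      congr 1 with a
      refine Finset.sum_congr rfl fun i hi => ?_
      simp [ind_of hi]
    · exact ((measurable_ind (measurable_fst (hIm i))).mul
        ((measurable_moveWeight hIm hA i).comp measurable_prodMk_left)).mul
          ((hG i).comp measurable_snd)
    · rw [abs_mul, abs_mul, abs_of_nonneg (moveWeight_nonneg hm hp0 hp1 u i a v)]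
      calc _ ≤ 1 * (1 / (m * p)) * C := by
            gcongr
            · exact moveWeight_nonneg hm hp0 hp1 u i a v
            · exact abs_ind_le_one
            · exact moveWeight_le hm hp0 hp1 u i a v
            · exact hGC i v
        _ = _ := by ring
  -- A positive weight forces the point to be movable, its old position to be outside the ball and
  -- its new one inside.
  have hwne : ∀ u θ, w u θ ≠ 0 → |Y (Function.update u θ.1 θ.2.2) - Y u| ≤ B := by
    rintro u ⟨i, a, v⟩ h
    simp only [hw, moveWeight] at h
    by_cases h1 : i ∈ I a
    · by_cases h2 : A a u (u i)
      · simp [ind_of_not (not_not.2 h2)] at h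
      · by_cases h3 : A a u v
        · exact hYB a i h1 u v h2 h3
        · simp [ind_of_not h3] at h
    · simp [ind_of_not h1] at h
  have hT : ∀ u, ∫ θ, w u θ * (Y (Function.update u θ.1 θ.2.2) - Y u)
      ∂((unifFin n).prod (α.prod ν)) = meanMove I A m p ν α Y u := fun u =>
    hone u (fun i v => Y (Function.update u i v) - Y u) (c + c)
      (fun i => (hYm.comp (measurable_update_right u i)).sub_const _)
      fun i v => (abs_sub _ _).trans (add_le_add (hYc _) (hYc _))
  have main := kolmogorovDist_le_of_sizeBias (P := iidLaw ν n)
    (τ := (unifFin n).prod (α.prod ν)) (Y := Y) (w := w) (M := c) (B := B) (Δ := Δ)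
    (C := n * (1 * (1 / (m * p)))) (Z := fun u θ => Y (Function.update u θ.1 θ.2.2)) hYm
    (hYm.comp hupd) hwm hYc
    (fun u θ => mul_nonneg (Nat.cast_nonneg n)
      (mul_nonneg ind_nonneg (moveWeight_nonneg hm hp0 hp1 _ _ _ _)))
    (fun u θ => mul_le_mul_of_nonneg_left (mul_le_mul ind_le_one
      (moveWeight_le hm hp0 hp1 _ _ _ _) (moveWeight_nonneg hm hp0 hp1 _ _ _ _) zero_le_one)
      (Nat.cast_nonneg n)) ?_ hB hwne hμ hσ ?_ ?_
  · rwa [hYmean] at main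
  · intro u
    have := hone u (fun _ _ => 1) 1 (fun _ => measurable_const) (by simp)
    simp only [mul_one] at this
    rw [this]
    have hle := abs_integral_le_of_abs_le (μ := α) (C := 1)
      (f := fun a => ∑ i ∈ I a, ∫ v, moveWeight I A m p u i a v ∂ν) fun a => by
        rw [abs_of_nonneg (Finset.sum_nonneg fun i _ => integral_nonneg fun v =>
          moveWeight_nonneg hm hp0 hp1 _ _ _ _)]
        exact sum_integral_moveWeight_le hm hI hp0 hp1 hA hAp u a
    exact (abs_le.1 hle).2
  · intro f hf
    obtain ⟨C, hC⟩ := (isCompact_Icc (a := -c) (b := c)).exists_bound_of_continuousOn hf.continuousOn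
    have hfC : ∀ u, |f (Y u)| ≤ C := fun u => hC _ (abs_le.1 (hYc u))
    have hfm : Measurable fun u => f (Y u) := hf.measurable.comp hYm
    rw [integral_coverage_mul hm hI hIm hA hAI hp0 hp1 hAp hY hfm hfC, hYmean]
    congr 3 with u
    symm
    exact hone u (fun i v => f (Y (Function.update u i v)) - f (Y u)) (C + C)
      (fun i => (hfm.comp (measurable_update_right u i)).sub_const _)
      fun i v => (abs_sub _ _).trans (add_le_add (hfC _) (hfC _))
  · simp_rw [hT]
    exact hΔ

end Coverage

end BinomialCoverage
end

noncomputable section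
set_option linter.unusedSectionVars false

namespace BinomialCoverage

/-! ### Covered volume for a homogeneous ball relation -/

/-- A symmetric and reflexive measurable relation, all of whose balls have measure `p`. -/
structure BallRel {X : Type*} [MeasurableSpace X] (ν : Measure X) (b : X → X → Prop) (p : ℝ) :
    Prop where
  measurableSet : MeasurableSet {q : X × X | b q.1 q.2}
  symm : ∀ {x y}, b x y → b y x
  refl : ∀ x, b x x
  measureReal : ∀ x, ν.real {y | b x y} = p

section Mean

variable {Ω : Type*} [MeasurableSpace Ω] {P : Measure Ω} [IsProbabilityMeasure P]

theorem sq_integral_le {f : Ω → ℝ} {C : ℝ} (hf : Measurable f) (hC : ∀ x, |f x| ≤ C) :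
    (∫ x, f x ∂P) ^ 2 ≤ ∫ x, f x ^ 2 ∂P := by
  have h := variance_nonneg f P
  rw [variance_eq_sub] at h
  · simpa using h
  · refine (memLp_two_iff_integrable_sq hf.aestronglyMeasurable).2
      (integrable_of_abs_le (C := C ^ 2) (hf.pow_const 2) fun x => ?_)
    rw [abs_pow]
    exact pow_le_pow_left₀ (abs_nonneg _) (hC x) 2

/-- Allows the deviation of a complicated `f` to be estimated through a simpler `g`: the variance is
needed for `g` only, and the replacement costs twice the mean distance, once for the values and once
for the means. -/
theorem integral_abs_sub_mean_le {f g : Ω → ℝ} {C : ℝ} (hf : Measurable f) (hg : Measurable g)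
    (hfC : ∀ x, |f x| ≤ C) (hgC : ∀ x, |g x| ≤ C) :
    ∫ x, |f x - ∫ y, f y ∂P| ∂P ≤ √(variance g P) + 2 * ∫ x, |f x - g x| ∂P := by
  have hfi : Integrable f P := integrable_of_abs_le hf hfC
  have hgi : Integrable g P := integrable_of_abs_le hg hgC
  have hd : Integrable (fun x => |f x - g x|) P := (hfi.sub hgi).abs
  have hgm : Integrable (fun x => |g x - ∫ y, g y ∂P|) P := (hgi.sub (integrable_const _)).abs
  have h1 : ∫ x, |g x - ∫ y, g y ∂P| ∂P ≤ √(variance g P) := by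
    refine Real.le_sqrt_of_sq_le ?_
    rw [variance_eq_integral hg.aemeasurable]
    have := sq_integral_le (P := P) (f := fun x => |g x - ∫ y, g y ∂P|) (C := C + C)
      (by exact ((hg.sub_const _).abs)) fun x => by
        rw [abs_abs]
        exact (abs_sub _ _).trans (add_le_add (hgC x) (abs_integral_le_of_abs_le hgC))
    simpa using this
  have h2 : |∫ y, g y ∂P - ∫ y, f y ∂P| ≤ ∫ x, |f x - g x| ∂P := by
    rw [abs_sub_comm, ← integral_sub hfi hgi]
    exact abs_integral_le_integral_abs
  calc _ ≤ ∫ x, (|f x - g x| + |g x - ∫ y, g y ∂P| + |∫ y, g y ∂P - ∫ y, f y ∂P|) ∂P := by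
        refine integral_mono (hfi.sub (integrable_const _)).abs
          ((hd.add hgm).add (integrable_const _)) fun x => ?_
        have e : f x - ∫ y, f y ∂P =
          (f x - g x) + (g x - ∫ y, g y ∂P) + (∫ y, g y ∂P - ∫ y, f y ∂P) := by ring
        simp only
        rw [e]
        exact (abs_add_le _ _).trans (add_le_add_left (abs_add_le _ _) _)
    _ = ∫ x, |f x - g x| ∂P + ∫ x, |g x - ∫ y, g y ∂P| ∂P + |∫ y, g y ∂P - ∫ y, f y ∂P| := by
        have i1 : Integrable (fun x => |f x - g x| + |g x - ∫ y, g y ∂P|) P := hd.add hgm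
        rw [integral_add i1 (integrable_const _), integral_add hd hgm]
        simp
    _ ≤ _ := by linarith

end Mean

section Volume

variable {X : Type*} [MeasurableSpace X] {n : ℕ} {ν : Measure X} [IsProbabilityMeasure ν]
  {b : X → X → Prop} {p : ℝ}

theorem BallRel.comm (h : BallRel ν b p) {x y : X} : b x y ↔ b y x := ⟨h.symm, h.symm⟩

theorem BallRel.measurable_ind {α : Type*} [MeasurableSpace α] (h : BallRel ν b p) {f g : α → X}
    (hf : Measurable f) (hg : Measurable g) : Measurable fun a => ind (b (f a) (g a)) :=
  BinomialCoverage.measurable_ind ((hf.prodMk hg) h.measurableSet)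

theorem BallRel.integral_ind (h : BallRel ν b p) (x : X) : ∫ y, ind (b x y) ∂ν = p := by
  rw [BinomialCoverage.integral_ind (by exact measurable_prodMk_left h.measurableSet)]
  exact h.measureReal x

theorem BallRel.integral_ind' (h : BallRel ν b p) (x : X) : ∫ y, ind (b y x) ∂ν = p := by
  rw [← h.integral_ind x]
  congr 1 with y
  exact ind_congr h.comm

theorem BallRel.integrable_ind (h : BallRel ν b p) (x : X) : Integrable (fun y => ind (b x y)) ν :=
  integrable_of_abs_le (C := 1) (h.measurable_ind measurable_const measurable_id)
    fun _ => abs_ind_le_one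

theorem BallRel.integrable_ind' (h : BallRel ν b p) (x : X) :
    Integrable (fun y => ind (b y x)) ν :=
  integrable_of_abs_le (C := 1) (h.measurable_ind measurable_id measurable_const)
    fun _ => abs_ind_le_one

theorem BallRel.measurable_count (h : BallRel ν b p) (K : Finset (Fin n)) :
    Measurable fun q : (Fin n → X) × X => cnt K fun i => b q.2 (q.1 i) :=
  measurable_cnt fun i _ =>
    (measurable_snd.prodMk ((measurable_pi_apply i).comp measurable_fst) :
      Measurable fun q : (Fin n → X) × X => (q.2, q.1 i)) h.measurableSet

/-- Volume of the part of the ball about `v` that no ball about a point of `K` covers. -/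
def emptyVol (ν : Measure X) (b : X → X → Prop) (K : Finset (Fin n)) (u : Fin n → X) (v : X) : ℝ :=
  ∫ y, ind (b v y) * ind (cnt K (fun i => b y (u i)) = 0) ∂ν

/-- Volume covered exactly once by the balls about the points of `K`. -/
def singleVol (ν : Measure X) (b : X → X → Prop) (K : Finset (Fin n)) (u : Fin n → X) : ℝ :=
  ∫ y, ind (cnt K (fun i => b y (u i)) = 1) ∂ν

/-- Mean probability of moving a point. -/
def meanProb (ν : Measure X) (b : X → X → Prop) (p : ℝ) (K : Finset (Fin n)) (u : Fin n → X) : ℝ :=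
  ∫ x, moveProb n p (cnt K fun i => b x (u i)) ∂ν

/-- Mean volume gained by a moved point. -/
def meanGain (ν : Measure X) (b : X → X → Prop) (p : ℝ) (K : Finset (Fin n)) (u : Fin n → X) : ℝ :=
  ∫ x, moveProb n p (cnt K fun i => b x (u i)) * ∫ v, ind (b x v) * emptyVol ν b K u v ∂ν ∂ν

/-- Main part of the conditional mean change of the covered volume. -/
def volMove (ν : Measure X) (b : X → X → Prop) (p : ℝ) (K : Finset (Fin n)) (u : Fin n → X) : ℝ :=
  n / p * meanGain ν b p K u - singleVol ν b K u * meanProb ν b p K u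

section Bounds

variable (K : Finset (Fin n)) (u : Fin n → X)

theorem BallRel.measurable_emptyVol (h : BallRel ν b p) :
    Measurable fun q : (Fin n → X) × X => emptyVol ν b K q.1 q.2 := by
  refine measurable_integral_right
    (f := fun (q : (Fin n → X) × X) y => ind (b q.2 y) * ind (cnt K (fun i => b y (q.1 i)) = 0)) ?_
  refine Measurable.mul (h.measurable_ind (measurable_snd.comp measurable_fst) measurable_snd) ?_
  exact BinomialCoverage.measurable_ind (((h.measurable_count K).comp
    ((measurable_fst.comp measurable_fst).prodMk measurable_snd)) (measurableSet_singleton 0))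

theorem BallRel.measurable_singleVol (h : BallRel ν b p) :
    Measurable fun u : Fin n → X => singleVol ν b K u :=
  measurable_integral_right (f := fun (u : Fin n → X) y => ind (cnt K (fun i => b y (u i)) = 1))
    (BinomialCoverage.measurable_ind ((h.measurable_count K) (measurableSet_singleton 1)))

theorem BallRel.measurable_moveProb (h : BallRel ν b p) :
    Measurable fun q : (Fin n → X) × X => moveProb n p (cnt K fun i => b q.2 (q.1 i)) :=
  (measurable_from_top (f := moveProb n p)).comp (h.measurable_count K)

theorem BallRel.measurable_meanProb (h : BallRel ν b p) :
    Measurable fun u : Fin n → X => meanProb ν b p K u :=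
  measurable_integral_right (f := fun (u : Fin n → X) x => moveProb n p (cnt K fun i => b x (u i)))
    (h.measurable_moveProb K)

theorem BallRel.measurable_gain (h : BallRel ν b p) :
    Measurable fun q : (Fin n → X) × X => ∫ v, ind (b q.2 v) * emptyVol ν b K q.1 v ∂ν := by
  refine measurable_integral_right
    (f := fun (q : (Fin n → X) × X) v => ind (b q.2 v) * emptyVol ν b K q.1 v) ?_
  refine Measurable.mul (h.measurable_ind (measurable_snd.comp measurable_fst) measurable_snd) ?_
  exact (h.measurable_emptyVol K).comp
    ((measurable_fst.comp measurable_fst).prodMk measurable_snd)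

theorem BallRel.measurable_meanGain (h : BallRel ν b p) :
    Measurable fun u : Fin n → X => meanGain ν b p K u :=
  measurable_integral_right (f := fun (u : Fin n → X) x =>
    moveProb n p (cnt K fun i => b x (u i)) * ∫ v, ind (b x v) * emptyVol ν b K u v ∂ν)
    ((h.measurable_moveProb K).mul (h.measurable_gain K))

theorem BallRel.measurable_volMove (h : BallRel ν b p) :
    Measurable fun u : Fin n → X => volMove ν b p K u :=
  ((h.measurable_meanGain K).const_mul _).sub
    ((h.measurable_singleVol K).mul (h.measurable_meanProb K))

omit [IsProbabilityMeasure ν] in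
theorem emptyVol_nonneg (v : X) : 0 ≤ emptyVol ν b K u v :=
  integral_nonneg fun _ => mul_nonneg ind_nonneg ind_nonneg

theorem BallRel.emptyVol_le (h : BallRel ν b p) (v : X) : emptyVol ν b K u v ≤ p := by
  rw [← h.integral_ind v]
  exact integral_mono_of_nonneg (Eventually.of_forall fun _ => mul_nonneg ind_nonneg ind_nonneg)
    (h.integrable_ind v) (Eventually.of_forall fun _ => mul_le_of_le_one_right ind_nonneg ind_le_one)

omit [IsProbabilityMeasure ν] in
theorem singleVol_nonneg : 0 ≤ singleVol ν b K u := integral_nonneg fun _ => ind_nonneg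

theorem singleVol_le_one : singleVol ν b K u ≤ 1 :=
  (abs_le.1 (abs_integral_le_of_abs_le fun _ => abs_ind_le_one)).2

theorem BallRel.integral_count (h : BallRel ν b p) :
    ∫ x, (cnt K fun i => b x (u i) : ℝ) ∂ν = K.card * p := by
  simp_rw [cnt_eq_sum]
  rw [integral_finsetSum _ fun i _ => h.integrable_ind' (u i)]
  simp_rw [h.integral_ind']
  simp

theorem BallRel.integrable_count (h : BallRel ν b p) :
    Integrable (fun x => (cnt K fun i => b x (u i) : ℝ)) ν := by
  simp_rw [cnt_eq_sum]
  exact integrable_finsetSum _ fun i _ => h.integrable_ind' (u i)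

theorem BallRel.singleVol_le (h : BallRel ν b p) : singleVol ν b K u ≤ K.card * p := by
  rw [← h.integral_count K u]
  refine integral_mono_of_nonneg (Eventually.of_forall fun _ => ind_nonneg)
    (h.integrable_count K u) (Eventually.of_forall fun y => ?_)
  simp only
  by_cases hy : cnt K (fun i => b y (u i)) = 1
  · rw [ind_of hy, hy]
    simp
  · rw [ind_of_not hy]
    positivity

variable {K u}

theorem meanProb_nonneg (hn : 1 ≤ n) (hp0 : 0 < p) (hp1 : p < 1) : 0 ≤ meanProb ν b p K u :=
  integral_nonneg fun _ => moveProb_nonneg hn hp0 hp1 _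

theorem abs_moveProb_le_one (hn : 1 ≤ n) (hp0 : 0 < p) (hp1 : p < 1) (k : ℕ) :
    |moveProb n p k| ≤ 1 := by
  rw [abs_of_nonneg (moveProb_nonneg hn hp0 hp1 k)]
  exact moveProb_le_one hn hp0 hp1 k

theorem abs_moveProb_sub_le_one (hn : 1 ≤ n) (hp0 : 0 < p) (hp1 : p < 1) (k l : ℕ) :
    |moveProb n p k - moveProb n p l| ≤ 1 := by
  have := moveProb_nonneg hn hp0 hp1 k
  have := moveProb_le_one hn hp0 hp1 k
  have := moveProb_nonneg hn hp0 hp1 l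
  have := moveProb_le_one hn hp0 hp1 l
  rw [abs_le]
  constructor <;> linarith

theorem meanProb_le_one (hn : 1 ≤ n) (hp0 : 0 < p) (hp1 : p < 1) : meanProb ν b p K u ≤ 1 :=
  (abs_le.1 (abs_integral_le_of_abs_le fun _ => abs_moveProb_le_one hn hp0 hp1 _)).2

theorem BallRel.gain_nonneg (x : X) : 0 ≤ ∫ v, ind (b x v) * emptyVol ν b K u v ∂ν :=
  integral_nonneg fun v => mul_nonneg ind_nonneg (emptyVol_nonneg K u v)

theorem BallRel.gain_le (h : BallRel ν b p) (x : X) :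
    ∫ v, ind (b x v) * emptyVol ν b K u v ∂ν ≤ p * p := by
  calc _ ≤ ∫ v, ind (b x v) * p ∂ν :=
        integral_mono_of_nonneg
          (Eventually.of_forall fun v => mul_nonneg ind_nonneg (emptyVol_nonneg K u v))
          ((h.integrable_ind x).mul_const p)
          (Eventually.of_forall fun v => mul_le_mul_of_nonneg_left (h.emptyVol_le K u v) ind_nonneg)
    _ = p * p := by rw [integral_mul_const, h.integral_ind]

theorem BallRel.abs_volMove_le (h : BallRel ν b p) (hn : 1 ≤ n) (hp0 : 0 < p) (hp1 : p < 1) :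
    |volMove ν b p K u| ≤ n / p * (1 * (p * p)) + 1 := by
  have h1 : |meanGain ν b p K u| ≤ 1 * (p * p) := abs_integral_le_of_abs_le fun x => by
    rw [abs_mul, abs_of_nonneg (BallRel.gain_nonneg x)]
    exact mul_le_mul (abs_moveProb_le_one hn hp0 hp1 _) (h.gain_le x) (BallRel.gain_nonneg x)
      zero_le_one
  have h2 : |singleVol ν b K u * meanProb ν b p K u| ≤ 1 := by
    rw [abs_of_nonneg (mul_nonneg (singleVol_nonneg K u) (meanProb_nonneg hn hp0 hp1))]
    exact mul_le_one₀ (singleVol_le_one K u) (meanProb_nonneg hn hp0 hp1)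
      (meanProb_le_one hn hp0 hp1)
  refine (abs_sub _ _).trans (add_le_add ?_ h2)
  rw [abs_mul, abs_of_nonneg (show (0 : ℝ) ≤ n / p by positivity)]
  gcongr

variable (u)

theorem cnt_erase_eq {j : Fin n} {y : X} (hy : ¬b y (u j)) :
    cnt Finset.univ (fun i => b y (u i)) = cnt (Finset.univ.erase j) fun i => b y (u i) := by
  have := cnt_erase (r := fun i => b y (u i)) (Finset.mem_univ j)
  rw [ind_of_not hy, zero_add] at this
  exact_mod_cast this

/-- Effect of one point on the main part of the conditional mean change. -/
theorem BallRel.abs_volMove_sub_le (h : BallRel ν b p) (hn : 1 ≤ n) (hp0 : 0 < p) (hp1 : p < 1)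
    (j : Fin n) : |volMove ν b p Finset.univ u - volMove ν b p (Finset.univ.erase j) u| ≤
      p * (1 + 3 * (n * p)) := by
  set K : Finset (Fin n) := Finset.univ with hK
  set L : Finset (Fin n) := Finset.univ.erase j with hL
  set e : X → ℝ := fun y => ind (b y (u j)) with he
  have hei : Integrable e ν := h.integrable_ind' _
  have hie : ∫ y, e y ∂ν = p := h.integral_ind' _
  have hcnt : ∀ y, ¬b y (u j) → cnt K (fun i => b y (u i)) = cnt L fun i => b y (u i) :=
    fun y hy => cnt_erase_eq u hy
  have mcnt : ∀ M : Finset (Fin n), Measurable fun y => cnt M fun i => b y (u i) := fun M =>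
    (h.measurable_count M).comp measurable_prodMk_left
  -- Deleting the `j`-th point changes counts only at places in the ball about that point, a set of
  -- measure `p`.
  have hlocal : ∀ φ : ℕ → ℝ, (∀ k l, |φ k - φ l| ≤ 1) → ∀ y,
      |φ (cnt K fun i => b y (u i)) - φ (cnt L fun i => b y (u i))| ≤ e y := fun φ hφ y => by
    by_cases hy : b y (u j)
    · rw [he]
      simp only
      rw [ind_of hy]
      exact hφ _ _
    · rw [hcnt y hy, sub_self, abs_zero]
      exact ind_nonneg
  have hind : ∀ c k l : ℕ, |ind (k = c) - ind (l = c)| ≤ 1 := fun c k l => by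
    rw [abs_le]
    constructor <;> linarith [ind_nonneg (p := k = c), ind_le_one (p := k = c),
      ind_nonneg (p := l = c), ind_le_one (p := l = c)]
  have mind : ∀ (c : ℕ) (M : Finset (Fin n)), Measurable fun y => ind (cnt M (fun i => b y (u i)) = c) :=
    fun c M => BinomialCoverage.measurable_ind (mcnt M (measurableSet_singleton c))
  have iind : ∀ (c : ℕ) (M : Finset (Fin n)),
      Integrable (fun y => ind (cnt M (fun i => b y (u i)) = c)) ν :=
    fun c M => integrable_of_abs_le (mind c M) fun _ => abs_ind_le_one
  have hΛ : |singleVol ν b K u - singleVol ν b L u| ≤ p := by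
    unfold singleVol
    rw [← integral_sub (iind 1 K) (iind 1 L), ← hie]
    exact abs_integral_le_integral_abs.trans (integral_mono ((iind 1 K).sub (iind 1 L)).abs hei
      (hlocal (fun k => ind (k = 1)) (hind 1)))
  have mπ : ∀ M : Finset (Fin n), Measurable fun x => moveProb n p (cnt M fun i => b x (u i)) :=
    fun M => (h.measurable_moveProb M).comp measurable_prodMk_left
  have iπ : ∀ M : Finset (Fin n), Integrable (fun x => moveProb n p (cnt M fun i => b x (u i))) ν :=
    fun M => integrable_of_abs_le (mπ M) fun _ => abs_moveProb_le_one hn hp0 hp1 _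
  have hmean : |meanProb ν b p K u - meanProb ν b p L u| ≤ p := by
    unfold meanProb
    rw [← integral_sub (iπ K) (iπ L)]
    exact (abs_integral_le_integral_abs.trans (integral_mono ((iπ K).sub (iπ L)).abs hei
      (hlocal (moveProb n p) (abs_moveProb_sub_le_one hn hp0 hp1)))).trans_eq hie
  set c : X → ℝ := fun v => ∫ y, ind (b v y) * e y ∂ν with hc
  have mbe : Measurable (Function.uncurry fun v y => ind (b v y) * e y) :=
    (h.measurable_ind measurable_fst measurable_snd).mul
      ((h.measurable_ind measurable_id measurable_const).comp measurable_snd)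
  have bbe : ∀ v y, |ind (b v y) * e y| ≤ 1 := fun v y => by
    rw [abs_mul]
    exact mul_le_one₀ abs_ind_le_one (abs_nonneg _) abs_ind_le_one
  have mc : Measurable c := measurable_integral_right mbe
  have bc : ∀ v, |c v| ≤ 1 := fun v => abs_integral_le_of_abs_le (bbe v)
  -- Overlaps are integrated along chains of related points that start at `u j`; every link
  -- contributes a factor `p`.
  have hic : ∫ v, c v ∂ν = p * p := by
    rw [hc, integral_integral_swap (integrable_of_abs_le mbe fun q => bbe _ _)]
    simp_rw [integral_mul_const, h.integral_ind']
    rw [integral_const_mul, hie]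
  have ibe : ∀ (M : Finset (Fin n)) v,
      Integrable (fun y => ind (b v y) * ind (cnt M (fun i => b y (u i)) = 0)) ν := fun M v =>
    integrable_of_abs_le (C := 1) ((h.measurable_ind measurable_const measurable_id).mul (mind 0 M))
      fun y => by
        rw [abs_mul]
        exact mul_le_one₀ abs_ind_le_one (abs_nonneg _) abs_ind_le_one
  have hΓ : ∀ v, |emptyVol ν b K u v - emptyVol ν b L u v| ≤ c v := fun v => by
    unfold emptyVol
    rw [← integral_sub (ibe K v) (ibe L v)]
    refine abs_integral_le_integral_abs.trans (integral_mono ((ibe K v).sub (ibe L v)).abs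
      (integrable_of_abs_le mbe.of_uncurry_left (bbe v)) fun y => ?_)
    simp only
    rw [← mul_sub, abs_mul, abs_of_nonneg ind_nonneg]
    exact mul_le_mul_of_nonneg_left (hlocal (fun k => ind (k = 0)) (hind 0) y) ind_nonneg
  set G : Finset (Fin n) → X → ℝ := fun M x => ∫ v, ind (b x v) * emptyVol ν b M u v ∂ν with hG
  set g : X → ℝ := fun x => ∫ v, ind (b x v) * c v ∂ν with hg
  have mbc : Measurable (Function.uncurry fun x v => ind (b x v) * c v) :=
    (h.measurable_ind measurable_fst measurable_snd).mul (mc.comp measurable_snd)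
  have bbc : ∀ x v, |ind (b x v) * c v| ≤ 1 := fun x v => by
    rw [abs_mul]
    exact mul_le_one₀ abs_ind_le_one (abs_nonneg _) (bc v)
  have mg : Measurable g := measurable_integral_right mbc
  have hig : ∫ x, g x ∂ν = p * (p * p) := by
    rw [hg, integral_integral_swap (integrable_of_abs_le mbc fun q => bbc _ _)]
    simp_rw [integral_mul_const, h.integral_ind']
    rw [integral_const_mul, hic]
  have mE : ∀ M : Finset (Fin n), Measurable fun v => emptyVol ν b M u v := fun M =>
    (h.measurable_emptyVol M).comp measurable_prodMk_left
  have ibE : ∀ (M : Finset (Fin n)) x, Integrable (fun v => ind (b x v) * emptyVol ν b M u v) ν :=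
    fun M x => integrable_of_abs_le (C := 1 * p)
      ((h.measurable_ind measurable_const measurable_id).mul (mE M)) fun v => by
        rw [abs_mul, abs_of_nonneg (emptyVol_nonneg M u v)]
        exact mul_le_mul abs_ind_le_one (h.emptyVol_le M u v) (emptyVol_nonneg M u v) zero_le_one
  have hGg : ∀ x, |G K x - G L x| ≤ g x := fun x => by
    simp only [hG]
    rw [← integral_sub (ibE K x) (ibE L x)]
    refine abs_integral_le_integral_abs.trans (integral_mono ((ibE K x).sub (ibE L x)).abs
      (integrable_of_abs_le mbc.of_uncurry_left (bbc x)) fun v => ?_)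
    simp only
    rw [← mul_sub, abs_mul, abs_of_nonneg ind_nonneg]
    exact mul_le_mul_of_nonneg_left (hΓ v) ind_nonneg
  have mG : ∀ M, Measurable (G M) := fun M => (h.measurable_gain M).comp measurable_prodMk_left
  have iπG : ∀ M : Finset (Fin n),
      Integrable (fun x => moveProb n p (cnt M fun i => b x (u i)) * G M x) ν := fun M =>
    integrable_of_abs_le (C := 1 * (p * p)) ((mπ M).mul (mG M)) fun x => by
      rw [abs_mul, abs_of_nonneg (BallRel.gain_nonneg x)]
      exact mul_le_mul (abs_moveProb_le_one hn hp0 hp1 _) (h.gain_le x) (BallRel.gain_nonneg x)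
        zero_le_one
  have hgain : |meanGain ν b p K u - meanGain ν b p L u| ≤ p * (p * p) + p * (p * p) := by
    have e1 : meanGain ν b p K u - meanGain ν b p L u =
        ∫ x, (moveProb n p (cnt K fun i => b x (u i)) * G K x -
          moveProb n p (cnt L fun i => b x (u i)) * G L x) ∂ν :=
      (integral_sub (iπG K) (iπG L)).symm
    have ig : Integrable g ν := integrable_of_abs_le mg fun x => abs_integral_le_of_abs_le (bbc x)
    rw [e1]
    calc _ ≤ ∫ x, (e x * (p * p) + g x) ∂ν := by
          refine abs_integral_le_integral_abs.trans (integral_mono ((iπG K).sub (iπG L)).abs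
            ((hei.mul_const _).add ig) fun x => ?_)
          have e2 : moveProb n p (cnt K fun i => b x (u i)) * G K x -
              moveProb n p (cnt L fun i => b x (u i)) * G L x =
              (moveProb n p (cnt K fun i => b x (u i)) -
                moveProb n p (cnt L fun i => b x (u i))) * G K x +
              moveProb n p (cnt L fun i => b x (u i)) * (G K x - G L x) := by ring
          simp only
          rw [e2]
          refine (abs_add_le _ _).trans (add_le_add ?_ ?_)
          · rw [abs_mul, abs_of_nonneg (BallRel.gain_nonneg x)]
            exact mul_le_mul (hlocal (moveProb n p) (abs_moveProb_sub_le_one hn hp0 hp1) x)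
              (h.gain_le x) (BallRel.gain_nonneg x) ind_nonneg
          · rw [abs_mul]
            calc _ ≤ 1 * g x := mul_le_mul (abs_moveProb_le_one hn hp0 hp1 _) (hGg x)
                  (abs_nonneg _) zero_le_one
              _ = g x := one_mul _
      _ = p * (p * p) + p * (p * p) := by
          rw [integral_add (hei.mul_const _) ig, integral_mul_const, hie, hig]
  have hΛL : singleVol ν b L u ≤ n * p := by
    refine (h.singleVol_le L u).trans ?_
    gcongr
    exact (Finset.card_le_univ L).trans (by simp)
  have hn0 : (0 : ℝ) ≤ n := Nat.cast_nonneg n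
  -- With `N = n * p`, the gain term contributes `2 * N * p`, the change of `singleVol` contributes
  -- `p`, and the change of `meanProb` contributes `N * p`.
  have e3 : volMove ν b p K u - volMove ν b p L u =
      n / p * (meanGain ν b p K u - meanGain ν b p L u) -
      ((singleVol ν b K u - singleVol ν b L u) * meanProb ν b p K u +
      singleVol ν b L u * (meanProb ν b p K u - meanProb ν b p L u)) := by
    unfold volMove
    ring
  rw [e3]
  refine (abs_sub _ _).trans ?_
  have t1 : |n / p * (meanGain ν b p K u - meanGain ν b p L u)| ≤
      n / p * (p * (p * p) + p * (p * p)) := by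
    rw [abs_mul, abs_of_nonneg (show (0 : ℝ) ≤ n / p by positivity)]
    gcongr
  have t2 : |(singleVol ν b K u - singleVol ν b L u) * meanProb ν b p K u| ≤ p * 1 := by
    rw [abs_mul, abs_of_nonneg (meanProb_nonneg hn hp0 hp1)]
    exact mul_le_mul hΛ (meanProb_le_one hn hp0 hp1) (meanProb_nonneg hn hp0 hp1) hp0.le
  have t3 : |singleVol ν b L u * (meanProb ν b p K u - meanProb ν b p L u)| ≤ n * p * p := by
    rw [abs_mul, abs_of_nonneg (singleVol_nonneg L u)]
    exact mul_le_mul hΛL hmean (abs_nonneg _) (by positivity)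
  have t4 := abs_add_le ((singleVol ν b K u - singleVol ν b L u) * meanProb ν b p K u)
    (singleVol ν b L u * (meanProb ν b p K u - meanProb ν b p L u))
  have t5 : n / p * (p * (p * p) + p * (p * p)) = 2 * (n * p * p) := by
    field_simp
    ring
  linarith

end Bounds

end Volume

end BinomialCoverage
end

noncomputable section
set_option linter.unusedSectionVars false

namespace BinomialCoverage

/-! ### The covered volume when one point moves -/

section Volume

variable {X : Type*} [MeasurableSpace X] {n : ℕ} {ν : Measure X} [IsProbabilityMeasure ν]
  {b : X → X → Prop} {p : ℝ}

/-- Covered volume, in units in which the whole space has volume `n`. -/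
def coverVol (ν : Measure X) (b : X → X → Prop) (u : Fin n → X) : ℝ :=
  n * ∫ x, ind (1 ≤ cnt Finset.univ fun i => b x (u i)) ∂ν

theorem BallRel.measurableSet_cover (h : BallRel ν b p) :
    MeasurableSet {q : X × (Fin n → X) × X | b q.1 q.2.2} :=
  (measurable_fst.prodMk (measurable_snd.comp measurable_snd) :
    Measurable fun q : X × (Fin n → X) × X => (q.1, q.2.2)) h.measurableSet

theorem BallRel.measurable_coverVol (h : BallRel ν b p) :
    Measurable fun u : Fin n → X => coverVol ν b u :=
  measurable_coverage (α := ν) (I := fun _ => Finset.univ) (A := fun a _ x => b a x) (c := n)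
    (fun _ => by simp) h.measurableSet_cover fun _ => rfl

theorem BallRel.measurable_moveWeight_univ (h : BallRel ν b p) (i : Fin n) :
    Measurable fun q : (Fin n → X) × X × X =>
      moveWeight (fun _ : X => Finset.univ) (fun a _ x => b a x) n p q.1 i q.2.1 q.2.2 :=
  measurable_moveWeight (I := fun _ : X => Finset.univ) (A := fun a _ x => b a x) (m := n) (p := p)
    (fun _ => by simp) h.measurableSet_cover i

/-- A place near `v` becomes covered if no ball covered it. A place near the old position becomes
uncovered if it was covered once, unless the ball about `v` covers it again. All cases follow from
the count of the other points. -/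
theorem ind_one_le_cnt_update (b : X → X → Prop) (u : Fin n → X) (i : Fin n) (v y : X) :
    ind (1 ≤ cnt Finset.univ fun k => b y (Function.update u i v k)) =
      ind (1 ≤ cnt Finset.univ fun k => b y (u k)) +
      (ind (b y v) * ind (cnt Finset.univ (fun k => b y (u k)) = 0) +
        ind (b y v) * (ind (b y (u i)) * ind (cnt Finset.univ (fun k => b y (u k)) = 1)) -
        ind (b y (u i)) * ind (cnt Finset.univ (fun k => b y (u k)) = 1)) := by
  have e1 := cnt_erase (r := fun k => b y (u k)) (Finset.mem_univ i)
  have e2 := cnt_erase (r := fun k => b y (Function.update u i v k)) (Finset.mem_univ i)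
  have e3 : (cnt (Finset.univ.erase i) fun k => b y (Function.update u i v k)) =
      cnt (Finset.univ.erase i) fun k => b y (u k) := cnt_congr fun k hk => by
    rw [Function.update_of_ne (Finset.ne_of_mem_erase hk)]
  rw [e3, Function.update_self] at e2
  generalize cnt (Finset.univ.erase i) (fun k => b y (u k)) = N at e1 e2
  generalize cnt Finset.univ (fun k => b y (u k)) = K at e1 ⊢
  generalize cnt Finset.univ (fun k => b y (Function.update u i v k)) = L at e2 ⊢
  by_cases h1 : b y (u i) <;> by_cases h2 : b y v
  all_goals
    simp only [ind_of, ind_of_not, h1, h2, not_false_eq_true] at e1 e2 ⊢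
  · obtain rfl : K = 1 + N := by exact_mod_cast e1
    obtain rfl : L = 1 + N := by exact_mod_cast e2
    rw [ind_of (show 1 ≤ 1 + N by omega), ind_of_not (show ¬1 + N = 0 by omega)]
    ring
  · obtain rfl : K = 1 + N := by exact_mod_cast e1
    obtain rfl : L = N := by
      rw [zero_add] at e2
      exact_mod_cast e2
    rw [ind_of (show 1 ≤ 1 + L by omega)]
    rcases L with _ | L
    · simp [ind]
    · rw [ind_of (by omega), ind_of_not (show ¬1 + (L + 1) = 1 by omega)]
      ring
  · obtain rfl : K = N := by
      rw [zero_add] at e1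
      exact_mod_cast e1
    obtain rfl : L = 1 + K := by exact_mod_cast e2
    rw [ind_of (show 1 ≤ 1 + K by omega)]
    rcases K with _ | K
    · simp [ind]
    · rw [ind_of (show 1 ≤ K + 1 by omega), ind_of_not (show ¬K + 1 = 0 by omega)]
      ring
  · have : K = L := by
      rw [zero_add] at e1 e2
      exact_mod_cast e1.trans e2.symm
    rw [this]
    ring

/-- The part of the ball about the `i`-th point that no other ball covers. -/
def ownVol (ν : Measure X) (b : X → X → Prop) (u : Fin n → X) (i : Fin n) : ℝ :=
  ∫ y, ind (b y (u i)) * ind (cnt Finset.univ (fun k => b y (u k)) = 1) ∂ν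

/-- The part of the ball about `v` that is covered by the `i`-th ball only. -/
def sharedVol (ν : Measure X) (b : X → X → Prop) (u : Fin n → X) (i : Fin n) (v : X) : ℝ :=
  ∫ y, ind (b y v) * (ind (b y (u i)) * ind (cnt Finset.univ (fun k => b y (u k)) = 1)) ∂ν

variable (u : Fin n → X)

theorem BallRel.measurable_cnt_eq (h : BallRel ν b p) (c : ℕ) :
    Measurable fun y => ind (cnt Finset.univ (fun k => b y (u k)) = c) :=
  BinomialCoverage.measurable_ind
    (((h.measurable_count Finset.univ).comp measurable_prodMk_left) (measurableSet_singleton c))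

theorem BallRel.measurable_right (h : BallRel ν b p) (x : X) : Measurable fun y => ind (b y x) :=
  h.measurable_ind measurable_id measurable_const

theorem BallRel.integrable_own (h : BallRel ν b p) (i : Fin n) :
    Integrable (fun y => ind (b y (u i)) * ind (cnt Finset.univ (fun k => b y (u k)) = 1)) ν :=
  integrable_of_abs_le (C := 1) ((h.measurable_right _).mul (h.measurable_cnt_eq u 1)) fun y => by
    rw [abs_mul]
    exact mul_le_one₀ abs_ind_le_one (abs_nonneg _) abs_ind_le_one

theorem BallRel.integrable_shared (h : BallRel ν b p) (i : Fin n) (v : X) :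
    Integrable (fun y => ind (b y v) *
      (ind (b y (u i)) * ind (cnt Finset.univ (fun k => b y (u k)) = 1))) ν :=
  integrable_of_abs_le (C := 1) ((h.measurable_right _).mul
    ((h.measurable_right _).mul (h.measurable_cnt_eq u 1))) fun y => by
      rw [abs_mul, abs_mul]
      exact mul_le_one₀ abs_ind_le_one (mul_nonneg (abs_nonneg _) (abs_nonneg _))
        (mul_le_one₀ abs_ind_le_one (abs_nonneg _) abs_ind_le_one)

theorem BallRel.emptyVol_eq (h : BallRel ν b p) (v : X) : emptyVol ν b Finset.univ u v =
    ∫ y, ind (b y v) * ind (cnt Finset.univ (fun k => b y (u k)) = 0) ∂ν := by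
  unfold emptyVol
  congr 1 with y
  rw [ind_congr h.comm]

/-- Change of the covered volume when a point moves. -/
theorem BallRel.coverVol_update_sub (h : BallRel ν b p) (i : Fin n) (v : X) :
    coverVol ν b (Function.update u i v) - coverVol ν b u =
      n * (emptyVol ν b Finset.univ u v + sharedVol ν b u i v - ownVol ν b u i) := by
  have i0 : Integrable (fun y => ind (b y v) * ind (cnt Finset.univ (fun k => b y (u k)) = 0)) ν :=
    integrable_of_abs_le (C := 1) ((h.measurable_right _).mul (h.measurable_cnt_eq u 0)) fun y => by
      rw [abs_mul]
      exact mul_le_one₀ abs_ind_le_one (abs_nonneg _) abs_ind_le_one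
  have i1 : Integrable (fun y => ind (1 ≤ cnt Finset.univ fun k => b y (u k))) ν :=
    integrable_of_abs_le (BinomialCoverage.measurable_ind
      (((h.measurable_count Finset.univ).comp measurable_prodMk_left) (measurableSet_Ici (a := 1))))
      fun _ => abs_ind_le_one
  have i2 : Integrable (fun y => ind (b y v) * ind (cnt Finset.univ (fun k => b y (u k)) = 0) +
      ind (b y v) * (ind (b y (u i)) * ind (cnt Finset.univ (fun k => b y (u k)) = 1))) ν :=
    i0.add (h.integrable_shared u i v)
  have i3 : Integrable (fun y => ind (b y v) * ind (cnt Finset.univ (fun k => b y (u k)) = 0) +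
      ind (b y v) * (ind (b y (u i)) * ind (cnt Finset.univ (fun k => b y (u k)) = 1)) -
      ind (b y (u i)) * ind (cnt Finset.univ (fun k => b y (u k)) = 1)) ν :=
    i2.sub (h.integrable_own u i)
  unfold coverVol
  simp_rw [ind_one_le_cnt_update b u i v]
  rw [integral_add i1 i3, integral_sub i2 (h.integrable_own u i),
    integral_add i0 (h.integrable_shared u i v), h.emptyVol_eq, sharedVol, ownVol]
  ring

theorem ownVol_nonneg (i : Fin n) : 0 ≤ ownVol ν b u i :=
  integral_nonneg fun _ => mul_nonneg ind_nonneg ind_nonneg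

theorem sharedVol_nonneg (i : Fin n) (v : X) : 0 ≤ sharedVol ν b u i v :=
  integral_nonneg fun _ => mul_nonneg ind_nonneg (mul_nonneg ind_nonneg ind_nonneg)

theorem BallRel.ownVol_le (h : BallRel ν b p) (i : Fin n) : ownVol ν b u i ≤ p := by
  rw [← h.integral_ind' (u i)]
  exact integral_mono (h.integrable_own u i) (h.integrable_ind' _) fun y =>
    mul_le_of_le_one_right ind_nonneg ind_le_one

theorem BallRel.sharedVol_le_ownVol (h : BallRel ν b p) (i : Fin n) (v : X) :
    sharedVol ν b u i v ≤ ownVol ν b u i :=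
  integral_mono (h.integrable_shared u i v) (h.integrable_own u i) fun _ =>
    mul_le_of_le_one_left (mul_nonneg ind_nonneg ind_nonneg) ind_le_one

theorem ind_eq_one_eq_sum (y : X) : ind (cnt Finset.univ (fun k => b y (u k)) = 1) =
    ∑ i, ind (b y (u i)) * ind (cnt Finset.univ (fun k => b y (u k)) = 1) := by
  rw [← Finset.sum_mul, ← cnt_eq_sum]
  by_cases hc : cnt Finset.univ (fun k => b y (u k)) = 1
  · rw [hc]
    simp
  · rw [ind_of_not hc, mul_zero]

theorem BallRel.sum_ownVol (h : BallRel ν b p) :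
    ∑ i, ownVol ν b u i = singleVol ν b Finset.univ u := by
  unfold ownVol singleVol
  rw [← integral_finsetSum _ fun i _ => h.integrable_own u i]
  congr 1 with y
  exact (ind_eq_one_eq_sum u y).symm

theorem BallRel.sum_sharedVol_le (h : BallRel ν b p) (v : X) :
    ∑ i, sharedVol ν b u i v ≤ p := by
  unfold sharedVol
  rw [← integral_finsetSum _ fun i _ => h.integrable_shared u i v, ← h.integral_ind' v]
  refine integral_mono (integrable_finsetSum _ fun i _ => h.integrable_shared u i v)
    (h.integrable_ind' _) fun y => ?_
  simp only
  rw [← Finset.mul_sum, ← ind_eq_one_eq_sum]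
  exact mul_le_of_le_one_right ind_nonneg ind_le_one

/-- The change is a gain minus a net loss, and both lie in `[0, p]` before the factor `n`. The
resulting bound `n * p` is the coupling bound, `φ` on the torus. -/
theorem BallRel.abs_coverVol_update_sub_le (h : BallRel ν b p) (i : Fin n) (v : X) :
    |coverVol ν b (Function.update u i v) - coverVol ν b u| ≤ n * p := by
  have h1 := emptyVol_nonneg (ν := ν) (b := b) Finset.univ u v
  have h3 := sharedVol_nonneg (ν := ν) (b := b) u i v
  have h4 := h.sharedVol_le_ownVol u i v
  have h5 := h.ownVol_le u i
  have h6 : emptyVol ν b Finset.univ u v ≤ p := h.emptyVol_le Finset.univ u v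
  rw [h.coverVol_update_sub, abs_mul, Nat.abs_cast]
  refine mul_le_mul_of_nonneg_left ?_ (Nat.cast_nonneg n)
  rw [abs_le]
  constructor <;> linarith

theorem BallRel.measurable_sharedVol (h : BallRel ν b p) (i : Fin n) :
    Measurable fun v => sharedVol ν b u i v :=
  measurable_integral_right (f := fun v y => ind (b y v) *
      (ind (b y (u i)) * ind (cnt Finset.univ (fun k => b y (u k)) = 1)))
    ((h.measurable_ind measurable_snd measurable_fst).mul
      (((h.measurable_right _).mul (h.measurable_cnt_eq u 1)).comp measurable_snd))

/-- The conditional mean change of the covered volume, up to a small error. -/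
theorem BallRel.abs_meanMove_sub_volMove_le (h : BallRel ν b p) (hn : 1 ≤ n) (hp0 : 0 < p)
    (hp1 : p < 1) :
    |meanMove (fun _ : X => Finset.univ) (fun a _ x => b a x) n p ν ν (coverVol ν b) u -
      volMove ν b p Finset.univ u| ≤ p * (1 + n * p) := by
  have hn' : (0 : ℝ) < n := by exact_mod_cast hn
  set π : X → ℝ := fun x => moveProb n p (cnt Finset.univ fun i => b x (u i)) with hπ
  have hπ0 : ∀ x, 0 ≤ π x := fun x => moveProb_nonneg hn hp0 hp1 _
  have hπ1 : ∀ x, π x ≤ 1 := fun x => moveProb_le_one hn hp0 hp1 _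
  set a : X → ℝ := fun v => emptyVol ν b Finset.univ u v with ha
  set s : Fin n → X → ℝ := sharedVol ν b u with hs
  set l : Fin n → ℝ := ownVol ν b u with hl
  have ma : Measurable a := (h.measurable_emptyVol Finset.univ).comp measurable_prodMk_left
  have ms : ∀ i, Measurable (s i) := fun i => h.measurable_sharedVol u i
  have a0 : ∀ v, 0 ≤ a v := fun v => emptyVol_nonneg _ _ _
  have ap : ∀ v, a v ≤ p := fun v => h.emptyVol_le _ _ _
  have s0 : ∀ i v, 0 ≤ s i v := fun i v => sharedVol_nonneg _ _ _
  have sl : ∀ i v, s i v ≤ l i := fun i v => h.sharedVol_le_ownVol u i v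
  have l0 : ∀ i, 0 ≤ l i := fun i => ownVol_nonneg _ _
  have lp : ∀ i, l i ≤ p := fun i => h.ownVol_le u i
  have mB : ∀ x, Measurable fun v => ind (b x v) := fun x =>
    h.measurable_ind measurable_const measurable_id
  -- the error, for a fixed ball
  set E : X → X → ℝ := fun x v => π x / p * ind (b x v) *
    ∑ i, (ind (¬b x (u i)) * s i v - ind (b x (u i)) * (a v - l i)) with hE
  have hsum : ∀ x v, |∑ i, (ind (¬b x (u i)) * s i v - ind (b x (u i)) * (a v - l i))| ≤
      p + (cnt Finset.univ fun i => b x (u i)) * p := fun x v => by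
    calc _ ≤ ∑ i, |ind (¬b x (u i)) * s i v - ind (b x (u i)) * (a v - l i)| :=
          Finset.abs_sum_le_sum_abs _ _
      _ ≤ ∑ i, (s i v + ind (b x (u i)) * p) := by
          refine Finset.sum_le_sum fun i _ => (abs_sub _ _).trans (add_le_add ?_ ?_)
          · rw [abs_mul, abs_of_nonneg (s0 i v)]
            exact mul_le_of_le_one_left (s0 i v) abs_ind_le_one
          · rw [abs_mul, abs_of_nonneg ind_nonneg]
            refine mul_le_mul_of_nonneg_left ?_ ind_nonneg
            rw [abs_le]
            constructor <;> linarith [a0 v, ap v, l0 i, lp i]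
      _ ≤ _ := by
          rw [Finset.sum_add_distrib, ← Finset.sum_mul, ← cnt_eq_sum]
          exact add_le_add_left (h.sum_sharedVol_le u v) _
  have hEle : ∀ x v, |E x v| ≤ ind (b x v) * (1 + cnt Finset.univ fun i => b x (u i)) :=
    fun x v => by
      rw [hE, abs_mul, abs_mul, abs_of_nonneg ind_nonneg, abs_of_nonneg (by
        have := hπ0 x
        positivity)]
      calc _ ≤ 1 / p * ind (b x v) * (p + (cnt Finset.univ fun i => b x (u i)) * p) := by
            have := ind_nonneg (p := b x v)
            have := hπ1 x
            gcongr
            exact hsum x v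
        _ = _ := by field_simp
  have mE : ∀ x, Measurable (E x) := fun x =>
    ((mB x).const_mul _).mul (Finset.measurable_sum _ fun i _ =>
      ((ms i).const_mul _).sub ((ma.sub_const _).const_mul _))
  have hmain : ∀ x, ∑ i, ∫ v, moveWeight (fun _ : X => Finset.univ) (fun a _ x => b a x) n p u i x v *
      (coverVol ν b (Function.update u i v) - coverVol ν b u) ∂ν =
      n / p * (π x * ∫ v, ind (b x v) * a v ∂ν) - singleVol ν b Finset.univ u * π x +
        ∫ v, E x v ∂ν := by
    intro x
    have hi : ∀ i ∈ Finset.univ, Integrable (fun v => moveWeight (fun _ : X => Finset.univ)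
        (fun a _ x => b a x) n p u i x v *
        (coverVol ν b (Function.update u i v) - coverVol ν b u)) ν := fun i _ => by
      refine integrable_of_abs_le (C := 1 / (n * p) * (n * p)) ?_ fun v => ?_
      · exact ((h.measurable_moveWeight_univ i).comp ((measurable_const (a := u)).prodMk
          ((measurable_const (a := x)).prodMk measurable_id))).mul
          ((h.measurable_coverVol.comp (measurable_update_right u i)).sub_const _)
      · rw [abs_mul, abs_of_nonneg (moveWeight_nonneg hn hp0 hp1 _ _ _ _)]
        exact mul_le_mul (moveWeight_le hn hp0 hp1 _ _ _ _) (h.abs_coverVol_update_sub_le u i v)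
          (abs_nonneg _) (by positivity)
    have iE : Integrable (E x) ν := integrable_of_abs_le
      (C := 1 * (1 + cnt Finset.univ fun i => b x (u i))) (mE x) fun v => by
        refine (hEle x v).trans (mul_le_mul_of_nonneg_right ind_le_one (by positivity))
    have ia : Integrable (fun v => ind (b x v) * a v) ν := integrable_of_abs_le (C := 1 * p)
      ((mB x).mul ma) fun v => by
        rw [abs_mul, abs_of_nonneg (a0 v)]
        exact mul_le_mul abs_ind_le_one (ap v) (a0 v) zero_le_one
    rw [← integral_finsetSum _ hi]
    have e : ∀ v, ∑ i, moveWeight (fun _ : X => Finset.univ) (fun a _ x => b a x) n p u i x v *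
        (coverVol ν b (Function.update u i v) - coverVol ν b u) =
        n / p * π x * (ind (b x v) * a v) - singleVol ν b Finset.univ u * π x / p * ind (b x v) +
          E x v := by
      intro v
      -- The main part ignores that the moved point must lie outside the ball and that old and new
      -- ball may share volume; its sum over `i` is then computed by `sum_ownVol`. The rest is small
      -- because few points lie in a given ball.
      have e1 : ∀ i, moveWeight (fun _ : X => Finset.univ) (fun a _ x => b a x) n p u i x v *
          (coverVol ν b (Function.update u i v) - coverVol ν b u) =
          π x / p * ind (b x v) * (a v - l i) + π x / p * ind (b x v) *
            (ind (¬b x (u i)) * s i v - ind (b x (u i)) * (a v - l i)) := fun i => by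
        rw [h.coverVol_update_sub]
        change π x * ind (¬b x (u i)) * ind (b x v) / (n * p) * (n * (a v + s i v - l i)) = _
        rw [ind_not]
        field_simp
        ring
      simp_rw [e1]
      rw [Finset.sum_add_distrib, ← Finset.mul_sum, ← Finset.mul_sum, Finset.sum_sub_distrib,
        h.sum_ownVol]
      simp only [Finset.sum_const, Finset.card_univ, Fintype.card_fin, nsmul_eq_mul, hE]
      ring
    simp_rw [e]
    have i5 : Integrable (fun v => n / p * π x * (ind (b x v) * a v) -
        singleVol ν b Finset.univ u * π x / p * ind (b x v)) ν :=
      (ia.const_mul _).sub ((h.integrable_ind x).const_mul _)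
    rw [integral_add i5 iE, integral_sub (ia.const_mul _) ((h.integrable_ind x).const_mul _),
      integral_const_mul, integral_const_mul, h.integral_ind]
    field_simp
  have mπ : Measurable π := (h.measurable_moveProb Finset.univ).comp measurable_prodMk_left
  have iπ : Integrable π ν := integrable_of_abs_le mπ fun _ => abs_moveProb_le_one hn hp0 hp1 _
  have iG : Integrable (fun x => π x * ∫ v, ind (b x v) * a v ∂ν) ν :=
    integrable_of_abs_le (C := 1 * (p * p)) (mπ.mul
      ((h.measurable_gain Finset.univ).comp measurable_prodMk_left)) fun x => by
        rw [abs_mul, abs_of_nonneg (BallRel.gain_nonneg x)]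
        exact mul_le_mul (abs_moveProb_le_one hn hp0 hp1 _) (h.gain_le x) (BallRel.gain_nonneg x)
          zero_le_one
  have iN := h.integrable_count Finset.univ u
  have hEint : ∀ x, |∫ v, E x v ∂ν| ≤ p * (1 + cnt Finset.univ fun i => b x (u i)) := fun x => by
    calc _ ≤ ∫ v, ind (b x v) * (1 + cnt Finset.univ fun i => b x (u i)) ∂ν := by
          refine abs_integral_le_integral_abs.trans (integral_mono_of_nonneg
            (Eventually.of_forall fun _ => abs_nonneg _) ((h.integrable_ind x).mul_const _)
            (Eventually.of_forall (hEle x)))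
      _ = _ := by rw [integral_mul_const, h.integral_ind]
  have mEE : Measurable fun x => ∫ v, E x v ∂ν := by
    refine measurable_integral_right (f := E) ?_
    refine ((mπ.comp measurable_fst).div_const _ |>.mul
      (h.measurable_ind measurable_fst measurable_snd)).mul (Finset.measurable_sum _ fun i _ => ?_)
    have m1 : Measurable fun x => ind (b x (u i)) := h.measurable_right _
    have m2 : Measurable fun x => ind (¬b x (u i)) :=
      BinomialCoverage.measurable_ind (MeasurableSet.compl
        ((measurable_id.prodMk measurable_const : Measurable fun x => (x, u i)) h.measurableSet))
    exact ((m2.comp measurable_fst).mul ((ms i).comp measurable_snd)).sub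
      ((m1.comp measurable_fst).mul ((ma.sub_const _).comp measurable_snd))
  have i6 : Integrable (fun x => p * (1 + (cnt Finset.univ fun i => b x (u i) : ℝ))) ν :=
    ((integrable_const _).add iN).const_mul _
  have iEE : Integrable (fun x => ∫ v, E x v ∂ν) ν :=
    i6.mono' mEE.aestronglyMeasurable (Eventually.of_forall hEint)
  have hT : meanMove (fun _ : X => Finset.univ) (fun a _ x => b a x) n p ν ν (coverVol ν b) u -
      volMove ν b p Finset.univ u = ∫ x, ∫ v, E x v ∂ν ∂ν := by
    unfold meanMove volMove meanGain meanProb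
    simp_rw [hmain]
    have i7 : Integrable (fun x => n / p * (π x * ∫ v, ind (b x v) * a v ∂ν) -
        singleVol ν b Finset.univ u * π x) ν := (iG.const_mul _).sub (iπ.const_mul _)
    rw [integral_add i7 iEE, integral_sub (iG.const_mul _) (iπ.const_mul _), integral_const_mul,
      integral_const_mul]
    ring
  rw [hT]
  calc _ ≤ ∫ x, p * (1 + (cnt Finset.univ fun i => b x (u i) : ℝ)) ∂ν :=
        abs_integral_le_integral_abs.trans (integral_mono iEE.abs i6 hEint)
    _ = p * (1 + n * p) := by
        rw [integral_const_mul, integral_add (integrable_const _) iN, h.integral_count]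
        simp

end Volume

/-! ### Normal approximation of the covered volume -/

section VolumeMain

variable {X : Type*} [MeasurableSpace X] {n : ℕ} {ν : Measure X} [IsProbabilityMeasure ν]
  {b : X → X → Prop} {p : ℝ}

/-- Normal approximation of the covered volume. -/
theorem BallRel.kolmogorovDist_coverVol_le (h : BallRel ν b p) (hn : 1 ≤ n) (hp0 : 0 < p)
    (hp1 : p < 1) (hσ : 0 < variance (fun u : Fin n → X => coverVol ν b u) (iidLaw ν n)) :
    kolmogorovDist (iidLaw ν n) (fun u : Fin n → X => coverVol ν b u) ≤
      n * (1 - (1 - p) ^ n) /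
        (5 * variance (fun u : Fin n → X => coverVol ν b u) (iidLaw ν n)) *
      (√(11 * (n * p) ^ 2 / √(variance (fun u : Fin n → X => coverVol ν b u) (iidLaw ν n)) +
        5 * (√(n * (p * (1 + 3 * (n * p))) ^ 2) + 2 * (p * (1 + n * p)))) +
        2 * (n * p) / √(√(variance (fun u : Fin n → X => coverVol ν b u) (iidLaw ν n)))) ^ 2 := by
  have hn' : (0 : ℝ) < n := by exact_mod_cast hn
  refine kolmogorovDist_le_of_coverage (α := ν) (I := fun _ => Finset.univ)
    (A := fun a _ x => b a x) hn hn (fun _ => by simp) (fun _ => by simp)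
    h.measurableSet_cover (fun _ _ _ _ _ _ => Iff.rfl) hp0 hp1 (fun a _ => h.measureReal a) hn'
    (fun _ => rfl) (by positivity) (fun _ i _ u v _ _ => h.abs_coverVol_update_sub_le u i v) hσ ?_
  set Y : (Fin n → X) → ℝ := fun u => coverVol ν b u with hY
  set T := meanMove (fun _ : X => (Finset.univ : Finset (Fin n))) (fun a _ x => b a x) n p ν ν Y
  have hYm : Measurable Y := h.measurable_coverVol
  have hTm : Measurable T := by
    refine measurable_integral_right (f := fun u a => ∑ i, ∫ v, moveWeight (fun _ : X => Finset.univ)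
      (fun a _ x => b a x) n p u i a v * (Y (Function.update u i v) - Y u) ∂ν) ?_
    refine Finset.measurable_sum _ fun i _ => ?_
    refine measurable_integral_right (f := fun (q : (Fin n → X) × X) v =>
      moveWeight (fun _ : X => Finset.univ)
      (fun a _ x => b a x) n p q.1 i q.2 v * (Y (Function.update q.1 i v) - Y q.1)) ?_
    have r : Measurable fun q : ((Fin n → X) × X) × X => (q.1.1, q.2) :=
      (measurable_fst.comp measurable_fst).prodMk measurable_snd
    have r' : Measurable fun q : ((Fin n → X) × X) × X => (q.1.1, q.1.2, q.2) :=
      (measurable_fst.comp measurable_fst).prodMk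
        ((measurable_snd.comp measurable_fst).prodMk measurable_snd)
    exact ((h.measurable_moveWeight_univ i).comp r').mul
        ((hYm.comp ((measurable_update_pair i).comp r)).sub
          (hYm.comp (measurable_fst.comp measurable_fst)))
  have hgb := fun u : Fin n → X => h.abs_volMove_le (K := Finset.univ) (u := u) hn hp0 hp1
  have hd := fun u : Fin n → X => h.abs_meanMove_sub_volMove_le u hn hp0 hp1
  have hTb : ∀ u, |T u| ≤ p * (1 + n * p) + (n / p * (1 * (p * p)) + 1) := fun u => by
    have := abs_sub_abs_le_abs_sub (T u) (volMove ν b p Finset.univ u)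
    linarith [hd u, hgb u]
  have hε : 0 ≤ p * (1 + n * p) := by positivity
  refine (integral_abs_sub_mean_le hTm (h.measurable_volMove Finset.univ) hTb fun u =>
    (hgb u).trans (by linarith)).trans (add_le_add ?_ ?_)
  · refine Real.sqrt_le_sqrt ?_
    -- Efron–Stein is applied with the functional of the other points, which does not depend on the
    -- `j`-th point.
    calc _ ≤ ∑ j, ∫ u, (volMove ν b p Finset.univ u - volMove ν b p (Finset.univ.erase j) u) ^ 2
          ∂(iidLaw ν n) := by
          refine variance_le_sum_integral_sq ν (C := n / p * (1 * (p * p)) + 1)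
            (h.measurable_volMove _) (fun j => h.measurable_volMove _) hgb
            (fun j u => h.abs_volMove_le hn hp0 hp1) fun j u v => ?_
          have e : ∀ y, (cnt (Finset.univ.erase j) fun i => b y (Function.update u j v i)) =
              cnt (Finset.univ.erase j) fun i => b y (u i) := fun y => cnt_congr fun k hk => by
            rw [Function.update_of_ne (Finset.ne_of_mem_erase hk)]
          simp only [volMove, meanGain, meanProb, singleVol, emptyVol, e]
      _ ≤ ∑ j : Fin n, (p * (1 + 3 * (n * p))) ^ 2 := by
          refine Finset.sum_le_sum fun j _ => ?_
          have : ∀ u : Fin n → X, |(volMove ν b p Finset.univ u -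
              volMove ν b p (Finset.univ.erase j) u) ^ 2| ≤ (p * (1 + 3 * (n * p))) ^ 2 := fun u => by
            rw [abs_pow]
            exact pow_le_pow_left₀ (abs_nonneg _) (h.abs_volMove_sub_le u hn hp0 hp1 j) 2
          exact (abs_le.1 (abs_integral_le_of_abs_le this)).2
      _ = _ := by simp
  · have : ∀ u : Fin n → X, |(|T u - volMove ν b p Finset.univ u|)| ≤ p * (1 + n * p) := fun u => by
      rw [abs_abs]
      exact hd u
    exact mul_le_mul_of_nonneg_left (abs_le.1 (abs_integral_le_of_abs_le this)).2 zero_le_two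

end VolumeMain

end BinomialCoverage
end

noncomputable section
set_option linter.unusedSectionVars false

namespace BinomialCoverage

/-! ### Isolated points for a homogeneous ball relation -/

section Combinatorics

variable {X : Type*} {n : ℕ} {b b' : X → X → Prop} {K : Finset (Fin n)} {u : Fin n → X}
  {i j k : Fin n} {v x : X} {κ : ℕ}

/-- Number of points of `K`, other than the `k`-th, in the ball about the `k`-th point. -/
def deg (b : X → X → Prop) (K : Finset (Fin n)) (u : Fin n → X) (k : Fin n) : ℕ :=
  cnt (K.erase k) fun i => b (u k) (u i)

/-- Number of isolated points of `K`. -/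
def isoCnt (b : X → X → Prop) (K : Finset (Fin n)) (u : Fin n → X) : ℕ :=
  cnt K fun k => deg b K u k = 0

/-- Number of isolated points of `K` whose balls contain `v`. -/
def isoNear (b : X → X → Prop) (K : Finset (Fin n)) (u : Fin n → X) (v : X) : ℕ :=
  cnt K fun k => deg b K u k = 0 ∧ b (u k) v

/-- Contribution to the difference between the numbers of isolated points and of points with
exactly one neighbour. -/
def balance (c : ℕ) : ℝ := ind (c = 0) - ind (c = 1)

/-- Any set of pairwise unrelated points that are all related to some point has at most `κ`
elements. -/
def Packing (b : X → X → Prop) (n κ : ℕ) : Prop :=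
  ∀ (x : X) (s : Finset (Fin n)) (u : Fin n → X), (∀ i ∈ s, b (u i) x) →
    (∀ i ∈ s, ∀ j ∈ s, i ≠ j → ¬b (u i) (u j)) → s.card ≤ κ

theorem abs_balance_le (c : ℕ) : |balance c| ≤ 1 := by
  have := ind_nonneg (p := c = 0)
  have := ind_le_one (p := c = 0)
  have := ind_nonneg (p := c = 1)
  have := ind_le_one (p := c = 1)
  unfold balance
  rw [abs_le]
  constructor <;> linarith

theorem cnt_le_of {ι : Type*} {I : Finset ι} {r : ι → Prop}
    (h : ∀ s ⊆ I, (∀ i ∈ s, r i) → s.card ≤ κ) : cnt I r ≤ κ := by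
  classical exact h _ (Finset.filter_subset _ _) fun i hi => (Finset.mem_filter.1 hi).2

theorem deg_eq_erase (hi : i ∈ K) (hk : k ≠ i) :
    (deg b K u k : ℝ) = ind (b (u k) (u i)) + deg b (K.erase i) u k := by
  unfold deg
  rw [cnt_erase (Finset.mem_erase.2 ⟨hk.symm, hi⟩), Finset.erase_right_comm]

theorem deg_of_adj (hi : i ∈ K) (hk : k ≠ i) (h : b (u k) (u i)) :
    deg b K u k = deg b (K.erase i) u k + 1 := by
  have := deg_eq_erase (b := b) (u := u) hi hk
  rw [ind_of h, add_comm] at this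
  exact_mod_cast this

theorem deg_of_not_adj (hi : i ∈ K) (hk : k ≠ i) (h : ¬b (u k) (u i)) :
    deg b K u k = deg b (K.erase i) u k := by
  have := deg_eq_erase (b := b) (u := u) hi hk
  rw [ind_of_not h, zero_add] at this
  exact_mod_cast this

theorem deg_le_card : deg b K u k ≤ K.card :=
  cnt_le_card.trans (Finset.card_le_card (Finset.erase_subset _ _))

theorem not_adj_of_deg_eq_zero (hj : j ∈ K) (hk : k ≠ j) (h : deg b K u k = 0) :
    ¬b (u k) (u j) := cnt_eq_zero.1 h j (Finset.mem_erase.2 ⟨hk.symm, hj⟩)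

/-- Isolated points are pairwise unrelated, so those near a common `v` form a packing. -/
theorem isoNear_le (h : Packing b n κ) : isoNear b K u v ≤ κ := by
  refine cnt_le_of fun s hsK hs => h v s u (fun i hi => (hs i hi).2) fun i hi j hj hij => ?_
  exact not_adj_of_deg_eq_zero (hsK hj) hij (hs i hi).1

/-- Adding the `i`-th point adds itself if it is isolated and destroys the isolated points in whose
balls it lands. -/
theorem isoCnt_eq_erase (hi : i ∈ K) : (isoCnt b K u : ℝ) =
    isoCnt b (K.erase i) u + ind (deg b K u i = 0) - isoNear b (K.erase i) u (u i) := by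
  unfold isoCnt isoNear
  rw [cnt_erase hi, cnt_eq_sum, cnt_eq_sum, cnt_eq_sum, add_comm (ind _), add_sub_right_comm,
    ← Finset.sum_sub_distrib]
  congr 1
  refine Finset.sum_congr rfl fun k hk => ?_
  have hk' := Finset.ne_of_mem_erase hk
  by_cases h : b (u k) (u i)
  · rw [deg_of_adj hi hk' h, ind_of_not (by omega), ind_and, ind_of h]
    ring
  · rw [deg_of_not_adj hi hk' h, ind_and, ind_of_not h]
    ring

theorem deg_update_of_ne (hk : k ≠ i) :
    deg b (K.erase i) (Function.update u i v) k = deg b (K.erase i) u k :=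
  cnt_congr fun l hl => by
    have hl : l ≠ i := Finset.ne_of_mem_erase (Finset.mem_of_mem_erase hl)
    rw [Function.update_of_ne hk, Function.update_of_ne hl]

theorem isoCnt_update : isoCnt b (K.erase i) (Function.update u i v) = isoCnt b (K.erase i) u :=
  cnt_congr fun k hk => by rw [deg_update_of_ne (Finset.ne_of_mem_erase hk)]

theorem isoNear_update :
    isoNear b (K.erase i) (Function.update u i v) x = isoNear b (K.erase i) u x :=
  cnt_congr fun k hk => by
    have hk := Finset.ne_of_mem_erase hk
    rw [deg_update_of_ne hk, Function.update_of_ne hk]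

/-- Change of the number of isolated points when a point moves next to another one. -/
theorem isoCnt_sub_update (hi : i ∈ K) (hj : j ∈ K) (hij : j ≠ i) (hv : b v (u j)) :
    (isoCnt b K u : ℝ) - isoCnt b K (Function.update u i v) =
      ind (deg b K u i = 0) + isoNear b (K.erase i) u v - isoNear b (K.erase i) u (u i) := by
  rw [isoCnt_eq_erase hi, isoCnt_eq_erase (u := Function.update u i v) hi, isoCnt_update,
    -- The moved point is not isolated at its new position, because the `j`-th point is near.
    isoNear_update, Function.update_self, ind_of_not (p := deg b K (Function.update u i v) i = 0)]
  · ring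
  · intro h
    refine not_adj_of_deg_eq_zero hj hij.symm h ?_
    rwa [Function.update_self, Function.update_of_ne hij]

/-- The coupling bound `κ + 1`: two counts of nearby isolated points enter with opposite signs, each
at most `κ`, and the moved point itself counts for at most 1. -/
theorem abs_isoCnt_sub_update_le (h : Packing b n κ) (hi : i ∈ K) (hj : j ∈ K) (hij : j ≠ i)
    (hv : b v (u j)) : |(isoCnt b K u : ℝ) - isoCnt b K (Function.update u i v)| ≤ κ + 1 := by
  rw [isoCnt_sub_update hi hj hij hv]
  have h1 : (isoNear b (K.erase i) u v : ℝ) ≤ κ := by exact_mod_cast isoNear_le h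
  have h2 : (isoNear b (K.erase i) u (u i) : ℝ) ≤ κ := by exact_mod_cast isoNear_le h
  have h3 : (0 : ℝ) ≤ isoNear b (K.erase i) u v := Nat.cast_nonneg _
  have h4 : (0 : ℝ) ≤ isoNear b (K.erase i) u (u i) := Nat.cast_nonneg _
  have h5 := ind_nonneg (p := deg b K u i = 0)
  have h6 := ind_le_one (p := deg b K u i = 0)
  rw [abs_le]
  constructor <;> linarith

/-- Deleting the `i`-th point removes it from the isolated points and makes isolated exactly the
points whose only neighbour it was. -/
theorem isoNear_erase_eq (hi : i ∈ K) : (isoNear b (K.erase i) u v : ℝ) =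
    isoNear b K u v - ind (deg b K u i = 0) * ind (b (u i) v) +
      ∑ k ∈ K.erase i, ind (b (u k) (u i)) * ind (deg b K u k = 1) * ind (b (u k) v) := by
  unfold isoNear
  rw [cnt_erase hi, ind_and, add_sub_cancel_left, cnt_eq_sum, cnt_eq_sum, ← Finset.sum_add_distrib]
  refine Finset.sum_congr rfl fun k hk => ?_
  have hk' := Finset.ne_of_mem_erase hk
  rw [ind_and, ind_and]
  by_cases h : b (u k) (u i)
  · rw [deg_of_adj hi hk' h, ind_of h, ind_of_not (p := _ + 1 = 0) (by omega),
      ind_congr (show deg b (K.erase i) u k + 1 = 1 ↔ deg b (K.erase i) u k = 0 by omega)]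
    ring
  · rw [deg_of_not_adj hi hk' h, ind_of_not h]
    ring

theorem deg_mul_ind (k : Fin n) : (∑ i ∈ K.erase k, ind (b (u k) (u i))) * ind (deg b K u k = 1) =
    ind (deg b K u k = 1) := by
  rw [← cnt_eq_sum]
  change (deg b K u k : ℝ) * _ = _
  by_cases h : deg b K u k = 1
  · rw [h]
    simp
  · rw [ind_of_not h, mul_zero]

theorem sum_erase_comm {f : Fin n → Fin n → ℝ} :
    ∑ i ∈ K, ∑ k ∈ K.erase i, f i k = ∑ k ∈ K, ∑ i ∈ K.erase k, f i k := by
  refine Finset.sum_comm' fun i k => ?_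
  simp only [Finset.mem_erase]
  tauto

/-- A point near the `i`-th one that is isolated after its deletion is a point whose only neighbour
is the `i`-th; every point of degree one is thus counted once, by its neighbour. -/
theorem sum_isoNear_self :
    ∑ i ∈ K, (isoNear b (K.erase i) u (u i) : ℝ) = ∑ k ∈ K, ind (deg b K u k = 1) := by
  have e : ∀ i ∈ K, (isoNear b (K.erase i) u (u i) : ℝ) =
      ∑ k ∈ K.erase i, ind (b (u k) (u i)) * ind (deg b K u k = 1) := fun i hi => by
    unfold isoNear
    rw [cnt_eq_sum]
    refine Finset.sum_congr rfl fun k hk => ?_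
    have hk' := Finset.ne_of_mem_erase hk
    rw [ind_and, mul_comm]
    by_cases h : b (u k) (u i)
    · rw [deg_of_adj hi hk' h, ind_of h,
        ind_congr (show deg b (K.erase i) u k + 1 = 1 ↔ deg b (K.erase i) u k = 0 by omega)]
    · rw [ind_of_not h]
      ring
  rw [Finset.sum_congr rfl e, sum_erase_comm]
  refine Finset.sum_congr rfl fun k _ => ?_
  rw [← Finset.sum_mul, deg_mul_ind]

theorem sum_abs_isoNear_sub_le : ∑ i ∈ K, |(isoNear b (K.erase i) u v : ℝ) - isoNear b K u v| ≤
    isoNear b K u v + cnt K fun k => b (u k) v := by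
  have e : ∀ i ∈ K, |(isoNear b (K.erase i) u v : ℝ) - isoNear b K u v| ≤
      ind (deg b K u i = 0 ∧ b (u i) v) +
      ∑ k ∈ K.erase i, ind (b (u k) (u i)) * ind (deg b K u k = 1) * ind (b (u k) v) :=
    fun i hi => by
      have h0 : 0 ≤ ∑ k ∈ K.erase i, ind (b (u k) (u i)) * ind (deg b K u k = 1) *
          ind (b (u k) v) := Finset.sum_nonneg fun k _ =>
        mul_nonneg (mul_nonneg ind_nonneg ind_nonneg) ind_nonneg
      rw [isoNear_erase_eq hi, ← ind_and]
      have := ind_nonneg (p := deg b K u i = 0 ∧ b (u i) v)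
      rw [abs_le]
      constructor <;> linarith
  refine (Finset.sum_le_sum e).trans ?_
  rw [Finset.sum_add_distrib, sum_erase_comm, isoNear, cnt_eq_sum, cnt_eq_sum]
  refine add_le_add_right (Finset.sum_le_sum fun k _ => ?_) _
  rw [← Finset.sum_mul, ← Finset.sum_mul, deg_mul_ind]
  exact mul_le_of_le_one_left ind_nonneg ind_le_one

/-- Total change of the number of isolated points over the possible moves to `v`. -/
theorem abs_sum_isoCnt_sub_update_le (h : Packing b n κ) (hr : ∀ x, b x x)
    (hs : ∀ {x y}, b x y → b y x) (h3 : ∀ {x y z w}, b x y → b y z → b z w → b' x w)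
    (hj : j ∈ K) (hv : b (u j) v) :
    |∑ i ∈ K.erase j, ind (¬b (u j) (u i)) *
        ((isoCnt b K u : ℝ) - isoCnt b K (Function.update u i v)) -
      (K.card * isoNear b K u v + ∑ k ∈ K, balance (deg b K u k))| ≤
      (2 * κ + 2) * (1 + deg b' K u j) := by
  set f : Fin n → ℝ := fun i =>
    ind (deg b K u i = 0) + isoNear b K u v - isoNear b (K.erase i) u (u i) with hf
  set g : Fin n → ℝ := fun i => (isoNear b (K.erase i) u v : ℝ) - isoNear b K u v with hg
  have h1 : ∑ i ∈ K, f i = K.card * isoNear b K u v + ∑ k ∈ K, balance (deg b K u k) := by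
    simp only [hf, balance]
    rw [Finset.sum_sub_distrib, Finset.sum_add_distrib, sum_isoNear_self,
      Finset.sum_sub_distrib, Finset.sum_const, nsmul_eq_mul]
    ring
  have hfb : ∀ i, |f i| ≤ κ + 1 := fun i => by
    have h1 : (isoNear b K u v : ℝ) ≤ κ := by exact_mod_cast isoNear_le h
    have h2 : (isoNear b (K.erase i) u (u i) : ℝ) ≤ κ := by exact_mod_cast isoNear_le h
    have h3 : (0 : ℝ) ≤ isoNear b K u v := Nat.cast_nonneg _
    have h4 : (0 : ℝ) ≤ isoNear b (K.erase i) u (u i) := Nat.cast_nonneg _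
    have h5 := ind_nonneg (p := deg b K u i = 0)
    have h6 := ind_le_one (p := deg b K u i = 0)
    simp only [hf]
    rw [abs_le]
    constructor <;> linarith
  -- The terms `f i` sum over all of `K` to the main part. The corrections are the missing index
  -- `j`, the points inside the ball about the `j`-th point, and the effect `g i` of deleting `i` on
  -- the count near `v`. The number of points near `v` is bounded by one plus the degree of `j` in
  -- the wider relation `b'`.
  have h2 : ∀ i ∈ K.erase j, ind (¬b (u j) (u i)) *
      ((isoCnt b K u : ℝ) - isoCnt b K (Function.update u i v)) =
      f i - ind (b (u j) (u i)) * f i + ind (¬b (u j) (u i)) * g i := fun i hi => by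
    rw [isoCnt_sub_update (Finset.mem_of_mem_erase hi) hj (Finset.ne_of_mem_erase hi).symm (hs hv),
      ind_not]
    simp only [hf, hg]
    ring
  rw [Finset.sum_congr rfl h2, ← h1, Finset.sum_add_distrib, Finset.sum_sub_distrib,
    ← Finset.add_sum_erase K f hj]
  have b1 : |∑ i ∈ K.erase j, ind (b (u j) (u i)) * f i| ≤ deg b K u j * (κ + 1) := by
    rw [deg, cnt_eq_sum, Finset.sum_mul]
    refine (Finset.abs_sum_le_sum_abs _ _).trans (Finset.sum_le_sum fun i _ => ?_)
    rw [abs_mul, abs_of_nonneg ind_nonneg]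
    exact mul_le_mul_of_nonneg_left (hfb i) ind_nonneg
  have b2 : |∑ i ∈ K.erase j, ind (¬b (u j) (u i)) * g i| ≤ κ + (1 + deg b' K u j) := by
    calc _ ≤ ∑ i ∈ K, |g i| := by
          refine (Finset.abs_sum_le_sum_abs _ _).trans ((Finset.sum_le_sum fun i _ => ?_).trans
            (Finset.sum_le_sum_of_subset_of_nonneg (Finset.erase_subset j K)
              fun _ _ _ => abs_nonneg _))
          rw [abs_mul]
          exact mul_le_of_le_one_left (abs_nonneg _) abs_ind_le_one
      _ ≤ isoNear b K u v + cnt K fun k => b (u k) v := sum_abs_isoNear_sub_le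
      _ ≤ κ + (1 + deg b' K u j) := by
          refine add_le_add (by exact_mod_cast isoNear_le h) ?_
          rw [cnt_erase hj]
          refine add_le_add ind_le_one ?_
          exact_mod_cast cnt_mono fun k _ hk => h3 hv (hs hk) (hr _)
  have b3 : (deg b K u j : ℝ) ≤ deg b' K u j := by
    exact_mod_cast cnt_mono fun k _ hk => h3 (hr _) (hr _) hk
  have b4 := hfb j
  have hκ : (0 : ℝ) ≤ κ := Nat.cast_nonneg _
  have hd : (0 : ℝ) ≤ deg b' K u j := Nat.cast_nonneg _
  have b5 : (deg b K u j : ℝ) * (κ + 1) ≤ deg b' K u j * (κ + 1) :=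
    mul_le_mul_of_nonneg_right b3 (by positivity)
  have b6 : 0 ≤ (deg b' K u j : ℝ) * κ := mul_nonneg hd hκ
  rw [abs_le] at b1 b2 b4 ⊢
  constructor <;> nlinarith

/-- If deleting `j` affected the status of a point `l` near `v`, the chain from `j` through `l` and
`v` to `k` would relate `j` and `k` in three steps. This is the reason for the relation `b'`, used
with three times the radius on the torus. -/
theorem isoNear_erase_of_not (hr : ∀ x, b x x) (hs : ∀ {x y}, b x y → b y x)
    (h3 : ∀ {x y z w}, b x y → b y z → b z w → b' x w) (hj : j ∈ K) (hk : ¬b' (u j) (u k))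
    (hv : b (u k) v) : isoNear b (K.erase j) u v = isoNear b K u v := by
  have h1 := cnt_erase (r := fun k => deg b K u k = 0 ∧ b (u k) v) hj
  rw [ind_of_not, zero_add] at h1
  · have h2 : isoNear b K u v = cnt (K.erase j) fun k => deg b K u k = 0 ∧ b (u k) v := by
      exact_mod_cast h1
    rw [h2]
    refine cnt_congr fun l hl => and_congr_left fun hlv => ?_
    rw [deg_of_not_adj hj (Finset.ne_of_mem_erase hl)]
    exact fun hlj => hk (h3 (hs hlj) hlv (hs hv))
  · exact fun hh => hk (h3 (hr _) hh.2 (hs hv))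

theorem abs_sum_balance_sub_le (hs : ∀ {x y}, b x y → b y x) (hj : j ∈ K) :
    |∑ k ∈ K, balance (deg b K u k) - ∑ k ∈ K.erase j, balance (deg b (K.erase j) u k)| ≤
      1 + 2 * deg b K u j := by
  rw [← Finset.add_sum_erase K _ hj, add_sub_assoc, ← Finset.sum_sub_distrib]
  refine (abs_add_le _ _).trans (add_le_add (abs_balance_le _) ?_)
  rw [deg, cnt_eq_sum, Finset.mul_sum]
  refine (Finset.abs_sum_le_sum_abs _ _).trans (Finset.sum_le_sum fun k hk => ?_)
  have hk' := Finset.ne_of_mem_erase hk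
  by_cases h : b (u k) (u j)
  · rw [ind_of (hs h)]
    exact (abs_sub _ _).trans ((add_le_add (abs_balance_le _) (abs_balance_le _)).trans (by norm_num))
  · rw [deg_of_not_adj hj hk' h, sub_self, abs_zero]
    exact mul_nonneg zero_le_two ind_nonneg

/-- A sum of local terms in `[0, C]` changes, when a point is deleted, only by the term of that
point and the terms of its neighbours, each by at most `C`. -/
theorem abs_sum_local_sub_le {f g : Fin n → ℝ} {C : ℝ} (hj : j ∈ K)
    (hf0 : ∀ k, 0 ≤ f k) (hfC : ∀ k, f k ≤ C) (hg0 : ∀ k, 0 ≤ g k) (hgC : ∀ k, g k ≤ C)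
    (hfg : ∀ k ∈ K.erase j, ¬b (u j) (u k) → f k = g k) :
    |∑ k ∈ K, f k - ∑ k ∈ K.erase j, g k| ≤ C * (1 + deg b K u j) := by
  have hC : 0 ≤ C := (hf0 j).trans (hfC j)
  rw [← Finset.add_sum_erase K _ hj, add_sub_assoc, ← Finset.sum_sub_distrib, mul_add, mul_one]
  refine (abs_add_le _ _).trans (add_le_add (by rw [abs_of_nonneg (hf0 j)]; exact hfC j) ?_)
  rw [deg, cnt_eq_sum, Finset.mul_sum]
  refine (Finset.abs_sum_le_sum_abs _ _).trans (Finset.sum_le_sum fun k hk => ?_)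
  by_cases h : b (u j) (u k)
  · rw [ind_of h, mul_one, abs_le]
    constructor <;> linarith [hf0 k, hfC k, hg0 k, hgC k]
  · rw [hfg k hk h, sub_self, abs_zero]
    exact mul_nonneg hC ind_nonneg

/-- Brings `n - S` into the form treated by `kolmogorovDist_le_of_coverage`: a sum over balls
centred at sample points of the indicators that another point lies in the ball. -/
theorem sum_ind_one_le_deg : ∑ k ∈ K, ind (1 ≤ deg b K u k) = K.card - isoCnt b K u := by
  rw [isoCnt, cnt_eq_sum, eq_sub_iff_add_eq, ← Finset.sum_add_distrib, ← nsmul_one,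
    ← Finset.sum_const]
  refine Finset.sum_congr rfl fun k _ => ?_
  rw [ind_congr (Nat.one_le_iff_ne_zero), ind_not]
  ring

end Combinatorics

end BinomialCoverage
end

noncomputable section
set_option linter.unusedSectionVars false

namespace BinomialCoverage

/-! ### Conditional mean change and normal approximation for isolated points -/

section Isolated

variable {X : Type*} [MeasurableSpace X] {n m κ : ℕ} {ν : Measure X} [IsProbabilityMeasure ν]
  {b b' : X → X → Prop} {p p' : ℝ}

/-- Mean number of isolated points near a uniform point of the ball about the `k`-th point, in
units of `1 / n`. -/
def isoGain (ν : Measure X) (b : X → X → Prop) (p : ℝ) (K : Finset (Fin n)) (u : Fin n → X)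
    (k : Fin n) : ℝ :=
  n / p * ∫ v, ind (b (u k) v) * isoNear b K u v ∂ν

/-- Main part of the conditional mean change of the number of isolated points. -/
def isoMove (ν : Measure X) (b : X → X → Prop) (m : ℕ) (p : ℝ) (K : Finset (Fin n))
    (u : Fin n → X) : ℝ :=
  (n * m : ℝ)⁻¹ * (∑ k ∈ K, moveProb m p (deg b K u k) * isoGain ν b p K u k +
    (∑ k ∈ K, balance (deg b K u k)) * ∑ k ∈ K, moveProb m p (deg b K u k))

theorem BallRel.measurable_deg (h : BallRel ν b p) (K : Finset (Fin n)) (k : Fin n) :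
    Measurable fun u : Fin n → X => deg b K u k :=
  measurable_cnt fun i _ => ((measurable_pi_apply k).prodMk (measurable_pi_apply i) :
    Measurable fun u : Fin n → X => (u k, u i)) h.measurableSet

theorem BallRel.measurable_isoNear (h : BallRel ν b p) (K : Finset (Fin n)) :
    Measurable fun q : (Fin n → X) × X => isoNear b K q.1 q.2 :=
  measurable_cnt fun k _ => (((h.measurable_deg K k).comp measurable_fst)
    (measurableSet_singleton 0)).inter (((measurable_pi_apply k).comp measurable_fst |>.prodMk
      measurable_snd : Measurable fun q : (Fin n → X) × X => (q.1 k, q.2)) h.measurableSet)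

theorem BallRel.measurable_isoCnt (h : BallRel ν b p) (K : Finset (Fin n)) :
    Measurable fun u : Fin n → X => isoCnt b K u :=
  measurable_cnt fun k _ => (h.measurable_deg K k) (measurableSet_singleton 0)

theorem measurable_natCast_comp {α : Type*} [MeasurableSpace α] {f : α → ℕ} (hf : Measurable f) :
    Measurable fun a => (f a : ℝ) := (measurable_from_top (f := (Nat.cast : ℕ → ℝ))).comp hf

theorem BallRel.measurable_isoGain (h : BallRel ν b p) (K : Finset (Fin n)) (k : Fin n) :
    Measurable fun u : Fin n → X => isoGain ν b p K u k := by
  refine (measurable_integral_right (f := fun (u : Fin n → X) v =>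
    ind (b (u k) v) * isoNear b K u v) ?_).const_mul _
  exact (h.measurable_ind ((measurable_pi_apply k).comp measurable_fst) measurable_snd).mul
    (measurable_natCast_comp (h.measurable_isoNear K))

theorem BallRel.measurable_moveProb_deg (h : BallRel ν b p) (K : Finset (Fin n)) (k : Fin n) :
    Measurable fun u : Fin n → X => moveProb m p (deg b K u k) :=
  (measurable_from_top (f := moveProb m p)).comp (h.measurable_deg K k)

theorem BallRel.measurable_isoMove (h : BallRel ν b p) (K : Finset (Fin n)) :
    Measurable fun u : Fin n → X => isoMove ν b m p K u :=
  ((Finset.measurable_sum _ fun k _ => (h.measurable_moveProb_deg K k).mul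
      (h.measurable_isoGain K k)).add ((Finset.measurable_sum _ fun k _ =>
        (measurable_from_top (f := balance)).comp (h.measurable_deg K k)).mul
        (Finset.measurable_sum _ fun k _ => h.measurable_moveProb_deg K k))).const_mul _

theorem BallRel.measurable_isoNear_right (h : BallRel ν b p) (K : Finset (Fin n)) (u : Fin n → X) :
    Measurable fun v => (isoNear b K u v : ℝ) :=
  have e : Measurable fun v => isoNear b K u v :=
    measurable_cnt fun k _ => (MeasurableSet.const _).inter
      ((measurable_const.prodMk measurable_id : Measurable fun v : X => (u k, v)) h.measurableSet)
  measurable_natCast_comp e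

theorem isoGain_nonneg (hp0 : 0 < p) (K : Finset (Fin n)) (u : Fin n → X) (k : Fin n) :
    0 ≤ isoGain ν b p K u k :=
  mul_nonneg (div_nonneg (Nat.cast_nonneg n) hp0.le)
    (integral_nonneg fun _ => mul_nonneg ind_nonneg (Nat.cast_nonneg _))

theorem BallRel.integrable_ind_mul_isoNear (h : BallRel ν b p) (hP : Packing b n κ)
    (K : Finset (Fin n)) (u : Fin n → X) (x : X) :
    Integrable (fun v => ind (b x v) * isoNear b K u v) ν :=
  integrable_of_abs_le (C := 1 * κ) ((h.measurable_ind measurable_const measurable_id).mul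
    (h.measurable_isoNear_right K u)) fun v => by
      rw [abs_mul, Nat.abs_cast]
      exact mul_le_mul abs_ind_le_one (by exact_mod_cast isoNear_le hP) (Nat.cast_nonneg _)
        zero_le_one

theorem BallRel.isoGain_le (h : BallRel ν b p) (hP : Packing b n κ) (hp0 : 0 < p)
    (K : Finset (Fin n)) (u : Fin n → X) (k : Fin n) : isoGain ν b p K u k ≤ n * κ := by
  have h1 : ∫ v, ind (b (u k) v) * isoNear b K u v ∂ν ≤ p * κ := by
    rw [← h.integral_ind (u k), ← integral_mul_const]
    refine integral_mono (h.integrable_ind_mul_isoNear hP K u _)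
      ((h.integrable_ind _).mul_const _) fun v =>
        mul_le_mul_of_nonneg_left (Nat.cast_le.2 (isoNear_le hP)) ind_nonneg
  calc isoGain ν b p K u k ≤ n / p * (p * κ) :=
        mul_le_mul_of_nonneg_left h1 (div_nonneg (Nat.cast_nonneg n) hp0.le)
    _ = n * κ := by field_simp

theorem abs_sum_balance_le (K : Finset (Fin n)) (u : Fin n → X) :
    |∑ k ∈ K, balance (deg b K u k)| ≤ n := by
  refine (Finset.abs_sum_le_sum_abs _ _).trans
    ((Finset.sum_le_sum fun k _ => abs_balance_le _).trans ?_)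
  simpa using K.card_le_univ

theorem abs_sum_moveProb_le (hm : 1 ≤ m) (hp0 : 0 < p) (hp1 : p < 1) (K : Finset (Fin n))
    (u : Fin n → X) : |∑ k ∈ K, moveProb m p (deg b K u k)| ≤ n := by
  refine (Finset.abs_sum_le_sum_abs _ _).trans
    ((Finset.sum_le_sum fun k _ => abs_moveProb_le_one hm hp0 hp1 _).trans ?_)
  simpa using K.card_le_univ

theorem BallRel.abs_isoMove_le (h : BallRel ν b p) (hP : Packing b n κ) (hm : 1 ≤ m)
    (hp0 : 0 < p) (hp1 : p < 1) (K : Finset (Fin n)) (u : Fin n → X) :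
    |isoMove ν b m p K u| ≤ (n * m : ℝ)⁻¹ * (n * (n * κ) + n * n) := by
  unfold isoMove
  rw [abs_mul, abs_of_nonneg (show (0 : ℝ) ≤ (n * m : ℝ)⁻¹ by positivity)]
  refine mul_le_mul_of_nonneg_left ((abs_add_le _ _).trans (add_le_add ?_ ?_)) (by positivity)
  · refine (Finset.abs_sum_le_sum_abs _ _).trans
      ((Finset.sum_le_sum (g := fun _ => (n * κ : ℝ)) fun k _ => ?_).trans ?_)
    · rw [abs_mul, abs_of_nonneg (isoGain_nonneg hp0 K u k)]
      exact (mul_le_of_le_one_left (isoGain_nonneg hp0 K u k)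
        (abs_moveProb_le_one hm hp0 hp1 _)).trans (h.isoGain_le hP hp0 K u k)
    · rw [Finset.sum_const, nsmul_eq_mul]
      refine mul_le_mul_of_nonneg_right ?_ (by positivity)
      simpa using K.card_le_univ
  · rw [abs_mul]
    exact mul_le_mul (abs_sum_balance_le K u) (abs_sum_moveProb_le hm hp0 hp1 K u) (abs_nonneg _)
      (Nat.cast_nonneg n)

/-- Effect of one point on the main part of the conditional mean change. -/
theorem BallRel.abs_isoMove_sub_le (h : BallRel ν b p) (hP : Packing b n κ) (hn : 1 ≤ n)
    (hm : 1 ≤ m) (hp0 : 0 < p) (hp1 : p < 1)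
    (h3 : ∀ {x y z w}, b x y → b y z → b z w → b' x w)
    (u : Fin n → X) (j : Fin n) :
    |isoMove ν b m p Finset.univ u - isoMove ν b m p (Finset.univ.erase j) u| ≤
      ((κ + 2) + (κ + 3) * deg b' Finset.univ u j) / m := by
  have hn' : (0 : ℝ) < n := by exact_mod_cast hn
  have hm' : (0 : ℝ) < m := by exact_mod_cast hm
  set K : Finset (Fin n) := Finset.univ with hK
  have hj : j ∈ K := Finset.mem_univ j
  have hπ0 : ∀ k, 0 ≤ moveProb m p k := fun k => moveProb_nonneg hm hp0 hp1 k
  have hπ1 : ∀ k, moveProb m p k ≤ 1 := fun k => moveProb_le_one hm hp0 hp1 k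
  have hbb : ∀ {x y}, b x y → b' x y := fun hxy => h3 (h.refl _) (h.refl _) hxy
  have hdeg : (deg b K u j : ℝ) ≤ deg b' K u j := by
    exact_mod_cast cnt_mono fun k _ hk => hbb hk
  -- The gains are local with respect to `b'`, not `b`, since `isoGain` at `k` looks at isolated
  -- points two steps away, whose status depends on points three steps away.
  have d1 : |∑ k ∈ K, moveProb m p (deg b K u k) * isoGain ν b p K u k -
      ∑ k ∈ K.erase j, moveProb m p (deg b (K.erase j) u k) * isoGain ν b p (K.erase j) u k| ≤
      n * κ * (1 + deg b' K u j) := by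
    have hle : ∀ (L : Finset (Fin n)) k,
        moveProb m p (deg b L u k) * isoGain ν b p L u k ≤ n * κ := fun L k =>
      (mul_le_of_le_one_left (isoGain_nonneg hp0 L u k) (hπ1 _)).trans (h.isoGain_le hP hp0 L u k)
    refine abs_sum_local_sub_le hj (fun k => mul_nonneg (hπ0 _) (isoGain_nonneg hp0 _ _ _)) (hle K)
      (fun k => mul_nonneg (hπ0 _) (isoGain_nonneg hp0 _ _ _)) (hle _) fun k hk hjk => ?_
    rw [deg_of_not_adj hj (Finset.ne_of_mem_erase hk) fun hkj => hjk (hbb (h.symm hkj))]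
    unfold isoGain
    congr 3 with v
    by_cases hv : b (u k) v
    · rw [isoNear_erase_of_not h.refl h.symm h3 hj hjk hv]
    · rw [ind_of_not hv, zero_mul, zero_mul]
  have d2 : |∑ k ∈ K, moveProb m p (deg b K u k) -
      ∑ k ∈ K.erase j, moveProb m p (deg b (K.erase j) u k)| ≤ 1 * (1 + deg b K u j) := by
    refine abs_sum_local_sub_le hj (fun k => hπ0 _) (fun k => hπ1 _) (fun k => hπ0 _)
      (fun k => hπ1 _) fun k hk hjk => ?_
    rw [deg_of_not_adj hj (Finset.ne_of_mem_erase hk) fun hkj => hjk (h.symm hkj)]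
  have d3 := abs_sum_balance_sub_le (b := b) (u := u) h.symm hj
  have d4 := abs_sum_balance_le (b := b) K u
  have d5 := abs_sum_moveProb_le (b := b) hm hp0 hp1 (K.erase j) u
  unfold isoMove
  generalize (∑ k ∈ K, balance (deg b K u k)) = B1 at *
  generalize (∑ k ∈ K.erase j, balance (deg b (K.erase j) u k)) = B2 at *
  generalize (∑ k ∈ K, moveProb m p (deg b K u k)) = P1 at *
  generalize (∑ k ∈ K.erase j, moveProb m p (deg b (K.erase j) u k)) = P2 at *
  generalize (∑ k ∈ K, moveProb m p (deg b K u k) * isoGain ν b p K u k) = G1 at *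
  generalize (∑ k ∈ K.erase j, moveProb m p (deg b (K.erase j) u k) *
    isoGain ν b p (K.erase j) u k) = G2 at *
  have e : (n * m : ℝ)⁻¹ * (G1 + B1 * P1) - (n * m : ℝ)⁻¹ * (G2 + B2 * P2) =
      (n * m : ℝ)⁻¹ * ((G1 - G2) + B1 * (P1 - P2) + (B1 - B2) * P2) := by ring
  rw [e, abs_mul, abs_of_pos (show (0 : ℝ) < (n * m : ℝ)⁻¹ by positivity)]
  have hd : (0 : ℝ) ≤ deg b K u j := Nat.cast_nonneg _
  have f2 : |B1 * (P1 - P2)| ≤ n * (1 * (1 + deg b K u j)) := by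
    rw [abs_mul]
    exact mul_le_mul d4 d2 (abs_nonneg _) hn'.le
  have f3 : |(B1 - B2) * P2| ≤ (1 + 2 * deg b K u j) * n := by
    rw [abs_mul]
    exact mul_le_mul d3 d5 (abs_nonneg _) (by positivity)
  calc _ ≤ (n * m : ℝ)⁻¹ * (n * κ * (1 + deg b' K u j) + n * (1 * (1 + deg b K u j)) +
        (1 + 2 * deg b K u j) * n) := by
        refine mul_le_mul_of_nonneg_left ?_ (by positivity)
        exact (abs_add_le _ _).trans (add_le_add ((abs_add_le _ _).trans (add_le_add d1 f2)) f3)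
    _ = (κ * (1 + deg b' K u j) + (1 + deg b K u j) + (1 + 2 * deg b K u j)) / m := by
        field_simp
    _ ≤ _ := by
        gcongr ?_ / _
        nlinarith

/-- Averages `abs_sum_isoCnt_sub_update_le` over the ball and the new position. Unlike for the
volume, the error depends on the configuration through degrees, so its mean is taken only later. -/
theorem BallRel.abs_meanMove_sub_isoMove_le (h : BallRel ν b p) (hP : Packing b n κ) (hn : 1 ≤ n)
    (hm : 1 ≤ m) (hp0 : 0 < p) (hp1 : p < 1)
    (h3 : ∀ {x y z w}, b x y → b y z → b z w → b' x w) (u : Fin n → X) :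
    |meanMove (fun k : Fin n => Finset.univ.erase k) (fun k u x => b (u k) x) m p ν (unifFin n)
      (fun u => n - isoCnt b Finset.univ u) u - isoMove ν b m p Finset.univ u| ≤
      (n * m : ℝ)⁻¹ * ∑ k, (2 * κ + 2 : ℝ) * (1 + deg b' Finset.univ u k) := by
  have hn' : (0 : ℝ) < n := by exact_mod_cast hn
  have hm' : (0 : ℝ) < m := by exact_mod_cast hm
  set K : Finset (Fin n) := Finset.univ with hK
  set bal : ℝ := ∑ k ∈ K, balance (deg b K u k) with hbal
  set D : Fin n → X → ℝ := fun k v => ∑ i ∈ K.erase k, ind (¬b (u k) (u i)) *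
    ((isoCnt b K u : ℝ) - isoCnt b K (Function.update u i v)) with hD
  have mD : ∀ i, Measurable fun v => (isoCnt b K u : ℝ) - isoCnt b K (Function.update u i v) :=
    fun i => measurable_const.sub
      (measurable_natCast_comp ((h.measurable_isoCnt K).comp (measurable_update_right u i)))
  have mb : ∀ k, Measurable fun v => ind (b (u k) v) := fun k =>
    h.measurable_ind measurable_const measurable_id
  have bD : ∀ i v, |(isoCnt b K u : ℝ) - isoCnt b K (Function.update u i v)| ≤ n + n :=
    fun i v => by
      have hc : ∀ w : Fin n → X, |(isoCnt b K w : ℝ)| ≤ n := fun w => by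
        rw [Nat.abs_cast]
        exact_mod_cast (cnt_le_card (I := K)).trans (by simp [hK])
      exact (abs_sub _ _).trans (add_le_add (hc _) (hc _))
  have iD : ∀ k i, Integrable (fun v => ind (b (u k) v) * (ind (¬b (u k) (u i)) *
      ((isoCnt b K u : ℝ) - isoCnt b K (Function.update u i v)))) ν := fun k i =>
    integrable_of_abs_le (C := 1 * (1 * (n + n))) ((mb k).mul ((mD i).const_mul _)) fun v => by
      rw [abs_mul, abs_mul]
      gcongr
      · exact abs_ind_le_one
      · exact abs_ind_le_one
      · exact bD i v
  have key : ∀ k, ∑ i ∈ K.erase k, ∫ v, moveWeight (fun k : Fin n => Finset.univ.erase k)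
      (fun k u x => b (u k) x) m p u i k v *
      ((n - isoCnt b K (Function.update u i v)) - (n - isoCnt b K u)) ∂ν =
      moveProb m p (deg b K u k) / (m * p) * ∫ v, ind (b (u k) v) * D k v ∂ν := fun k => by
    have e : ∀ v, ind (b (u k) v) * D k v = ∑ i ∈ K.erase k, ind (b (u k) v) *
        (ind (¬b (u k) (u i)) * ((isoCnt b K u : ℝ) - isoCnt b K (Function.update u i v))) :=
      fun v => by rw [hD, Finset.mul_sum]
    simp_rw [e]
    rw [integral_finsetSum _ fun i _ => iD k i, Finset.mul_sum]
    refine Finset.sum_congr rfl fun i _ => ?_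
    rw [← integral_const_mul]
    congr 1 with v
    simp only [moveWeight, deg, hK]
    ring
  have eA : meanMove (fun k : Fin n => Finset.univ.erase k) (fun k u x => b (u k) x) m p ν
      (unifFin n) (fun u => n - isoCnt b Finset.univ u) u =
      (n : ℝ)⁻¹ * ∑ k, moveProb m p (deg b K u k) / (m * p) * ∫ v, ind (b (u k) v) * D k v ∂ν := by
    unfold meanMove
    rw [integral_unifFin]
    exact congrArg _ (Finset.sum_congr rfl fun k _ => key k)
  have iG : ∀ k, Integrable (fun v => ind (b (u k) v) * (n * isoNear b K u v + bal)) ν := fun k => by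
    have e : ∀ v, ind (b (u k) v) * (n * isoNear b K u v + bal) =
        n * (ind (b (u k) v) * isoNear b K u v) + ind (b (u k) v) * bal := fun v => by ring
    simp_rw [e]
    exact ((h.integrable_ind_mul_isoNear hP K u _).const_mul _).add ((h.integrable_ind _).mul_const _)
  have eB : isoMove ν b m p K u = (n : ℝ)⁻¹ * ∑ k, moveProb m p (deg b K u k) / (m * p) *
      ∫ v, ind (b (u k) v) * (n * isoNear b K u v + bal) ∂ν := by
    unfold isoMove
    rw [mul_inv, mul_assoc, ← hbal, Finset.mul_sum (a := bal), ← Finset.sum_add_distrib,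
      Finset.mul_sum (a := (m : ℝ)⁻¹)]
    congr 1
    refine Finset.sum_congr rfl fun k _ => ?_
    have e : ∀ v, ind (b (u k) v) * (n * isoNear b K u v + bal) =
        n * (ind (b (u k) v) * isoNear b K u v) + ind (b (u k) v) * bal := fun v => by ring
    simp_rw [e]
    rw [integral_add ((h.integrable_ind_mul_isoNear hP K u _).const_mul _)
      ((h.integrable_ind _).mul_const _), integral_const_mul, integral_mul_const, h.integral_ind,
      isoGain]
    field_simp
  have iDD : ∀ k, Integrable (fun v => ind (b (u k) v) * D k v) ν := fun k => by
    have e : ∀ v, ind (b (u k) v) * D k v = ∑ i ∈ K.erase k, ind (b (u k) v) *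
        (ind (¬b (u k) (u i)) * ((isoCnt b K u : ℝ) - isoCnt b K (Function.update u i v))) :=
      fun v => by rw [hD, Finset.mul_sum]
    simp_rw [e]
    exact integrable_finsetSum _ fun i _ => iD k i
  rw [eA, eB, ← mul_sub, ← Finset.sum_sub_distrib, abs_mul, abs_of_pos (inv_pos.2 hn'), mul_inv,
    mul_assoc, Finset.mul_sum (a := (m : ℝ)⁻¹)]
  refine mul_le_mul_of_nonneg_left ((Finset.abs_sum_le_sum_abs _ _).trans
    (Finset.sum_le_sum fun k _ => ?_)) (inv_nonneg.2 hn'.le)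
  rw [← mul_sub, ← integral_sub (iDD k) (iG k), abs_mul, abs_of_nonneg (div_nonneg
    (moveProb_nonneg hm hp0 hp1 _) (by positivity))]
  have hint : |∫ v, (ind (b (u k) v) * D k v - ind (b (u k) v) * (n * isoNear b K u v + bal)) ∂ν| ≤
      p * ((2 * κ + 2) * (1 + deg b' K u k)) := by
    rw [← h.integral_ind (u k), ← integral_mul_const]
    refine abs_integral_le_integral_abs.trans (integral_mono ((iDD k).sub (iG k)).abs
      ((h.integrable_ind _).mul_const _) fun v => ?_)
    simp only
    rw [← mul_sub, abs_mul, abs_of_nonneg ind_nonneg]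
    by_cases hv : b (u k) v
    · rw [ind_of hv]
      have := abs_sum_isoCnt_sub_update_le (b' := b') hP h.refl h.symm h3 (Finset.mem_univ k) hv
      rw [Finset.card_univ, Fintype.card_fin] at this
      exact mul_le_mul_of_nonneg_left this zero_le_one
    · rw [ind_of_not hv]
      simp
  calc _ ≤ 1 / (m * p) * (p * ((2 * κ + 2) * (1 + deg b' K u k))) := by
        gcongr
        exact moveProb_le_one hm hp0 hp1 _
    _ = _ := by field_simp

/-! ### Moments of the degree of a point -/

section Degree

variable (h : BallRel ν b p)
include h

/-- Resampling the `i`-th point, which `F` does not see, makes the indicator independent of `F` with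
mean `p`. -/
theorem BallRel.integral_ind_coord {i j : Fin n} (hij : i ≠ j) {F : (Fin n → X) → ℝ} {C : ℝ}
    (hF : Measurable F) (hFC : ∀ u, |F u| ≤ C) (hFi : ∀ u v, F (Function.update u i v) = F u) :
    ∫ u, ind (b (u j) (u i)) * F u ∂(iidLaw ν n) = p * ∫ u, F u ∂(iidLaw ν n) := by
  rw [← integral_resample ν i (F := fun u => ind (b (u j) (u i)) * F u) (C := 1 * C)
    ((h.measurable_ind (measurable_pi_apply j) (measurable_pi_apply i)).mul hF) fun u => by
      rw [abs_mul]
      exact mul_le_mul abs_ind_le_one (hFC u) (abs_nonneg _) zero_le_one]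
  simp only [Function.update_self, Function.update_of_ne hij.symm, hFi]
  simp_rw [integral_mul_const, h.integral_ind]
  rw [integral_const_mul]

theorem BallRel.integral_deg (hnm : n = m + 1) (j : Fin n) :
    ∫ u, (deg b Finset.univ u j : ℝ) ∂(iidLaw ν n) = m * p := by
  unfold deg
  simp_rw [cnt_eq_sum]
  rw [integral_finsetSum _ fun i _ => integrable_of_abs_le
    (h.measurable_ind (measurable_pi_apply j) (measurable_pi_apply i)) fun _ => abs_ind_le_one]
  have e : ∀ i ∈ Finset.univ.erase j, ∫ u, ind (b (u j) (u i)) ∂(iidLaw ν n) = p := fun i hi => by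
    have := h.integral_ind_coord (n := n) (Finset.ne_of_mem_erase hi) (F := fun _ => 1) (C := 1)
      measurable_const (by simp) fun _ _ => rfl
    simpa using this
  rw [Finset.sum_congr rfl e, Finset.sum_const, Finset.card_erase_of_mem (Finset.mem_univ j)]
  simp [hnm]

/-- One factor of the square is expanded into indicators. On the event of the `i`-th indicator the
degree is 1 plus the degree without `i`, and the latter is independent of the `i`-th point; its mean
is bounded by that of the full degree. -/
theorem BallRel.integral_deg_sq_le (hnm : n = m + 1) (j : Fin n) :
    ∫ u, (deg b Finset.univ u j : ℝ) ^ 2 ∂(iidLaw ν n) ≤ m * p + (m * p) ^ 2 := by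
  have mi : ∀ i : Fin n, Measurable fun u : Fin n → X => ind (b (u j) (u i)) := fun i =>
    h.measurable_ind (measurable_pi_apply j) (measurable_pi_apply i)
  have md : Measurable fun u : Fin n → X => (deg b Finset.univ u j : ℝ) :=
    measurable_natCast_comp (h.measurable_deg _ _)
  have bd : ∀ u : Fin n → X, |(deg b Finset.univ u j : ℝ)| ≤ n := fun u => by
    rw [Nat.abs_cast]
    exact_mod_cast deg_le_card.trans (by simp)
  have hp : 0 ≤ p := by
    obtain ⟨x⟩ := ν.nonempty_of_neZero
    rw [← h.measureReal x]
    exact measureReal_nonneg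
  have e : ∀ u : Fin n → X, (deg b Finset.univ u j : ℝ) ^ 2 =
      ∑ i ∈ Finset.univ.erase j, ind (b (u j) (u i)) * deg b Finset.univ u j := fun u => by
    rw [sq, ← Finset.sum_mul, ← cnt_eq_sum]
    rfl
  simp_rw [e]
  have hint : ∀ i, Integrable (fun u : Fin n → X => ind (b (u j) (u i)) * deg b Finset.univ u j)
      (iidLaw ν n) := fun i => integrable_of_abs_le (C := 1 * n) ((mi i).mul md) fun u => by
    rw [abs_mul]
    exact mul_le_mul abs_ind_le_one (bd u) (abs_nonneg _) zero_le_one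
  rw [integral_finsetSum _ fun i _ => hint i]
  have hi : ∀ i ∈ Finset.univ.erase j, ∫ u, ind (b (u j) (u i)) * deg b Finset.univ u j
      ∂(iidLaw ν n) ≤ p + p * (m * p) := fun i hi => by
    have hij := Finset.ne_of_mem_erase hi
    have mR : Measurable fun u : Fin n → X => (deg b (Finset.univ.erase i) u j : ℝ) :=
      measurable_natCast_comp (h.measurable_deg _ _)
    have bR : ∀ u : Fin n → X, |(deg b (Finset.univ.erase i) u j : ℝ)| ≤ n := fun u => by
      rw [Nat.abs_cast]
      exact_mod_cast deg_le_card.trans ((Finset.card_le_univ _).trans (by simp))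
    have e2 : ∀ u : Fin n → X, ind (b (u j) (u i)) * deg b Finset.univ u j =
        ind (b (u j) (u i)) * (1 + deg b (Finset.univ.erase i) u j) := fun u => by
      rw [deg_eq_erase (Finset.mem_univ i) hij.symm]
      by_cases hb : b (u j) (u i)
      · rw [ind_of hb]
      · rw [ind_of_not hb]
        ring
    simp_rw [e2]
    rw [h.integral_ind_coord hij (F := fun u => 1 + (deg b (Finset.univ.erase i) u j : ℝ))
      (C := 1 + n) (measurable_const.add mR) (fun u => (abs_add_le _ _).trans
        (add_le_add (by simp) (bR u))) fun u v => by rw [deg_update_of_ne hij.symm]]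
    have iR : Integrable (fun u : Fin n → X => (deg b (Finset.univ.erase i) u j : ℝ)) (iidLaw ν n) :=
      integrable_of_abs_le mR bR
    rw [integral_add (integrable_const _) iR]
    have hle : ∫ u, (deg b (Finset.univ.erase i) u j : ℝ) ∂(iidLaw ν n) ≤ m * p := by
      rw [← h.integral_deg hnm j]
      refine integral_mono iR (integrable_of_abs_le md bd) fun u => ?_
      rw [deg_eq_erase (Finset.mem_univ i) hij.symm]
      exact le_add_of_nonneg_left ind_nonneg
    simp only [integral_const, probReal_univ, smul_eq_mul, mul_one]
    nlinarith
  refine (Finset.sum_le_sum hi).trans_eq ?_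
  rw [Finset.sum_const, Finset.card_erase_of_mem (Finset.mem_univ j)]
  simp [hnm]
  ring

end Degree

/-- Normal approximation of the number of points with a neighbour. -/
theorem BallRel.kolmogorovDist_isoCnt_le (h : BallRel ν b p) (h' : BallRel ν b' p')
    (hP : Packing b n κ) (hnm : n = m + 1) (hm : 1 ≤ m) (hp0 : 0 < p) (hp1 : p < 1)
    (h3 : ∀ {x y z w}, b x y → b y z → b z w → b' x w)
    (hσ : 0 < variance (fun u : Fin n → X => (n : ℝ) - isoCnt b Finset.univ u) (iidLaw ν n)) :
    kolmogorovDist (iidLaw ν n) (fun u : Fin n → X => (n : ℝ) - isoCnt b Finset.univ u) ≤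
      n * (1 - (1 - p) ^ m) /
        (5 * variance (fun u : Fin n → X => (n : ℝ) - isoCnt b Finset.univ u) (iidLaw ν n)) *
      (√(11 * (κ + 1) ^ 2 /
        √(variance (fun u : Fin n → X => (n : ℝ) - isoCnt b Finset.univ u) (iidLaw ν n)) +
        5 * (√(n * (((κ + 2) ^ 2 + 2 * (κ + 2) * (κ + 3) * (m * p') +
          (κ + 3) ^ 2 * (m * p' + (m * p') ^ 2)) / m ^ 2)) +
          2 * ((2 * κ + 2) * (1 + m * p') / m))) +
        2 * (κ + 1) /
        √(√(variance (fun u : Fin n → X => (n : ℝ) - isoCnt b Finset.univ u) (iidLaw ν n)))) ^ 2 := by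
  have hn : 1 ≤ n := by omega
  have hn' : (0 : ℝ) < n := by exact_mod_cast hn
  have hm' : (0 : ℝ) < m := by exact_mod_cast hm
  have := isProbabilityMeasure_unifFin hn
  have hA : MeasurableSet {q : Fin n × (Fin n → X) × X | b (q.2.1 q.1) q.2.2} := by
    have : Measurable fun q : Fin n × (Fin n → X) × X => (q.2.1 q.1, q.2.2) :=
      measurable_from_prod_countable_right fun k =>
        ((measurable_pi_apply k).comp measurable_fst).prodMk measurable_snd
    exact this h.measurableSet
  have hI : ∀ k : Fin n, (Finset.univ.erase k).card = m := fun k => by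
    rw [Finset.card_erase_of_mem (Finset.mem_univ k)]
    simp [hnm]
  have hAI : ∀ k : Fin n, ∀ i ∈ Finset.univ.erase k, ∀ (u : Fin n → X) (v x : X),
      b (Function.update u i v k) x ↔ b (u k) x := fun k i hi u v x => by
    rw [Function.update_of_ne (Finset.ne_of_mem_erase hi).symm]
  refine kolmogorovDist_le_of_coverage (α := unifFin n) (I := fun k => Finset.univ.erase k)
    (A := fun k u x => b (u k) x) hn hm hI (fun i => MeasurableSet.of_discrete)
    hA hAI hp0 hp1 (fun k u => h.measureReal (u k)) hn'
    (fun u => ?_) (by positivity) (fun k i hi u v _ hv => ?_) hσ ?_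
  · rw [integral_unifFin, mul_inv_cancel_left₀ hn'.ne']
    have := sum_ind_one_le_deg (b := b) (K := Finset.univ) (u := u)
    rw [Finset.card_univ, Fintype.card_fin] at this
    exact this.symm
  · rw [sub_sub_sub_cancel_left]
    exact abs_isoCnt_sub_update_le hP (Finset.mem_univ i) (Finset.mem_univ k)
      (Finset.ne_of_mem_erase hi).symm (h.symm hv)
  set Y : (Fin n → X) → ℝ := fun u => (n : ℝ) - isoCnt b Finset.univ u with hY
  set T := meanMove (fun k : Fin n => Finset.univ.erase k) (fun k u x => b (u k) x) m p ν
    (unifFin n) Y with hT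
  have hYm : Measurable Y := measurable_const.sub (measurable_natCast_comp (h.measurable_isoCnt _))
  have mw : ∀ i, Measurable fun q : (Fin n → X) × Fin n × X =>
      moveWeight (fun k : Fin n => Finset.univ.erase k) (fun k u x => b (u k) x) m p q.1 i
        q.2.1 q.2.2 := fun i =>
    measurable_moveWeight (I := fun k : Fin n => Finset.univ.erase k)
      (A := fun k u x => b (u k) x) (m := m) (p := p) (fun i => MeasurableSet.of_discrete) hA i
  have hTm : Measurable T := by
    have e : T = fun u => (n : ℝ)⁻¹ * ∑ k, ∑ i ∈ Finset.univ.erase k, ∫ v, moveWeight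
        (fun k : Fin n => Finset.univ.erase k) (fun k u x => b (u k) x) m p u i k v *
        (Y (Function.update u i v) - Y u) ∂ν := funext fun u => by
      rw [hT, meanMove, integral_unifFin]
    rw [e]
    refine (Finset.measurable_sum _ fun k _ => Finset.measurable_sum _ fun i _ => ?_).const_mul _
    refine measurable_integral_right (f := fun (u : Fin n → X) v => moveWeight
        (fun k : Fin n => Finset.univ.erase k) (fun k u x => b (u k) x) m p u i k v *
        (Y (Function.update u i v) - Y u)) ?_
    have r : Measurable fun q : (Fin n → X) × X => (q.1, k, q.2) :=
      measurable_fst.prodMk (measurable_const.prodMk measurable_snd)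
    exact ((mw i).comp r).mul ((hYm.comp (measurable_update_pair i)).sub (hYm.comp measurable_fst))
  have hgb := fun u : Fin n → X => h.abs_isoMove_le hP hm hp0 hp1 Finset.univ u
  have hd := fun u : Fin n → X => h.abs_meanMove_sub_isoMove_le hP hn hm hp0 hp1 h3 u
  set ε : (Fin n → X) → ℝ := fun u =>
    (n * m : ℝ)⁻¹ * ∑ k, (2 * κ + 2 : ℝ) * (1 + deg b' Finset.univ u k) with hε
  have bdeg : ∀ (u : Fin n → X) k, |(deg b' Finset.univ u k : ℝ)| ≤ n := fun u k => by
    rw [Nat.abs_cast]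
    exact_mod_cast deg_le_card.trans (by simp)
  have mdeg : ∀ k, Measurable fun u : Fin n → X => (deg b' Finset.univ u k : ℝ) := fun k =>
    measurable_natCast_comp (h'.measurable_deg _ _)
  have ideg : ∀ k, Integrable (fun u : Fin n → X => (deg b' Finset.univ u k : ℝ)) (iidLaw ν n) :=
    fun k => integrable_of_abs_le (mdeg k) fun u => bdeg u k
  have hεb : ∀ u, ε u ≤ (n * m : ℝ)⁻¹ * ∑ k : Fin n, (2 * κ + 2 : ℝ) * (1 + n) := fun u => by
    simp only [hε]
    gcongr with k
    exact deg_le_card.trans (by simp)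
  have hεi : ∀ k : Fin n, Integrable (fun u : Fin n → X =>
      (2 * κ + 2) * (1 + (deg b' Finset.univ u k : ℝ))) (iidLaw ν n) := fun k =>
    ((integrable_const _).add (ideg k)).const_mul _
  have hεint : ∫ u, ε u ∂(iidLaw ν n) = (2 * κ + 2) * (1 + m * p') / m := by
    simp only [hε]
    rw [integral_const_mul, integral_finsetSum _ fun k _ => hεi k]
    have e : ∀ k : Fin n, ∫ u, (2 * κ + 2) * (1 + (deg b' Finset.univ u k : ℝ)) ∂(iidLaw ν n) =
        (2 * κ + 2) * (1 + m * p') := fun k => by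
      rw [integral_const_mul, integral_add (integrable_const _) (ideg k), h'.integral_deg hnm]
      simp
    simp_rw [e]
    rw [Finset.sum_const, Finset.card_univ, Fintype.card_fin, nsmul_eq_mul]
    field_simp
  set CT : ℝ := (n * m : ℝ)⁻¹ * ∑ k : Fin n, (2 * κ + 2 : ℝ) * (1 + n) +
    (n * m : ℝ)⁻¹ * (n * (n * κ) + n * n) with hCT
  have hC0 : 0 ≤ (n * m : ℝ)⁻¹ * ∑ k : Fin n, (2 * κ + 2 : ℝ) * (1 + n) := by positivity
  have hTb : ∀ u, |T u| ≤ CT := fun u => by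
    have := abs_sub_abs_le_abs_sub (T u) (isoMove ν b m p Finset.univ u)
    linarith [hd u, hgb u, hεb u]
  refine (integral_abs_sub_mean_le hTm (h.measurable_isoMove Finset.univ) hTb fun u =>
    (hgb u).trans (by linarith)).trans (add_le_add ?_ ?_)
  · refine Real.sqrt_le_sqrt ?_
    calc _ ≤ ∑ j, ∫ u, (isoMove ν b m p Finset.univ u - isoMove ν b m p (Finset.univ.erase j) u) ^ 2
          ∂(iidLaw ν n) := by
          refine variance_le_sum_integral_sq ν (C := (n * m : ℝ)⁻¹ * (n * (n * κ) + n * n))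
            (h.measurable_isoMove _) (fun j => h.measurable_isoMove _) hgb
            (fun j u => h.abs_isoMove_le hP hm hp0 hp1 _ u) fun j u v => ?_
          have e1 : ∀ k ∈ Finset.univ.erase j, deg b (Finset.univ.erase j) (Function.update u j v) k =
              deg b (Finset.univ.erase j) u k := fun k hk =>
            deg_update_of_ne (Finset.ne_of_mem_erase hk)
          have e2 : ∀ k ∈ Finset.univ.erase j,
              isoGain ν b p (Finset.univ.erase j) (Function.update u j v) k =
              isoGain ν b p (Finset.univ.erase j) u k := fun k hk => by
            unfold isoGain
            simp_rw [isoNear_update, Function.update_of_ne (Finset.ne_of_mem_erase hk)]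
          have e3 : ∀ f : ℕ → ℝ, ∑ k ∈ Finset.univ.erase j,
              f (deg b (Finset.univ.erase j) (Function.update u j v) k) =
              ∑ k ∈ Finset.univ.erase j, f (deg b (Finset.univ.erase j) u k) := fun f =>
            Finset.sum_congr rfl fun k hk => congrArg f (e1 k hk)
          have e4 : ∑ k ∈ Finset.univ.erase j,
              moveProb m p (deg b (Finset.univ.erase j) (Function.update u j v) k) *
                isoGain ν b p (Finset.univ.erase j) (Function.update u j v) k =
              ∑ k ∈ Finset.univ.erase j, moveProb m p (deg b (Finset.univ.erase j) u k) *
                isoGain ν b p (Finset.univ.erase j) u k :=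
            Finset.sum_congr rfl fun k hk => congrArg₂ _ (congrArg _ (e1 k hk)) (e2 k hk)
          rw [isoMove, isoMove, e4, e3 balance, e3 (moveProb m p)]
      _ ≤ ∑ j : Fin n, ((κ + 2) ^ 2 + 2 * (κ + 2) * (κ + 3) * (m * p') +
          (κ + 3) ^ 2 * (m * p' + (m * p') ^ 2)) / m ^ 2 := by
          refine Finset.sum_le_sum fun j _ => ?_
          have hle : ∀ u : Fin n → X, (isoMove ν b m p Finset.univ u -
              isoMove ν b m p (Finset.univ.erase j) u) ^ 2 ≤
              ((κ + 2) ^ 2 + 2 * (κ + 2) * (κ + 3) * deg b' Finset.univ u j +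
                (κ + 3) ^ 2 * (deg b' Finset.univ u j : ℝ) ^ 2) / m ^ 2 := fun u => by
            rw [← sq_abs]
            refine (pow_le_pow_left₀ (abs_nonneg _)
              (h.abs_isoMove_sub_le hP hn hm hp0 hp1 h3 u j) 2).trans_eq ?_
            field_simp
            ring
          have isq : Integrable (fun u : Fin n → X => (deg b' Finset.univ u j : ℝ) ^ 2)
              (iidLaw ν n) := integrable_of_abs_le (C := (n : ℝ) ^ 2) ((mdeg j).pow_const 2)
            fun u => by
              rw [abs_pow]
              exact pow_le_pow_left₀ (abs_nonneg _) (bdeg u j) 2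
          have i1 : Integrable (fun u : Fin n → X => (κ + 2 : ℝ) ^ 2 +
              2 * (κ + 2) * (κ + 3) * deg b' Finset.univ u j) (iidLaw ν n) :=
            (integrable_const _).add ((ideg j).const_mul _)
          have i2 : Integrable (fun u : Fin n → X => (κ + 2 : ℝ) ^ 2 +
              2 * (κ + 2) * (κ + 3) * deg b' Finset.univ u j +
                (κ + 3) ^ 2 * (deg b' Finset.univ u j : ℝ) ^ 2) (iidLaw ν n) :=
            i1.add (isq.const_mul _)
          refine (integral_mono_of_nonneg (Eventually.of_forall fun _ => sq_nonneg _)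
            (i2.div_const _) (Eventually.of_forall hle)).trans ?_
          rw [integral_div, integral_add i1 (isq.const_mul _), integral_add (integrable_const _)
            ((ideg j).const_mul _), integral_const_mul, integral_const_mul, h'.integral_deg hnm]
          have := h'.integral_deg_sq_le hnm j
          simp only [integral_const, probReal_univ, smul_eq_mul, one_mul]
          gcongr
      _ = _ := by simp
  · rw [← hεint]
    refine mul_le_mul_of_nonneg_left (integral_mono_of_nonneg
      (Eventually.of_forall fun _ => abs_nonneg _) ((integrable_finsetSum _ fun k _ =>
        hεi k).const_mul _) (Eventually.of_forall hd)) zero_le_two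

end Isolated

end BinomialCoverage
end

noncomputable section
set_option linter.unusedSectionVars false

namespace BinomialCoverage

/-! ### First and second moments -/

section Moments

variable {X : Type*} [MeasurableSpace X] {n m : ℕ} {ν : Measure X} [IsProbabilityMeasure ν]
  {b : X → X → Prop} {p : ℝ}

/-- The points indexed by `s` are integrated out one at a time. Neither `F` nor `g` depends on them,
so each contributes the same factor given the rest of the configuration. -/
theorem integral_mul_prod {s : Finset (Fin n)} {F : (Fin n → X) → ℝ} {g : (Fin n → X) → X → ℝ}
    {C : ℝ} (hF : Measurable F) (hFC : ∀ u, |F u| ≤ C) (hg : Measurable (Function.uncurry g))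
    (hg1 : ∀ u v, |g u v| ≤ 1) (hFs : ∀ i ∈ s, ∀ u v, F (Function.update u i v) = F u)
    (hgs : ∀ i ∈ s, ∀ u v, g (Function.update u i v) = g u) :
    ∫ u, F u * ∏ i ∈ s, g u (u i) ∂(iidLaw ν n) =
      ∫ u, F u * (∫ v, g u v ∂ν) ^ s.card ∂(iidLaw ν n) := by
  induction s using Finset.induction_on generalizing F with
  | empty => simp
  | insert i s hi ih =>
    have mgi : Measurable fun u : Fin n → X => g u (u i) :=
      hg.comp (measurable_id.prodMk (measurable_pi_apply i))
    have mint : Measurable fun u => ∫ v, g u v ∂ν := measurable_integral_right hg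
    have bint : ∀ u, |∫ v, g u v ∂ν| ≤ 1 := fun u => abs_integral_le_of_abs_le (hg1 u)
    have e1 : ∀ u : Fin n → X, F u * ∏ k ∈ insert i s, g u (u k) =
        F u * g u (u i) * ∏ k ∈ s, g u (u k) := fun u => by
      rw [Finset.prod_insert hi]
      ring
    simp_rw [e1]
    rw [ih (F := fun u => F u * g u (u i)) (hF.mul mgi)
      (fun u => by
        rw [abs_mul]
        exact (mul_le_of_le_one_right (abs_nonneg _) (hg1 _ _)).trans (hFC u))
      (fun k hk u v => by
        have hik : i ≠ k := fun hik => hi (hik ▸ hk)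
        rw [hFs k (Finset.mem_insert_of_mem hk), hgs k (Finset.mem_insert_of_mem hk),
          Function.update_of_ne hik])
      (fun k hk => hgs k (Finset.mem_insert_of_mem hk)),
      ← integral_resample ν i (F := fun u => F u * g u (u i) * (∫ v, g u v ∂ν) ^ s.card)
        (C := C * 1 * 1) ((hF.mul mgi).mul (mint.pow_const _)) fun u => by
          rw [abs_mul, abs_mul, abs_pow]
          have hC : 0 ≤ C := (abs_nonneg _).trans (hFC u)
          exact mul_le_mul (mul_le_mul (hFC u) (hg1 _ _) (abs_nonneg _) hC)
            (pow_le_one₀ (abs_nonneg _) (bint u)) (by positivity) (by positivity)]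
    have hF' := hFs i (Finset.mem_insert_self i s)
    have hg' := hgs i (Finset.mem_insert_self i s)
    simp only [hF', hg', Function.update_self, Finset.card_insert_of_notMem hi]
    congr 1 with u
    rw [integral_mul_const, integral_const_mul, pow_succ]
    ring

/-- Probability that a point avoids the balls about `x` and `y`. -/
def void2 (ν : Measure X) (b : X → X → Prop) (x y : X) : ℝ := ν.real {z | ¬b x z ∧ ¬b y z}

theorem BallRel.measurable_avoid (h : BallRel ν b p) :
    Measurable fun q : (X × X) × X => ind (¬b q.1.1 q.2 ∧ ¬b q.1.2 q.2) :=
  BinomialCoverage.measurable_ind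
    ((((measurable_fst.comp measurable_fst).prodMk measurable_snd :
        Measurable fun q : (X × X) × X => (q.1.1, q.2)) h.measurableSet).compl.inter
      (((measurable_snd.comp measurable_fst).prodMk measurable_snd :
        Measurable fun q : (X × X) × X => (q.1.2, q.2)) h.measurableSet).compl)

theorem BallRel.integral_avoid (h : BallRel ν b p) (x y : X) :
    ∫ z, ind (¬b x z ∧ ¬b y z) ∂ν = void2 ν b x y :=
  BinomialCoverage.integral_ind
    (((measurable_const.prodMk measurable_id : Measurable fun z => (x, z)) h.measurableSet).compl.inter
      ((measurable_const.prodMk measurable_id : Measurable fun z => (y, z)) h.measurableSet).compl)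

theorem BallRel.measurable_void2 (h : BallRel ν b p) :
    Measurable fun q : X × X => void2 ν b q.1 q.2 := by
  simp_rw [← h.integral_avoid]
  exact measurable_integral_right (f := fun (q : X × X) z => ind (¬b q.1 z ∧ ¬b q.2 z))
    h.measurable_avoid

theorem void2_nonneg (x y : X) : 0 ≤ void2 ν b x y := measureReal_nonneg

theorem void2_le_one (x y : X) : void2 ν b x y ≤ 1 := measureReal_le_one

theorem abs_void2_pow_le (x y : X) (k : ℕ) : |void2 ν b x y ^ k| ≤ 1 := by
  rw [abs_pow, abs_of_nonneg (void2_nonneg x y)]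
  exact pow_le_one₀ (void2_nonneg x y) (void2_le_one x y)

theorem BallRel.void2_eq (h : BallRel ν b p) (x y : X) :
    void2 ν b x y = 1 - 2 * p + ν.real {z | b x z ∧ b y z} := by
  have mx : MeasurableSet {z | b x z} :=
    (measurable_const.prodMk measurable_id : Measurable fun z => (x, z)) h.measurableSet
  have my : MeasurableSet {z | b y z} :=
    (measurable_const.prodMk measurable_id : Measurable fun z => (y, z)) h.measurableSet
  have e : {z | ¬b x z ∧ ¬b y z} = ({z | b x z} ∪ {z | b y z})ᶜ := by
    ext z
    simp
  have := measureReal_union_add_inter (μ := ν) (s := {z | b x z}) my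
  rw [h.measureReal, h.measureReal] at this
  rw [void2, e, probReal_compl_eq_one_sub (mx.union my)]
  change _ = 1 - 2 * p + ν.real ({z | b x z} ∩ {z | b y z})
  linarith

theorem BallRel.integral_coverVol (h : BallRel ν b p) (hn : 1 ≤ n) (hp0 : 0 < p) (hp1 : p < 1) :
    ∫ u, coverVol ν b u ∂(iidLaw ν n) = n * (1 - (1 - p) ^ n) := by
  have := integral_coverage_mul (α := ν) (I := fun _ => Finset.univ) (c := n)
    (A := fun a _ x => b a x) (Y := fun u : Fin n → X => coverVol ν b u) hn (fun _ => by simp)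
    (fun _ => by simp) h.measurableSet_cover
    (fun _ _ _ _ _ _ => Iff.rfl) hp0 hp1 (fun a _ => h.measureReal a) (fun _ => rfl)
    (F := fun _ => 1) (C := 1) measurable_const (by simp)
  simpa using this

/-- The variance is that of the uncovered volume, whose second moment is the probability that two
uniform places are both uncovered; given the two places, all `n` points must avoid both balls. -/
theorem BallRel.variance_coverVol (h : BallRel ν b p) (hn : 1 ≤ n) (hp0 : 0 < p) (hp1 : p < 1) :
    variance (fun u : Fin n → X => coverVol ν b u) (iidLaw ν n) =
      n ^ 2 * (∫ x, ∫ y, void2 ν b x y ^ n ∂ν ∂ν - (1 - p) ^ (2 * n)) := by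
  set W : (Fin n → X) → ℝ := fun u => ∫ x, ind (∀ i, ¬b x (u i)) ∂ν with hW
  have mset : MeasurableSet {q : (Fin n → X) × X | ∀ i, ¬b q.2 (q.1 i)} := by
    rw [Set.ofPred_forall]
    exact MeasurableSet.iInter fun i =>
      ((measurable_snd.prodMk ((measurable_pi_apply i).comp measurable_fst) :
        Measurable fun q : (Fin n → X) × X => (q.2, q.1 i)) h.measurableSet).compl
  have mu : ∀ u : Fin n → X, Measurable fun x => ind (∀ i, ¬b x (u i)) := fun u =>
    (BinomialCoverage.measurable_ind mset).comp
      (measurable_const.prodMk measurable_id : Measurable fun x : X => (u, x))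
  have mW : Measurable W := measurable_integral_right
    (f := fun (u : Fin n → X) x => ind (∀ i, ¬b x (u i))) (BinomialCoverage.measurable_ind mset)
  have bW : ∀ u, |W u| ≤ 1 := fun u => abs_integral_le_of_abs_le fun _ => abs_ind_le_one
  have e1 : ∀ u : Fin n → X, coverVol ν b u = n - n * W u := fun u => by
    have e : ∀ x, ind (1 ≤ cnt Finset.univ fun i => b x (u i)) = 1 - ind (∀ i, ¬b x (u i)) :=
      fun x => by
        rw [← ind_not]
        refine ind_congr ?_
        rw [cnt_pos]
        push Not
        simp
    rw [coverVol]
    simp_rw [e]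
    rw [integral_sub (integrable_const _) (integrable_of_abs_le (mu u) fun _ => abs_ind_le_one)]
    simp [hW]
    ring
  have mean := h.integral_coverVol hn hp0 hp1
  simp_rw [e1] at mean ⊢
  have iW : Integrable W (iidLaw ν n) := integrable_of_abs_le mW bW
  have hn' : (n : ℝ) ≠ 0 := by
    have : 0 < n := hn
    positivity
  rw [integral_sub (integrable_const _) (iW.const_mul _), integral_const_mul] at mean
  have meanW : ∫ u, W u ∂(iidLaw ν n) = (1 - p) ^ n := by
    simp only [integral_const, probReal_univ, smul_eq_mul, one_mul] at mean
    have : (n : ℝ) * ∫ u, W u ∂(iidLaw ν n) = n * (1 - p) ^ n := by linarith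
    exact mul_left_cancel₀ hn' this
  rw [variance_const_sub (by exact (mW.const_mul _).aestronglyMeasurable), variance_const_mul,
    variance_eq_sub ((memLp_two_iff_integrable_sq mW.aestronglyMeasurable).2
      (integrable_of_abs_le (C := 1) (mW.pow_const 2) fun u => by
        rw [abs_pow]
        exact pow_le_one₀ (abs_nonneg _) (bW u))), meanW]
  congr 2
  · have e2 : ∀ u, (W ^ 2) u = ∫ q, ind (∀ i, ¬b q.1 (u i) ∧ ¬b q.2 (u i)) ∂(ν.prod ν) := fun u => by
      rw [Pi.pow_apply, sq]
      simp only [hW]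
      rw [← integral_prod_mul]
      congr 1 with q
      rw [← ind_and]
      exact ind_congr forall_and.symm
    simp_rw [e2]
    have ms2 : MeasurableSet {q : (Fin n → X) × X × X |
        ∀ i, ¬b q.2.1 (q.1 i) ∧ ¬b q.2.2 (q.1 i)} := by
      rw [Set.ofPred_forall]
      exact MeasurableSet.iInter fun i => MeasurableSet.inter
        (((measurable_fst.comp measurable_snd).prodMk ((measurable_pi_apply i).comp measurable_fst) :
          Measurable fun q : (Fin n → X) × X × X => (q.2.1, q.1 i)) h.measurableSet).compl
        (((measurable_snd.comp measurable_snd).prodMk ((measurable_pi_apply i).comp measurable_fst) :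
          Measurable fun q : (Fin n → X) × X × X => (q.2.2, q.1 i)) h.measurableSet).compl
    rw [integral_integral_swap (f := fun (u : Fin n → X) (q : X × X) => ind (∀ i, ¬b q.1 (u i) ∧ ¬b q.2 (u i)))
      (integrable_of_abs_le (C := 1) (BinomialCoverage.measurable_ind ms2) fun _ => abs_ind_le_one)]
    have e3 : ∀ q : X × X, ∫ u, ind (∀ i, ¬b q.1 (u i) ∧ ¬b q.2 (u i)) ∂(iidLaw ν n) =
        void2 ν b q.1 q.2 ^ n := fun q => by
      have := integral_mul_prod (ν := ν) (n := n) (s := Finset.univ) (F := fun _ => 1)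
        (g := fun _ z => ind (¬b q.1 z ∧ ¬b q.2 z)) (C := 1) measurable_const (by simp)
        ((h.measurable_avoid.comp (measurable_const.prodMk measurable_id :
          Measurable fun z : X => (q, z))).comp measurable_snd) (fun _ _ => abs_ind_le_one)
        (fun _ _ _ _ => rfl) fun _ _ _ _ => rfl
      simp only [one_mul, h.integral_avoid] at this
      simp only [integral_const, probReal_univ, smul_eq_mul, one_mul, Finset.card_univ,
        Fintype.card_fin] at this
      rw [← this]
      congr 1 with u
      by_cases hu : ∀ i, ¬b q.1 (u i) ∧ ¬b q.2 (u i)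
      · rw [ind_of hu, Finset.prod_eq_one fun i _ => ind_of (hu i)]
      · rw [ind_of_not hu]
        obtain ⟨i, hi⟩ := not_forall.1 hu
        exact (Finset.prod_eq_zero (Finset.mem_univ i) (ind_of_not hi)).symm
    simp_rw [e3]
    exact integral_prod (f := fun q : X × X => void2 ν b q.1 q.2 ^ n)
      (integrable_of_abs_le (h.measurable_void2.pow_const n) fun q => abs_void2_pow_le _ _ _)
  · rw [← pow_mul, mul_comm]

theorem BallRel.integral_isoCnt (h : BallRel ν b p) (hnm : n = m + 1) : ∫ u, (isoCnt b Finset.univ u : ℝ) ∂(iidLaw ν n) = n * (1 - p) ^ m := by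
  have mi : ∀ k : Fin n, Measurable fun u : Fin n → X => ind (deg b Finset.univ u k = 0) := fun k =>
    BinomialCoverage.measurable_ind ((h.measurable_deg _ k) (measurableSet_singleton 0))
  simp_rw [isoCnt, cnt_eq_sum]
  rw [integral_finsetSum _ fun k _ => integrable_of_abs_le (mi k) fun _ => abs_ind_le_one]
  have e : ∀ k : Fin n, ∫ u, ind (deg b Finset.univ u k = 0) ∂(iidLaw ν n) = (1 - p) ^ m := fun k => by
    have := integral_mul_prod (ν := ν) (n := n) (s := Finset.univ.erase k) (F := fun _ => 1)
      (g := fun u z => ind (¬b (u k) z)) (C := 1) measurable_const (by simp)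
      (BinomialCoverage.measurable_ind ((((measurable_pi_apply k).comp measurable_fst).prodMk
        measurable_snd : Measurable fun q : (Fin n → X) × X => (q.1 k, q.2)) h.measurableSet).compl)
      (fun _ _ => abs_ind_le_one) (fun _ _ _ _ => rfl)
      fun i hi u v => by rw [Function.update_of_ne (Finset.ne_of_mem_erase hi).symm]
    have e2 : ∀ x, ∫ z, ind (¬b x z) ∂ν = 1 - p := fun x => by
      simp_rw [ind_not]
      rw [integral_sub (integrable_const _) (h.integrable_ind x), h.integral_ind]
      simp
    simp only [one_mul, e2] at this
    simp only [integral_const, probReal_univ, smul_eq_mul, one_mul,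
      Finset.card_erase_of_mem (Finset.mem_univ k), Finset.card_univ, Fintype.card_fin] at this
    rw [show m = n - 1 by omega, ← this]
    congr 1 with u
    by_cases hu : deg b Finset.univ u k = 0
    · rw [ind_of hu, Finset.prod_eq_one fun i hi => ind_of (cnt_eq_zero.1 hu i hi)]
    · rw [ind_of_not hu]
      rw [deg, cnt_eq_zero] at hu
      push Not at hu
      obtain ⟨i, hi, hi'⟩ := hu
      exact (Finset.prod_eq_zero hi (ind_of_not (not_not.2 hi'))).symm
  simp_rw [e]
  simp

theorem integral_pair {k l : Fin n} (hkl : k ≠ l) {H : X → X → ℝ} {C : ℝ}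
    (hH : Measurable (Function.uncurry H)) (hC : ∀ x y, |H x y| ≤ C) :
    ∫ u, H (u k) (u l) ∂(iidLaw ν n) = ∫ x, ∫ y, H x y ∂ν ∂ν := by
  have m1 : Measurable fun u : Fin n → X => H (u k) (u l) :=
    hH.comp ((measurable_pi_apply k).prodMk (measurable_pi_apply l) :
      Measurable fun u : Fin n → X => (u k, u l))
  rw [← integral_resample ν l m1 fun u => hC _ _]
  simp only [Function.update_self, Function.update_of_ne hkl]
  have m2 : Measurable fun x => ∫ y, H x y ∂ν := measurable_integral_right hH
  rw [← integral_resample ν k (F := fun u => ∫ y, H (u k) y ∂ν) (m2.comp (measurable_pi_apply k))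
    fun u => abs_integral_le_of_abs_le (hC _)]
  simp

/-- Given the two points, both are isolated when they are unrelated and the other `m - 1` points
avoid both balls. -/
theorem BallRel.integral_ind_deg_mul (h : BallRel ν b p) (hnm : n = m + 1) {k l : Fin n}
    (hkl : k ≠ l) :
    ∫ u, ind (deg b Finset.univ u k = 0) * ind (deg b Finset.univ u l = 0) ∂(iidLaw ν n) =
      ∫ x, ∫ y, ind (¬b x y) * void2 ν b x y ^ (m - 1) ∂ν ∂ν := by
  have mn : Measurable fun q : X × X => ind (¬b q.1 q.2) :=
    BinomialCoverage.measurable_ind h.measurableSet.compl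
  have mkl : Measurable fun u : Fin n → X => (u k, u l) :=
    (measurable_pi_apply k).prodMk (measurable_pi_apply l)
  have mkl' : Measurable fun q : (Fin n → X) × X => ((q.1 k, q.1 l), q.2) :=
    (mkl.comp measurable_fst).prodMk measurable_snd
  have hne : ∀ i ∈ (Finset.univ.erase k).erase l, k ≠ i ∧ l ≠ i := fun i hi =>
    ⟨(Finset.ne_of_mem_erase (Finset.mem_of_mem_erase hi)).symm, (Finset.ne_of_mem_erase hi).symm⟩
  have := integral_mul_prod (ν := ν) (n := n) (s := (Finset.univ.erase k).erase l)
    (F := fun u => ind (¬b (u k) (u l))) (g := fun u z => ind (¬b (u k) z ∧ ¬b (u l) z)) (C := 1)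
    (mn.comp mkl) (fun _ => abs_ind_le_one) (h.measurable_avoid.comp mkl')
    (fun _ _ => abs_ind_le_one)
    (fun i hi u v => by rw [Function.update_of_ne (hne i hi).1, Function.update_of_ne (hne i hi).2])
    (fun i hi u v => by rw [Function.update_of_ne (hne i hi).1, Function.update_of_ne (hne i hi).2])
  simp only [h.integral_avoid] at this
  rw [Finset.card_erase_of_mem (Finset.mem_erase.2 ⟨hkl.symm, Finset.mem_univ l⟩),
    Finset.card_erase_of_mem (Finset.mem_univ k), Finset.card_univ, Fintype.card_fin,
    show n - 1 - 1 = m - 1 by omega] at this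
  rw [← integral_pair (ν := ν) hkl (H := fun x y => ind (¬b x y) * void2 ν b x y ^ (m - 1))
    (C := 1 * 1) (mn.mul (h.measurable_void2.pow_const _)) fun x y => by
      rw [abs_mul]
      exact mul_le_mul abs_ind_le_one (abs_void2_pow_le _ _ _) (abs_nonneg _) zero_le_one, ← this]
  congr 1 with u
  rw [← ind_and]
  by_cases hu : deg b Finset.univ u k = 0 ∧ deg b Finset.univ u l = 0
  · have h1 := cnt_eq_zero.1 hu.1
    have h2 := cnt_eq_zero.1 hu.2
    rw [ind_of hu, ind_of (h1 l (Finset.mem_erase.2 ⟨hkl.symm, Finset.mem_univ l⟩)),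
      Finset.prod_eq_one fun i hi => ind_of ⟨h1 i (Finset.mem_of_mem_erase hi),
        h2 i (Finset.mem_erase.2 ⟨(hne i hi).2.symm, Finset.mem_univ i⟩)⟩, one_mul]
  · rw [ind_of_not hu]
    by_cases hb : b (u k) (u l)
    · rw [ind_of_not (not_not.2 hb), zero_mul]
    have : ∃ i ∈ (Finset.univ.erase k).erase l, b (u k) (u i) ∨ b (u l) (u i) := by
      by_contra! hc
      refine hu ⟨cnt_eq_zero.2 fun i hi => ?_, cnt_eq_zero.2 fun i hi => ?_⟩
      · by_cases hil : i = l
        · rwa [hil]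
        · exact (hc i (Finset.mem_erase.2 ⟨hil, hi⟩)).1
      · by_cases hik : i = k
        · rw [hik]
          exact fun hlk => hb (h.symm hlk)
        · exact (hc i (Finset.mem_erase.2 ⟨Finset.ne_of_mem_erase hi,
            Finset.mem_erase.2 ⟨hik, Finset.mem_univ i⟩⟩)).2
    obtain ⟨i, hi, hi'⟩ := this
    rw [Finset.prod_eq_zero hi (ind_of_not fun hc => hi'.elim hc.1 hc.2), mul_zero]

/-- The square of a sum of indicators is the sum itself plus the `n * m` off-diagonal products. -/
theorem BallRel.variance_isoCnt (h : BallRel ν b p) (hnm : n = m + 1) :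
    variance (fun u : Fin n → X => (isoCnt b Finset.univ u : ℝ)) (iidLaw ν n) =
      n * (1 - p) ^ m + n * m * ∫ x, ∫ y, ind (¬b x y) * void2 ν b x y ^ (m - 1) ∂ν ∂ν -
        n ^ 2 * (1 - p) ^ (2 * m) := by
  have mi : ∀ k : Fin n, Measurable fun u : Fin n → X => ind (deg b Finset.univ u k = 0) := fun k =>
    BinomialCoverage.measurable_ind ((h.measurable_deg _ k) (measurableSet_singleton 0))
  have mS : Measurable fun u : Fin n → X => (isoCnt b Finset.univ u : ℝ) :=
    measurable_natCast_comp (h.measurable_isoCnt _)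
  have bS : ∀ u : Fin n → X, |(isoCnt b Finset.univ u : ℝ)| ≤ n := fun u => by
    rw [Nat.abs_cast]
    exact_mod_cast (cnt_le_card (I := Finset.univ)).trans (by simp)
  rw [variance_eq_sub ((memLp_two_iff_integrable_sq mS.aestronglyMeasurable).2
    (integrable_of_abs_le (C := (n : ℝ) ^ 2) (mS.pow_const 2) fun u => by
      rw [abs_pow]
      exact pow_le_pow_left₀ (abs_nonneg _) (bS u) 2)), h.integral_isoCnt hnm]
  have ikl : ∀ k l : Fin n, Integrable (fun u : Fin n → X =>
      ind (deg b Finset.univ u k = 0) * ind (deg b Finset.univ u l = 0)) (iidLaw ν n) := fun k l =>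
    integrable_of_abs_le (C := 1 * 1) ((mi k).mul (mi l)) fun u => by
      rw [abs_mul]
      exact mul_le_mul abs_ind_le_one abs_ind_le_one (abs_nonneg _) zero_le_one
  have e : ∀ u : Fin n → X, ((fun u : Fin n → X => (isoCnt b Finset.univ u : ℝ)) ^ 2) u =
      isoCnt b Finset.univ u + ∑ k, ∑ l ∈ Finset.univ.erase k,
        ind (deg b Finset.univ u k = 0) * ind (deg b Finset.univ u l = 0) := fun u => by
    rw [Pi.pow_apply, isoCnt, cnt_eq_sum, sq, Finset.sum_mul, ← Finset.sum_add_distrib]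
    refine Finset.sum_congr rfl fun k _ => ?_
    rw [← Finset.add_sum_erase _ _ (Finset.mem_univ k), mul_add, ← ind_and, and_self,
      Finset.mul_sum]
  simp_rw [e]
  rw [integral_add (integrable_of_abs_le mS bS) (integrable_finsetSum _ fun k _ =>
      integrable_finsetSum _ fun l _ => ikl k l), h.integral_isoCnt hnm,
    integral_finsetSum _ fun k _ => integrable_finsetSum _ fun l _ => ikl k l]
  have e2 : ∀ k : Fin n, ∫ u, ∑ l ∈ Finset.univ.erase k,
      ind (deg b Finset.univ u k = 0) * ind (deg b Finset.univ u l = 0) ∂(iidLaw ν n) =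
      m * ∫ x, ∫ y, ind (¬b x y) * void2 ν b x y ^ (m - 1) ∂ν ∂ν := fun k => by
    rw [integral_finsetSum _ fun l _ => ikl k l, Finset.sum_congr rfl fun l hl =>
      h.integral_ind_deg_mul hnm (Finset.ne_of_mem_erase hl).symm, Finset.sum_const,
      Finset.card_erase_of_mem (Finset.mem_univ k), Finset.card_univ, Fintype.card_fin, nsmul_eq_mul,
      show n - 1 = m by omega]
  simp_rw [e2]
  rw [Finset.sum_const, Finset.card_univ, Fintype.card_fin, nsmul_eq_mul, mul_comm 2 m, pow_mul]
  ring

end Moments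

end BinomialCoverage
end

noncomputable section
set_option linter.unusedSectionVars false

namespace BinomialCoverage

/-! ### The torus -/

section Torus

variable {d n : ℕ} {r s : ℝ} {x y z : E d} {k l : Fin d → ℤ}

theorem side_pow (hd : d ≠ 0) (n : ℕ) : side d n ^ d = n := by
  rw [side, ← Real.rpow_natCast, ← Real.rpow_mul (Nat.cast_nonneg n), one_div,
    inv_mul_cancel₀ (by exact_mod_cast hd), Real.rpow_one]

theorem side_pos (hn : 1 ≤ n) : 0 < side d n :=
  Real.rpow_pos_of_pos (by exact_mod_cast hn) _

theorem tendsto_side (hd : d ≠ 0) : Tendsto (fun n : ℕ => side d n) atTop atTop :=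
  (tendsto_rpow_atTop (by positivity)).comp tendsto_natCast_atTop_atTop

/-- The vectors of the lattice. -/
def latVec (d n : ℕ) : (Fin d → ℤ) →+ E d where
  toFun k := WithLp.toLp 2 fun i => side d n * (k i : ℝ)
  map_zero' := by
    ext i
    simp
  map_add' k l := by
    ext i
    simp [mul_add]

theorem latVec_apply (k : Fin d → ℤ) (i : Fin d) : latVec d n k i = side d n * (k i : ℝ) := rfl

/-- Distance at most `r` on the torus. -/
def near (d n : ℕ) (r : ℝ) (x y : E d) : Prop := torusDist d n x y ≤ r

theorem finite_dist_latVec_le (hn : 1 ≤ n) (x y : E d) (r : ℝ) :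
    {k | dist x (y + latVec d n k) ≤ r}.Finite := by
  have hL := side_pos (d := d) hn
  refine Set.Finite.subset (Set.Finite.pi' (t := fun i => Set.Icc ⌊(x i - y i - r) / side d n⌋
    ⌈(x i - y i + r) / side d n⌉) fun i => Set.finite_Icc _ _) fun k hk i => ?_
  have h : ‖(x - (y + latVec d n k)) i‖ ≤ r :=
    (PiLp.norm_apply_le (x - (y + latVec d n k)) i).trans (by rwa [← dist_eq_norm])
  rw [PiLp.sub_apply, PiLp.add_apply, latVec_apply, Real.norm_eq_abs, abs_le] at h
  constructor
  · refine Int.cast_le.1 ((Int.floor_le _).trans ?_)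
    rw [div_le_iff₀ hL]
    linarith
  · refine Int.cast_le.1 (le_trans ?_ (Int.le_ceil _))
    rw [le_div_iff₀ hL]
    linarith

/-- Only finitely many lattice translates lie within a given distance, so the infimum defining
`torusDist` is attained. -/
theorem near_iff (hn : 1 ≤ n) : near d n r x y ↔ ∃ k, dist x (y + latVec d n k) ≤ r := by
  have hbdd : BddBelow (Set.range fun k : Fin d → ℤ => dist x (y + latVec d n k)) :=
    ⟨0, by rintro _ ⟨k, rfl⟩; exact dist_nonneg⟩
  constructor
  · intro h
    obtain ⟨k, hk, hmin⟩ := Set.exists_min_image _ (fun k => dist x (y + latVec d n k))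
      (finite_dist_latVec_le hn x y (dist x (y + latVec d n 0))) ⟨0, le_refl (dist x (y + latVec d n 0))⟩
    refine ⟨k, le_trans (le_ciInf fun l => ?_) h⟩
    by_cases hl : dist x (y + latVec d n l) ≤ dist x (y + latVec d n 0)
    · exact hmin l hl
    · exact le_trans (hmin 0 (le_refl (dist x (y + latVec d n 0)))) (not_le.1 hl).le
  · rintro ⟨k, hk⟩
    exact (ciInf_le hbdd k).trans hk

theorem le_norm_latVec (hk : k ≠ 0) : side d n ≤ ‖latVec d n k‖ := by
  obtain ⟨i, hi⟩ := Function.ne_iff.1 hk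
  have hL : 0 ≤ side d n := Real.rpow_nonneg (Nat.cast_nonneg n) _
  refine le_trans ?_ (PiLp.norm_apply_le (latVec d n k) i)
  rw [latVec_apply, norm_mul, Real.norm_of_nonneg hL]
  refine le_mul_of_one_le_right hL ?_
  rw [Real.norm_eq_abs]
  exact_mod_cast Int.one_le_abs hi

theorem near_refl (hn : 1 ≤ n) (hr : 0 ≤ r) (x : E d) : near d n r x x :=
  (near_iff hn).2 ⟨0, by simpa⟩

theorem dist_add_latVec_comm (k : Fin d → ℤ) :
    dist x (y + latVec d n k) = dist y (x + latVec d n (-k)) := by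
  rw [dist_comm, map_neg, dist_eq_norm, dist_eq_norm]
  congr 1
  abel

theorem near_symm (hn : 1 ≤ n) (h : near d n r x y) : near d n r y x := by
  obtain ⟨k, hk⟩ := (near_iff hn).1 h
  exact (near_iff hn).2 ⟨-k, by rwa [← dist_add_latVec_comm]⟩

theorem near_trans (hn : 1 ≤ n) (h : near d n r x y) (h' : near d n s y z) :
    near d n (r + s) x z := by
  obtain ⟨k, hk⟩ := (near_iff hn).1 h
  obtain ⟨l, hl⟩ := (near_iff hn).1 h'
  refine (near_iff hn).2 ⟨l + k, (dist_triangle x (y + latVec d n k) _).trans (add_le_add hk ?_)⟩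
  rwa [map_add, ← add_assoc, dist_add_right]

theorem near_mono (h : near d n r x y) (hrs : r ≤ s) : near d n s x y := h.trans hrs

theorem near_add_latVec (hn : 1 ≤ n) : near d n r x (y + latVec d n k) ↔ near d n r x y := by
  rw [near_iff hn, near_iff hn]
  constructor
  · rintro ⟨l, hl⟩
    exact ⟨k + l, by rwa [map_add, ← add_assoc]⟩
  · rintro ⟨l, hl⟩
    exact ⟨-k + l, by rwa [map_add, map_neg, add_assoc, add_neg_cancel_left]⟩

theorem near_add_latVec_left (hn : 1 ≤ n) : near d n r (x + latVec d n k) y ↔ near d n r x y :=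
  ⟨fun h => near_symm hn ((near_add_latVec hn).1 (near_symm hn h)),
    fun h => near_symm hn ((near_add_latVec hn).2 (near_symm hn h))⟩

theorem near_of_dist_le (hn : 1 ≤ n) (h : dist x y ≤ r) : near d n r x y :=
  (near_iff hn).2 ⟨0, by simpa⟩

/-- Two such lattice vectors would differ by a nonzero one of norm less than the side. Hence
distances small against the side involve no wrapping around. -/
theorem latVec_unique (h : dist x (y + latVec d n k) ≤ r) (h' : dist x (y + latVec d n l) ≤ s)
    (hr : r + s < side d n) : k = l := by
  by_contra hkl
  have h1 := le_norm_latVec (n := n) (sub_ne_zero.2 hkl)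
  have h2 : ‖latVec d n (k - l)‖ = dist (y + latVec d n k) (y + latVec d n l) := by
    rw [dist_eq_norm, map_sub]
    congr 1
    abel
  have h3 := dist_triangle_left (y + latVec d n k) (y + latVec d n l) x
  linarith

theorem existsUnique_mem_cube (hn : 1 ≤ n) (x : E d) : ∃! k, x + latVec d n k ∈ cube d n := by
  have hL := side_pos (d := d) hn
  have e : ∀ k : Fin d → ℤ, x + latVec d n k ∈ cube d n ↔ ∀ i, -k i = ⌊x i / side d n⌋ := fun k => by
    refine forall_congr' fun i => ?_
    rw [PiLp.add_apply, latVec_apply, Set.mem_Ico, eq_comm, Int.floor_eq_iff, le_div_iff₀ hL,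
      div_lt_iff₀ hL]
    push_cast
    constructor <;> rintro ⟨h1, h2⟩ <;> constructor <;> linarith
  refine ⟨fun i => -⌊x i / side d n⌋, (e _).2 fun i => neg_neg _, fun k hk => funext fun i => ?_⟩
  have := (e k).1 hk i
  omega

theorem measurableSet_cube : MeasurableSet (cube d n) := by
  rw [cube, Set.ofPred_forall]
  exact MeasurableSet.iInter fun i =>
    (EuclideanSpace.proj (𝕜 := ℝ) i).continuous.measurable measurableSet_Ico

theorem volume_cube (hd : d ≠ 0) : volume (cube d n) = n := by
  have e : cube d n = (WithLp.ofLp : E d → Fin d → ℝ) ⁻¹'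
      (Set.univ.pi fun _ => Set.Ico 0 (side d n)) := by
    ext x
    simp [cube]
  rw [e, (PiLp.volume_preserving_ofLp (Fin d)).measure_preimage
    (MeasurableSet.univ_pi fun _ => measurableSet_Ico).nullMeasurableSet, Real.volume_pi_Ico]
  simp only [sub_zero, Finset.prod_const, Finset.card_univ, Fintype.card_fin]
  rw [← ENNReal.ofReal_pow (show 0 ≤ side d n from Real.rpow_nonneg (Nat.cast_nonneg n) _), side_pow hd]
  simp

/-- Uniform law on the cube. -/
def unifCube (d n : ℕ) : Measure (E d) := volume[|cube d n]

theorem unifCube_eq (hd : d ≠ 0) : unifCube d n = (n : ENNReal)⁻¹ • volume.restrict (cube d n) := by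
  rw [unifCube, ProbabilityTheory.cond, volume_cube hd]

theorem isProbabilityMeasure_unifCube (hd : d ≠ 0) (hn : 1 ≤ n) :
    IsProbabilityMeasure (unifCube d n) :=
  cond_isProbabilityMeasure_of_finite (by rw [volume_cube hd]; simpa using by omega)
    (by rw [volume_cube hd]; simp)

theorem measurableSet_near (hn : 1 ≤ n) : MeasurableSet {q : E d × E d | near d n r q.1 q.2} := by
  simp_rw [near_iff hn, Set.ofPred_exists]
  exact MeasurableSet.iUnion fun k =>
    (isClosed_le (continuous_fst.dist (continuous_snd.add continuous_const))
      continuous_const).measurableSet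

theorem isAddFundamentalDomain_cube (hn : 1 ≤ n) :
    IsAddFundamentalDomain (latVec d n).range (cube d n) := by
  refine IsAddFundamentalDomain.mk' measurableSet_cube.nullMeasurableSet fun x => ?_
  obtain ⟨k, hk, hu⟩ := existsUnique_mem_cube hn x
  refine ⟨⟨latVec d n k, k, rfl⟩, ?_, ?_⟩
  · change latVec d n k + x ∈ _
    rwa [add_comm]
  · rintro ⟨_, l, rfl⟩ hl
    have : x + latVec d n l ∈ cube d n := by
      rw [add_comm]
      exact hl
    exact Subtype.ext (congrArg (latVec d n) (hu l this))

/-- The cube is a fundamental domain, so the integral over the Euclidean ball is the integral over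
the cube of the sum of the translated indicators. As twice the radius is below the side, at most one
translate is nonzero at each place, and one is nonzero exactly on the toroidal ball. -/
theorem setLIntegral_cube_near (hn : 1 ≤ n) (hr : r + r < side d n) {f : E d → ENNReal}
    (hf : Measurable f) (hper : ∀ k y, f (y + latVec d n k) = f y) (x : E d) :
    ∫⁻ y in cube d n, {y | near d n r x y}.indicator f y =
      ∫⁻ y in Metric.closedBall x r, f y := by
  have : Countable (latVec d n).range := (latVec d n).rangeRestrict_surjective.countable
  rw [← lintegral_indicator Metric.isClosed_closedBall.measurableSet,
    (isAddFundamentalDomain_cube hn).lintegral_eq_tsum', ← lintegral_tsum (f := fun (g : (latVec d n).range) y =>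
      (Metric.closedBall x r).indicator f (-g +ᵥ y)) fun g =>
      ((hf.indicator Metric.isClosed_closedBall.measurableSet).comp
        (measurable_const_vadd (-g))).aemeasurable]
  refine lintegral_congr fun y => ?_
  have hmem : ∀ k, ((-(⟨latVec d n k, k, rfl⟩ : (latVec d n).range) +ᵥ y : E d)) =
      y + latVec d n (-k) := fun k => by
    change -latVec d n k + y = _
    rw [map_neg, add_comm]
  by_cases h : near d n r x y
  · rw [Set.indicator_of_mem (show y ∈ {y | near d n r x y} from h)]
    obtain ⟨k, hk⟩ := (near_iff hn).1 h
    rw [tsum_eq_single ⟨latVec d n (-k), -k, rfl⟩]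
    · rw [hmem, neg_neg, Set.indicator_of_mem (by rwa [Metric.mem_closedBall'])]
      exact (hper k y).symm
    · rintro ⟨_, l, rfl⟩ hl
      rw [hmem]
      refine Set.indicator_of_notMem (fun hm => hl ?_) _
      rw [Metric.mem_closedBall'] at hm
      refine Subtype.ext ?_
      change latVec d n l = latVec d n (-k)
      rw [latVec_unique hk hm hr, neg_neg]
  · rw [Set.indicator_of_notMem (show y ∉ {y | near d n r x y} from h)]
    symm
    refine ENNReal.tsum_eq_zero.2 ?_
    rintro ⟨_, l, rfl⟩
    rw [hmem]
    refine Set.indicator_of_notMem (fun hm => h ?_) _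
    rw [Metric.mem_closedBall'] at hm
    exact (near_iff hn).2 ⟨-l, hm⟩

/-- Integration over a small ball of the torus. -/
theorem integral_ind_near_mul (hd : d ≠ 0) (hn : 1 ≤ n) (hr : r + r < side d n) {F : E d → ℝ}
    (hF : Measurable F) (hF0 : ∀ y, 0 ≤ F y) (hper : ∀ k y, F (y + latVec d n k) = F y) (x : E d) :
    ∫ y, ind (near d n r x y) * F y ∂(unifCube d n) =
      (n : ℝ)⁻¹ * ∫ y in Metric.closedBall x r, F y := by
  have mnear : MeasurableSet {y | near d n r x y} :=
    (measurable_const.prodMk measurable_id : Measurable fun y : E d => (x, y)) (measurableSet_near hn)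
  rw [unifCube_eq hd, integral_smul_measure, ENNReal.toReal_inv, ENNReal.toReal_natCast, smul_eq_mul,
    integral_eq_lintegral_of_nonneg_ae (Eventually.of_forall fun y => mul_nonneg ind_nonneg (hF0 y))
      ((measurable_ind mnear).mul hF).aestronglyMeasurable,
    integral_eq_lintegral_of_nonneg_ae (Eventually.of_forall hF0) hF.aestronglyMeasurable,
    ← setLIntegral_cube_near hn hr hF.ennreal_ofReal fun k y => by rw [hper]]
  congr 2
  refine lintegral_congr fun y => ?_
  by_cases h : near d n r x y
  · rw [Set.indicator_of_mem (show y ∈ {y | near d n r x y} from h), ind_of h, one_mul]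
  · rw [Set.indicator_of_notMem (show y ∉ {y | near d n r x y} from h), ind_of_not h, zero_mul]
    simp

theorem finrank_E : Module.finrank ℝ (E d) = d := by simp

theorem volume_closedBall_eq (hd : d ≠ 0) (hr : 0 ≤ r) (x : E d) :
    volume.real (Metric.closedBall x r) = r ^ d * unitBallVol d := by
  have : Nonempty (Fin d) := Fin.pos_iff_nonempty.1 (Nat.pos_of_ne_zero hd)
  rw [measureReal_def, EuclideanSpace.volume_closedBall, ENNReal.toReal_mul, ENNReal.toReal_pow,
    ENNReal.toReal_ofReal hr, ENNReal.toReal_ofReal (by positivity), Fintype.card_fin, unitBallVol,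
    Real.rpow_div_two_eq_sqrt _ Real.pi_pos.le, Real.rpow_natCast, add_comm]

theorem unitBallVol_pos : 0 < unitBallVol d :=
  div_pos (Real.rpow_pos_of_pos Real.pi_pos _) (Real.Gamma_pos_of_pos (by positivity))

theorem phi_pos (hr : 0 < r) : 0 < phi d r := mul_pos unitBallVol_pos (pow_pos hr d)

theorem volume_closedBall_eq_phi (hd : d ≠ 0) (hr : 0 ≤ r) (x : E d) :
    volume.real (Metric.closedBall x r) = phi d r := by
  rw [volume_closedBall_eq hd hr, phi, mul_comm]

theorem phi_mul (c r : ℝ) : phi d (c * r) = c ^ d * phi d r := by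
  rw [phi, phi, mul_pow]
  ring

theorem measureReal_near (hd : d ≠ 0) (hn : 1 ≤ n) (hr0 : 0 ≤ r) (hr : r + r < side d n) (x : E d) :
    (unifCube d n).real {y | near d n r x y} = phi d r / n := by
  have mnear : MeasurableSet {y | near d n r x y} :=
    (measurable_const.prodMk measurable_id : Measurable fun y : E d => (x, y)) (measurableSet_near hn)
  have := integral_ind_near_mul hd hn hr (F := fun _ => 1) measurable_const (fun _ => zero_le_one)
    (fun _ _ => rfl) x
  simp only [mul_one, integral_const, smul_eq_mul, measureReal_restrict_apply_univ] at this
  rw [integral_ind mnear, volume_closedBall_eq_phi hd hr0] at this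
  rw [this]
  ring

theorem ballRel_near (hd : d ≠ 0) (hn : 1 ≤ n) (hr0 : 0 ≤ r) (hr : r + r < side d n) :
    BallRel (unifCube d n) (near d n r) (phi d r / n) where
  measurableSet := measurableSet_near hn
  symm := near_symm hn
  refl := near_refl hn hr0
  measureReal := measureReal_near hd hn hr0 hr

/-- Volume of the intersection of two balls of radius `r` with centres `z` apart. -/
def lens (d : ℕ) (r : ℝ) (z : E d) : ℝ :=
  volume.real (Metric.closedBall (0 : E d) r ∩ Metric.closedBall z r)

theorem volume_inter_closedBall (x y : E d) :
    volume.real (Metric.closedBall x r ∩ Metric.closedBall y r) = lens d r (y - x) := by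
  have e : Metric.closedBall x r ∩ Metric.closedBall y r =
      (fun z => -x + z) ⁻¹' (Metric.closedBall (0 : E d) r ∩ Metric.closedBall (y - x) r) := by
    ext z
    simp only [Set.mem_inter_iff, Metric.mem_closedBall, Set.mem_preimage, dist_eq_norm]
    rw [show -x + z - 0 = z - x by abel, show -x + z - (y - x) = z - y by abel]
  rw [e, measureReal_def, measure_preimage_add]
  rfl

theorem lens_nonneg (z : E d) : 0 ≤ lens d r z := measureReal_nonneg

theorem lens_le (hd : d ≠ 0) (hr : 0 ≤ r) (z : E d) : lens d r z ≤ phi d r := by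
  rw [← volume_closedBall_eq_phi hd hr 0]
  exact measureReal_mono Set.inter_subset_left measure_closedBall_lt_top.ne

theorem measurable_lens : Measurable (lens d r) := by
  have h : MeasurableSet {q : E d × E d |
      q.2 ∈ Metric.closedBall (0 : E d) r ∩ Metric.closedBall q.1 r} := by
    simp only [Set.mem_inter_iff, Metric.mem_closedBall]
    exact ((isClosed_le (continuous_snd.dist continuous_const) continuous_const).inter
      (isClosed_le (continuous_snd.dist continuous_fst) continuous_const)).measurableSet
  exact (measurable_measure_prodMk_left h).ennreal_toReal

/-- Unfolding around `x` turns the first ball into a Euclidean one. A point of it lies within `3 *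
r` of `y`, so if it is also within toroidal distance `r` of `y`, then `r + 3 * r < side d n` forces
the lattice vector to be 0. -/
theorem measureReal_near_inter (hd : d ≠ 0) (hn : 1 ≤ n) (hr : 4 * r < side d n) (x y : E d)
    (hxy : dist x y ≤ 2 * r) :
    (unifCube d n).real {z | near d n r x z ∧ near d n r y z} = lens d r (y - x) / n := by
  have hr0 : 0 ≤ r := by linarith [dist_nonneg (x := x) (y := y)]
  have msec : ∀ x : E d, MeasurableSet {z | near d n r x z} := fun x =>
    (measurable_const.prodMk measurable_id : Measurable fun y : E d => (x, y)) (measurableSet_near hn)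
  have h := integral_ind_near_mul hd hn (r := r) (by linarith) (F := fun z => ind (near d n r y z))
    (measurable_ind (msec y)) (fun _ => ind_nonneg)
    (fun k z => ind_congr (near_add_latVec hn)) x
  simp_rw [← ind_and] at h
  rw [← integral_ind (p := fun z => near d n r x z ∧ near d n r y z) ((msec x).inter (msec y)), h, ← volume_inter_closedBall, integral_ind (msec y), measureReal_restrict_apply (msec y),
    div_eq_inv_mul]
  congr 2
  ext z
  simp only [Set.mem_inter_iff, Set.mem_ofPred_eq, Metric.mem_closedBall']
  constructor
  · rintro ⟨h1, h2⟩
    refine ⟨h2, ?_⟩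
    obtain ⟨k, hk⟩ := (near_iff hn).1 h1
    have h3 : dist y (z + latVec d n 0) ≤ 3 * r := by
      rw [map_zero, add_zero]
      linarith [dist_triangle_left y z x]
    have := latVec_unique hk h3 (by linarith)
    rw [this] at hk
    simpa using hk
  · rintro ⟨h1, h2⟩
    exact ⟨near_of_dist_le hn h2, h1⟩

theorem measureReal_near_inter_eq_zero (hn : 1 ≤ n) {x y : E d} (h : ¬near d n (2 * r) x y) :
    (unifCube d n).real {z | near d n r x z ∧ near d n r y z} = 0 := by
  have e : {z | near d n r x z ∧ near d n r y z} = ∅ := by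
    rw [Set.eq_empty_iff_forall_notMem]
    rintro z ⟨h1, h2⟩
    rw [two_mul] at h
    exact h (near_trans hn h1 (near_symm hn h2))
  rw [e, measureReal_empty]

end Torus

end BinomialCoverage
end

noncomputable section
set_option linter.unusedSectionVars false

namespace BinomialCoverage

/-! ### The packing number -/

section Kappa

variable {d : ℕ}

theorem bddAbove_kappa (hd : d ≠ 0) : BddAbove {m : ℕ | ∃ c : Fin m → E d,
    (∀ i, (Metric.closedBall (c i) 1 ∩ Metric.closedBall 0 1).Nonempty) ∧
    Pairwise fun i j => Disjoint (Metric.closedBall (c i) 1) (Metric.closedBall (c j) 1)} := by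
  refine ⟨3 ^ d, ?_⟩
  rintro m ⟨c, hc, hdisj⟩
  have hsub : ⋃ i, Metric.closedBall (c i) 1 ⊆ Metric.closedBall (0 : E d) 3 := by
    refine Set.iUnion_subset fun i x hx => ?_
    obtain ⟨y, hy1, hy2⟩ := hc i
    rw [Metric.mem_closedBall] at *
    linarith [dist_triangle x y 0, dist_triangle_right x y (c i)]
  have h := measureReal_mono hsub (μ := volume) measure_closedBall_lt_top.ne
  rw [measureReal_iUnion_fintype hdisj (fun i => Metric.isClosed_closedBall.measurableSet)
    fun i => measure_closedBall_lt_top.ne] at h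
  simp_rw [volume_closedBall_eq hd zero_le_one, volume_closedBall_eq hd (show (0 : ℝ) ≤ 3 by norm_num)]
    at h
  simp only [one_pow, one_mul, Finset.sum_const, Finset.card_univ, Fintype.card_fin,
    nsmul_eq_mul] at h
  exact_mod_cast le_of_mul_le_mul_right h unitBallVol_pos

/-- A unit ball with centre of norm at most 2 meets the unit ball at the origin at half its centre;
distances above 2 make the balls disjoint. -/
theorem card_le_kappa (hd : d ≠ 0) {ι : Type*} (s : Finset ι) (c : ι → E d)
    (h1 : ∀ i ∈ s, ‖c i‖ ≤ 2) (h2 : ∀ i ∈ s, ∀ j ∈ s, i ≠ j → 2 < dist (c i) (c j)) :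
    s.card ≤ kappa d := by
  refine le_csSup (bddAbove_kappa hd) ⟨fun i => c (s.equivFin.symm i), fun i => ?_, fun i j hij => ?_⟩
  · have := h1 _ (s.equivFin.symm i).2
    refine ⟨(1 / 2 : ℝ) • c (s.equivFin.symm i), ?_, ?_⟩
    · rw [Metric.mem_closedBall, dist_eq_norm, show (1 / 2 : ℝ) • c (s.equivFin.symm i) -
        c (s.equivFin.symm i) = (-(1 / 2) : ℝ) • c (s.equivFin.symm i) by module, norm_smul]
      norm_num
      linarith
    · rw [mem_closedBall_zero_iff, norm_smul]
      norm_num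
      linarith
  · refine Metric.closedBall_disjoint_closedBall ?_
    have := h2 _ (s.equivFin.symm i).2 _ (s.equivFin.symm j).2
      fun h => hij (s.equivFin.symm.injective (Subtype.ext h))
    linarith

theorem one_le_kappa (hd : d ≠ 0) : 1 ≤ kappa d := by
  have := card_le_kappa hd {()} (fun _ => (0 : E d)) (by simp) (by simp)
  simpa using this

/-- Each point is replaced by a translate within Euclidean distance `ρ` of `x`. Centring at `x` and
scaling by `2 / ρ` makes the norms at most 2, and the mutual distances exceed 2 because unrelated
points have all their translates more than `ρ` apart. -/
theorem packing_near {n : ℕ} {ρ : ℝ} (hd : d ≠ 0) (hn : 1 ≤ n) (hρ : 0 < ρ) (N : ℕ) :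
    Packing (near d n ρ) N (kappa d) := by
  intro x s u h1 h2
  have h3 : ∀ i, ∃ k : Fin d → ℤ, i ∈ s → dist x (u i + latVec d n k) ≤ ρ := fun i => by
    by_cases hi : i ∈ s
    · obtain ⟨k, hk⟩ := (near_iff hn).1 (near_symm hn (h1 i hi))
      exact ⟨k, fun _ => hk⟩
    · exact ⟨0, fun h => absurd h hi⟩
  choose k hk using h3
  refine card_le_kappa hd s (fun i => (2 / ρ) • (u i + latVec d n (k i) - x)) (fun i hi => ?_)
    fun i hi j hj hij => ?_
  · rw [norm_smul, ← dist_eq_norm, dist_comm, Real.norm_of_nonneg (by positivity)]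
    calc 2 / ρ * dist x (u i + latVec d n (k i)) ≤ 2 / ρ * ρ := by gcongr; exact hk i hi
      _ = 2 := by field_simp
  · have h4 : ρ < dist (u i + latVec d n (k i)) (u j + latVec d n (k j)) := by
      by_contra! hle
      exact h2 i hi j hj hij ((near_add_latVec_left hn).1 ((near_add_latVec hn).1
        (near_of_dist_le hn hle)))
    rw [dist_smul₀, dist_sub_right, Real.norm_of_nonneg (by positivity)]
    calc 2 = 2 / ρ * ρ := by field_simp
      _ < _ := by gcongr

end Kappa

/-! ### Exact variances on the torus -/

section Variance

variable {d n m k : ℕ} {ρ s : ℝ}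

theorem setIntegral_closedBall_sub (x : E d) (s : ℝ) (G : E d → ℝ) :
    ∫ y in Metric.closedBall x s, G (y - x) = ∫ z in Metric.closedBall 0 s, G z := by
  rw [← (measurePreserving_sub_right volume x).setIntegral_preimage_emb
    (MeasurableEquiv.subRight x).measurableEmbedding G (Metric.closedBall 0 s)]
  congr 2
  ext y
  simp [dist_eq_norm]

/-- Integral over a ball of a power of the probability to avoid two balls. -/
def avoidInt (d : ℕ) (ρ : ℝ) (n k : ℕ) (s : ℝ) : ℝ :=
  ∫ z in Metric.closedBall (0 : E d) s, (1 - 2 * (phi d ρ / n) + lens d ρ z / n) ^ k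

theorem integral_ind_near_mul_void2_pow (hd : d ≠ 0) (hn : 1 ≤ n) (hρ : 0 ≤ ρ)
    (hL : 4 * ρ < side d n) (hs : s ≤ 2 * ρ) (k : ℕ) (x : E d) :
    ∫ y, ind (near d n s x y) * void2 (unifCube d n) (near d n ρ) x y ^ k ∂(unifCube d n) =
      (n : ℝ)⁻¹ * avoidInt d ρ n k s := by
  have := isProbabilityMeasure_unifCube hd hn
  have hB := ballRel_near hd hn hρ (show ρ + ρ < side d n by linarith)
  rw [integral_ind_near_mul hd hn (F := fun y => void2 (unifCube d n) (near d n ρ) x y ^ k)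
    (by linarith) ((hB.measurable_void2.comp
      (measurable_const.prodMk measurable_id : Measurable fun y : E d => (x, y))).pow_const k)
    (fun y => pow_nonneg (void2_nonneg _ _) _) (fun k y => by
      simp only [void2, near_add_latVec_left hn]), avoidInt,
    ← setIntegral_closedBall_sub x s fun z => (1 - 2 * (phi d ρ / n) + lens d ρ z / n) ^ k]
  congr 1
  refine setIntegral_congr_fun Metric.isClosed_closedBall.measurableSet fun y hy => ?_
  rw [Metric.mem_closedBall'] at hy
  rw [hB.void2_eq, measureReal_near_inter hd hn hL x y (hy.trans hs)]

/-- Split at toroidal distance `2 * ρ`: beyond it the two balls are disjoint and the integrand is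
constant, within it the integral unfolds to a Euclidean one. -/
theorem integral_void2_pow (hd : d ≠ 0) (hn : 1 ≤ n) (hρ : 0 ≤ ρ) (hL : 4 * ρ < side d n) (k : ℕ)
    (x : E d) :
    ∫ y, void2 (unifCube d n) (near d n ρ) x y ^ k ∂(unifCube d n) =
      (1 - 2 * (phi d ρ / n)) ^ k * (1 - phi d (2 * ρ) / n) +
        (n : ℝ)⁻¹ * avoidInt d ρ n k (2 * ρ) := by
  have := isProbabilityMeasure_unifCube hd hn
  have hB := ballRel_near hd hn hρ (show ρ + ρ < side d n by linarith)
  have hB2 := ballRel_near hd hn (r := 2 * ρ) (by linarith) (by linarith)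
  have e : ∀ y, void2 (unifCube d n) (near d n ρ) x y ^ k =
      ind (near d n (2 * ρ) x y) * void2 (unifCube d n) (near d n ρ) x y ^ k +
      (1 - ind (near d n (2 * ρ) x y)) * (1 - 2 * (phi d ρ / n)) ^ k := fun y => by
    by_cases h : near d n (2 * ρ) x y
    · rw [ind_of h]
      ring
    · rw [ind_of_not h, hB.void2_eq, measureReal_near_inter_eq_zero hn h]
      ring
  have mv : Measurable fun y => void2 (unifCube d n) (near d n ρ) x y ^ k :=
    (hB.measurable_void2.comp
      (measurable_const.prodMk measurable_id : Measurable fun y : E d => (x, y))).pow_const k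
  have i1 : Integrable (fun y => ind (near d n (2 * ρ) x y) *
      void2 (unifCube d n) (near d n ρ) x y ^ k) (unifCube d n) :=
    integrable_of_abs_le (C := 1 * 1)
      ((hB2.measurable_ind measurable_const measurable_id).mul mv) fun y => by
        rw [abs_mul]
        exact mul_le_mul abs_ind_le_one (abs_void2_pow_le _ _ _) (abs_nonneg _) zero_le_one
  have i2 : Integrable (fun y => 1 - ind (near d n (2 * ρ) x y)) (unifCube d n) :=
    (integrable_const _).sub (hB2.integrable_ind x)
  rw [integral_congr_ae (Eventually.of_forall e), integral_add i1 (i2.mul_const _),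
    integral_ind_near_mul_void2_pow hd hn hρ hL le_rfl, integral_mul_const,
    integral_sub (integrable_const _) (hB2.integrable_ind x), hB2.integral_ind]
  simp
  ring

/-- Variance of the covered volume, for uniform points. -/
theorem variance_coverVol_eq (hd : d ≠ 0) (hn : 1 ≤ n) (hρ : 0 < ρ) (hL : 4 * ρ < side d n)
    (hφ : phi d ρ < n) :
    variance (fun u : Fin n → E d => coverVol (unifCube d n) (near d n ρ) u)
      (iidLaw (unifCube d n) n) =
      n ^ 2 * ((1 - 2 * (phi d ρ / n)) ^ n * (1 - phi d (2 * ρ) / n) +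
        (n : ℝ)⁻¹ * avoidInt d ρ n n (2 * ρ) - (1 - phi d ρ / n) ^ (2 * n)) := by
  have := isProbabilityMeasure_unifCube hd hn
  have hn' : (0 : ℝ) < n := by exact_mod_cast hn
  have hB := ballRel_near hd hn hρ.le (show ρ + ρ < side d n by linarith)
  rw [hB.variance_coverVol hn (div_pos (phi_pos hρ) hn') ((div_lt_one hn').2 hφ)]
  simp_rw [integral_void2_pow hd hn hρ.le hL]
  simp

/-- Variance of the number of isolated points, for uniform points. -/
theorem variance_isoCnt_eq (hd : d ≠ 0) (hnm : n = m + 1) (hρ : 0 < ρ) (hL : 4 * ρ < side d n) :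
    variance (fun u : Fin n → E d => (isoCnt (near d n ρ) Finset.univ u : ℝ))
      (iidLaw (unifCube d n) n) =
      n * (1 - phi d ρ / n) ^ m + n * m * ((1 - 2 * (phi d ρ / n)) ^ (m - 1) *
        (1 - phi d (2 * ρ) / n) + (n : ℝ)⁻¹ * (avoidInt d ρ n (m - 1) (2 * ρ) -
          avoidInt d ρ n (m - 1) ρ)) - n ^ 2 * (1 - phi d ρ / n) ^ (2 * m) := by
  have hn : 1 ≤ n := by omega
  have := isProbabilityMeasure_unifCube hd hn
  have hB := ballRel_near hd hn hρ.le (show ρ + ρ < side d n by linarith)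
  rw [hB.variance_isoCnt hnm]
  have e : ∀ x, ∫ y, ind (¬near d n ρ x y) * void2 (unifCube d n) (near d n ρ) x y ^ (m - 1)
      ∂(unifCube d n) = (1 - 2 * (phi d ρ / n)) ^ (m - 1) * (1 - phi d (2 * ρ) / n) +
        (n : ℝ)⁻¹ * (avoidInt d ρ n (m - 1) (2 * ρ) - avoidInt d ρ n (m - 1) ρ) := fun x => by
    have mv : Measurable fun y => void2 (unifCube d n) (near d n ρ) x y ^ (m - 1) :=
      (hB.measurable_void2.comp
        (measurable_const.prodMk measurable_id : Measurable fun y : E d => (x, y))).pow_const _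
    have iv : Integrable (fun y => void2 (unifCube d n) (near d n ρ) x y ^ (m - 1)) (unifCube d n) :=
      integrable_of_abs_le mv fun y => abs_void2_pow_le _ _ _
    have i1 : Integrable (fun y => ind (near d n ρ x y) *
        void2 (unifCube d n) (near d n ρ) x y ^ (m - 1)) (unifCube d n) :=
      integrable_of_abs_le (C := 1 * 1)
        ((hB.measurable_ind measurable_const measurable_id).mul mv) fun y => by
          rw [abs_mul]
          exact mul_le_mul abs_ind_le_one (abs_void2_pow_le _ _ _) (abs_nonneg _) zero_le_one
    simp_rw [ind_not, sub_mul, one_mul]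
    rw [integral_sub iv i1, integral_void2_pow hd hn hρ.le hL,
      integral_ind_near_mul_void2_pow hd hn hρ.le hL (by linarith)]
    ring
  simp_rw [e]
  simp

end Variance

end BinomialCoverage
end

noncomputable section
set_option linter.unusedSectionVars false

namespace BinomialCoverage

/-! ### Limiting variances -/

section Limits

theorem tendsto_one_add_div_pow_sub (a : ℝ) (j : ℕ) :
    Tendsto (fun n : ℕ => (1 + a / n) ^ (n - j)) atTop (𝓝 (Real.exp a)) := by
  have h0 : Tendsto (fun n : ℕ => 1 + a / (n : ℝ)) atTop (𝓝 1) := by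
    simpa using (tendsto_const_div_atTop_nhds_zero_nat a).const_add 1
  have h := (Real.tendsto_one_add_div_pow_exp a).div (h0.pow j) (by simp)
  rw [one_pow, div_one] at h
  refine h.congr' ?_
  filter_upwards [h0.eventually_const_lt zero_lt_one, eventually_ge_atTop j] with n hn hj
  rw [Pi.div_apply, div_eq_iff (pow_pos hn j).ne', ← pow_add, Nat.sub_add_cancel hj]

theorem le_pow_succ_sub {a b : ℝ} (ha : 0 ≤ a) (hab : a ≤ b) (k : ℕ) :
    (k + 1) * a ^ k * (b - a) ≤ b ^ (k + 1) - a ^ (k + 1) := by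
  induction k with
  | zero => simp
  | succ k ih =>
    have h1 := pow_le_pow_left₀ ha hab (k + 1)
    have h2 := mul_le_mul_of_nonneg_left ih ha
    have h3 := mul_le_mul_of_nonneg_right h1 (sub_nonneg.2 hab)
    push_cast
    rw [pow_succ b (k + 1), pow_succ a (k + 1)]
    rw [pow_succ a k] at *
    nlinarith

theorem pow_succ_sub_le {a b : ℝ} (ha : 0 ≤ a) (hab : a ≤ b) (k : ℕ) :
    b ^ (k + 1) - a ^ (k + 1) ≤ (k + 1) * b ^ k * (b - a) := by
  induction k with
  | zero => simp
  | succ k ih =>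
    have h1 := pow_le_pow_left₀ ha hab (k + 1)
    have h2 := mul_le_mul_of_nonneg_left ih (ha.trans hab)
    have h3 := mul_le_mul_of_nonneg_right h1 (sub_nonneg.2 hab)
    push_cast
    rw [pow_succ b (k + 1), pow_succ a (k + 1)]
    rw [pow_succ b k] at *
    nlinarith

/-- The bases `1 - 2 * a / n` and `(1 - a / n) ^ 2` differ by `(a / n) ^ 2`. The mean value
inequalities for powers enclose the difference of the powers between `n - j` times this gap times a
power of either base, and both of these powers tend to `exp (-2 * a)`. -/
theorem tendsto_mul_pow_sub_pow (a : ℝ) (j : ℕ) :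
    Tendsto (fun n : ℕ => n * ((1 - 2 * (a / n)) ^ (n - j) - (1 - a / n) ^ (2 * (n - j)))) atTop
      (𝓝 (-(a ^ 2 * Real.exp (-2 * a)))) := by
  have hk : Tendsto (fun n : ℕ => ((n - j : ℕ) : ℝ) / n) atTop (𝓝 1) := by
    have := tendsto_ratio 1 j 0
    refine this.congr' ?_
    filter_upwards [eventually_ge_atTop j] with n hn
    rw [Nat.cast_sub hn, one_mul, sub_zero]
  have e2 : ∀ x : ℝ, 1 - 2 * (a / x) = 1 + -2 * a / x := fun x => by ring
  have e1 : ∀ x : ℝ, 1 - a / x = 1 + -a / x := fun x => by ring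
  have hA : Tendsto (fun n : ℕ => (1 - 2 * (a / n)) ^ (n - (j + 1))) atTop
      (𝓝 (Real.exp (-2 * a))) := by
    simp_rw [e2]
    exact tendsto_one_add_div_pow_sub _ _
  have hB : Tendsto (fun n : ℕ => ((1 - a / n) ^ 2) ^ (n - (j + 1))) atTop
      (𝓝 (Real.exp (-2 * a))) := by
    have := (tendsto_one_add_div_pow_sub (-a) (j + 1)).pow 2
    rw [← Real.exp_nat_mul, show ((2 : ℕ) : ℝ) * -a = -2 * a by push_cast; ring] at this
    refine this.congr fun n => ?_
    rw [e1, ← pow_mul, ← pow_mul, mul_comm]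
  have hnn : ∀ᶠ n : ℕ in atTop, (0 : ℝ) ≤ 1 - 2 * (a / n) := by
    have : Tendsto (fun n : ℕ => 1 - 2 * (a / (n : ℝ))) atTop (𝓝 1) := by
      simpa using ((tendsto_const_div_atTop_nhds_zero_nat a).const_mul 2).const_sub 1
    filter_upwards [this.eventually_const_lt zero_lt_one] with n hn using hn.le
  have lim : ∀ F : ℕ → ℝ, Tendsto F atTop (𝓝 (Real.exp (-2 * a))) →
      Tendsto (fun n : ℕ => -(a ^ 2 * (((n - j : ℕ) : ℝ) / n) * F n)) atTop
        (𝓝 (-(a ^ 2 * Real.exp (-2 * a)))) := fun F hF => by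
    have := ((hk.const_mul (a ^ 2)).mul hF).neg
    rwa [mul_one] at this
  refine tendsto_of_tendsto_of_tendsto_of_le_of_le' (lim _ hB) (lim _ hA) ?_ ?_
  all_goals
    filter_upwards [hnn, eventually_ge_atTop (j + 1)] with n hn hj
    have hn' : (0 : ℝ) < n := by
      have : 0 < n := by omega
      exact_mod_cast this
    have hd : (1 - a / n) ^ 2 - (1 - 2 * (a / n)) = (a / n) ^ 2 := by ring
    have hle : 1 - 2 * (a / (n : ℝ)) ≤ (1 - a / n) ^ 2 := by nlinarith [sq_nonneg (a / (n : ℝ))]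
    have h1 := le_pow_succ_sub hn hle (n - (j + 1))
    have h2 := pow_succ_sub_le hn hle (n - (j + 1))
    rw [hd, show n - (j + 1) + 1 = n - j by omega, ← pow_mul] at h1 h2
    have e : ((n - (j + 1) : ℕ) : ℝ) + 1 = ((n - j : ℕ) : ℝ) := by
      rw [← Nat.cast_succ]
      congr 1
      omega
    rw [e] at h1 h2
  · have := mul_le_mul_of_nonneg_left h2 hn'.le
    have e3 : (n : ℝ) * (((n - j : ℕ) : ℝ) * ((1 - a / n) ^ 2) ^ (n - (j + 1)) * (a / n) ^ 2) =
        a ^ 2 * (((n - j : ℕ) : ℝ) / n) * ((1 - a / n) ^ 2) ^ (n - (j + 1)) := by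
      field_simp
    linarith
  · have := mul_le_mul_of_nonneg_left h1 hn'.le
    have e3 : (n : ℝ) * (((n - j : ℕ) : ℝ) * (1 - 2 * (a / n)) ^ (n - (j + 1)) * (a / n) ^ 2) =
        a ^ 2 * (((n - j : ℕ) : ℝ) / n) * (1 - 2 * (a / n)) ^ (n - (j + 1)) := by
      field_simp
    linarith

variable {d : ℕ} {ρ : ℝ}

/-- Limit of the integrals `avoidInt`. -/
def avoidLim (d : ℕ) (ρ s : ℝ) : ℝ :=
  ∫ z in Metric.closedBall (0 : E d) s, Real.exp (-2 * phi d ρ + lens d ρ z)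

/-- Dominated convergence on the ball, with the constant 1 as majorant once `2 * phi d ρ ≤ n` makes
the base nonnegative. -/
theorem tendsto_avoidInt (hd : d ≠ 0) (hρ : 0 < ρ) (j : ℕ) (s : ℝ) :
    Tendsto (fun n : ℕ => avoidInt d ρ n (n - j) s) atTop (𝓝 (avoidLim d ρ s)) := by
  have : IsFiniteMeasure (volume.restrict (Metric.closedBall (0 : E d) s)) :=
    isFiniteMeasure_restrict.2 measure_closedBall_lt_top.ne
  refine tendsto_integral_filter_of_dominated_convergence (fun _ => 1)
    (Eventually.of_forall fun n =>
      ((measurable_const.add (measurable_lens.div_const _)).pow_const _).aestronglyMeasurable) ?_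
    (integrable_const _) (Eventually.of_forall fun z => ?_)
  · filter_upwards [eventually_ge_atTop 1, tendsto_natCast_atTop_atTop.eventually_ge_atTop
      (2 * phi d ρ)] with n hn hφ
    refine Eventually.of_forall fun z => ?_
    have hn' : (0 : ℝ) < n := by exact_mod_cast hn
    have h1 := lens_nonneg (r := ρ) z
    have h2 := lens_le hd hρ.le z
    have h3 := phi_pos (d := d) hρ
    have h4 : 2 * (phi d ρ / n) ≤ 1 := by
      rw [← mul_div_assoc, div_le_one hn']
      exact hφ
    have h5 : lens d ρ z / n ≤ phi d ρ / n := by gcongr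
    have h6 : 0 ≤ lens d ρ z / n := by positivity
    have h7 : 0 ≤ phi d ρ / n := by positivity
    rw [norm_pow, Real.norm_of_nonneg (by linarith)]
    exact pow_le_one₀ (by linarith) (by linarith)
  · refine (tendsto_one_add_div_pow_sub _ j).congr fun n => ?_
    ring

theorem phi_two_mul : phi d (2 * ρ) = 2 ^ d * phi d ρ := phi_mul 2 ρ

/-- Limiting variance of the covered volume, with an integral over the ball. -/
def limVarV (d : ℕ) (ρ : ℝ) : ℝ :=
  avoidLim d ρ (2 * ρ) - (2 ^ d * phi d ρ + phi d ρ ^ 2) * Real.exp (-2 * phi d ρ)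

/-- Limiting variance of the number of isolated points, with integrals over balls. -/
def limVarS (d : ℕ) (ρ : ℝ) : ℝ :=
  Real.exp (-phi d ρ) - (1 + (2 ^ d - 2) * phi d ρ + phi d ρ ^ 2) * Real.exp (-2 * phi d ρ) +
    (avoidLim d ρ (2 * ρ) - avoidLim d ρ ρ)

/-- The thresholds beyond which `φ / n` is a probability below 1 and the torus is wide enough. The
factor `c` is 2 for single balls, 4 for overlaps of two balls, and 6 for balls of radius `3 * ρ`. -/
theorem eventually_large (hd : d ≠ 0) (ρ : ℝ) (c : ℝ) :
    ∀ᶠ n : ℕ in atTop, 1 ≤ n ∧ c * ρ < side d n ∧ phi d ρ < n :=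
  (eventually_ge_atTop 1).and (((tendsto_side hd).eventually_gt_atTop _).and
    (tendsto_natCast_atTop_atTop.eventually_gt_atTop _))

theorem tendsto_variance_coverVol (hd : d ≠ 0) (hρ : 0 < ρ) :
    Tendsto (fun n : ℕ => variance (fun u : Fin n → E d => coverVol (unifCube d n) (near d n ρ) u)
      (iidLaw (unifCube d n) n) / n) atTop (𝓝 (limVarV d ρ)) := by
  have h1 := tendsto_avoidInt hd hρ 0 (2 * ρ)
  have h2 := tendsto_mul_pow_sub_pow (phi d ρ) 0
  have h3 := tendsto_one_add_div_pow_sub (-2 * phi d ρ) 0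
  have h := (h1.add h2).sub (h3.const_mul (phi d (2 * ρ)))
  have el : avoidLim d ρ (2 * ρ) + -(phi d ρ ^ 2 * Real.exp (-2 * phi d ρ)) -
      phi d (2 * ρ) * Real.exp (-2 * phi d ρ) = limVarV d ρ := by
    rw [limVarV, phi_two_mul]
    ring
  rw [el] at h
  refine h.congr' ?_
  filter_upwards [eventually_large hd ρ 4] with n hn
  have hn' : (n : ℝ) ≠ 0 := by
    have : 0 < n := hn.1
    positivity
  rw [variance_coverVol_eq hd hn.1 hρ hn.2.1 hn.2.2]
  simp only [Nat.sub_zero]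
  rw [show 1 + -2 * phi d ρ / (n : ℝ) = 1 - 2 * (phi d ρ / n) by ring]
  field_simp
  ring

theorem tendsto_variance_isoCnt (hd : d ≠ 0) (hρ : 0 < ρ) :
    Tendsto (fun n : ℕ => variance (fun u : Fin n → E d =>
      (isoCnt (near d n ρ) Finset.univ u : ℝ)) (iidLaw (unifCube d n) n) / n) atTop
      (𝓝 (limVarS d ρ)) := by
  have h1 := (tendsto_avoidInt hd hρ 2 (2 * ρ)).sub (tendsto_avoidInt hd hρ 2 ρ)
  have h2 := tendsto_mul_pow_sub_pow (phi d ρ) 1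
  have h3 := tendsto_one_add_div_pow_sub (-2 * phi d ρ) 2
  have h4 := tendsto_one_add_div_pow_sub (-phi d ρ) 1
  have h5 := tendsto_ratio 1 1 0
  -- The coefficient `-1 + 2 * φ` collects two shifts: there are `n - 1` rather than `n` partners of
  -- a point, and the exponent of the avoidance probability is `n - 2` rather than `n - 1`.
  have h := ((h4.add (h3.const_mul (-1 + 2 * phi d ρ))).add h2).add
    (h5.mul (h1.sub (h3.const_mul (phi d (2 * ρ)))))
  have el : Real.exp (-phi d ρ) + (-1 + 2 * phi d ρ) * Real.exp (-2 * phi d ρ) +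
      -(phi d ρ ^ 2 * Real.exp (-2 * phi d ρ)) + 1 * (avoidLim d ρ (2 * ρ) - avoidLim d ρ ρ -
      phi d (2 * ρ) * Real.exp (-2 * phi d ρ)) = limVarS d ρ := by
    rw [limVarS, phi_two_mul]
    ring
  rw [el] at h
  refine h.congr' ?_
  filter_upwards [eventually_large hd ρ 4, eventually_ge_atTop 2] with n hn hn2
  obtain ⟨k, rfl⟩ : ∃ k, n = k + 2 := ⟨n - 2, by omega⟩
  have hn' : ((k + 2 : ℕ) : ℝ) ≠ 0 := by positivity
  rw [variance_isoCnt_eq (m := k + 1) hd rfl hρ hn.2.1]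
  simp only [show k + 2 - 2 = k by omega, show k + 2 - 1 = k + 1 by omega, Nat.add_sub_cancel]
  have e1 : ((k + 1 : ℕ) : ℝ) = ((k + 2 : ℕ) : ℝ) - 1 := by push_cast; ring
  rw [e1]
  generalize ((k + 2 : ℕ) : ℝ) = N at *
  rw [show 1 + -2 * phi d ρ / N = 1 - 2 * (phi d ρ / N) by ring,
    show 1 + -phi d ρ / N = 1 - phi d ρ / N by ring, pow_succ (1 - 2 * (phi d ρ / N)) k]
  generalize (1 - 2 * (phi d ρ / N)) ^ k = Q at *
  generalize (1 - phi d ρ / N) ^ (2 * (k + 1)) = Q2 at *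
  generalize (1 - phi d ρ / N) ^ (k + 1) = Q1 at *
  field_simp
  ring

end Limits

/-! ### Reduction of the limiting integrals to `J` -/

section Radial

open scoped Pointwise

variable {d : ℕ} {ρ r : ℝ}

/-- A reflection carries `w` to the first coordinate axis, so the volume of the union depends only
on the distance of the centres. -/
theorem unionVol_norm [NeZero d] (w : E d) :
    unionVol d ‖w‖ = volume.real (Metric.closedBall (0 : E d) 1 ∪ Metric.closedBall w 1) := by
  have hw : ‖w‖ = ‖EuclideanSpace.single (0 : Fin d) ‖w‖‖ := by simp
  set f := (ℝ ∙ (w - EuclideanSpace.single (0 : Fin d) ‖w‖))ᗮ.reflection with hf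
  have hfw : f w = EuclideanSpace.single (0 : Fin d) ‖w‖ := Submodule.reflection_sub hw
  rw [unionVol, ← hfw, ← f.measurePreserving.measureReal_preimage
    ((Metric.isClosed_closedBall.union Metric.isClosed_closedBall).measurableSet.nullMeasurableSet)]
  congr 1
  ext x
  have h0 : dist (f x) 0 = dist x 0 := by rw [← f.dist_map x 0, f.map_zero]
  simp only [Set.mem_preimage, Set.mem_union, Metric.mem_closedBall, f.dist_map, h0]

theorem volume_union_closedBall_smul (hρ : 0 < ρ) (w : E d) :
    volume.real (Metric.closedBall (0 : E d) ρ ∪ Metric.closedBall (ρ • w) ρ) =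
      ρ ^ d * volume.real (Metric.closedBall (0 : E d) 1 ∪ Metric.closedBall w 1) := by
  have h : Metric.closedBall (0 : E d) ρ ∪ Metric.closedBall (ρ • w) ρ =
      ρ • (Metric.closedBall (0 : E d) 1 ∪ Metric.closedBall w 1) := by
    rw [Set.smul_set_union, smul_closedBall _ _ zero_le_one, smul_closedBall _ _ zero_le_one,
      smul_zero, Real.norm_of_nonneg hρ.le, mul_one]
  rw [h, measureReal_def, Measure.addHaar_smul, ENNReal.toReal_mul,
    ENNReal.toReal_ofReal (abs_nonneg _), finrank_E, abs_of_pos (pow_pos hρ d)]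
  rfl

theorem lens_eq (hd : d ≠ 0) (hρ : 0 ≤ ρ) (z : E d) : -2 * phi d ρ + lens d ρ z =
    -volume.real (Metric.closedBall (0 : E d) ρ ∪ Metric.closedBall z ρ) := by
  have := measureReal_union_add_inter (μ := volume) (s := Metric.closedBall (0 : E d) ρ)
    (t := Metric.closedBall z ρ) Metric.isClosed_closedBall.measurableSet
    measure_closedBall_lt_top.ne measure_closedBall_lt_top.ne
  rw [volume_closedBall_eq_phi hd hρ, volume_closedBall_eq_phi hd hρ] at this
  rw [lens]
  linarith

theorem setIntegral_closedBall_norm (hd : d ≠ 0) (hr : 0 ≤ r) (f : ℝ → ℝ) :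
    ∫ w in Metric.closedBall (0 : E d) r, f ‖w‖ =
      d * unitBallVol d * ∫ t in (0 : ℝ)..r, f t * t ^ (d - 1) := by
  have : Nonempty (Fin d) := Fin.pos_iff_nonempty.1 (Nat.pos_of_ne_zero hd)
  have e1 : ∫ w in Metric.closedBall (0 : E d) r, f ‖w‖ =
      ∫ w : E d, (Set.Iic r).indicator f ‖w‖ := by
    rw [← integral_indicator Metric.isClosed_closedBall.measurableSet]
    congr 1 with w
    by_cases hw : ‖w‖ ≤ r
    · rw [Set.indicator_of_mem (by simpa), Set.indicator_of_mem (by simpa)]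
    · rw [Set.indicator_of_notMem (by simpa using hw), Set.indicator_of_notMem (by simpa using hw)]
  have e2 : volume.real (Metric.ball (0 : E d) 1) = unitBallVol d := by
    rw [measureReal_def, ← Measure.addHaar_closedBall_eq_addHaar_ball, ← measureReal_def,
      volume_closedBall_eq hd zero_le_one, one_pow, one_mul]
  rw [e1, integral_fun_norm_addHaar, finrank_E, e2, intervalIntegral.integral_of_le hr, nsmul_eq_mul,
    smul_eq_mul, mul_assoc, ← Set.Ioi_inter_Iic, ← setIntegral_indicator measurableSet_Iic]
  congr 3 with t
  by_cases ht : t ≤ r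
  · rw [Set.indicator_of_mem (by simpa), Set.indicator_of_mem (by simpa), smul_eq_mul, mul_comm]
  · rw [Set.indicator_of_notMem (by simpa using ht), Set.indicator_of_notMem (by simpa using ht),
      smul_zero]

/-- The exponent is minus the volume of a union of two balls. Scaling by `ρ` reduces to unit balls,
and polar coordinates then give the one-dimensional integral. -/
theorem avoidLim_eq [NeZero d] (hρ : 0 < ρ) (hr : 0 ≤ r) :
    avoidLim d ρ (r * ρ) = ρ ^ d * J d r ρ := by
  have hd : d ≠ 0 := NeZero.ne d
  have h := Measure.setIntegral_comp_smul volume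
    (fun z : E d => Real.exp (-2 * phi d ρ + lens d ρ z)) (Metric.closedBall (0 : E d) r) hρ.ne'
  rw [smul_closedBall _ _ hr, smul_zero, Real.norm_of_nonneg hρ.le, finrank_E,
    abs_of_pos (inv_pos.2 (pow_pos hρ d)), smul_eq_mul, mul_comm ρ r] at h
  rw [avoidLim, J, ← setIntegral_closedBall_norm hd hr fun t => Real.exp (-ρ ^ d * unionVol d t),
    ← mul_inv_cancel_left₀ (pow_pos hρ d).ne' (∫ z in Metric.closedBall (0 : E d) (r * ρ), _), ← h]
  congr 2 with w
  rw [lens_eq hd hρ.le, volume_union_closedBall_smul hρ, unionVol_norm, neg_mul]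

theorem limVarV_eq [NeZero d] (hρ : 0 < ρ) : limVarV d ρ = gV d ρ := by
  rw [limVarV, gV, avoidLim_eq hρ zero_le_two]

theorem limVarS_eq [NeZero d] (hρ : 0 < ρ) : limVarS d ρ = gS d ρ := by
  have := avoidLim_eq (d := d) hρ zero_le_one
  rw [one_mul] at this
  rw [limVarS, gS, avoidLim_eq hρ zero_le_two, this]
  ring

end Radial

/-! ### Positivity of the limiting variances -/

section Positivity

variable {d : ℕ} {ρ s : ℝ}

theorem isFiniteMeasure_restrict_closedBall (x : E d) (s : ℝ) :
    IsFiniteMeasure (volume.restrict (Metric.closedBall x s)) :=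
  isFiniteMeasure_restrict.2 measure_closedBall_lt_top.ne

theorem integrableOn_lens (hd : d ≠ 0) (hρ : 0 ≤ ρ) (s : ℝ) :
    IntegrableOn (lens d ρ) (Metric.closedBall 0 s) := by
  have := isFiniteMeasure_restrict_closedBall (0 : E d) s
  refine integrable_of_abs_le (C := phi d ρ) measurable_lens fun z => ?_
  rw [abs_of_nonneg (lens_nonneg z)]
  exact lens_le hd hρ z

theorem integrableOn_exp_lens (hd : d ≠ 0) (hρ : 0 ≤ ρ) (s : ℝ) :
    IntegrableOn (fun z => Real.exp (lens d ρ z)) (Metric.closedBall 0 s) := by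
  have := isFiniteMeasure_restrict_closedBall (0 : E d) s
  refine integrable_of_abs_le (C := Real.exp (phi d ρ)) measurable_lens.exp fun z => ?_
  rw [abs_of_pos (Real.exp_pos _)]
  exact Real.exp_le_exp.2 (lens_le hd hρ z)

/-- By Fubini the overlap volume is integrated over its points first: for `x` in the ball about 0,
the centres `z` whose ball contains `x` form a ball of radius `ρ`, which lies inside the ball of
radius `2 * ρ`. -/
theorem integral_lens (hd : d ≠ 0) (hρ : 0 ≤ ρ) :
    ∫ z in Metric.closedBall (0 : E d) (2 * ρ), lens d ρ z = phi d ρ ^ 2 := by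
  have := isFiniteMeasure_restrict_closedBall (0 : E d) (2 * ρ)
  have := isFiniteMeasure_restrict_closedBall (0 : E d) ρ
  have mset : MeasurableSet {q : E d × E d | dist q.2 q.1 ≤ ρ} :=
    (isClosed_le (continuous_snd.dist continuous_fst) continuous_const).measurableSet
  have e1 : ∀ z : E d, lens d ρ z = ∫ x in Metric.closedBall (0 : E d) ρ, ind (dist x z ≤ ρ) :=
    fun z => by
      rw [integral_ind (Metric.isClosed_closedBall (x := z) (ε := ρ)).measurableSet]
      change _ = (volume.restrict _).real (Metric.closedBall z ρ)
      rw [measureReal_restrict_apply (Metric.isClosed_closedBall (x := z) (ε := ρ)).measurableSet,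
        lens, Set.inter_comm]
  simp_rw [e1]
  rw [integral_integral_swap (f := fun z x : E d => ind (dist x z ≤ ρ))
    (integrable_of_abs_le (C := 1) (measurable_ind mset) fun _ => abs_ind_le_one)]
  have e2 : ∀ x ∈ Metric.closedBall (0 : E d) ρ,
      ∫ z in Metric.closedBall (0 : E d) (2 * ρ), ind (dist x z ≤ ρ) = phi d ρ := fun x hx => by
    have e3 : ∀ z, ind (dist x z ≤ ρ) = ind (z ∈ Metric.closedBall x ρ) := fun z =>
      ind_congr (by rw [Metric.mem_closedBall, dist_comm])
    simp_rw [e3]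
    rw [integral_ind (p := fun z => z ∈ Metric.closedBall x ρ)
      (Metric.isClosed_closedBall (x := x) (ε := ρ)).measurableSet]
    change (volume.restrict _).real (Metric.closedBall x ρ) = _
    rw [measureReal_restrict_apply Metric.isClosed_closedBall.measurableSet,
      Set.inter_eq_left.2, volume_closedBall_eq_phi hd hρ]
    refine Metric.closedBall_subset_closedBall' ?_
    rw [Metric.mem_closedBall] at hx
    linarith
  rw [setIntegral_congr_fun Metric.isClosed_closedBall.measurableSet e2]
  simp [volume_closedBall_eq_phi hd hρ, sq]

theorem avoidLim_eq_exp_mul (s : ℝ) : avoidLim d ρ s = Real.exp (-2 * phi d ρ) *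
    ∫ z in Metric.closedBall (0 : E d) s, Real.exp (lens d ρ z) := by
  rw [avoidLim, ← integral_const_mul]
  simp_rw [Real.exp_add]

/-- Up to the factor `exp (-2 * φ)`, the subtracted term is the integral of `1 + lens` over the ball
of radius `2 * ρ`. Positivity is therefore the strict excess of the exponential over its tangent at
0, which a quadratic lower bound supplies. -/
theorem limVarV_pos (hd : d ≠ 0) (hρ : 0 < ρ) : 0 < limVarV d ρ := by
  have hφ := phi_pos (d := d) hρ
  have := isFiniteMeasure_restrict_closedBall (0 : E d) (2 * ρ)
  -- `t` is the mean overlap over the ball of radius `2 * ρ`. The quadratic term `x ^ 2 / 2` is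
  -- replaced by its tangent at `t`, so that only the integral of `lens` is needed; the gain is `t *
  -- φ ^ 2 / 2`.
  set t : ℝ := phi d ρ / 2 ^ d with ht
  have ht0 : 0 < t := by positivity
  have hle : ∫ z in Metric.closedBall (0 : E d) (2 * ρ), ((1 - t ^ 2 / 2) + (1 + t) * lens d ρ z) ≤
      ∫ z in Metric.closedBall (0 : E d) (2 * ρ), Real.exp (lens d ρ z) := by
    refine integral_mono ((integrable_const _).add ((integrableOn_lens hd hρ.le _).const_mul _))
      (integrableOn_exp_lens hd hρ.le _) fun z => ?_
    have := Real.quadratic_le_exp_of_nonneg (lens_nonneg (r := ρ) z)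
    nlinarith [sq_nonneg (lens d ρ z - t)]
  rw [integral_add (integrable_const _) ((integrableOn_lens hd hρ.le _).const_mul _),
    integral_const_mul, integral_lens hd hρ.le] at hle
  simp only [integral_const, measureReal_restrict_apply_univ, smul_eq_mul] at hle
  rw [volume_closedBall_eq_phi hd (by positivity), phi_two_mul] at hle
  have hpos : 0 < (∫ z in Metric.closedBall (0 : E d) (2 * ρ), Real.exp (lens d ρ z)) -
      (2 ^ d * phi d ρ + phi d ρ ^ 2) := by
    have : 0 < 2 ^ d * phi d ρ * (-(t ^ 2 / 2)) + t * phi d ρ ^ 2 := by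
      have e : 2 ^ d * phi d ρ * (-(t ^ 2 / 2)) + t * phi d ρ ^ 2 = t * phi d ρ ^ 2 / 2 := by
        rw [ht]
        field_simp
        ring
      rw [e]
      positivity
    linarith
  rw [limVarV, avoidLim_eq_exp_mul, mul_comm (Real.exp _), ← sub_mul]
  exact mul_pos hpos (Real.exp_pos _)

/-- Over the annulus between radii `ρ` and `2 * ρ`, the integral of `exp lens` is at least that of
`1 + lens`, hence at least `(2 ^ d - 1) * φ`, because the integral of `lens` over the inner ball is
at most `φ ^ 2`. What remains is `exp φ - 1 + φ - φ ^ 2 > 0`, which follows from the cubic Taylor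
polynomial of the exponential. -/
theorem limVarS_pos (hd : d ≠ 0) (hρ : 0 < ρ) : 0 < limVarS d ρ := by
  have hφ := phi_pos (d := d) hρ
  have := isFiniteMeasure_restrict_closedBall (0 : E d) (2 * ρ)
  have := isFiniteMeasure_restrict_closedBall (0 : E d) ρ
  have ih : ∀ s, IntegrableOn (fun z : E d => Real.exp (lens d ρ z) - (1 + lens d ρ z))
      (Metric.closedBall 0 s) := fun s => by
    have := isFiniteMeasure_restrict_closedBall (0 : E d) s
    exact (integrableOn_exp_lens hd hρ.le s).sub ((integrable_const _).add
      (integrableOn_lens hd hρ.le s))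
  have e : ∀ s, 0 ≤ s → ∫ z in Metric.closedBall (0 : E d) s, (Real.exp (lens d ρ z) -
      (1 + lens d ρ z)) = (∫ z in Metric.closedBall (0 : E d) s, Real.exp (lens d ρ z)) -
      (phi d s + ∫ z in Metric.closedBall (0 : E d) s, lens d ρ z) := fun s hs => by
    have := isFiniteMeasure_restrict_closedBall (0 : E d) s
    have i1 : IntegrableOn (fun z : E d => 1 + lens d ρ z) (Metric.closedBall 0 s) :=
      (integrable_const _).add (integrableOn_lens hd hρ.le s)
    rw [integral_sub (integrableOn_exp_lens hd hρ.le s) i1, integral_add (integrable_const _)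
      (integrableOn_lens hd hρ.le s)]
    simp [volume_closedBall_eq_phi hd hs]
  have hmono : ∫ z in Metric.closedBall (0 : E d) ρ, (Real.exp (lens d ρ z) - (1 + lens d ρ z)) ≤
      ∫ z in Metric.closedBall (0 : E d) (2 * ρ), (Real.exp (lens d ρ z) - (1 + lens d ρ z)) :=
    setIntegral_mono_set (ih _) (Eventually.of_forall fun z => by
      have := Real.add_one_le_exp (lens d ρ z)
      simp only [Pi.zero_apply]
      linarith) (Eventually.of_forall (Metric.closedBall_subset_closedBall (by linarith)))
  have hl : ∫ z in Metric.closedBall (0 : E d) ρ, lens d ρ z ≤ phi d ρ * phi d ρ := by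
    calc _ ≤ ∫ z in Metric.closedBall (0 : E d) ρ, phi d ρ :=
          integral_mono (integrableOn_lens hd hρ.le _) (integrable_const _) (lens_le hd hρ.le)
      _ = _ := by simp [volume_closedBall_eq_phi hd hρ.le]
  rw [e ρ hρ.le, e (2 * ρ) (by positivity), integral_lens hd hρ.le, phi_two_mul] at hmono
  have hcubic := Real.sum_le_exp_of_nonneg hφ.le 4
  simp only [Finset.sum_range_succ, Finset.sum_range_zero, Nat.factorial] at hcubic
  norm_num at hcubic
  rw [limVarS, avoidLim_eq_exp_mul, avoidLim_eq_exp_mul]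
  have e0 : Real.exp (-phi d ρ) = Real.exp (-2 * phi d ρ) * Real.exp (phi d ρ) := by
    rw [← Real.exp_add]
    congr 1
    ring
  rw [e0]
  have hpos : 0 < Real.exp (phi d ρ) - (1 + (2 ^ d - 2) * phi d ρ + phi d ρ ^ 2) +
      ((∫ z in Metric.closedBall (0 : E d) (2 * ρ), Real.exp (lens d ρ z)) -
        ∫ z in Metric.closedBall (0 : E d) ρ, Real.exp (lens d ρ z)) := by
    nlinarith [sq_nonneg (phi d ρ - 3 / 2), mul_pos hφ hφ]
  have := mul_pos (Real.exp_pos (-2 * phi d ρ)) hpos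
  linarith

end Positivity

end BinomialCoverage
end

noncomputable section
set_option linter.unusedSectionVars false

namespace BinomialCoverage

/-! ### Invariance of the Kolmogorov distance -/

section KolmogorovInvariance

variable {Ω Ω' : Type*} [MeasurableSpace Ω] [MeasurableSpace Ω'] {P : Measure Ω}

theorem kolmogorovDist_congr {X Y : Ω → ℝ} (h : X =ᵐ[P] Y) :
    kolmogorovDist P X = kolmogorovDist P Y := by
  unfold kolmogorovDist
  rw [integral_congr_ae h, variance_congr h]
  congr 1
  ext t
  congr 2
  refine measureReal_congr ?_
  filter_upwards [h] with ω hω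
  change (_ ≤ t) = (_ ≤ t)
  rw [hω]

theorem kolmogorovDist_map {Y : Ω → Ω'} (hY : Measurable Y) {X : Ω' → ℝ} (hX : Measurable X) :
    kolmogorovDist (P.map Y) X = kolmogorovDist P fun ω => X (Y ω) := by
  unfold kolmogorovDist
  rw [integral_map hY.aemeasurable hX.aestronglyMeasurable,
    variance_map hX.aemeasurable hY.aemeasurable]
  congr 1
  ext t
  rw [map_measureReal_apply hY (measurableSet_le (by fun_prop) measurable_const)]
  rfl

/-- The strict distribution function is a limit of ordinary ones from the left, and `ncdf` is
continuous. It is needed for reflections and for the jumps of integer-valued variables. -/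
theorem abs_measureReal_lt_sub_ncdf_le [IsProbabilityMeasure P] {X : Ω → ℝ} (s : ℝ) :
    |P.real {ω | (X ω - ∫ ω', X ω' ∂P) / √(variance X P) < s} - ncdf s| ≤
      kolmogorovDist P X := by
  set W := fun ω => (X ω - ∫ ω', X ω' ∂P) / √(variance X P)
  have hs : Tendsto (fun k : ℕ => s - 1 / ((k : ℝ) + 1)) atTop (𝓝 s) := by
    simpa using (tendsto_const_nhds (x := s)).sub (tendsto_one_div_add_atTop_nhds_zero_nat (𝕜 := ℝ))
  have e : {ω | W ω < s} = ⋃ k : ℕ, {ω | W ω ≤ s - 1 / ((k : ℝ) + 1)} := by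
    ext ω
    simp only [Set.mem_ofPred_eq, Set.mem_iUnion]
    constructor
    · intro h
      exact ((hs.eventually_const_lt h).exists).imp fun k hk => hk.le
    · rintro ⟨k, hk⟩
      have : 0 < 1 / ((k : ℝ) + 1) := by positivity
      linarith
  have hm : Monotone fun k : ℕ => {ω | W ω ≤ s - 1 / ((k : ℝ) + 1)} := fun k l hkl ω hω => by
    have : 1 / ((l : ℝ) + 1) ≤ 1 / ((k : ℝ) + 1) := by gcongr
    simp only [Set.mem_ofPred_eq] at hω ⊢
    linarith
  have h1 := (ENNReal.tendsto_toReal (measure_ne_top P _)).comp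
    (tendsto_measure_iUnion_atTop (μ := P) hm)
  rw [← e] at h1
  exact le_of_tendsto' (h1.sub ((continuous_ncdf.tendsto s).comp hs)).abs
    fun k => le_kolmogorovDist _

/-- The normal law is symmetric, and reflection exchanges weak and strict inequalities. This carries
the bound from `n - S` over to `S`. -/
theorem kolmogorovDist_const_sub_le [IsProbabilityMeasure P] {X : Ω → ℝ} (hX : Measurable X)
    (hi : Integrable X P) (c : ℝ) :
    kolmogorovDist P (fun ω => c - X ω) ≤ kolmogorovDist P X := by
  refine kolmogorovDist_le fun t => ?_
  have e1 : ∫ ω, (c - X ω) ∂P = c - ∫ ω, X ω ∂P := by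
    rw [integral_sub (integrable_const _) hi]
    simp
  rw [e1, variance_const_sub hi.aestronglyMeasurable]
  have e : {ω | (c - X ω - (c - ∫ ω, X ω ∂P)) / √(variance X P) ≤ t} =
      {ω | (X ω - ∫ ω', X ω' ∂P) / √(variance X P) < -t}ᶜ := by
    ext ω
    simp only [Set.mem_ofPred_eq, Set.mem_compl_iff, not_lt]
    rw [neg_le, ← neg_div]
    ring_nf
  rw [e, probReal_compl_eq_one_sub (measurableSet_lt (by fun_prop) measurable_const),
    ← abs_neg]
  have h := abs_measureReal_lt_sub_ncdf_le (P := P) (X := X) (-t)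
  rw [ncdf_neg] at h
  convert h using 2
  ring

end KolmogorovInvariance

/-! ### The functionals of a uniform sample -/

section Sample

variable {d n : ℕ} {ρ : ℝ}

theorem IsUniformSample.map_eq {Ω : Type*} [MeasurableSpace Ω] {P : Measure Ω}
    {U : Fin n → Ω → E d} (hU : IsUniformSample d n P U) :
    P.map (fun ω i => U i ω) = iidLaw (unifCube d n) n := by
  rw [hU.indep.map_fun_eq_pi_map fun i => (hU.measurable i).aemeasurable]
  congr 1
  ext1 i
  exact hU.uniform i

theorem coveredVolume_eq (hd : d ≠ 0) (hn : 1 ≤ n) (hρ : 0 ≤ ρ) (hr : ρ + ρ < side d n)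
    (u : Fin n → E d) : coveredVolume d n ρ u = coverVol (unifCube d n) (near d n ρ) u := by
  have := isProbabilityMeasure_unifCube hd hn
  have h := ballRel_near hd hn hρ hr
  have hn' : (n : ℝ) ≠ 0 := by positivity
  have hm : MeasurableSet {x | 1 ≤ cnt Finset.univ fun i => near d n ρ x (u i)} :=
    ((h.measurable_count Finset.univ).comp measurable_prodMk_left) (measurableSet_Ici (a := 1))
  rw [coverVol, integral_ind hm, unifCube_eq hd, measureReal_ennreal_smul_apply,
    measureReal_restrict_apply hm, ENNReal.toReal_inv, ENNReal.toReal_natCast,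
    mul_inv_cancel_left₀ hn', coveredVolume]
  congr 1
  ext x
  simp only [torusBall, Set.mem_iUnion, Set.mem_ofPred_eq, Set.mem_inter_iff, cnt_pos,
    Finset.mem_univ, true_and]
  constructor
  · rintro ⟨i, hx, hi⟩
    exact ⟨⟨i, near_symm hn hi⟩, hx⟩
  · rintro ⟨⟨i, hi⟩, hx⟩
    exact ⟨i, hx, near_symm hn hi⟩

/-- `singletonCount` refers to the set of points and `isoCnt` to indices. Coinciding points would be
one element of the set, so the two agree only almost surely. -/
theorem ae_injective (hd : d ≠ 0) (hn : 1 ≤ n) :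
    ∀ᵐ u ∂iidLaw (unifCube d n) n, Function.Injective u := by
  have := isProbabilityMeasure_unifCube hd hn
  have : NeZero d := ⟨hd⟩
  have : Nontrivial (E d) := inferInstance
  have h0 : ∀ x, unifCube d n {x} = 0 := fun x => by
    rw [unifCube_eq hd, Measure.smul_apply, measure_mono_null
      (Set.singleton_subset_iff.2 (Set.mem_singleton x)) (le_zero_iff.1
        ((Measure.restrict_apply_le _ _).trans (measure_singleton x).le)), smul_zero]
  have h : ∀ k l : Fin n, k ≠ l → ∀ᵐ u ∂iidLaw (unifCube d n) n, u k ≠ u l := fun k l hkl => by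
    have hm : MeasurableSet {u : Fin n → E d | u k = u l} :=
      measurableSet_eq_fun (measurable_pi_apply k) (measurable_pi_apply l)
    have e := integral_pair (ν := unifCube d n) hkl (H := fun x y => ind (x = y)) (C := 1)
      (measurable_ind (measurableSet_eq_fun measurable_fst measurable_snd))
      fun x y => abs_ind_le_one
    have e0 : ∀ x : E d, ∫ y, ind (x = y) ∂unifCube d n = 0 := fun x => by
      have e1 : {y | x = y} = {x} := by
        ext y
        exact eq_comm
      rw [integral_ind (e1 ▸ measurableSet_singleton x), e1, measureReal_def, h0,
        ENNReal.toReal_zero]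
    simp only [e0, integral_zero] at e
    rw [integral_ind hm] at e
    rw [ae_iff]
    simpa [measureReal_def, ENNReal.toReal_eq_zero_iff] using e
  have h' : ∀ᵐ u ∂iidLaw (unifCube d n) n, ∀ k l : Fin n, k ≠ l → u k ≠ u l := by
    simp only [ae_all_iff, Filter.eventually_imp_distrib_left]
    exact h
  filter_upwards [h'] with u hu k l hkl
  by_contra hne
  exact hu k l hne hkl

theorem ae_mem_cube (hd : d ≠ 0) (hn : 1 ≤ n) :
    ∀ᵐ u ∂iidLaw (unifCube d n) n, ∀ i, u i ∈ cube d n := by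
  have := isProbabilityMeasure_unifCube hd hn
  exact ae_all_iff.2 fun i => (measurePreserving_eval (fun _ : Fin n => unifCube d n)
    i).quasiMeasurePreserving.ae (ae_cond_mem measurableSet_cube)

theorem singletonCount_eq (hn : 1 ≤ n) (hρ : 0 ≤ ρ) {u : Fin n → E d}
    (hu : Function.Injective u) (hc : ∀ i, u i ∈ cube d n) :
    singletonCount d n ρ u = isoCnt (near d n ρ) Finset.univ u := by
  rw [isoCnt, cnt_eq_sum, singletonCount]
  refine Finset.sum_congr rfl fun i _ => ?_
  rw [ind]
  congr 1
  rw [deg, cnt_eq_zero, eq_iff_iff]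
  constructor
  · intro h k hk hki
    have h1 : u k ∈ Set.range u ∩ torusBall d n ρ (u i) := ⟨⟨k, rfl⟩, hc k, hki⟩
    rw [h] at h1
    exact Finset.ne_of_mem_erase hk (hu h1)
  · intro h
    ext x
    constructor
    · rintro ⟨⟨k, rfl⟩, -, hk⟩
      by_contra hx
      refine h k (Finset.mem_erase.2 ⟨fun e => hx ?_, Finset.mem_univ k⟩) hk
      rw [e]
      rfl
    · rintro rfl
      exact ⟨⟨i, rfl⟩, hc i, near_refl hn hρ (u i)⟩

variable {Ω : Type*} [MeasurableSpace Ω] {P : Measure Ω} {U : Fin n → Ω → E d}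

theorem IsUniformSample.measurable_pi (hU : IsUniformSample d n P U) :
    Measurable fun ω i => U i ω :=
  measurable_pi_lambda _ hU.measurable

/-- The number of isolated sample points, almost surely. -/
theorem IsUniformSample.singletonCount_ae (hU : IsUniformSample d n P U) (hd : d ≠ 0) (hn : 1 ≤ n)
    (hρ : 0 ≤ ρ) : (fun ω => singletonCount d n ρ fun i => U i ω) =ᵐ[P]
      fun ω => (isoCnt (near d n ρ) Finset.univ (fun i => U i ω) : ℝ) := by
  have h := (ae_injective (n := n) hd hn).and (ae_mem_cube hd hn)
  rw [← hU.map_eq] at h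
  filter_upwards [ae_of_ae_map hU.measurable_pi.aemeasurable h] with ω hω
  exact singletonCount_eq hn hρ hω.1 hω.2

end Sample

end BinomialCoverage
end

noncomputable section
set_option linter.unusedSectionVars false

namespace BinomialCoverage

/-! ### Distributional comparison with independent points -/

section Comparison

variable {d n : ℕ} {Ω : Type*} [MeasurableSpace Ω] {P : Measure Ω} {U : Fin n → Ω → E d}
  {X : Ω → ℝ} {F : (Fin n → E d) → ℝ}

theorem IsUniformSample.integral_eq (hU : IsUniformSample d n P U) (hF : Measurable F)
    (h : X =ᵐ[P] fun ω => F fun i => U i ω) : ∫ ω, X ω ∂P = ∫ u, F u ∂iidLaw (unifCube d n) n := by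
  rw [integral_congr_ae h, ← hU.map_eq, integral_map hU.measurable_pi.aemeasurable
    hF.aestronglyMeasurable]

theorem IsUniformSample.variance_eq (hU : IsUniformSample d n P U) (hF : Measurable F)
    (h : X =ᵐ[P] fun ω => F fun i => U i ω) :
    variance X P = variance F (iidLaw (unifCube d n) n) := by
  rw [variance_congr h, ← hU.map_eq, variance_map hF.aemeasurable hU.measurable_pi.aemeasurable]
  rfl

theorem IsUniformSample.kolmogorovDist_eq (hU : IsUniformSample d n P U) (hF : Measurable F)
    (h : X =ᵐ[P] fun ω => F fun i => U i ω) :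
    kolmogorovDist P X = kolmogorovDist (iidLaw (unifCube d n) n) F := by
  rw [kolmogorovDist_congr h, ← hU.map_eq, kolmogorovDist_map hU.measurable_pi hF]

end Comparison

/-! ### Asymptotics of the bounds -/

/-- With a variance `n * v`, the factor `√n` is the square of `√√n` and is absorbed into the squared
sum, so only `√n * e` still depends on `n` once `v` stabilises. -/
theorem sqrt_mul_bound_eq {n v q a b e : ℝ} (hn : 0 < n) :
    √n * (n * q / (5 * (n * v)) * (√(a / √(n * v) + 5 * e) + b / √√(n * v)) ^ 2) =
      q / (5 * v) * (√(a / √v + 5 * (√n * e)) + b / √√v) ^ 2 := by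
  have hs : 0 < √n := Real.sqrt_pos.2 hn
  have ht : 0 < √√n := Real.sqrt_pos.2 hs
  have htt : √√n ^ 2 = √n := Real.sq_sqrt hs.le
  have e1 : √(a / √v + 5 * (√n * e)) = √√n * √(a / √(n * v) + 5 * e) := by
    rw [← Real.sqrt_mul hs.le, Real.sqrt_mul hn.le]
    congr 1
    field_simp
  have e2 : b / √√v = √√n * (b / √√(n * v)) := by
    rw [Real.sqrt_mul hn.le, Real.sqrt_mul hs.le]
    field_simp
  have e3 : n * q / (5 * (n * v)) = q / (5 * v) := by field_simp
  rw [e1, e2, e3, ← mul_add, mul_pow, htt]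
  ring

/-- The limit `e` of the scaled error may be replaced by any larger `e'`. This is how `√η` enters
although the estimates above give a smaller constant. -/
theorem limsup_sqrt_mul_le {D var q err : ℕ → ℝ} {g Q a b e e' : ℝ} (hg : 0 < g) (hQ : 0 ≤ Q)
    (hvar : Tendsto (fun n : ℕ => var n / n) atTop (𝓝 g)) (hq : Tendsto q atTop (𝓝 Q))
    (he : Tendsto (fun n : ℕ => √(n : ℝ) * err n) atTop (𝓝 e)) (hb : 0 ≤ b) (hee : e ≤ e')
    (hD : ∀ᶠ n : ℕ in atTop, D n ≤ n * q n / (5 * var n) *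
      (√(a / √(var n) + 5 * err n) + b / √√(var n)) ^ 2) :
    limsup (fun n : ℕ => ((√(n : ℝ) * D n : ℝ) : EReal)) atTop ≤
      ((Q / (5 * g) * (√(a / √g + 5 * e') + b / g ^ (1 / 4 : ℝ)) ^ 2 : ℝ) : EReal) := by
  have hs : Tendsto (fun n : ℕ => √(var n / n)) atTop (𝓝 √g) :=
    (Real.continuous_sqrt.tendsto g).comp hvar
  have hss : Tendsto (fun n : ℕ => √√(var n / n)) atTop (𝓝 √√g) :=
    (Real.continuous_sqrt.tendsto _).comp hs
  have h1 : 0 < √g := Real.sqrt_pos.2 hg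
  have h2 : 0 < √√g := Real.sqrt_pos.2 h1
  have hlim : Tendsto (fun n : ℕ => q n / (5 * (var n / n)) *
      (√(a / √(var n / n) + 5 * (√(n : ℝ) * err n)) + b / √√(var n / n)) ^ 2) atTop
      (𝓝 (Q / (5 * g) * (√(a / √g + 5 * e) + b / √√g) ^ 2)) := by
    refine (hq.div (hvar.const_mul 5) (by positivity)).mul (Tendsto.pow ?_ 2)
    exact ((Real.continuous_sqrt.tendsto _).comp
      ((tendsto_const_nhds.div hs h1.ne').add (he.const_mul 5))).add
      (tendsto_const_nhds.div hss h2.ne')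
  have hle : ∀ᶠ n : ℕ in atTop, ((√(n : ℝ) * D n : ℝ) : EReal) ≤
      ((q n / (5 * (var n / n)) * (√(a / √(var n / n) + 5 * (√(n : ℝ) * err n)) +
        b / √√(var n / n)) ^ 2 : ℝ) : EReal) := by
    filter_upwards [hD, eventually_ge_atTop 1] with n hn hn1
    have hn0 : (0 : ℝ) < n := by exact_mod_cast hn1
    rw [EReal.coe_le_coe_iff, ← sqrt_mul_bound_eq hn0, mul_div_cancel₀ _ hn0.ne']
    exact mul_le_mul_of_nonneg_left hn (Real.sqrt_nonneg _)
  refine (limsup_le_limsup hle).trans ?_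
  refine (((continuous_coe_real_ereal.tendsto _).comp hlim).limsup_eq).trans_le ?_
  rw [EReal.coe_le_coe_iff]
  have h4 : g ^ (1 / 4 : ℝ) = √√g := by
    rw [Real.sqrt_eq_rpow, Real.sqrt_eq_rpow, ← Real.rpow_mul hg.le]
    norm_num
  rw [h4]
  gcongr

/-! ### Lower bound for integer-valued variables -/

theorem nd_anti {x s : ℝ} (h : |x| ≤ s) : nd s ≤ nd x := by
  rw [nd_eq, nd_eq]
  have := sq_le_sq' (by linarith [neg_abs_le x, abs_nonneg x]) h
  have h2 : x ^ 2 ≤ s ^ 2 := by rwa [sq_abs] at this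
  gcongr

/-- With `k` the integer part of the mean, `N ≤ k` and `N < k + 1` are the same event, while `ncdf`
rises between the two standardized levels. These levels lie within `1 / σ` of 0 and are `1 / σ`
apart, so the rise is at least `nd (1 / σ) / σ`; it is at most twice the distance. -/
theorem nd_div_le_kolmogorovDist {Ω : Type*} [MeasurableSpace Ω] {P : Measure Ω}
    [IsProbabilityMeasure P] (N : Ω → ℕ) (hσ : 0 < variance (fun ω => (N ω : ℝ)) P) :
    nd (1 / √(variance (fun ω => (N ω : ℝ)) P)) / (2 * √(variance (fun ω => (N ω : ℝ)) P)) ≤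
      kolmogorovDist P fun ω => (N ω : ℝ) := by
  have hs : 0 < √(variance (fun ω => (N ω : ℝ)) P) := Real.sqrt_pos.2 hσ
  set μ := ∫ ω, (N ω : ℝ) ∂P with hμ
  set k : ℕ := ⌊μ⌋₊
  have hμ0 : 0 ≤ μ := integral_nonneg fun ω => Nat.cast_nonneg _
  have k1 : (k : ℝ) ≤ μ := Nat.floor_le hμ0
  have k2 : μ < k + 1 := Nat.lt_floor_add_one μ
  have h1 := le_kolmogorovDist (P := P) (X := fun ω => (N ω : ℝ))
    ((k - μ) / √(variance (fun ω => (N ω : ℝ)) P))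
  have h2 := abs_measureReal_lt_sub_ncdf_le (P := P) (X := fun ω => (N ω : ℝ))
    ((k + 1 - μ) / √(variance (fun ω => (N ω : ℝ)) P))
  rw [← hμ] at h1 h2
  have e : {ω | ((N ω : ℝ) - μ) / √(variance (fun ω => (N ω : ℝ)) P) ≤
      (k - μ) / √(variance (fun ω => (N ω : ℝ)) P)} =
      {ω | ((N ω : ℝ) - μ) / √(variance (fun ω => (N ω : ℝ)) P) <
        (k + 1 - μ) / √(variance (fun ω => (N ω : ℝ)) P)} := by
    ext ω
    simp only [Set.mem_ofPred_eq]
    rw [div_le_div_iff_of_pos_right hs, div_lt_div_iff_of_pos_right hs, sub_le_sub_iff_right,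
      sub_lt_sub_iff_right, Nat.cast_le]
    exact_mod_cast Nat.lt_succ_iff.symm
  rw [e] at h1
  generalize √(variance (fun ω => (N ω : ℝ)) P) = s at *
  have h3 : ncdf ((k + 1 - μ) / s) - ncdf ((k - μ) / s) ≤
      2 * kolmogorovDist P fun ω => (N ω : ℝ) := by
    have := abs_le.1 h1
    have := abs_le.1 h2
    linarith
  have hle : (k - μ) / s ≤ (k + 1 - μ) / s := by gcongr; linarith
  have h4 : ∫ x in ((k - μ) / s)..((k + 1 - μ) / s), nd (1 / s) ≤
      ∫ x in ((k - μ) / s)..((k + 1 - μ) / s), nd x := by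
    refine intervalIntegral.integral_mono_on hle (by simp)
      (continuous_nd.intervalIntegrable _ _) fun x hx => nd_anti ?_
    have l1 : -(1 / s) ≤ (k - μ) / s := by
      rw [← neg_div]
      gcongr
      linarith
    have l2 : (k + 1 - μ) / s ≤ 1 / s := by
      gcongr
      linarith
    rw [abs_le]
    exact ⟨l1.trans hx.1, hx.2.trans l2⟩
  rw [← ncdf_sub, intervalIntegral.integral_const, smul_eq_mul] at h4
  have e5 : ((k + 1 - μ) / s - (k - μ) / s) * nd (1 / s) = 2 * (nd (1 / s) / (2 * s)) := by
    field_simp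
    ring
  linarith

theorem le_liminf_sqrt_mul {D var : ℕ → ℝ} {g : ℝ} (hg : 0 < g)
    (hvar : Tendsto (fun n : ℕ => var n / n) atTop (𝓝 g))
    (hD : ∀ᶠ n : ℕ in atTop, nd (1 / √(var n)) / (2 * √(var n)) ≤ D n) :
    (((8 * Real.pi * g) ^ (-(1 / 2) : ℝ) : ℝ) : EReal) ≤
      liminf (fun n : ℕ => ((√(n : ℝ) * D n : ℝ) : EReal)) atTop := by
  have hs : Tendsto (fun n : ℕ => √(var n / n)) atTop (𝓝 √g) :=
    (Real.continuous_sqrt.tendsto g).comp hvar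
  have h1 : 0 < √g := Real.sqrt_pos.2 hg
  have hsq : Tendsto (fun n : ℕ => √(n : ℝ)) atTop atTop :=
    Real.tendsto_sqrt_atTop.comp tendsto_natCast_atTop_atTop
  have hz : Tendsto (fun n : ℕ => 1 / (√(n : ℝ) * √(var n / n))) atTop (𝓝 0) :=
    (hsq.atTop_mul_pos h1 hs).const_div_atTop 1
  have hlim := ((continuous_nd.tendsto 0).comp hz).div (hs.const_mul 2) (by positivity)
  -- In the limit the density is taken at 0, where it equals `1 / √(2 * π)`.
  have el : nd 0 / (2 * √g) = (8 * Real.pi * g) ^ (-(1 / 2) : ℝ) := by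
    have e1 : √(8 * Real.pi * g) = 2 * √(2 * Real.pi) * √g := by
      rw [show 8 * Real.pi * g = 2 ^ 2 * (2 * Real.pi) * g by ring, Real.sqrt_mul (by positivity),
        Real.sqrt_mul (by positivity), Real.sqrt_sq zero_le_two]
    rw [Real.rpow_neg (by positivity), ← Real.sqrt_eq_rpow, nd_eq, e1, zero_pow two_ne_zero,
      neg_zero, zero_div, Real.exp_zero]
    field_simp
  rw [el] at hlim
  rw [← ((continuous_coe_real_ereal.tendsto _).comp hlim).liminf_eq]
  refine liminf_le_liminf ?_
  filter_upwards [hD, eventually_ge_atTop 1] with n hn hn1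
  have hn0 : (0 : ℝ) < n := by exact_mod_cast hn1
  simp only [Function.comp_apply, EReal.coe_le_coe_iff, Pi.div_apply]
  have e : √(var n) = √n * √(var n / n) := by
    rw [← Real.sqrt_mul hn0.le, mul_div_cancel₀ _ hn0.ne']
  rw [e] at hn
  refine le_trans (le_of_eq ?_) (mul_le_mul_of_nonneg_left hn (Real.sqrt_nonneg n))
  have : 0 < √(n : ℝ) := Real.sqrt_pos.2 hn0
  field_simp

theorem isTheta_of_limsup_liminf {D : ℕ → ℝ} {c C : ℝ} (hc : 0 < c)
    (h1 : limsup (fun n : ℕ => ((√(n : ℝ) * D n : ℝ) : EReal)) atTop ≤ (C : EReal))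
    (h2 : (c : EReal) ≤ liminf (fun n : ℕ => ((√(n : ℝ) * D n : ℝ) : EReal)) atTop) :
    Asymptotics.IsTheta atTop D fun n : ℕ => (n : ℝ) ^ (-(1 / 2) : ℝ) := by
  have u1 := eventually_lt_of_limsup_lt (h1.trans_lt (EReal.coe_lt_coe_iff.2 (lt_add_one C)))
  have u2 := eventually_lt_of_lt_liminf
    ((EReal.coe_lt_coe_iff.2 (half_lt_self hc)).trans_le h2)
  have e : ∀ n : ℕ, (n : ℝ) ^ (-(1 / 2) : ℝ) = (√(n : ℝ))⁻¹ := fun n => by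
    rw [Real.rpow_neg (Nat.cast_nonneg n), Real.sqrt_eq_rpow]
  simp only [e]
  constructor
  · refine Asymptotics.IsBigO.of_bound (C + 1) ?_
    filter_upwards [u1, u2, eventually_ge_atTop 1] with n h1 h2 hn1
    have hs : 0 < √(n : ℝ) := Real.sqrt_pos.2 (by exact_mod_cast hn1)
    rw [EReal.coe_lt_coe_iff] at h1 h2
    have hD : 0 < D n := pos_of_mul_pos_right (by linarith : 0 < √(n : ℝ) * D n) hs.le
    rw [Real.norm_of_nonneg hD.le, Real.norm_of_nonneg (by positivity), ← div_eq_mul_inv,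
      le_div_iff₀ hs]
    linarith
  · refine Asymptotics.IsBigO.of_bound (2 / c) ?_
    filter_upwards [u2, eventually_ge_atTop 1] with n h2 hn1
    have hs : 0 < √(n : ℝ) := Real.sqrt_pos.2 (by exact_mod_cast hn1)
    rw [EReal.coe_lt_coe_iff] at h2
    have hD : 0 < D n := pos_of_mul_pos_right (by linarith : 0 < √(n : ℝ) * D n) hs.le
    rw [Real.norm_of_nonneg hD.le, Real.norm_of_nonneg (by positivity), inv_le_iff_one_le_mul₀ hs]
    have : 1 ≤ 2 / c * (√(n : ℝ) * D n) := by
      rw [div_mul_eq_mul_div, le_div_iff₀ hc]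
      linarith
    linarith

end BinomialCoverage
end

noncomputable section
set_option linter.unusedSectionVars false

namespace BinomialCoverage

/-! ### Asymptotics for independent uniform points on the torus -/

section Asymptotic

variable {d : ℕ} {ρ : ℝ}

theorem eventually_pos_of_tendsto_div {var : ℕ → ℝ} {g : ℝ} (hg : 0 < g)
    (h : Tendsto (fun n : ℕ => var n / n) atTop (𝓝 g)) : ∀ᶠ n in atTop, 0 < var n := by
  filter_upwards [h.eventually_const_lt hg] with n hn
  by_contra hv
  exact hn.not_ge (div_nonpos_of_nonpos_of_nonneg (not_lt.1 hv) (Nat.cast_nonneg n))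

theorem tendsto_one_sub_phi_div_pow (d : ℕ) (ρ : ℝ) (j : ℕ) :
    Tendsto (fun n : ℕ => (1 - phi d ρ / n) ^ (n - j)) atTop (𝓝 (Real.exp (-phi d ρ))) := by
  refine (tendsto_one_add_div_pow_sub (-phi d ρ) j).congr fun n => ?_
  rw [neg_div, sub_eq_add_neg]

theorem phi_div_pos (hρ : 0 < ρ) {n : ℕ} (hn : 1 ≤ n) : 0 < phi d ρ / n :=
  div_pos (phi_pos hρ) (by exact_mod_cast hn)

theorem phi_div_lt_one {n : ℕ} (hn : 1 ≤ n) (h : phi d ρ < n) : phi d ρ / n < 1 :=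
  (div_lt_one (by exact_mod_cast hn)).2 h

theorem one_sub_exp_neg_phi_nonneg (hρ : 0 < ρ) : 0 ≤ 1 - Real.exp (-phi d ρ) := by
  have := Real.exp_le_one_iff.2 (neg_nonpos.2 (phi_pos (d := d) hρ).le)
  linarith

theorem tendsto_integral_coverVol (hd : d ≠ 0) (hρ : 0 < ρ) :
    Tendsto (fun n : ℕ => 1 - (∫ u : Fin n → E d, coverVol (unifCube d n) (near d n ρ) u
      ∂iidLaw (unifCube d n) n) / n) atTop (𝓝 (Real.exp (-phi d ρ))) := by
  refine (tendsto_one_sub_phi_div_pow d ρ 0).congr' ?_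
  filter_upwards [eventually_large hd ρ 2] with n ⟨hn, hr, hφ⟩
  have := isProbabilityMeasure_unifCube hd hn
  have hn' : (n : ℝ) ≠ 0 := by positivity
  rw [(ballRel_near hd hn hρ.le (by linarith)).integral_coverVol hn (phi_div_pos hρ hn)
    (phi_div_lt_one hn hφ), mul_div_cancel_left₀ _ hn', sub_sub_cancel, Nat.sub_zero]

theorem tendsto_integral_isoCnt (hd : d ≠ 0) (hρ : 0 < ρ) :
    Tendsto (fun n : ℕ => (∫ u : Fin n → E d, (isoCnt (near d n ρ) Finset.univ u : ℝ)
      ∂iidLaw (unifCube d n) n) / n) atTop (𝓝 (Real.exp (-phi d ρ))) := by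
  refine (tendsto_one_sub_phi_div_pow d ρ 1).congr' ?_
  filter_upwards [eventually_large hd ρ 2] with n ⟨hn, hr, hφ⟩
  have := isProbabilityMeasure_unifCube hd hn
  have hn' : (n : ℝ) ≠ 0 := by positivity
  rw [(ballRel_near hd hn hρ.le (by linarith)).integral_isoCnt (Nat.succ_pred_eq_of_pos hn).symm,
    mul_div_cancel_left₀ _ hn', Nat.pred_eq_sub_one]

/-- The left side is the limit of `n` times the Efron–Stein bound for `volMove`. The first summand
of `η_V`, with its last factor replaced by 1, already dominates it because `3 ^ d + 1 ≥ 3`. -/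
theorem sq_le_etaV (hd : d ≠ 0) (hρ : 0 < ρ) : (phi d ρ * (1 + 3 * phi d ρ)) ^ 2 ≤ etaV d ρ := by
  rw [etaV_eq]
  have h0 := (phi_pos (d := d) hρ).le
  generalize phi d ρ = x at *
  have h1 : (3 : ℝ) ≤ 3 ^ d := le_self_pow₀ (by norm_num) hd
  have h2 : x * (1 + 3 * x) ≤ x * ((3 ^ d + 1) * x + 1) :=
    mul_le_mul_of_nonneg_left (by nlinarith) h0
  have h3 := pow_le_pow_left₀ (by positivity) h2 2
  have h4 : 0 ≤ x ^ 2 * ((3 ^ d + 1) * x + 1) ^ 2 := by positivity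
  have h5 : 0 ≤ 2 * x ^ 2 * ((3 ^ d + 1) * x + 1) ^ 2 *
      ((2 ^ d + 1) * 6 ^ d * x + 2 * 6 ^ (2 * d) * x ^ 2) := by positivity
  have h6 : 0 ≤ 2 * x ^ 4 * (3 * (4 ^ d + 2 ^ d) * x + 6 * 4 ^ d * x ^ 2 + 4) := by positivity
  rw [mul_pow x (_ + 1)] at h3
  linarith

/-- The left side is the limit of `n` times the Efron–Stein bound for `isoMove`. The first summand
of `η_S` suffices; the coefficients are compared through `κ + 2 ≤ 1 + 2 * κ` and `κ + 3 ≤ 2 + 2 *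
κ`, which need `κ ≥ 1`. -/
theorem le_etaS (hd : d ≠ 0) (hρ : 0 < ρ) :
    ((kappa d : ℝ) + 2) ^ 2 + 2 * (kappa d + 2) * (kappa d + 3) * phi d (3 * ρ) +
      (kappa d + 3) ^ 2 * (phi d (3 * ρ) + phi d (3 * ρ) ^ 2) ≤ etaS d ρ := by
  rw [etaS_eq, phi_mul]
  have h0 := (phi_pos (d := d) hρ).le
  have hk : (1 : ℝ) ≤ kappa d := by exact_mod_cast one_le_kappa hd
  have h2 : (2 : ℝ) ≤ 2 ^ d := le_self_pow₀ (by norm_num) hd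
  rw [show (9 : ℝ) ^ d = 3 ^ d * 3 ^ d by rw [← mul_pow]; norm_num]
  generalize (kappaPlus d : ℝ) = K
  generalize phi d ρ = x at *
  generalize (kappa d : ℝ) = κ at *
  have h6 : 0 ≤ K ^ 2 / 2 * ((2 ^ d + 2 * 3 ^ d + 3) * x + (2 ^ (d + 1) + 1) * 2 * x ^ 2 + 4) := by
    positivity
  have hl : (0 : ℝ) ≤ 3 ^ d * x := by positivity
  have e : (2 : ℝ) * (1 + 2 * κ) ^ 2 * (1 + (2 ^ d + 1) * 3 ^ d * x + 2 * (3 ^ d * 3 ^ d) * x ^ 2) =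
      2 * (1 + 2 * κ) ^ 2 * (1 + (2 ^ d + 1) * (3 ^ d * x) + 2 * (3 ^ d * x) ^ 2) := by ring
  rw [e]
  generalize (3 : ℝ) ^ d * x = l at *
  have h7 : 2 * (1 + 2 * κ) ^ 2 * (1 + 3 * l + 2 * l ^ 2) ≤
      2 * (1 + 2 * κ) ^ 2 * (1 + (2 ^ d + 1) * l + 2 * l ^ 2) := by
    gcongr
    linarith
  have a1 : (κ + 2) ^ 2 ≤ (1 + 2 * κ) ^ 2 := by gcongr ?_ ^ 2; linarith
  have a2 : (κ + 3) ^ 2 ≤ (2 + 2 * κ) ^ 2 := by gcongr ?_ ^ 2; linarith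
  have a3 : (2 + 2 * κ) ^ 2 ≤ 2 * (1 + 2 * κ) ^ 2 := by nlinarith
  have a4 : (κ + 2) * (κ + 3) ≤ (1 + 2 * κ) * (2 + 2 * κ) :=
    mul_le_mul (by linarith) (by linarith) (by linarith) (by linarith)
  have a5 : 2 * ((1 + 2 * κ) * (2 + 2 * κ)) ≤ 4 * (1 + 2 * κ) ^ 2 := by nlinarith
  have b1 := mul_le_mul_of_nonneg_right a2 hl
  have b2 := mul_le_mul_of_nonneg_right a3 hl
  have b3 := mul_le_mul_of_nonneg_right a4 hl
  have b4 := mul_le_mul_of_nonneg_right a5 hl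
  have b5 := mul_le_mul_of_nonneg_right (a2.trans a3) (sq_nonneg l)
  nlinarith [mul_nonneg (sq_nonneg (1 + 2 * κ)) (sq_nonneg l), sq_nonneg (1 + 2 * κ)]

theorem tendsto_const_div_sqrt (c : ℝ) : Tendsto (fun n : ℕ => c / √(n : ℝ)) atTop (𝓝 0) :=
  (Real.tendsto_sqrt_atTop.comp tendsto_natCast_atTop_atTop).const_div_atTop c

theorem limsup_kolmogorovDist_coverVol [NeZero d] (hρ : 0 < ρ) :
    limsup (fun n : ℕ => ((√(n : ℝ) * kolmogorovDist (iidLaw (unifCube d n) n)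
      (fun u : Fin n → E d => coverVol (unifCube d n) (near d n ρ) u) : ℝ) : EReal)) atTop ≤
      (((1 - Real.exp (-phi d ρ)) / (5 * gV d ρ) *
        (√(11 * phi d ρ ^ 2 / √(gV d ρ) + 5 * √(etaV d ρ))
          + 2 * phi d ρ / gV d ρ ^ (1 / 4 : ℝ)) ^ 2 : ℝ) : EReal) := by
  have hd := NeZero.ne d
  have hg : 0 < gV d ρ := limVarV_eq (d := d) hρ ▸ limVarV_pos hd hρ
  have hvar := tendsto_variance_coverVol hd hρ
  rw [limVarV_eq hρ] at hvar
  have h0 := (phi_pos (d := d) hρ).le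
  refine limsup_sqrt_mul_le hg (one_sub_exp_neg_phi_nonneg hρ) hvar
    -- Only the Efron–Stein part of the error survives multiplication by `√n`; the part from
    -- replacing `meanMove` is of order `1 / n`.
    ((tendsto_one_sub_phi_div_pow d ρ 0).const_sub 1) (e := phi d ρ * (1 + 3 * phi d ρ))
    (err := fun n => √(n * (phi d ρ / n * (1 + 3 * phi d ρ)) ^ 2) +
      2 * (phi d ρ / n * (1 + phi d ρ))) ?_ (by positivity)
    (Real.le_sqrt_of_sq_le (sq_le_etaV hd hρ)) ?_
  · have h := (tendsto_const_div_sqrt (2 * (phi d ρ * (1 + phi d ρ)))).const_add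
      (phi d ρ * (1 + 3 * phi d ρ))
    rw [add_zero] at h
    refine h.congr' ?_
    filter_upwards [eventually_ge_atTop 1] with n hn
    have hn0 : (0 : ℝ) < n := by exact_mod_cast hn
    have hs : 0 < √(n : ℝ) := Real.sqrt_pos.2 hn0
    rw [Real.sqrt_mul hn0.le, Real.sqrt_sq (by positivity)]
    have hss : √(n : ℝ) * √(n : ℝ) = n := Real.mul_self_sqrt hn0.le
    generalize √(n : ℝ) = s at *
    rw [← hss]
    field_simp
  · filter_upwards [eventually_large hd ρ 2, eventually_pos_of_tendsto_div hg hvar] with n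
      ⟨hn, hr, hφ⟩ hv
    have := isProbabilityMeasure_unifCube hd hn
    have hn0 : (n : ℝ) ≠ 0 := by positivity
    have h := (ballRel_near hd hn hρ.le (by linarith)).kolmogorovDist_coverVol_le hn
      (phi_div_pos hρ hn) (phi_div_lt_one hn hφ) hv
    rwa [mul_div_cancel₀ _ hn0] at h

theorem variance_natCast_sub_isoCnt {n : ℕ} (hd : d ≠ 0) (hn : 1 ≤ n) (hρ : 0 < ρ)
    (hr : 2 * ρ < side d n) :
    variance (fun u : Fin n → E d => (n : ℝ) - isoCnt (near d n ρ) Finset.univ u)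
      (iidLaw (unifCube d n) n) =
    variance (fun u : Fin n → E d => (isoCnt (near d n ρ) Finset.univ u : ℝ))
      (iidLaw (unifCube d n) n) := by
  have := isProbabilityMeasure_unifCube hd hn
  have hm : Measurable fun u : Fin n → E d => (isoCnt (near d n ρ) Finset.univ u : ℝ) :=
    measurable_natCast_comp ((ballRel_near hd hn hρ.le (by linarith)).measurable_isoCnt _)
  exact variance_const_sub hm.aestronglyMeasurable n

theorem kolmogorovDist_isoCnt_le_sub {n : ℕ} (hd : d ≠ 0) (hn : 1 ≤ n) (hρ : 0 < ρ)
    (hr : 2 * ρ < side d n) :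
    kolmogorovDist (iidLaw (unifCube d n) n)
      (fun u : Fin n → E d => (isoCnt (near d n ρ) Finset.univ u : ℝ)) ≤
    kolmogorovDist (iidLaw (unifCube d n) n)
      (fun u : Fin n → E d => (n : ℝ) - isoCnt (near d n ρ) Finset.univ u) := by
  have := isProbabilityMeasure_unifCube hd hn
  have hm : Measurable fun u : Fin n → E d => (isoCnt (near d n ρ) Finset.univ u : ℝ) :=
    measurable_natCast_comp ((ballRel_near hd hn hρ.le (by linarith)).measurable_isoCnt _)
  have hi : Integrable (fun u : Fin n → E d => (n : ℝ) - isoCnt (near d n ρ) Finset.univ u)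
      (iidLaw (unifCube d n) n) := integrable_of_abs_le (C := n) (hm.const_sub _) fun u => by
    have : (isoCnt (near d n ρ) Finset.univ u : ℝ) ≤ n := by
      exact_mod_cast cnt_le_card.trans_eq (Finset.card_fin n)
    rw [abs_of_nonneg (by linarith)]
    simp
  simpa using kolmogorovDist_const_sub_le (hm.const_sub _) hi n

theorem limsup_kolmogorovDist_isoCnt [NeZero d] (hρ : 0 < ρ) :
    limsup (fun n : ℕ => ((√(n : ℝ) * kolmogorovDist (iidLaw (unifCube d n) n)
      (fun u : Fin n → E d => (isoCnt (near d n ρ) Finset.univ u : ℝ)) : ℝ) : EReal)) atTop ≤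
      (((1 - Real.exp (-phi d ρ)) / (5 * gS d ρ) *
        (√(11 * (kappaPlus d : ℝ) ^ 2 / √(gS d ρ) + 5 * √(etaS d ρ))
          + 2 * (kappaPlus d : ℝ) / gS d ρ ^ (1 / 4 : ℝ)) ^ 2 : ℝ) : EReal) := by
  have hd := NeZero.ne d
  have hg : 0 < gS d ρ := limVarS_eq (d := d) hρ ▸ limVarS_pos hd hρ
  have hvar := tendsto_variance_isoCnt hd hρ
  rw [limVarS_eq hρ] at hvar
  have h0 := (phi_pos (d := d) (r := 3 * ρ) (by positivity)).le
  have hle := le_etaS hd hρ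
  have hK : (kappaPlus d : ℝ) = kappa d + 1 := by rw [kappaPlus]; push_cast; ring
  rw [hK]
  generalize hA : ((kappa d : ℝ) + 2) ^ 2 = A at hle
  generalize hB : 2 * ((kappa d : ℝ) + 2) * (kappa d + 3) = B at hle
  generalize hC : ((kappa d : ℝ) + 3) ^ 2 = C at hle
  have hratio : Tendsto (fun n : ℕ => ((n - 1 : ℕ) : ℝ) / n) atTop (𝓝 1) := by
    refine (tendsto_ratio 1 1 0).congr' ?_
    filter_upwards [eventually_ge_atTop 1] with n hn
    rw [Nat.cast_sub hn]
    simp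
  have hl : Tendsto (fun n : ℕ => ((n - 1 : ℕ) : ℝ) * (phi d (3 * ρ) / n)) atTop
      (𝓝 (phi d (3 * ρ))) := by
    have h := hratio.mul_const (phi d (3 * ρ))
    rw [one_mul] at h
    refine h.congr fun n => ?_
    ring
  refine limsup_sqrt_mul_le hg (one_sub_exp_neg_phi_nonneg hρ) hvar
    ((tendsto_one_sub_phi_div_pow d ρ 1).const_sub 1)
    (e := √(A + B * phi d (3 * ρ) + C * (phi d (3 * ρ) + phi d (3 * ρ) ^ 2)))
    (err := fun n => √(n * ((A + B * ((n - 1 : ℕ) * (phi d (3 * ρ) / n)) +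
      C * ((n - 1 : ℕ) * (phi d (3 * ρ) / n) + ((n - 1 : ℕ) * (phi d (3 * ρ) / n)) ^ 2)) /
        ((n - 1 : ℕ) : ℝ) ^ 2)) +
      2 * ((2 * kappa d + 2) * (1 + (n - 1 : ℕ) * (phi d (3 * ρ) / n)) / (n - 1 : ℕ)))
    ?_ (by positivity) (Real.sqrt_le_sqrt hle) ?_
  · have hQ := ((hl.const_mul B).const_add A).add ((hl.add (hl.pow 2)).const_mul C)
    have h1 := (Real.continuous_sqrt.tendsto _).comp (hQ.div (hratio.pow 2) (by norm_num))
    have h2 := (((hl.const_add 1).const_mul (2 * (kappa d : ℝ) + 2)).div hratio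
      one_ne_zero).mul (tendsto_const_div_sqrt 2)
    have h := h1.add h2
    simp only [one_pow, div_one, mul_zero, add_zero] at h
    refine h.congr' ?_
    filter_upwards [eventually_ge_atTop 2] with n hn
    have hn0 : (0 : ℝ) < n := by positivity
    have hm0 : (0 : ℝ) < (n - 1 : ℕ) := by
      have : 0 < n - 1 := by omega
      exact_mod_cast this
    have hs : 0 < √(n : ℝ) := Real.sqrt_pos.2 hn0
    have hss : √(n : ℝ) * √(n : ℝ) = n := Real.mul_self_sqrt hn0.le
    simp only [Function.comp_apply, Pi.div_apply]
    rw [mul_add √(n : ℝ), ← Real.sqrt_mul hn0.le]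
    congr 1
    · congr 1
      field_simp
    · generalize ((n - 1 : ℕ) : ℝ) * (phi d (3 * ρ) / n) = l
      generalize √(n : ℝ) = s at *
      rw [← hss]
      field_simp
  -- The factor 6 ensures that balls of radius `3 * ρ`, which serve as the three-step relation,
  -- still have their Euclidean volume on the torus.
  · filter_upwards [eventually_large hd ρ 6, eventually_pos_of_tendsto_div hg hvar,
      eventually_ge_atTop 2] with n ⟨hn, hr, hφ⟩ hv hn2
    have := isProbabilityMeasure_unifCube hd hn
    refine (kolmogorovDist_isoCnt_le_sub hd hn hρ (by linarith)).trans ?_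
    have hv' := variance_natCast_sub_isoCnt hd hn hρ (by linarith)
    have h := (ballRel_near hd hn hρ.le (by linarith)).kolmogorovDist_isoCnt_le (m := n - 1)
      (ballRel_near hd hn (r := 3 * ρ) (by positivity) (by linarith))
      (packing_near hd hn hρ n) (by omega) (by omega)
      (phi_div_pos hρ hn) (phi_div_lt_one hn hφ)
      (fun h1 h2 h3 => near_mono (near_trans hn (near_trans hn h1 h2) h3) (by linarith))
      (hv'.symm ▸ hv)
    rwa [hv', hA, hB, hC] at h

theorem le_liminf_kolmogorovDist_isoCnt [NeZero d] (hρ : 0 < ρ) :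
    (((8 * Real.pi * gS d ρ) ^ (-(1 / 2) : ℝ) : ℝ) : EReal) ≤
      liminf (fun n : ℕ => ((√(n : ℝ) * kolmogorovDist (iidLaw (unifCube d n) n)
        (fun u : Fin n → E d => (isoCnt (near d n ρ) Finset.univ u : ℝ)) : ℝ) : EReal)) atTop := by
  have hd := NeZero.ne d
  have hg : 0 < gS d ρ := limVarS_eq (d := d) hρ ▸ limVarS_pos hd hρ
  have hvar := tendsto_variance_isoCnt hd hρ
  rw [limVarS_eq hρ] at hvar
  refine le_liminf_sqrt_mul hg hvar ?_
  filter_upwards [eventually_pos_of_tendsto_div hg hvar, eventually_ge_atTop 1] with n hv hn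
  have := isProbabilityMeasure_unifCube hd hn
  exact nd_div_le_kolmogorovDist _ hv

end Asymptotic

end BinomialCoverage
end

theorem theorem2p3 (d : ℕ) [NeZero d] (ρ : ℝ) (hρ : 0 < ρ)
    {Ω : ℕ → Type*} [∀ n, MeasurableSpace (Ω n)] (P : ∀ n, Measure (Ω n))
    [∀ n, IsProbabilityMeasure (P n)] (U : ∀ n, Fin n → Ω n → BinomialCoverage.E d)
    (hU : ∀ n, IsUniformSample d n (P n) (U n))
    (V S : ∀ n, Ω n → ℝ)
    (hV : ∀ n ω, V n ω = coveredVolume d n ρ (fun i => U n i ω))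
    (hS : ∀ n ω, S n ω = singletonCount d n ρ (fun i => U n i ω)) :
    -- means
    Tendsto (fun n : ℕ => 1 - (∫ ω, V n ω ∂P n) / (n : ℝ)) atTop (𝓝 (Real.exp (-phi d ρ))) ∧
    Tendsto (fun n : ℕ => (∫ ω, S n ω ∂P n) / (n : ℝ)) atTop (𝓝 (Real.exp (-phi d ρ))) ∧
    -- variances
    (Tendsto (fun n : ℕ => variance (V n) (P n) / (n : ℝ)) atTop (𝓝 (gV d ρ)) ∧ 0 < gV d ρ) ∧
    (Tendsto (fun n : ℕ => variance (S n) (P n) / (n : ℝ)) atTop (𝓝 (gS d ρ)) ∧ 0 < gS d ρ) ∧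
    -- Kolmogorov distances; the limits superior and inferior are taken in the extended reals
    limsup (fun n : ℕ => ((√(n : ℝ) * kolmogorovDist (P n) (V n) : ℝ) : EReal)) atTop ≤
      (((1 - Real.exp (-phi d ρ)) / (5 * gV d ρ) *
        (√(11 * phi d ρ ^ 2 / √(gV d ρ) + 5 * √(etaV d ρ))
          + 2 * phi d ρ / gV d ρ ^ (1 / 4 : ℝ)) ^ 2 : ℝ) : EReal) ∧
    limsup (fun n : ℕ => ((√(n : ℝ) * kolmogorovDist (P n) (S n) : ℝ) : EReal)) atTop ≤
      (((1 - Real.exp (-phi d ρ)) / (5 * gS d ρ) *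
        (√(11 * (kappaPlus d : ℝ) ^ 2 / √(gS d ρ) + 5 * √(etaS d ρ))
          + 2 * (kappaPlus d : ℝ) / gS d ρ ^ (1 / 4 : ℝ)) ^ 2 : ℝ) : EReal) ∧
    (((8 * Real.pi * gS d ρ) ^ (-(1 / 2) : ℝ) : ℝ) : EReal) ≤
      liminf (fun n : ℕ => ((√(n : ℝ) * kolmogorovDist (P n) (S n) : ℝ) : EReal)) atTop ∧
    Asymptotics.IsTheta atTop (fun n : ℕ => kolmogorovDist (P n) (S n))
      (fun n : ℕ => (n : ℝ) ^ (-(1 / 2) : ℝ)) := by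
  have hd := NeZero.ne d
  -- The identification with functionals of independent points needs `n` large, so that a ball fits
  -- into the torus; every assertion is asymptotic and insensitive to small `n`.
  have hVeq : ∀ᶠ n : ℕ in atTop, V n =ᵐ[P n] (fun ω =>
      coverVol (unifCube d n) (near d n ρ) fun i => U n i ω) ∧
      Measurable fun u : Fin n → BinomialCoverage.E d => coverVol (unifCube d n) (near d n ρ) u := by
    filter_upwards [eventually_large hd ρ 2] with n ⟨hn, hr, _⟩
    have := isProbabilityMeasure_unifCube hd hn
    have hr' : ρ + ρ < side d n := by linarith
    exact ⟨.of_forall fun ω => (hV n ω).trans (coveredVolume_eq hd hn hρ.le hr' _),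
      (ballRel_near hd hn hρ.le hr').measurable_coverVol⟩
  have hSeq : ∀ᶠ n : ℕ in atTop, S n =ᵐ[P n] (fun ω =>
      (isoCnt (near d n ρ) Finset.univ (fun i => U n i ω) : ℝ)) ∧
      Measurable fun u : Fin n → BinomialCoverage.E d =>
        (isoCnt (near d n ρ) Finset.univ u : ℝ) := by
    filter_upwards [eventually_large hd ρ 2] with n ⟨hn, hr, _⟩
    have := isProbabilityMeasure_unifCube hd hn
    have hr' : ρ + ρ < side d n := by linarith
    refine ⟨?_, measurable_natCast_comp ((ballRel_near hd hn hρ.le hr').measurable_isoCnt _)⟩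
    exact (EventuallyEq.of_eq (funext (hS n))).trans ((hU n).singletonCount_ae hd hn hρ.le)
  have hgS : 0 < gS d ρ := limVarS_eq (d := d) hρ ▸ limVarS_pos hd hρ
  have hDS : (fun n : ℕ => kolmogorovDist (P n) (S n)) =ᶠ[atTop] fun n : ℕ =>
      kolmogorovDist (iidLaw (unifCube d n) n) (fun u : Fin n → BinomialCoverage.E d =>
        (isoCnt (near d n ρ) Finset.univ u : ℝ)) := by
    filter_upwards [hSeq] with n h
    exact (hU n).kolmogorovDist_eq h.2 h.1
  have hDS' : ∀ᶠ n : ℕ in atTop, ((√(n : ℝ) * kolmogorovDist (P n) (S n) : ℝ) : EReal) =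
      ((√(n : ℝ) * kolmogorovDist (iidLaw (unifCube d n) n)
        (fun u : Fin n → BinomialCoverage.E d =>
          (isoCnt (near d n ρ) Finset.univ u : ℝ)) : ℝ) : EReal) := by
    filter_upwards [hDS] with n h
    rw [h]
  have hlimsupS := (limsup_congr hDS').trans_le (limsup_kolmogorovDist_isoCnt hρ)
  have hliminfS := (le_liminf_kolmogorovDist_isoCnt hρ).trans_eq (liminf_congr hDS').symm
  refine ⟨?_, ?_, ⟨?_, limVarV_eq (d := d) hρ ▸ limVarV_pos hd hρ⟩, ⟨?_, hgS⟩, ?_, hlimsupS,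
    hliminfS, isTheta_of_limsup_liminf (by positivity) hlimsupS hliminfS⟩
  · refine (tendsto_integral_coverVol hd hρ).congr' ?_
    filter_upwards [hVeq] with n h
    rw [(hU n).integral_eq h.2 h.1]
  · refine (tendsto_integral_isoCnt hd hρ).congr' ?_
    filter_upwards [hSeq] with n h
    rw [(hU n).integral_eq h.2 h.1]
  · refine (limVarV_eq (d := d) hρ ▸ tendsto_variance_coverVol hd hρ).congr' ?_
    filter_upwards [hVeq] with n h
    rw [(hU n).variance_eq h.2 h.1]
  · refine (limVarS_eq (d := d) hρ ▸ tendsto_variance_isoCnt hd hρ).congr' ?_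
    filter_upwards [hSeq] with n h
    rw [(hU n).variance_eq h.2 h.1]
  · refine (limsup_congr ?_).trans_le (limsup_kolmogorovDist_coverVol (d := d) hρ)
    filter_upwards [hVeq] with n h
    rw [(hU n).kolmogorovDist_eq h.2 h.1]
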